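/- **Definitions.** A *simplicial tree* is a nonempty, connected, locally finite 1-dimensional simplicial complex without cycles; $E_v$ is the set of edges at a vertex $v$, and the *valence* of $v$ is $|E_v|$. The space of ends $\partial T$ is the inverse limit of the sets of components of $T\setminus K$ over the finite subtrees $K$. Let $F:T\to T$ be a proper, open, continuous simplicial self-map of a simplicial tree that carries each edge linearly onto an edge. A *local degree function* assigns an integer $\deg\ge 1$ to each vertex and each edge so that, for each vertex $v$, $$2\deg(v)-2\ \ge\sum_{e\in E_v}(\deg(e)-1),\qquad \deg(v)=\sum_{e'\in E_v,\ F(e')=F(e)}\deg(e')\quad\text{for each } e\in E_v .$$ The map $F$ is *polynomial-like of degree $D$* if $\partial T$ has exactly one isolated point $\infty$; $F$ has a local degree function with $\sum_{F(v)=w}\deg(v)=D$ for every vertex $w$ (it is then unique); no vertex has valence $1$; and the grand orbit of each vertex contains a vertex of valence at least $3$. (Points $x,y$ are in the same grand orbit if $F^n(x)=F^m(y)$ for some $n,m$.) A *metrized polynomial-like tree* $(T,\operatorname{dist},F)$ of degree $D$ is such an $F$ with a path metric on $T$, linear on edges, that satisfies $\operatorname{dist}(F(e))=D\cdot\operatorname{dist}(e)$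 for every edge $e$. Let $\mathcal T_D$ be the set of metrized polynomial-like trees of degree $D$ up to isometries that conjugate the dynamics. The *base* $v_0$ of $T$ is the vertex of valence at least $3$ closest to $\infty$, and $v_0,v_1,v_2,\dots$ are the consecutive vertices of $[v_0,\infty)$. Let $N$ be the number of edges between $v_0$ and $F(v_0)$, and let $T(k)$ be the finite subtree spanned by the vertices at most $kN$ edges away from $v_0$. A sequence $(T_n,\operatorname{dist}_n,F_n)$ *converges strongly* if $\operatorname{dist}_n(v_0,v_i)$ converges for $1\le i\le D$, with a positive limit for $i=D$, and for each $k>0$ and all large $n$ there is a simplicial isomorphism $T_n(k)\cong T_{n+1}(k)$ that respects the dynamics (and the base points). The stable finite trees $T_n(k)$ then define a limiting tree with dynamics and with a limiting pseudo-metric; its *limit* in $\mathcal T_D$ is obtained by collapsing the edges of length zero to points. The *geometric topology* on $\mathcal T_D$ is the finest topology in which every strongly convergent sequence converges to its limit. Let $\mathbb P\mathcal T_D=\mathcal T_D/\mathbb R_+$ be the quotient by rescaling of the metric, with the quotient topology. (This space is the boundary of the natural compactification of the moduli space of polynomials of degree $D$.) The *critical multiplicity* of a vertex is $m(v)=2\deg(v)-2-\sum_{e\in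 E_v}(\deg(e)-1)$, and the *escaping critical points* are the vertices with $m(v)>0$. Let $\mathbb P\mathcal T_D(p_1,\dots,p_N)$ be the set of trees whose escaping critical points fall into exactly $N$ grand orbits, which contain $p_1,\dots,p_N$ of them, counted with multiplicity. **Theorem 1.10.** The space $\mathbb P\mathcal T_3$ is the completion of an infinite simplicial tree $\mathbb P\mathcal T_3(2)\cup\mathbb P\mathcal T_3(1,1)$ by its space of ends $\mathbb P\mathcal T_3(1)$. That is, there are an infinite simplicial tree $P$ (connected, locally finite, without cycles) with vertex set $\mathbb P\mathcal T_3(2)$ and a homeomorphism $$\Phi: P\cup\partial P\ \to\ \mathbb P\mathcal T_3$$ (for the natural topology of the union of a locally finite tree and its space of ends) that restricts to the identity on the vertices, maps the union of the open edges of $P$ onto $\mathbb P\mathcal T_3(1,1)$, and maps $\partial P$ onto $\mathbb P\mathcal T_3(1)$. In particular $\mathbb P\mathcal T_3=\mathbb P\mathcal T_3(2)\sqcup\mathbb P\mathcal T_3(1,1)\sqcup\mathbb P\mathcal T_3(1)$. -/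

import Mathlib

open Filter Topology

/-! ### Simplicial trees and their branched self-coverings -/

/-- A simplicial tree (connected, without cycles, locally finite, non-empty), given by its vertices
and edges, with a branched covering `F` of it to itself.  A simplicial map carries each edge
linearly onto an edge, so it is determined by its values on the vertices.  Such a map is automatically
continuous; it is open exactly if it maps the edges at each `v` onto the edges at `F v`, and it is
proper exactly if each vertex has finitely many preimages. -/
structure TreeMap : Type 1 where
  V : Type
  G : SimpleGraph V
  isTree : G.IsTree
  locallyFinite : ∀ v, (G.neighborSet v).Finite
  F : V → V
  simplicial : ∀ u w, G.Adj u w → G.Adj (F u) (F w)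
  isOpenMap : ∀ v w', G.Adj (F v) w' → ∃ w, G.Adj v w ∧ F w = w'
  proper : ∀ v, (F ⁻¹' {v}).Finite

namespace TreeMap

variable (T : TreeMap)

/-- The neighbours of a vertex; `w ∈ T.nbrs v` stands for the edge `s(v, w)` at `v`. -/
noncomputable def nbrs (v : T.V) : Finset T.V := (T.locallyFinite v).toFinset

/-- The vertices that `F` maps to `v`. -/
noncomputable def fiber (v : T.V) : Finset T.V := (T.proper v).toFinset

noncomputable def valence (v : T.V) : ℕ := (T.nbrs v).card

/-- Two vertices are in the same grand orbit if some forward iterates of them agree. -/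
def grandOrbit : Setoid T.V where
  r x y := ∃ n m : ℕ, T.F^[n] x = T.F^[m] y
  iseqv :=
    { refl := fun _ => ⟨0, 0, rfl⟩
      symm := fun ⟨n, m, h⟩ => ⟨m, n, h.symm⟩
      trans := by
        rintro x y z ⟨n, m, h⟩ ⟨k, l, h'⟩
        refine ⟨k + n, m + l, ?_⟩
        rw [Function.iterate_add_apply, h, ← Function.iterate_add_apply, Nat.add_comm k m,
          Function.iterate_add_apply, h', ← Function.iterate_add_apply] }

open Classical in
/-- `dv` and `de` (on vertices and on edges; the values of `de` outside the edge set are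
irrelevant) form a local degree function for `F`. -/
structure IsLocalDegree (dv : T.V → ℕ) (de : Sym2 T.V → ℕ) : Prop where
  one_le_vertex : ∀ v, 1 ≤ dv v
  one_le_edge : ∀ e ∈ T.G.edgeSet, 1 ≤ de e
  sum_le : ∀ v, (∑ w ∈ T.nbrs v, (de s(v, w) - 1)) ≤ 2 * dv v - 2
  eq_sum : ∀ v w, T.G.Adj v w →
    dv v = ∑ w' ∈ (T.nbrs v).filter (fun w' => T.F w' = T.F w), de s(v, w')

/-- The critical multiplicity of a vertex, `m(v) = 2 deg(v) - 2 - ∑ (deg(e) - 1)`.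
For a local degree function none of the subtractions truncates. -/
noncomputable def critMult (dv : T.V → ℕ) (de : Sym2 T.V → ℕ) (v : T.V) : ℕ :=
  2 * dv v - 2 - ∑ w ∈ T.nbrs v, (de s(v, w) - 1)

/-- The global degree is `D`: over each vertex the local degrees add up to `D`. -/
def HasGlobalDegree (dv : T.V → ℕ) (D : ℕ) : Prop :=
  ∀ w, ∑ v ∈ T.fiber w, dv v = D

end TreeMap

/-- The component of the complement of the finite vertex set `K` that contains the end `e`. -/
def endComponent {V : Type*} (G : SimpleGraph V) (e : G.end) (K : Finset V) :
    G.ComponentCompl (K : Set V) :=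
  e.1 (Opposite.op K)

theorem endComponent_hom {V : Type*} (G : SimpleGraph V) (e : G.end) {K L : Finset V}
    (h : K ⊆ L) :
    (endComponent G e L).hom (Finset.coe_subset.2 h) = endComponent G e K :=
  e.2 (CategoryTheory.opHomOfLE h)

theorem endComponent_subset {V : Type*} (G : SimpleGraph V) (e : G.end) {K L : Finset V}
    (h : K ⊆ L) {v : V} (hv : v ∈ endComponent G e L) : v ∈ endComponent G e K := by
  rw [← endComponent_hom G e h]
  exact SimpleGraph.ComponentCompl.subset_hom _ _ hv

/-- An end is isolated in the space of ends: it is the only end in some component of the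
complement of some finite set. -/
def IsIsolatedEnd {V : Type*} (G : SimpleGraph V) (e : G.end) : Prop :=
  ∃ K : Finset V, ∀ e' : G.end, endComponent G e' K = endComponent G e K → e' = e

namespace TreeMap

variable (T : TreeMap)

/-- `F` is polynomial-like of global degree `D`. -/
structure IsPolynomialLike (D : ℕ) : Prop where
  isolated_end : ∃! e : T.G.end, IsIsolatedEnd T.G e
  local_degree : ∃ dv de, T.IsLocalDegree dv de ∧ T.HasGlobalDegree dv D
  no_endpoint : ∀ v, T.valence v ≠ 1
  branch : ∀ v, ∃ w, T.grandOrbit v w ∧ 3 ≤ T.valence w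

/-- `r` lists the vertices `v₀, v₁, v₂, …` of `[v₀, ∞)`, where `v₀` is the base of the tree, that is
the vertex of valence at least 3 closest to the isolated end `∞`.  (A ray all of whose later vertices
have valence 2 runs to an isolated end, and `∞` is the only one.) -/
structure IsBaseRay (r : ℕ → T.V) : Prop where
  adj : ∀ i, T.G.Adj (r i) (r (i + 1))
  injective : Function.Injective r
  valence_base : 3 ≤ T.valence (r 0)
  valence_succ : ∀ i, T.valence (r (i + 1)) = 2

open Classical in
/-- The escaping critical points (the critical vertices) fall into grand orbits which contain
`p₁, …, p_N` of them, counted with multiplicity, where `p = {p₁, …, p_N}`. -/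
def HasEscapeType (p : Multiset ℕ) : Prop :=
  ∃ dv de, T.IsLocalDegree dv de ∧ ∃ C : Finset T.V,
    (∀ v, v ∈ C ↔ 0 < T.critMult dv de v) ∧
    ((C.image (Quotient.mk T.grandOrbit)).val.map fun o =>
      ∑ v ∈ C.filter (fun v => Quotient.mk T.grandOrbit v = o), T.critMult dv de v) = p

end TreeMap

/-! ### Metrized polynomial-like trees -/

/-- A metrized polynomial-like tree `(T, dist, F)` of degree `D`.  The height metric is a path metric
that is linear on edges, so it is given by the edge lengths (the values of `len` outside the edge
set are irrelevant). -/
structure MetrizedTree (D : ℕ) extends TreeMap where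
  polynomialLike : toTreeMap.IsPolynomialLike D
  len : Sym2 V → ℝ
  len_pos : ∀ u w, G.Adj u w → 0 < len s(u, w)
  len_map : ∀ u w, G.Adj u w → len s(F u, F w) = D * len s(u, w)

namespace MetrizedTree

variable {D : ℕ}

/-- The height metric between vertices: the length of the unique path that joins them. -/
noncomputable def dist (T : MetrizedTree D) (u w : T.V) : ℝ :=
  ((T.isTree.existsUnique_path u w).exists.choose.edges.map T.len).sum

/-- Isometry of trees respecting the dynamics.  The vertices of `T` are the grand orbits of its branch
points, and they cut `T` into its edges, so such an isometry is the same thing as an isomorphism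
of simplicial trees that respects the edge lengths and the dynamics. -/
def Equivalent (T₁ T₂ : MetrizedTree D) : Prop :=
  ∃ i : T₁.G ≃g T₂.G, (∀ v, i (T₁.F v) = T₂.F (i v)) ∧
    ∀ u w, T₁.G.Adj u w → T₂.len s(i u, i w) = T₁.len s(u, w)

instance setoid (D : ℕ) : Setoid (MetrizedTree D) where
  r := Equivalent
  iseqv :=
    { refl := fun _ => ⟨SimpleGraph.Iso.refl, fun _ => rfl, fun _ _ _ => rfl⟩
      symm := by
        rintro T₁ T₂ ⟨i, hF, hl⟩
        refine ⟨i.symm, fun v => ?_, fun u w h => ?_⟩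
        · apply i.injective
          rw [hF]
          simp
        · rw [← hl _ _ (i.symm.map_adj_iff.2 h)]
          simp
      trans := by
        rintro T₁ T₂ T₃ ⟨i, hF, hl⟩ ⟨j, hF', hl'⟩
        refine ⟨i.trans j, fun v => ?_, fun u w h => ?_⟩
        · simp [hF, hF']
        · simp only [RelIso.trans_apply]
          rw [hl' _ _ (i.map_adj_iff.2 h), hl _ _ h] }

/-- Multiplication of the metric by `c > 0`. -/
def scale (c : {c : ℝ // 0 < c}) (T : MetrizedTree D) : MetrizedTree D where
  toTreeMap := T.toTreeMap
  polynomialLike := T.polynomialLike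
  len := fun e => c.1 * T.len e
  len_pos := fun u w h => mul_pos c.2 (T.len_pos u w h)
  len_map := fun u w h => by rw [T.len_map u w h]; ring

end MetrizedTree

/-- The set `𝒯_D` of isometry classes of metrized polynomial-like trees of degree `D`. -/
def TreeSpace (D : ℕ) : Type 1 := Quotient (MetrizedTree.setoid D)

namespace TreeSpace

variable {D : ℕ}

def mk (T : MetrizedTree D) : TreeSpace D := Quotient.mk _ T

/-- The action of `ℝ₊` by rescaling of the metric. -/
instance : MulAction {c : ℝ // 0 < c} (TreeSpace D) where
  smul c := Quotient.map (MetrizedTree.scale c) (by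
    rintro T₁ T₂ ⟨i, hF, hl⟩
    exact ⟨i, hF, fun u w h => congrArg (c.1 * ·) (hl u w h)⟩)
  one_smul := by
    rintro ⟨T⟩
    refine Quotient.sound ⟨SimpleGraph.Iso.refl, fun _ => rfl, fun u w _ => ?_⟩
    exact (one_mul (T.len s(u, w))).symm
  mul_smul := by
    rintro a b ⟨T⟩
    refine Quotient.sound ⟨SimpleGraph.Iso.refl, fun _ => rfl, fun u w _ => ?_⟩
    exact (mul_assoc a.1 b.1 (T.len s(u, w))).symm

end TreeSpace

/-! ### The geometric topology -/

/-- A pointed graph with dynamics. -/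
structure PointedDynamics : Type 1 where
  V : Type
  G : SimpleGraph V
  F : V → V
  base : V

namespace PointedDynamics

/-- The vertices of the finite subtree `T(k)`, that is those of combinatorial height between `-kN`
and `kN`.  As the height of `v` is, up to its sign, the number of edges from `v` to the base,
`N = h(F v₀)` is the number of edges from `v₀` to `F v₀`, and `T(k)` is the ball of radius `kN`. -/
def trunc (A : PointedDynamics) (k : ℕ) : Set A.V :=
  {v | A.G.dist A.base v ≤ k * A.G.dist A.base (A.F A.base)}

/-- Simplicial isomorphisms `A(k) ≅ B(k)` that respect the base point and the dynamics. -/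
structure TruncIso (A B : PointedDynamics) (k : ℕ) where
  iso : A.G.induce (A.trunc k) ≃g B.G.induce (B.trunc k)
  map_base : ∀ x, x.1 = A.base → (iso x).1 = B.base
  map_dynamics : ∀ x y, A.F x.1 = y.1 ↔ B.F (iso x).1 = (iso y).1

end PointedDynamics

namespace MetrizedTree

variable {D : ℕ}

/-- The dynamics of a tree, with a chosen vertex as base point. -/
def pointed (T : MetrizedTree D) (v₀ : T.V) : PointedDynamics := ⟨T.V, T.G, T.F, v₀⟩

/-- The sequence `S` of trees converges strongly.  Here `r n` lists the vertices
`v₀, v₁, …` of `[v₀, ∞)` in the `n`-th tree. -/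
structure StronglyConvergent (S : ℕ → MetrizedTree D) (r : ∀ n, ℕ → (S n).V) : Prop where
  isBaseRay : ∀ n, (S n).IsBaseRay (r n)
  dist_tendsto : ∀ i, 1 ≤ i → i ≤ D →
    ∃ L : ℝ, Tendsto (fun n => (S n).dist (r n 0) (r n i)) atTop (𝓝 L)
  dist_tendsto_pos :
    ∃ L : ℝ, 0 < L ∧ Tendsto (fun n => (S n).dist (r n 0) (r n D)) atTop (𝓝 L)
  trunc_iso : ∀ k, 0 < k → ∀ᶠ n in atTop,
    Nonempty (((S n).pointed (r n 0)).TruncIso ((S (n + 1)).pointed (r (n + 1) 0)) k)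

/-- `A`, with the pseudo-metric `d` on its vertices, is the limit `(T', dist', F')` of the
finite subtrees `T_n(k)`: these are eventually isomorphic to `A(k)`, and `d` is the limit of their
metrics. -/
structure IsTruncLimit (S : ℕ → MetrizedTree D) (r : ∀ n, ℕ → (S n).V)
    (A : PointedDynamics) (d : A.V → A.V → ℝ) : Prop where
  connected : A.G.Connected
  trunc_iso : ∀ k, 0 < k → ∀ ε : ℝ, 0 < ε → ∀ᶠ n in atTop,
    ∃ s : A.TruncIso ((S n).pointed (r n 0)) k,
      ∀ u w : A.trunc k, |(S n).dist (s.iso u).1 (s.iso w).1 - d u.1 w.1| < ε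

/-- `T` is the metrized dynamical system obtained from `(A, d)` by collapsing the edges of length
zero to points.  The map `j` picks a vertex of `A` over each vertex of `T`.  It is an isometric
embedding that respects the dynamics after the collapse, and each vertex of `A` lies on a geodesic
between two vertices in its image; so `T` fills the collapse of `A`.  The vertices of the collapse
that are not in the image are those whose grand orbit contains no branch point; they are no vertices
of `T`, but inner points of its edges. -/
def IsCollapse (A : PointedDynamics) (d : A.V → A.V → ℝ) (T : MetrizedTree D) : Prop :=
  ∃ j : T.V → A.V,
    (∀ u w, T.dist u w = d (j u) (j w)) ∧
    (∀ u, d (A.F (j u)) (j (T.F u)) = 0) ∧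
    ∀ x, ∃ u w, d (j u) x + d x (j w) = d (j u) (j w)

/-- The sequence `S` converges strongly, and `T` is its limit. -/
def StrongLimit (S : ℕ → MetrizedTree D) (T : MetrizedTree D) : Prop :=
  ∃ r : ∀ n, ℕ → (S n).V, StronglyConvergent S r ∧
    ∃ (A : PointedDynamics) (d : A.V → A.V → ℝ), IsTruncLimit S r A d ∧ IsCollapse A d T

end MetrizedTree

/-- The geometric topology: the finest topology in which every strongly convergent sequence
converges to its limit. -/
instance (D : ℕ) : TopologicalSpace (TreeSpace D) where
  IsOpen U := ∀ (S : ℕ → MetrizedTree D) (T : MetrizedTree D), MetrizedTree.StrongLimit S T →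
    TreeSpace.mk T ∈ U → ∀ᶠ n in atTop, TreeSpace.mk (S n) ∈ U
  isOpen_univ := fun _ _ _ _ => Eventually.of_forall fun _ => trivial
  isOpen_inter := fun _ _ hU hV S T h hT => (hU S T h hT.1).and (hV S T h hT.2)
  isOpen_sUnion := fun _ hs S T h ⟨U, hU, hT⟩ =>
    (hs U hU S T h hT).mono fun _ hn => ⟨U, hU, hn⟩

/-! ### The projective space of trees and its strata -/

/-- `ℙ𝒯_D = 𝒯_D / ℝ₊`. -/
def ProjTreeSpace (D : ℕ) : Type 1 :=
  Quotient (MulAction.orbitRel {c : ℝ // 0 < c} (TreeSpace D))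

namespace ProjTreeSpace

/-- The quotient topology of the geometric topology. -/
instance (D : ℕ) : TopologicalSpace (ProjTreeSpace D) :=
  inferInstanceAs (TopologicalSpace (Quotient (MulAction.orbitRel {c : ℝ // 0 < c} (TreeSpace D))))

noncomputable def mk {D : ℕ} (T : MetrizedTree D) : ProjTreeSpace D := Quotient.mk _ (TreeSpace.mk T)

/-- The stratum `ℙ𝒯_D(p₁, …, p_N)`. -/
def stratum (D : ℕ) (p : Multiset ℕ) : Set (ProjTreeSpace D) :=
  {x | ∃ T : MetrizedTree D, mk T = x ∧ T.HasEscapeType p}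

end ProjTreeSpace

/-! ### Geometric realization and completion by the space of ends -/

/-- The geometric realization of a graph as a 1-dimensional simplicial complex: its points
are given by their barycentric coordinates, which are carried by a vertex or by an edge. -/
def Realization {V : Type*} (G : SimpleGraph V) : Set (V → ℝ) :=
  {x | (∀ v, 0 ≤ x v) ∧ (∃ u w, (u = w ∨ G.Adj u w) ∧ ∀ v, x v ≠ 0 → v = u ∨ v = w) ∧
    ∑ᶠ v, x v = 1}

open Classical in
/-- A vertex as a point of the geometric realization. -/
noncomputable def Realization.vertex {V : Type*} (G : SimpleGraph V) (v : V) : Realization G :=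
  ⟨Pi.single v 1, by
    refine ⟨fun w => ?_, ⟨v, v, Or.inl rfl, fun w hw => Or.inl ?_⟩, ?_⟩
    · by_cases h : w = v
      · subst h; simp
      · simp [h]
    · by_contra h
      exact hw (by simp [h])
    · rw [finsum_eq_single _ v fun w hw => by simp [hw]]
      simp⟩

/-- The points of a locally finite tree (or graph) together with its ends. -/
inductive EndCompletion {V : Type*} (G : SimpleGraph V) where
  | point : Realization G → EndCompletion G
  | endpt : G.end → EndCompletion G

/-- The natural topology.  A set is open if its points form an open set of the
geometric realization (topologized by the barycentric coordinates, which for a locally finite complex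
is the usual topology) and, with each end in it, it contains the component of the complement of
some finite subcomplex that leads to this end, with all the ends of this component.  The component
that contains the set `C` of vertices is the union of the open stars of the vertices in `C`. -/
instance {V : Type*} (G : SimpleGraph V) : TopologicalSpace (EndCompletion G) where
  IsOpen U := IsOpen {x : Realization G | EndCompletion.point x ∈ U} ∧
    ∀ e : G.end, EndCompletion.endpt e ∈ U → ∃ K : Finset V,
      (∀ x : Realization G, (∃ v ∈ endComponent G e K, x.1 v ≠ 0) → EndCompletion.point x ∈ U) ∧
      ∀ e' : G.end, endComponent G e' K = endComponent G e K → EndCompletion.endpt e' ∈ U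
  isOpen_univ := ⟨by simp, fun _ _ => ⟨∅, fun _ _ => trivial, fun _ _ => trivial⟩⟩
  isOpen_inter := by
    rintro U W ⟨hU, hU'⟩ ⟨hW, hW'⟩
    refine ⟨hU.inter hW, fun e he => ?_⟩
    obtain ⟨K, hK, hK'⟩ := hU' e he.1
    obtain ⟨L, hL, hL'⟩ := hW' e he.2
    classical
    have hKL : K ⊆ K ∪ L := Finset.subset_union_left
    have hLK : L ⊆ K ∪ L := Finset.subset_union_right
    refine ⟨K ∪ L, ?_, ?_⟩
    · rintro x ⟨v, hv, hx⟩
      exact ⟨hK x ⟨v, endComponent_subset G e hKL hv, hx⟩,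
        hL x ⟨v, endComponent_subset G e hLK hv, hx⟩⟩
    · intro e' h
      refine ⟨hK' e' ?_, hL' e' ?_⟩
      · rw [← endComponent_hom G e' hKL, h, endComponent_hom G e hKL]
      · rw [← endComponent_hom G e' hLK, h, endComponent_hom G e hLK]
  isOpen_sUnion := by
    intro s hs
    refine ⟨?_, ?_⟩
    · have : {x : Realization G | EndCompletion.point x ∈ ⋃₀ s} =
          ⋃ U ∈ s, {x : Realization G | EndCompletion.point x ∈ U} := by
        ext x
        simp
      rw [this]
      exact isOpen_biUnion fun U hU => (hs U hU).1
    · rintro e ⟨U, hU, he⟩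
      obtain ⟨K, hK, hK'⟩ := (hs U hU).2 e he
      exact ⟨K, fun x hx => ⟨U, hU, hK x hx⟩, fun e' h => ⟨U, hU, hK' e' h⟩⟩

/-!
A cubic polynomial-like tree is best seen from its distinguished end `∞`. Each vertex has a level,
which grows by one with each step towards `∞` and is 0 at the base, so that the tree is the graph of
a parent map `p`; the map `F` commutes with `p` and raises the levels by `N` (`IsLevel.F_p`,
`MetrizedTree.exists_models`). The lengths of the edges depend only on their level and grow by the
factor 3 every `N` levels. What remains is combinatorial, a *level tree* `CTree`. Its local degrees
are 3 on the ray above the base and at most 2 below; on each level below the base at most one vertex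
has degree 2, and together with the base these vertices form the *spine*, a path that descends from
the base (`CTree.eq_of_spine`). Exactly `deg v` children of a vertex `v`, counted with degree, are
mapped to each child of `F v`, so that the tree can be built level by level, and the only freedom is
the choice of the image of the next spine vertex (`IsPIso.extend`, `VertexName.tree`).

The critical vertices are the base and the lower end of the spine. Each grand orbit contains a branch
point, and the branch points lie in the grand orbits of the critical vertices; this leaves two cases
(`IsBranched.N_eq`). If `N = 1`, then the escape type is `{2}` for a finite spine and `{1}` for an
infinite one. If `N = 2`, then the spine ends at odd depth and the type is `{1, 1}`.

For `N = 1` the edge lengths are determined up to scale, so points of `ℙ𝒯₃` are isomorphism classes of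
level trees. The classes with a finite spine are the vertices of a rooted tree `P`, where the parent of
a class is obtained by cutting the last step off the spine; `P` is locally finite since
the image of the new spine vertex has finitely many possible values
(`IsClassification.exists_isRooted`). A level tree with infinite spine is determined by all its
truncations, and each sequence of compatible truncations comes from such a tree, by compactness
(`exists_isIso_of_isPIso`, `exists_limit`); hence these classes are the ends of `P`. For `N = 2` the
vertices of even level, and those of odd level, each form a level tree with `N = 1`. The even half is
the parent of the odd one, the odd half determines the whole tree and can be any vertex of `P` but the
root (`exists_isPIso_even_odd`, `exists_isIso_of_odd`, `exists_odd`); so the trees with `N = 2`, whose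
metric has the ratio of two edge lengths as its only parameter, fill the open edges of `P`. Together
this is the bijection `ProjTreeSpace.exists_equiv`.

For the topology both sides get coordinates, one for each vertex `v` of `P`: the indicator of the trees
that extend `v`, interpolated linearly on the edges of `P`. On the completion of `P` they
define the topology (`IsRooted.isInducing_endCoord`). On `ℙ𝒯₃` they are continuous, that is, they
converge along strongly convergent sequences. To see this, choose a subsequence whose finite subtrees
stabilize to those of a level tree, possibly with some edges of length zero
(`ProjTreeSpace.exists_subseq_strongLimit`); its coordinates converge to those of the collapse, and
the collapse is the given limit because strong limits are unique
(`MetrizedTree.IsTruncLimit.equivalent`). The latter holds since the stable subtrees determine the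
limiting tree and its dynamics, and the pseudo-metric determines the vertices of the collapse: the
branch points are medians, and the other vertices are their iterated images and preimages.
The same subsequences show that `ℙ𝒯₃` is sequentially compact, so the inverse bijection is continuous
as well (`ProjTreeSpace.exists_homeomorph`).
-/

/-! ### Rooted trees and their ends -/

/-- `G` is the tree with root `o` in which `q v` is the neighbour of `v` on the way to the root and
`dep v` is the number of edges between `v` and the root. -/
structure IsRooted {V : Type*} (G : SimpleGraph V) (o : V) (q : V → V) (dep : V → ℕ) : Prop where
  dep_eq_zero : ∀ v, dep v = 0 ↔ v = o
  dep_parent : ∀ v, v ≠ o → dep (q v) + 1 = dep v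
  adj_iff : ∀ u v, G.Adj u v ↔ (u ≠ o ∧ q u = v) ∨ (v ≠ o ∧ q v = u)

/-- `ξ` lists the vertices of a geodesic ray that starts at the root `o`. -/
structure IsRootRay {V : Type*} (o : V) (q : V → V) (ξ : ℕ → V) : Prop where
  zero : ξ 0 = o
  succ_ne : ∀ n, ξ (n + 1) ≠ o
  parent : ∀ n, q (ξ (n + 1)) = ξ n

/-- The end `e` is the limit of the ray `ξ` from the root. -/
def RayToEnd {V : Type*} {G : SimpleGraph V} (dep : V → ℕ) (e : G.end) (ξ : ℕ → V) : Prop :=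
  ∀ (K : Finset V) (n : ℕ), (∀ v ∈ K, dep v < n) → ξ n ∈ endComponent G e K

theorem SimpleGraph.IsTree.exists_isRooted {V : Type*} {G : SimpleGraph V} (h : G.IsTree) (o : V) :
    ∃ q : V → V, IsRooted G o q (G.dist o) := by
  classical
  have key : ∀ v, v ≠ o → ∃ w, G.Adj v w ∧ G.dist o w + 1 = G.dist o v := by
    intro v hv
    obtain ⟨p, hp⟩ := h.connected.exists_walk_length_eq_dist v o
    cases p with
    | nil => exact absurd rfl hv
    | cons a p =>
      refine ⟨_, a, ?_⟩
      have h1 := SimpleGraph.dist_le p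
      rw [SimpleGraph.Walk.length_cons] at hp
      have h2 := h.dist_eq_dist_add_one_of_adj o a
      rw [SimpleGraph.dist_comm, SimpleGraph.dist_comm (v := o)] at *
      omega
  choose! q hq1 hq2 using key
  have huniq : ∀ v w, G.Adj v w → G.dist o w + 1 = G.dist o v → v ≠ o ∧ q v = w := by
    intro v w hvw hd
    have hv : v ≠ o := by rintro rfl; simp at hd
    refine ⟨hv, ?_⟩
    obtain ⟨p, hp, hpl⟩ := (h.connected o w).exists_path_of_dist
    obtain ⟨p', hp', hpl'⟩ := (h.connected o (q v)).exists_path_of_dist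
    have aux : ∀ (x : V) (r : G.Walk o x), r.length = G.dist o x →
        G.dist o x + 1 = G.dist o v → v ∉ r.support := by
      intro x r hr hx hmem
      have := SimpleGraph.dist_le (r.takeUntil v hmem)
      have := r.length_takeUntil_le_length hmem
      omega
    have e1 := hp.concat (aux _ p hpl hd) hvw.symm
    have e2 := hp'.concat (aux _ p' hpl' (hq2 v hv)) (hq1 v hv).symm
    have := congrArg (fun r : G.Path o v => r.1.penultimate)
      ((h.isAcyclic.subsingleton_path o v).elim ⟨_, e2⟩ ⟨_, e1⟩)
    simpa using this
  refine ⟨q, fun v => ?_, hq2, fun u v => ⟨fun huv => ?_, ?_⟩⟩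
  · rw [(h.connected o v).dist_eq_zero_iff]; exact eq_comm
  · rcases h.dist_eq_dist_add_one_of_adj o huv with h1 | h1
    · exact Or.inl (huniq u v huv h1.symm)
    · exact Or.inr (huniq v u huv.symm h1.symm)
  · rintro (⟨h1, rfl⟩ | ⟨h1, rfl⟩)
    · exact hq1 u h1
    · exact (hq1 v h1).symm

namespace IsRooted

variable {V : Type*} {G : SimpleGraph V} {o : V} {q : V → V} {dep : V → ℕ}

theorem adj_parent (h : IsRooted G o q dep) {v : V} (hv : v ≠ o) : G.Adj v (q v) :=
  (h.adj_iff _ _).2 (Or.inl ⟨hv, rfl⟩)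

theorem dep_root (h : IsRooted G o q dep) : dep o = 0 := (h.dep_eq_zero o).2 rfl

theorem ne_root (h : IsRooted G o q dep) {v : V} (hv : dep v ≠ 0) : v ≠ o :=
  fun e => hv ((h.dep_eq_zero v).2 e)

theorem dep_iterate (h : IsRooted G o q dep) (v : V) (n : ℕ) (hn : n ≤ dep v) :
    dep (q^[n] v) = dep v - n := by
  induction n with
  | zero => rfl
  | succ n ih =>
    rw [Function.iterate_succ_apply']
    have h1 := ih (by omega)
    have := h.dep_parent _ (h.ne_root (v := q^[n] v) (by omega))
    omega

theorem reachable (h : IsRooted G o q dep) (v : V) : G.Reachable v o := by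
  suffices ∀ n v, dep v = n → G.Reachable v o from this _ v rfl
  intro n
  induction n with
  | zero => intro v hv; rw [(h.dep_eq_zero v).1 hv]
  | succ n ih =>
    intro v hv
    have hv' := h.ne_root (v := v) (by omega)
    have := h.dep_parent v hv'
    exact (h.adj_parent hv').reachable.trans (ih _ (by omega))

theorem connected (h : IsRooted G o q dep) : G.Connected :=
  { preconnected := fun u v => (h.reachable u).trans (h.reachable v).symm
    nonempty := ⟨o⟩ }

theorem eq_of_cross (h : IsRooted G o q dep) {v a b : V} (hab : G.Adj a b)
    (ha : ∃ n, n ≤ dep a ∧ q^[n] a = v) (hb : ¬ ∃ n, n ≤ dep b ∧ q^[n] b = v) :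
    a = v ∧ b = q v ∧ v ≠ o := by
  obtain ⟨n, hn, hn'⟩ := ha
  rcases (h.adj_iff a b).1 hab with ⟨h1, rfl⟩ | ⟨h1, rfl⟩
  · cases n with
    | zero => simp only [Function.iterate_zero, id] at hn'; subst hn'; exact ⟨rfl, rfl, h1⟩
    | succ n =>
      refine absurd ⟨n, ?_, hn'⟩ hb
      have := h.dep_parent a h1
      omega
  · refine absurd ⟨n + 1, ?_, hn'⟩ hb
    have := h.dep_parent b h1
    omega

theorem isTree (h : IsRooted G o q dep) : G.IsTree := by
  refine ⟨h.connected, SimpleGraph.isAcyclic_iff_forall_adj_isBridge.2 ?_⟩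
  have main : ∀ v, v ≠ o → G.IsBridge s(v, q v) := by
    intro v hv
    rw [SimpleGraph.isBridge_iff_forall_walk_mem_edges]
    intro w
    have hnot : ¬ ∃ n, n ≤ dep (q v) ∧ q^[n] (q v) = v := by
      rintro ⟨n, hn, hn'⟩
      have := h.dep_iterate _ n hn
      have := h.dep_parent v hv
      rw [hn'] at *
      omega
    obtain ⟨d, hd, h1, h2⟩ := w.exists_boundary_dart {x | ∃ n, n ≤ dep x ∧ q^[n] x = v}
      ⟨0, by omega, rfl⟩ hnot
    obtain ⟨e1, e2, -⟩ := h.eq_of_cross d.adj h1 h2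
    have := List.mem_map_of_mem (f := SimpleGraph.Dart.edge) hd
    rwa [SimpleGraph.Dart.edge, ← Prod.mk.eta (p := d.toProd), e1, e2] at this
  intro v w hvw
  rcases (h.adj_iff v w).1 hvw with ⟨h1, rfl⟩ | ⟨h1, rfl⟩
  · exact main v h1
  · rw [Sym2.eq_swap]; exact main w h1

theorem dist_root (h : IsRooted G o q dep) (v : V) : G.dist o v = dep v := by
  apply le_antisymm
  · suffices ∀ n v, dep v = n → G.dist o v ≤ n from this _ v rfl
    intro n
    induction n with
    | zero => intro v hv; rw [(h.dep_eq_zero v).1 hv]; simp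
    | succ n ih =>
      intro v hv
      have hv' := h.ne_root (v := v) (by omega)
      have h1 := h.dep_parent v hv'
      have h2 := ih (q v) (by omega)
      have h3 := h.connected.dist_triangle (u := o) (v := q v) (w := v)
      have h4 := SimpleGraph.dist_eq_one_iff_adj.2 (h.adj_parent hv').symm
      omega
  · obtain ⟨p, hp⟩ := h.connected.exists_walk_length_eq_dist o v
    rw [← hp]
    have : ∀ {u w : V} (p : G.Walk u w), dep w ≤ dep u + p.length := by
      intro u w p
      induction p with
      | nil => simp
      | cons a p ih =>
        rw [SimpleGraph.Walk.length_cons]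
        rcases (h.adj_iff _ _).1 a with ⟨h1, rfl⟩ | ⟨h1, rfl⟩
        · have := h.dep_parent _ h1; omega
        · have := h.dep_parent _ h1; omega
    have := this p
    rw [h.dep_root] at this
    omega

theorem dep_ray (h : IsRooted G o q dep) {ξ : ℕ → V} (hξ : IsRootRay o q ξ) (n : ℕ) :
    dep (ξ n) = n := by
  induction n with
  | zero => rw [hξ.zero, h.dep_root]
  | succ n ih => rw [← h.dep_parent _ (hξ.succ_ne n), hξ.parent, ih]

theorem _root_.IsRootRay.iterate {ξ : ℕ → V} (hξ : IsRootRay o q ξ) (n m : ℕ) :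
    q^[n] (ξ (m + n)) = ξ m := by
  induction n with
  | zero => rfl
  | succ n ih => rw [Function.iterate_succ_apply, ← Nat.add_assoc, hξ.parent, ih]

theorem _root_.IsRootRay.eq_of_le {ξ η : ℕ → V} (hξ : IsRootRay o q ξ) (hη : IsRootRay o q η)
    {m n : ℕ} (hmn : m ≤ n) (e : ξ n = η n) : ξ m = η m := by
  obtain ⟨k, rfl⟩ := Nat.exists_eq_add_of_le hmn
  rw [← hξ.iterate k m, ← hη.iterate k m, e]

/-- Beyond depth `n` a connected set stays below one vertex of depth `n`. -/
theorem anc_eq_of_mem (h : IsRooted G o q dep) {K : Finset V} {n : ℕ}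
    (hK : ∀ v, v ∉ K → n ≤ dep v) {C : G.ComponentCompl (K : Set V)} {u v : V}
    (hu : u ∈ C) (hv : v ∈ C) : q^[dep u - n] u = q^[dep v - n] v := by
  let f : G.ComponentCompl (K : Set V) → V :=
    SimpleGraph.ComponentCompl.lift (fun v _ => q^[dep v - n] v) (by
      intro v w hv hw hvw
      have hv' := hK v (by simpa using hv)
      have hw' := hK w (by simpa using hw)
      rcases (h.adj_iff v w).1 hvw with ⟨h1, rfl⟩ | ⟨h1, rfl⟩
      · have := h.dep_parent _ h1
        rw [show dep v - n = (dep (q v) - n) + 1 by omega, Function.iterate_succ_apply]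
      · have := h.dep_parent _ h1
        rw [show dep w - n = (dep (q w) - n) + 1 by omega, Function.iterate_succ_apply])
  obtain ⟨hu', rfl⟩ := hu
  obtain ⟨hv', e⟩ := hv
  exact (congrArg f e).symm

theorem finite_ball (h : IsRooted G o q dep) (hf : ∀ v, (G.neighborSet v).Finite) (n : ℕ) :
    {v | dep v ≤ n}.Finite := by
  induction n with
  | zero =>
    refine (Set.finite_singleton o).subset fun v hv => ?_
    exact (h.dep_eq_zero v).1 (Nat.le_zero.1 hv)
  | succ n ih =>
    refine (ih.union (ih.biUnion fun v _ => hf v)).subset fun v hv => ?_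
    by_cases hv' : dep v ≤ n
    · exact Or.inl hv'
    · have hv0 := h.ne_root (v := v) (by omega)
      have := h.dep_parent v hv0
      refine Or.inr (Set.mem_biUnion (x := q v) ?_ (h.adj_parent hv0).symm)
      change dep (q v) ≤ n
      change dep v ≤ n + 1 at hv
      omega

/-- Each end is the limit of a ray from the root: the vertex of depth `n` of the ray is the common
ancestor of the vertices in the component of the end outside the ball of radius `n`. -/
theorem exists_ray (h : IsRooted G o q dep) (hf : ∀ v, (G.neighborSet v).Finite) (e : G.end) :
    ∃ ξ, IsRootRay o q ξ ∧ RayToEnd dep e ξ := by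
  classical
  let B : ℕ → Finset V := fun n => (h.finite_ball hf n).toFinset
  have hB : ∀ n v, v ∈ B n ↔ dep v ≤ n := fun n v => by simp [B]
  have hBm : ∀ {m n : ℕ}, m ≤ n → B m ⊆ B n := fun {m n} hmn v hv => by
    rw [hB] at *; omega
  choose x hx using fun n => (endComponent G e (B n)).nonempty
  have hxd : ∀ n, n + 1 ≤ dep (x n) := fun n => by
    have := (endComponent G e (B n)).notMem_of_mem (hx n)
    rw [Finset.mem_coe, hB] at this
    omega
  have hBK : ∀ n v, v ∉ B n → n + 1 ≤ dep v := fun n v hv => by rw [hB] at hv; omega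
  let ξ : ℕ → V := fun n => q^[dep (x n) - n] (x n)
  have hdep : ∀ n, dep (ξ n) = n := fun n => by
    have := hxd n
    change dep (q^[dep (x n) - n] (x n)) = n
    rw [h.dep_iterate _ _ (by omega)]
    omega
  have hray : IsRootRay o q ξ := by
    refine ⟨(h.dep_eq_zero _).1 (hdep 0), fun n => h.ne_root (by rw [hdep]; omega), fun n => ?_⟩
    have h1 : x (n + 1) ∈ endComponent G e (B n) :=
      endComponent_subset G e (hBm (Nat.le_succ n)) (hx (n + 1))
    have h2 := h.anc_eq_of_mem (hBK n) (hx n) h1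
    change q (q^[dep (x (n+1)) - (n+1)] (x (n+1))) = q^[dep (x n) - n] (x n)
    have a := hxd n
    have b := hxd (n + 1)
    rw [← h2, ← Function.iterate_succ_apply' q]
    congr 1
    omega
  refine ⟨ξ, hray, fun K n hK => ?_⟩
  -- it suffices to treat the ball of radius `n - 1`
  have hx1 : ξ n ∈ endComponent G e (K.filter fun v => dep v < n) → ξ n ∈ endComponent G e K := by
    have : K.filter (fun v => dep v < n) = K := Finset.filter_true_of_mem hK
    rw [this]; exact id
  have hxK : x n ∈ endComponent G e K := endComponent_subset G e (K := K) (L := B n)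
    (fun v hv => (hB n v).2 (hK v hv).le) (hx n)
  -- walk down from `x n` to `ξ n` outside `K`
  have : ∀ m, m + n ≤ dep (x n) → q^[m] (x n) ∈ endComponent G e K := by
    intro m
    induction m with
    | zero => intro _; exact hxK
    | succ m ih =>
      intro hm
      rw [Function.iterate_succ_apply']
      have d1 := h.dep_iterate (x n) m (by omega)
      have d2 := h.dep_iterate (x n) (m + 1) (by omega)
      rw [Function.iterate_succ_apply'] at d2
      refine SimpleGraph.ComponentCompl.mem_of_adj _ _ (ih (by omega)) ?_
        (h.adj_parent (h.ne_root (by omega)))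
      intro hmem
      have := hK _ hmem
      omega
  exact this _ (by have := hxd n; omega)

/-- Each ray from the root converges to an end. -/
theorem exists_end (h : IsRooted G o q dep) {ξ : ℕ → V} (hξ : IsRootRay o q ξ) :
    ∃ e : G.end, RayToEnd dep e ξ := by
  classical
  let b : Finset V → ℕ := fun K => K.sup dep + 1
  have hb : ∀ K : Finset V, ∀ n, b K ≤ n → ξ n ∉ (K : Set V) := fun K n hn hmem => by
    have := Finset.le_sup (f := dep) (Finset.mem_coe.1 hmem)
    rw [h.dep_ray hξ] at this
    change K.sup dep + 1 ≤ n at hn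
    omega
  have hadj : ∀ n, G.Adj (ξ n) (ξ (n + 1)) := fun n =>
    (h.adj_iff _ _).2 (Or.inr ⟨hξ.succ_ne n, hξ.parent n⟩)
  let c : ∀ K : Finset V, G.ComponentCompl (K : Set V) :=
    fun K => G.componentComplMk (hb K (b K) le_rfl)
  have hc : ∀ (K : Finset V) n, (∀ m, n ≤ m → ξ m ∉ (K : Set V)) → ξ n ∈ c K := by
    intro K n hn
    have hup : ∀ j, ξ (b K + j) ∈ c K := by
      intro j
      induction j with
      | zero => exact ⟨hb K _ le_rfl, rfl⟩
      | succ j ih =>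
        exact SimpleGraph.ComponentCompl.mem_of_adj _ _ ih (hb K _ (by omega)) (hadj _)
    have hdown : ∀ j m, n ≤ m → ξ (m + j) ∈ c K → ξ m ∈ c K := by
      intro j
      induction j with
      | zero => intro m _ hm; exact hm
      | succ j ih =>
        intro m hm hmem
        exact ih m hm (SimpleGraph.ComponentCompl.mem_of_adj _ _ hmem (hn _ (by omega))
          (hadj (m + j)).symm)
    exact hdown (b K) n le_rfl (by rw [Nat.add_comm]; exact hup n)
  refine ⟨⟨fun K => c K.unop, ?_⟩, ?_⟩
  · intro K L f
    have hsub : (L.unop : Set V) ⊆ K.unop := Finset.coe_subset.2 (CategoryTheory.leOfHom f.unop)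
    change (c K.unop).hom hsub = c L.unop
    rw [SimpleGraph.ComponentCompl.hom_eq_iff_not_disjoint, Set.not_disjoint_iff]
    refine ⟨ξ (b K.unop), hc K.unop _ fun m hm => hb _ m hm, hc L.unop _ fun m hm hmem => ?_⟩
    exact hb _ m hm (hsub hmem)
  · intro K n hK
    refine hc K n fun m hm hmem => ?_
    have := hK _ hmem
    rw [h.dep_ray hξ] at this
    omega

theorem end_unique {e e' : G.end} {ξ : ℕ → V} (h1 : RayToEnd dep e ξ) (h2 : RayToEnd dep e' ξ) :
    e = e' := by
  apply Subtype.ext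
  funext K
  have hK : ∀ v ∈ K.unop, dep v < K.unop.sup dep + 1 := fun v hv =>
    Nat.lt_succ_of_le (Finset.le_sup hv)
  obtain ⟨_, e1⟩ := h1 K.unop _ hK
  obtain ⟨_, e2⟩ := h2 K.unop _ hK
  exact e1.symm.trans e2

theorem endComponent_eq {e e' : G.end} {ξ η : ℕ → V} (h1 : RayToEnd dep e ξ)
    (h2 : RayToEnd dep e' η) {K : Finset V} {n : ℕ} (hK : ∀ v ∈ K, dep v < n) (hn : ξ n = η n) :
    endComponent G e K = endComponent G e' K := by
  obtain ⟨_, e1⟩ := h1 K n hK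
  obtain ⟨_, e2⟩ := h2 K n hK
  rw [← e1, ← e2]
  congr 1

theorem ray_eq_of_endComponent_eq (h : IsRooted G o q dep) {e e' : G.end} {ξ η : ℕ → V}
    (hξ : IsRootRay o q ξ) (hη : IsRootRay o q η) (h1 : RayToEnd dep e ξ)
    (h2 : RayToEnd dep e' η) {K : Finset V} {n : ℕ} (hK : ∀ v, v ∈ K ↔ dep v < n)
    (he : endComponent G e K = endComponent G e' K) : ξ n = η n := by
  have a := h1 K n fun v hv => (hK v).1 hv
  have b := h2 K n fun v hv => (hK v).1 hv
  rw [← he] at b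
  have := h.anc_eq_of_mem (n := n) (fun v hv => by rw [hK] at hv; omega) a b
  rw [h.dep_ray hξ, h.dep_ray hη] at this
  simpa using this

theorem ray_unique (h : IsRooted G o q dep) (hf : ∀ v, (G.neighborSet v).Finite) {e : G.end}
    {ξ η : ℕ → V} (hξ : IsRootRay o q ξ) (hη : IsRootRay o q η) (h1 : RayToEnd dep e ξ)
    (h2 : RayToEnd dep e η) : ξ = η := by
  funext n
  have hfin : {v | dep v < n}.Finite := (h.finite_ball hf n).subset fun v hv => Nat.le_of_lt hv
  exact h.ray_eq_of_endComponent_eq hξ hη h1 h2 (K := hfin.toFinset) (n := n) (by simp) rfl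

/-- An end is isolated if and only if its ray is determined by one of its vertices. -/
theorem isIsolatedEnd_iff (h : IsRooted G o q dep) (hf : ∀ v, (G.neighborSet v).Finite)
    {e : G.end} {ξ : ℕ → V} (hξ : IsRootRay o q ξ) (he : RayToEnd dep e ξ) :
    IsIsolatedEnd G e ↔ ∃ n, ∀ η, IsRootRay o q η → η n = ξ n → η = ξ := by
  constructor
  · rintro ⟨K, hK⟩
    refine ⟨K.sup dep + 1, fun η hη e1 => ?_⟩
    obtain ⟨e', he'⟩ := h.exists_end hη
    have := hK e' (endComponent_eq he' he (fun v hv => Nat.lt_succ_of_le (Finset.le_sup hv)) e1)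
    subst this
    exact h.ray_unique hf hη hξ he' he
  · rintro ⟨n, hn⟩
    have hfin : {v | dep v < n}.Finite := (h.finite_ball hf n).subset fun v hv => Nat.le_of_lt hv
    refine ⟨hfin.toFinset, fun e' h' => ?_⟩
    obtain ⟨η, hη, hη'⟩ := h.exists_ray hf e'
    have := hn η hη (h.ray_eq_of_endComponent_eq hη hξ hη' he (n := n) (by simp) h')
    subst this
    exact end_unique hη' he

end IsRooted

/-! ### Cubic level trees -/

/-- The combinatorial skeleton of a cubic polynomial-like tree. The end `∞` is at the top: `p v` is
the neighbour of `v` in the direction of `∞`, and the level `lv v` increases along `p`. There is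
exactly one vertex of each level `≥ 0`; these vertices form the ray from the base to `∞`, and `F`
moves them up by `N`. The local degree of a vertex is also that of the edge above it. -/
structure CTree : Type 1 where
  V : Type
  N : ℕ
  p : V → V
  F : V → V
  lv : V → ℤ
  deg : V → ℕ
  N_pos : 1 ≤ N
  lv_p : ∀ v, lv (p v) = lv v + 1
  lv_F : ∀ v, lv (F v) = lv v + N
  F_p : ∀ v, F (p v) = p (F v)
  exists_base : ∃ v, lv v = 0
  eq_of_lv_eq : ∀ u v, 0 ≤ lv u → lv u = lv v → u = v
  deg_ray : ∀ v, 0 ≤ lv v → deg v = 3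
  one_le_deg : ∀ v, 1 ≤ deg v
  deg_le_two : ∀ v, lv v < 0 → deg v ≤ 2
  finite_children : ∀ v, {u | p u = v}.Finite
  cover : ∀ v w, p w = F v → ∑ᶠ u ∈ {u | p u = v ∧ F u = w}, deg u = deg v
  rh : ∀ v, ∑ᶠ u ∈ {u | p u = v}, (deg u - 1) ≤ deg v - 1

namespace CTree

variable (C : CTree)

/-- The base of the tree. -/
noncomputable def base : C.V := C.exists_base.choose

theorem lv_base : C.lv C.base = 0 := C.exists_base.choose_spec

/-- The vertex of level `i ≥ 0`. -/
noncomputable def ray (i : ℕ) : C.V := C.p^[i] C.base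

theorem lv_iterate (n : ℕ) (v : C.V) : C.lv (C.p^[n] v) = C.lv v + n := by
  induction n with
  | zero => simp
  | succ n ih => rw [Function.iterate_succ_apply', C.lv_p, ih]; push_cast; ring

theorem lv_ray (i : ℕ) : C.lv (C.ray i) = i := by
  rw [ray, lv_iterate, lv_base, zero_add]

theorem eq_ray {v : C.V} {i : ℕ} (h : C.lv v = i) : v = C.ray i :=
  C.eq_of_lv_eq _ _ (by omega) (by rw [h, lv_ray])

theorem ray_zero : C.ray 0 = C.base := rfl

theorem p_ray (i : ℕ) : C.p (C.ray i) = C.ray (i + 1) :=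
  C.eq_ray (by rw [C.lv_p, lv_ray]; push_cast; ring)

theorem F_ray (i : ℕ) : C.F (C.ray i) = C.ray (i + C.N) :=
  C.eq_ray (by rw [C.lv_F, lv_ray]; push_cast; ring)

theorem F_iterate_p (n : ℕ) (v : C.V) : C.F (C.p^[n] v) = C.p^[n] (C.F v) := by
  induction n with
  | zero => rfl
  | succ n ih => rw [Function.iterate_succ_apply', C.F_p, ih, Function.iterate_succ_apply']

theorem lv_iterate_F (n : ℕ) (v : C.V) : C.lv (C.F^[n] v) = C.lv v + n * C.N := by
  induction n with
  | zero => simp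
  | succ n ih => rw [Function.iterate_succ_apply', C.lv_F, ih]; push_cast; ring

theorem exists_child_up {v : C.V} (hv : 0 < C.lv v) : ∃ u, C.p u = v := by
  refine ⟨C.ray (C.lv v).toNat.pred, ?_⟩
  refine C.eq_of_lv_eq _ _ ?_ ?_ <;> rw [C.lv_p, lv_ray] <;> simp only [Nat.pred_eq_sub_one] <;> omega

/-- The children of `v` over a given child of `F v`. -/
noncomputable def fib (v w : C.V) : Finset C.V :=
  ((C.finite_children v).subset (t := {u | C.p u = v ∧ C.F u = w}) fun _ h => h.1).toFinset

/-- The vertices with parent `v`. -/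
noncomputable def children (v : C.V) : Finset C.V := (C.finite_children v).toFinset

@[simp] theorem mem_fib {u v w : C.V} : u ∈ C.fib v w ↔ C.p u = v ∧ C.F u = w := by simp [fib]

@[simp] theorem mem_children {u v : C.V} : u ∈ C.children v ↔ C.p u = v := by simp [children]

theorem sum_fib {v w : C.V} (h : C.p w = C.F v) : ∑ u ∈ C.fib v w, C.deg u = C.deg v := by
  rw [← C.cover v w h, fib, finsum_mem_eq_finite_toFinset_sum]

theorem sum_children (v : C.V) : ∑ u ∈ C.children v, (C.deg u - 1) ≤ C.deg v - 1 := by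
  rw [children, ← finsum_mem_eq_finite_toFinset_sum]
  exact C.rh v

theorem exists_lift {v w : C.V} (h : C.p w = C.F v) : ∃ u, C.p u = v ∧ C.F u = w := by
  by_contra hne
  push Not at hne
  have : C.fib v w = ∅ := by
    ext u; simpa using hne u
  have h1 := C.sum_fib h
  rw [this, Finset.sum_empty] at h1
  have := C.one_le_deg v
  omega

theorem exists_child (v : C.V) : ∃ u, C.p u = v := by
  suffices ∀ (n : ℕ) v, -(n : ℤ) < C.lv v → ∃ u, C.p u = v from
    this ((-C.lv v).toNat + 1) v (by omega)
  intro n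
  induction n with
  | zero => intro v hv; exact C.exists_child_up (by simpa using hv)
  | succ n ih =>
    intro v hv
    have h1 := C.N_pos
    obtain ⟨w, hw⟩ := ih (C.F v) (by rw [C.lv_F]; push_cast at hv; omega)
    obtain ⟨u, hu, -⟩ := C.exists_lift hw
    exact ⟨u, hu⟩

theorem deg_le_parent (u : C.V) : C.deg u ≤ C.deg (C.p u) := by
  have h1 := C.sum_children (C.p u)
  have h2 := Finset.single_le_sum (f := fun u => C.deg u - 1) (fun _ _ => Nat.zero_le _)
    ((C.mem_children (u := u)).2 rfl)
  have h3 : C.deg u - 1 ≤ C.deg (C.p u) - 1 := h2.trans h1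
  have := C.one_le_deg u
  have := C.one_le_deg (C.p u)
  omega

/-- The vertex of level `j` above `v`, for `j ≥ lv v`. -/
def anc (v : C.V) (j : ℤ) : C.V := C.p^[(j - C.lv v).toNat] v

theorem lv_anc {v : C.V} {j : ℤ} (h : C.lv v ≤ j) : C.lv (C.anc v j) = j := by
  rw [anc, lv_iterate]; omega

theorem anc_self (v : C.V) : C.anc v (C.lv v) = v := by simp [anc]

theorem p_anc {v : C.V} {j : ℤ} (h : C.lv v ≤ j) : C.p (C.anc v j) = C.anc v (j + 1) := by
  rw [anc, anc, ← Function.iterate_succ_apply' C.p]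
  congr 1
  omega

theorem anc_p {v : C.V} {j : ℤ} (h : C.lv v + 1 ≤ j) : C.anc (C.p v) j = C.anc v j := by
  rw [anc, anc, C.lv_p, ← Function.iterate_succ_apply C.p]
  congr 1
  omega

theorem F_anc (v : C.V) (j : ℤ) : C.F (C.anc v j) = C.anc (C.F v) (j + C.N) := by
  rw [anc, anc, F_iterate_p, C.lv_F]
  congr 1
  omega

theorem anc_congr {u w : C.V} {i j : ℤ} (hu : C.lv u ≤ i) (hw : C.lv w ≤ i) (hij : i ≤ j)
    (h : C.anc u i = C.anc w i) : C.anc u j = C.anc w j := by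
  obtain ⟨n, rfl⟩ := Int.le.dest hij
  clear hij
  induction n with
  | zero => simpa using h
  | succ n ih =>
    push_cast
    rw [← add_assoc, ← C.p_anc (by omega), ← C.p_anc (by omega), ih]

theorem anc_of_nonneg {u w : C.V} {j : ℤ} (hj : 0 ≤ j) (hu : C.lv u ≤ j) (hw : C.lv w ≤ j) :
    C.anc u j = C.anc w j :=
  C.eq_of_lv_eq _ _ (by rw [C.lv_anc hu]; exact hj) (by rw [C.lv_anc hu, C.lv_anc hw])

open Classical in
theorem exists_join (u w : C.V) :
    ∃ n : ℕ, C.anc u (max (C.lv u) (C.lv w) + n) = C.anc w (max (C.lv u) (C.lv w) + n) :=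
  ⟨(-max (C.lv u) (C.lv w)).toNat, C.anc_of_nonneg (by omega) (by omega) (by omega)⟩

open Classical in
/-- The level of the lowest common ancestor of `u` and `w`. -/
noncomputable def join (u w : C.V) : ℤ :=
  max (C.lv u) (C.lv w) + (Nat.find (C.exists_join u w) : ℕ)

theorem join_le_iff {u w : C.V} {j : ℤ} :
    C.join u w ≤ j ↔ C.lv u ≤ j ∧ C.lv w ≤ j ∧ C.anc u j = C.anc w j := by
  classical
  constructor
  · intro h
    have h1 : max (C.lv u) (C.lv w) ≤ C.join u w := by unfold join; omega
    exact ⟨by omega, by omega, C.anc_congr (i := C.join u w) (by omega) (by omega) h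
      (Nat.find_spec (C.exists_join u w))⟩
  · rintro ⟨h1, h2, h3⟩
    obtain ⟨n, hn⟩ := Int.le.dest (max_le h1 h2)
    have := Nat.find_min' (C.exists_join u w) (m := n) (by rw [hn]; exact h3)
    unfold join
    omega

theorem lv_le_join_left (u w : C.V) : C.lv u ≤ C.join u w := (C.join_le_iff.1 le_rfl).1

theorem lv_le_join_right (u w : C.V) : C.lv w ≤ C.join u w := (C.join_le_iff.1 le_rfl).2.1

theorem join_comm (u w : C.V) : C.join u w = C.join w u := by
  apply le_antisymm <;> rw [join_le_iff] <;>
    · obtain ⟨h1, h2, h3⟩ := C.join_le_iff.1 le_rfl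
      exact ⟨h2, h1, h3.symm⟩

theorem join_le_max (u v w : C.V) : C.join u w ≤ max (C.join u v) (C.join v w) := by
  rw [join_le_iff]
  obtain ⟨h1, h2, h3⟩ := C.join_le_iff.1 (le_max_left (C.join u v) (C.join v w))
  obtain ⟨h4, h5, h6⟩ := C.join_le_iff.1 (le_max_right (C.join u v) (C.join v w))
  exact ⟨h1, h5, h3.trans h6⟩

theorem join_anc {u : C.V} {j : ℤ} (h : C.lv u ≤ j) : C.join u (C.anc u j) = j := by
  apply le_antisymm
  · rw [join_le_iff, C.lv_anc h]
    have h1 := C.anc_self (C.anc u j)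
    rw [C.lv_anc h] at h1
    exact ⟨h, le_rfl, h1.symm⟩
  · conv_lhs => rw [← C.lv_anc h]
    exact C.lv_le_join_right _ _

theorem join_self (u : C.V) : C.join u u = C.lv u := by
  conv_lhs => rw [← C.anc_self u]
  rw [C.anc_self u]
  have := C.join_anc (u := u) le_rfl
  rwa [anc_self] at this

theorem join_p (u : C.V) : C.join u (C.p u) = C.lv u + 1 := by
  have := C.join_anc (u := u) (j := C.lv u + 1) (by omega)
  rwa [← C.p_anc le_rfl, anc_self] at this

/-- `u` lies above `w` if and only if the join of both has the level of `u`. -/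
theorem join_eq_lv_iff {u w : C.V} : C.join u w = C.lv u ↔ C.lv w ≤ C.lv u ∧ C.anc w (C.lv u) = u := by
  constructor
  · intro h
    obtain ⟨-, h2, h3⟩ := C.join_le_iff.1 h.le
    exact ⟨h2, by rw [← h3, anc_self]⟩
  · rintro ⟨h1, h2⟩
    exact le_antisymm (C.join_le_iff.2 ⟨le_rfl, h1, by rw [anc_self, h2]⟩) (C.lv_le_join_left _ _)

theorem join_p_of_ne {u w : C.V} (h : C.join u w ≠ C.lv u) : C.join (C.p u) w = C.join u w := by
  have h1 := C.lv_le_join_left u w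
  apply le_antisymm
  · obtain ⟨h1, h2, h3⟩ := C.join_le_iff.1 (le_refl (C.join u w))
    rw [join_le_iff, C.lv_p, C.anc_p (by omega)]
    exact ⟨by omega, h2, h3⟩
  · obtain ⟨h1, h2, h3⟩ := C.join_le_iff.1 (le_refl (C.join (C.p u) w))
    rw [C.lv_p] at h1
    rw [C.anc_p (by omega)] at h3
    rw [join_le_iff]
    exact ⟨by omega, h2, h3⟩

theorem join_p_of_eq {u w : C.V} (h : C.join u w = C.lv u) : C.join (C.p u) w = C.lv u + 1 := by
  have h2 := C.join_eq_lv_iff.1 h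
  rw [← C.lv_p, join_eq_lv_iff, C.lv_p]
  refine ⟨by omega, ?_⟩
  rw [← C.p_anc h2.1, h2.2]

theorem join_le_F {u w : C.V} : C.join (C.F u) (C.F w) ≤ C.join u w + C.N := by
  obtain ⟨h1, h2, h3⟩ := C.join_le_iff.1 (le_refl (C.join u w))
  rw [join_le_iff, C.lv_F, C.lv_F, ← F_anc, ← F_anc, h3]
  exact ⟨by omega, by omega, rfl⟩

/-! ### The tree as a graph -/

/-- The underlying graph: each vertex is joined to its parent. -/
def G : SimpleGraph C.V where
  Adj u v := C.p u = v ∨ C.p v = u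
  symm := ⟨fun _ _ h => h.symm⟩
  loopless := ⟨fun u h => by
    have := C.lv_p u
    rcases h with h | h <;> rw [h] at this <;> omega⟩

theorem adj_iff {u v : C.V} : C.G.Adj u v ↔ C.p u = v ∨ C.p v = u := Iff.rfl

open Classical in
/-- The next vertex on the way from `v` to the base. -/
noncomputable def toBase (v : C.V) : C.V :=
  if 0 < C.lv v then C.ray (C.lv v - 1).toNat else C.p v

theorem isRooted : IsRooted C.G C.base C.toBase fun v => (C.lv v).natAbs := by
  have hup : ∀ v, 0 < C.lv v → C.toBase v = C.ray (C.lv v - 1).toNat := fun v h => if_pos h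
  have hlow : ∀ v, ¬ 0 < C.lv v → C.toBase v = C.p v := fun v h => if_neg h
  have hb : ∀ v, v ≠ C.base → C.lv v ≠ 0 := fun v h h' => h (C.eq_ray (i := 0) (by simpa using h'))
  have hb' : ∀ v, C.lv v ≠ 0 → v ≠ C.base := fun v h h' => h (by rw [h', lv_base])
  refine ⟨fun v => ?_, fun v hv => ?_, fun u v => ?_⟩
  · constructor
    · intro h
      exact C.eq_ray (i := 0) (by simpa using h)
    · rintro rfl; rw [lv_base]; rfl
  · have := hb v hv
    by_cases h : 0 < C.lv v
    · rw [hup v h, lv_ray]; omega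
    · rw [hlow v h, C.lv_p]; omega
  · rw [adj_iff]
    have key : ∀ u v, C.p u = v → (u ≠ C.base ∧ C.toBase u = v) ∨ (v ≠ C.base ∧ C.toBase v = u) := by
      rintro u v rfl
      by_cases h : 0 ≤ C.lv u
      · have h1 := C.lv_p u
        refine Or.inr ⟨hb' _ (by omega), ?_⟩
        rw [hup _ (by omega)]
        exact (C.eq_ray (by omega)).symm
      · exact Or.inl ⟨hb' _ (by omega), hlow _ (by omega)⟩
    have key' : ∀ u v, u ≠ C.base → C.toBase u = v → C.p u = v ∨ C.p v = u := by
      rintro u v hu rfl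
      have := hb u hu
      by_cases h : 0 < C.lv u
      · right
        rw [hup _ h, p_ray]
        exact (C.eq_ray (by omega)).symm
      · exact Or.inl (hlow _ h).symm
    constructor
    · rintro (h | h)
      · exact key u v h
      · exact (key v u h).symm
    · rintro (⟨h1, h2⟩ | ⟨h1, h2⟩)
      · exact key' u v h1 h2
      · exact (key' v u h1 h2).symm

theorem neighborSet_finite (v : C.V) : (C.G.neighborSet v).Finite := by
  refine ((C.finite_children v).union (Set.finite_singleton (C.p v))).subset ?_
  rintro u (h | h)
  · exact Or.inr h.symm
  · exact Or.inl h

theorem dist_base (v : C.V) : C.G.dist C.base v = (C.lv v).natAbs := C.isRooted.dist_root v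

theorem finite_level (n : ℕ) : {v | (C.lv v).natAbs ≤ n}.Finite :=
  C.isRooted.finite_ball C.neighborSet_finite n

theorem simplicial (u w : C.V) (h : C.G.Adj u w) : C.G.Adj (C.F u) (C.F w) := by
  rcases h with h | h
  · exact Or.inl (by rw [← C.F_p, h])
  · exact Or.inr (by rw [← C.F_p, h])

/-- The branched covering of trees that belongs to a level tree. -/
@[reducible] def toTreeMap : TreeMap where
  V := C.V
  G := C.G
  isTree := C.isRooted.isTree
  locallyFinite := C.neighborSet_finite
  F := C.F
  simplicial := C.simplicial
  isOpenMap := by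
    rintro v w' (h | h)
    · exact ⟨C.p v, Or.inl rfl, by rw [C.F_p, h]⟩
    · obtain ⟨u, h1, h2⟩ := C.exists_lift h
      exact ⟨u, Or.inr h1, h2⟩
  proper := fun v => (C.finite_level (C.lv v - C.N).natAbs).subset fun u hu => by
    have h : C.F u = v := hu
    have := C.lv_F u
    rw [h] at this
    change (C.lv u).natAbs ≤ _
    rw [this]
    simp

end CTree

/-! ### Height metrics -/

/-- The height of level `i` above level `0`, if level `j` and level `j + 1` are `ℓ j` apart. -/
noncomputable def hgt (ℓ : ℤ → ℝ) (i : ℤ) : ℝ :=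
  ∑ j ∈ Finset.Ico 0 i, ℓ j - ∑ j ∈ Finset.Ico i 0, ℓ j

theorem hgt_add_one (ℓ : ℤ → ℝ) (i : ℤ) : hgt ℓ (i + 1) = hgt ℓ i + ℓ i := by
  unfold hgt
  rcases le_or_gt 0 i with h | h
  · have h1 : Finset.Ico 0 (i + 1) = insert i (Finset.Ico 0 i) := by
      ext j; simp only [Finset.mem_Ico, Finset.mem_insert]; omega
    rw [h1, Finset.sum_insert (by simp), Finset.Ico_eq_empty (by omega : ¬ i + 1 < 0),
      Finset.Ico_eq_empty (by omega : ¬ i < 0)]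
    ring
  · have h1 : Finset.Ico i 0 = insert i (Finset.Ico (i + 1) 0) := by
      ext j; simp only [Finset.mem_Ico, Finset.mem_insert]; omega
    rw [h1, Finset.sum_insert (by simp), Finset.Ico_eq_empty (by omega : ¬ 0 < i),
      Finset.Ico_eq_empty (by omega : ¬ 0 < i + 1)]
    ring

theorem hgt_zero (ℓ : ℤ → ℝ) : hgt ℓ 0 = 0 := by simp [hgt]

theorem hgt_mono {ℓ : ℤ → ℝ} (h : ∀ i, 0 ≤ ℓ i) : Monotone (hgt ℓ) :=
  monotone_int_of_le_succ fun i => by rw [hgt_add_one]; linarith [h i]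

theorem hgt_strictMono {ℓ : ℤ → ℝ} (h : ∀ i, 0 < ℓ i) : StrictMono (hgt ℓ) :=
  strictMono_int_of_lt_succ fun i => by rw [hgt_add_one]; linarith [h i]

theorem hgt_sub_shift {ℓ : ℤ → ℝ} {N : ℤ} (h : ∀ i, ℓ (i + N) = 3 * ℓ i) (a b : ℤ) :
    hgt ℓ (a + N) - hgt ℓ (b + N) = 3 * (hgt ℓ a - hgt ℓ b) := by
  have key : ∀ b, ∀ n : ℕ, hgt ℓ (b + n + N) - hgt ℓ (b + N) = 3 * (hgt ℓ (b + n) - hgt ℓ b) := by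
    intro b n
    induction n with
    | zero => simp
    | succ n ih =>
      push_cast
      rw [show b + ((n : ℤ) + 1) + N = (b + n + N) + 1 by ring, hgt_add_one,
        show b + ((n : ℤ) + 1) = (b + n) + 1 by ring, hgt_add_one, h]
      linarith
  rcases le_total b a with hab | hab
  · obtain ⟨n, rfl⟩ := Int.le.dest hab
    exact key b n
  · obtain ⟨n, rfl⟩ := Int.le.dest hab
    have := key a n
    linarith

theorem tendsto_hgt {ι : Type*} {f : Filter ι} {ℓ : ι → ℤ → ℝ} {ℓ' : ℤ → ℝ}
    (h : ∀ i, Tendsto (fun n => ℓ n i) f (𝓝 (ℓ' i))) (i : ℤ) :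
    Tendsto (fun n => hgt (ℓ n) i) f (𝓝 (hgt ℓ' i)) :=
  (tendsto_finsetSum _ fun j _ => h j).sub (tendsto_finsetSum _ fun j _ => h j)

namespace CTree

variable (C : CTree)

/-- The height metric on the vertices of a level tree. -/
noncomputable def dst (ℓ : ℤ → ℝ) (u w : C.V) : ℝ :=
  2 * hgt ℓ (C.join u w) - hgt ℓ (C.lv u) - hgt ℓ (C.lv w)

variable {C} {ℓ : ℤ → ℝ}

theorem dst_comm (u w : C.V) : C.dst ℓ u w = C.dst ℓ w u := by
  unfold dst; rw [join_comm]; ring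

theorem dst_self (u : C.V) : C.dst ℓ u u = 0 := by
  unfold dst; rw [join_self]; ring

theorem eq_of_dst_eq_zero (h : ∀ i, 0 < ℓ i) {u w : C.V} (h0 : C.dst ℓ u w = 0) : u = w := by
  have h1 := hgt_mono (fun i => (h i).le) (C.lv_le_join_left u w)
  have h2 := hgt_mono (fun i => (h i).le) (C.lv_le_join_right u w)
  unfold dst at h0
  have e1 := (hgt_strictMono h).injective (show hgt ℓ (C.join u w) = hgt ℓ (C.lv u) by linarith)
  have e2 := (hgt_strictMono h).injective (show hgt ℓ (C.join u w) = hgt ℓ (C.lv w) by linarith)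
  have h3 := (C.join_eq_lv_iff.1 e1).2
  rw [← e1, e2, anc_self] at h3
  exact h3.symm

theorem dst_p (u : C.V) : C.dst ℓ u (C.p u) = ℓ (C.lv u) := by
  unfold dst; rw [join_p, C.lv_p, hgt_add_one]; ring

/-- The four-point condition. -/
theorem dst_four (h : ∀ i, 0 ≤ ℓ i) (x y z t : C.V) :
    C.dst ℓ x y + C.dst ℓ z t ≤
      max (C.dst ℓ x z + C.dst ℓ y t) (C.dst ℓ x t + C.dst ℓ y z) := by
  have m := hgt_mono h
  have a1 := C.join_le_max x z y
  have a2 := C.join_le_max x t y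
  have b1 := C.join_le_max z x t
  have b2 := C.join_le_max z y t
  rw [C.join_comm z y, C.join_comm t y] at *
  rw [C.join_comm z x] at b1
  have key : (C.join x y ≤ C.join x z ∧ C.join z t ≤ C.join y t) ∨
      (C.join x y ≤ C.join y t ∧ C.join z t ≤ C.join x z) ∨
      (C.join x y ≤ C.join x t ∧ C.join z t ≤ C.join y z) ∨
      (C.join x y ≤ C.join y z ∧ C.join z t ≤ C.join x t) := by omega
  unfold dst
  rcases key with ⟨k1, k2⟩ | ⟨k1, k2⟩ | ⟨k1, k2⟩ | ⟨k1, k2⟩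
  · exact le_max_of_le_left (by linarith [m k1, m k2])
  · exact le_max_of_le_left (by linarith [m k1, m k2])
  · exact le_max_of_le_right (by linarith [m k1, m k2])
  · exact le_max_of_le_right (by linarith [m k1, m k2])

theorem dst_F (h : ∀ i, 0 ≤ ℓ i) (hs : ∀ i, ℓ (i + C.N) = 3 * ℓ i) (u w : C.V) :
    C.dst ℓ (C.F u) (C.F w) ≤ 3 * C.dst ℓ u w := by
  have h1 := hgt_mono h (C.join_le_F (u := u) (w := w))
  have h2 := hgt_sub_shift hs (C.join u w) (C.lv u)
  have h3 := hgt_sub_shift hs (C.join u w) (C.lv w)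
  unfold dst
  rw [C.lv_F, C.lv_F]
  linarith

theorem eq_of_adj_of_join {u x y : C.V} (h : C.G.Adj x y) (hx : C.join u x ≠ C.lv u)
    (hy : C.join u y = C.lv u) : y = u ∧ x = C.p u := by
  obtain ⟨h1, h2⟩ := C.join_eq_lv_iff.1 hy
  rcases h with rfl | rfl
  · rw [C.lv_p] at h1
    rw [C.anc_p h1] at h2
    exact absurd (C.join_eq_lv_iff.2 ⟨by omega, h2⟩) hx
  · by_cases h3 : C.lv y = C.lv u
    · rw [← h3, anc_self] at h2
      exact ⟨h2, by rw [h2]⟩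
    · refine absurd (C.join_eq_lv_iff.2 ⟨by rw [C.lv_p]; omega, ?_⟩) hx
      rw [C.anc_p (by omega), h2]

end CTree

/-! ### Metrized trees and their level trees -/

/-- The level tree `C` with lengths `ℓ i` of the edges above level `i` is a description of the
metrized tree `T`. -/
structure Models (C : CTree) (ℓ : ℤ → ℝ) (T : MetrizedTree 3) (i : C.V → T.V) : Prop where
  bij : Function.Bijective i
  adj : ∀ u v, T.G.Adj (i u) (i v) ↔ C.G.Adj u v
  map_F : ∀ v, T.F (i v) = i (C.F v)
  pos : ∀ k, 0 < ℓ k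
  scale : ∀ k, ℓ (k + C.N) = 3 * ℓ k
  len : ∀ v, T.len s(i v, i (C.p v)) = ℓ (C.lv v)

namespace Models

variable {C : CTree} {ℓ : ℤ → ℝ} {T : MetrizedTree 3} {i : C.V → T.V}

theorem nonneg (h : Models C ℓ T i) (k : ℤ) : 0 ≤ ℓ k := (h.pos k).le

/-- The length of a path is given by the heights of its ends and of the join of these. -/
theorem sum_of_isPath (h : Models C ℓ T i) {a b : T.V} (p : T.G.Walk a b) (hp : p.IsPath) :
    ∀ u w, i u = a → i w = b → (p.edges.map T.len).sum = C.dst ℓ u w := by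
  induction p with
  | nil =>
    rintro u w h1 h2
    have := h.bij.1 (h1.trans h2.symm)
    subst this
    simp [CTree.dst_self]
  | @cons a a' b hadj p ih =>
    rintro u w rfl rfl
    obtain ⟨u', rfl⟩ := h.bij.2 a'
    rw [SimpleGraph.Walk.cons_isPath_iff] at hp
    have ih' := ih hp.1 u' w rfl rfl
    rw [SimpleGraph.Walk.edges_cons, List.map_cons, List.sum_cons, ih']
    have hcross : ∀ x, C.join x u' = C.lv x → C.join x w ≠ C.lv x → C.p x = u → False := by
      intro x h1 h2 h3
      obtain ⟨d, hd, hd1, hd2⟩ := p.exists_boundary_dart {t | ∃ y, i y = t ∧ C.join x y = C.lv x}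
        ⟨u', rfl, h1⟩ (by rintro ⟨y, hy, hy'⟩; exact h2 (h.bij.1 hy ▸ hy'))
      obtain ⟨y, hy, hy'⟩ := hd1
      obtain ⟨z, hz⟩ := h.bij.2 d.snd
      have hz' : C.join x z ≠ C.lv x := fun e => hd2 ⟨z, hz, e⟩
      have hyz := (h.adj z y).1 (by rw [hz, hy]; exact d.adj.symm)
      obtain ⟨e1, e2⟩ := CTree.eq_of_adj_of_join hyz hz' hy'
      apply hp.2
      rw [← h3, ← e2, hz]
      exact p.dart_snd_mem_support_of_mem_darts hd
    rcases (h.adj _ _).1 hadj with rfl | rfl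
    · -- the first step goes up, and `w` does not lie below `u`
      have hw : C.join u w ≠ C.lv u := by
        intro hw
        obtain ⟨d, hd, hd1, hd2⟩ := p.exists_boundary_dart
          {t | ∃ y, i y = t ∧ C.join u y ≠ C.lv u} ⟨C.p u, rfl, by rw [C.join_p]; omega⟩
          (by rintro ⟨y, hy, hy'⟩; exact hy' (h.bij.1 hy ▸ hw))
        obtain ⟨y, hy, hy'⟩ := hd1
        obtain ⟨z, hz⟩ := h.bij.2 d.snd
        have hz' : C.join u z = C.lv u := by
          by_contra e
          exact hd2 ⟨z, hz, e⟩
        have hyz := (h.adj y z).1 (by rw [hz, hy]; exact d.adj)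
        obtain ⟨e1, e2⟩ := CTree.eq_of_adj_of_join hyz hy' hz'
        have hmem := p.dart_snd_mem_support_of_mem_darts hd
        rw [← hz, e1] at hmem
        exact hp.2 hmem
      rw [h.len]
      unfold CTree.dst
      rw [C.join_p_of_ne hw, C.lv_p, hgt_add_one]
      ring
    · -- the first step goes down, and `w` lies below `u'`
      have hw : C.join u' w = C.lv u' := by
        by_contra hw
        exact hcross u' (C.join_self _) hw rfl
      rw [Sym2.eq_swap, h.len]
      unfold CTree.dst
      rw [C.join_p_of_eq hw, hw, C.lv_p, hgt_add_one]
      ring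

theorem dist_eq (h : Models C ℓ T i) (u w : C.V) : T.dist (i u) (i w) = C.dst ℓ u w :=
  h.sum_of_isPath _ (T.isTree.existsUnique_path (i u) (i w)).exists.choose_spec u w rfl rfl

end Models

/-! ### Rays in polynomial-like trees -/

namespace TreeMap

variable {T : TreeMap}

@[simp] theorem mem_nbrs {v w : T.V} : w ∈ T.nbrs v ↔ T.G.Adj v w := by simp [nbrs]

@[simp] theorem mem_fiber {v w : T.V} : w ∈ T.fiber v ↔ T.F w = v := by
  simp [fiber, Set.mem_preimage]

theorem nbrs_F_subset [DecidableEq T.V] (v : T.V) : T.nbrs (T.F v) ⊆ (T.nbrs v).image T.F := by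
  intro w hw
  obtain ⟨u, h1, h2⟩ := T.isOpenMap v w (mem_nbrs.1 hw)
  exact Finset.mem_image.2 ⟨u, mem_nbrs.2 h1, h2⟩

theorem valence_F_le (v : T.V) : T.valence (T.F v) ≤ T.valence v := by
  classical
  exact (Finset.card_le_card (nbrs_F_subset v)).trans Finset.card_image_le

theorem eq_or_eq_of_valence {v a b c : T.V} (h : T.valence v = 2) (ha : T.G.Adj v a)
    (hb : T.G.Adj v b) (hab : a ≠ b) (hc : T.G.Adj v c) : c = a ∨ c = b := by
  classical
  have h1 : ({a, b} : Finset T.V) = T.nbrs v := by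
    apply Finset.eq_of_subset_of_card_le
    · intro x hx
      rcases Finset.mem_insert.1 hx with rfl | hx
      · exact mem_nbrs.2 ha
      · rw [Finset.mem_singleton.1 hx]; exact mem_nbrs.2 hb
    · rw [Finset.card_pair hab]; exact h.le
  have := mem_nbrs.2 hc
  rw [← h1] at this
  simpa using this

theorem F_ne_of_valence {v a b : T.V} (h : T.valence (T.F v) = T.valence v) (ha : T.G.Adj v a)
    (hb : T.G.Adj v b) (hab : a ≠ b) : T.F a ≠ T.F b := by
  classical
  have h1 : (T.nbrs v).card ≤ ((T.nbrs v).image T.F).card :=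
    h.ge.trans (Finset.card_le_card (nbrs_F_subset v))
  have h2 : Set.InjOn T.F (T.nbrs v) :=
    Finset.card_image_iff.1 (le_antisymm Finset.card_image_le h1)
  exact fun e => hab (h2 (mem_nbrs.2 ha) (mem_nbrs.2 hb) e)

namespace IsPolynomialLike

variable {D : ℕ} (h : T.IsPolynomialLike D)
include h

theorem two_le_valence (v : T.V) : 2 ≤ T.valence v := by
  obtain ⟨q, hq⟩ := T.isTree.exists_isRooted v
  obtain ⟨e, -⟩ := h.isolated_end
  obtain ⟨ξ, hξ, -⟩ := hq.exists_ray T.locallyFinite e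
  have h1 := hq.adj_parent (hξ.succ_ne 0)
  rw [hξ.parent, hξ.zero] at h1
  have h2 : 0 < T.valence v := Finset.card_pos.2 ⟨_, mem_nbrs.2 h1.symm⟩
  have := h.no_endpoint v
  omega

variable {o : T.V} {q : T.V → T.V} {dep : T.V → ℕ}

theorem exists_rooted_child (hq : IsRooted T.G o q dep) (v : T.V) : ∃ u, u ≠ o ∧ q u = v := by
  classical
  have h1 := h.two_le_valence v
  obtain ⟨u, hu, hne⟩ := Finset.exists_mem_ne (s := T.nbrs v) h1 (q v)
  rcases (hq.adj_iff _ _).1 (mem_nbrs.1 hu) with ⟨-, h2⟩ | h2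
  · exact absurd h2.symm hne
  · exact ⟨u, h2⟩

/-- Every vertex lies on a ray from the root. -/
theorem exists_rootRay (hq : IsRooted T.G o q dep) (v : T.V) :
    ∃ ξ, IsRootRay o q ξ ∧ ξ (dep v) = v := by
  choose c hc1 hc2 using h.exists_rooted_child hq
  refine ⟨fun n => if n ≤ dep v then q^[dep v - n] v else c^[n - dep v] v, ⟨?_, ?_, ?_⟩, by simp⟩
  · simp only [Nat.zero_le, if_true]
    exact (hq.dep_eq_zero _).1 (by rw [hq.dep_iterate _ _ (by omega)]; omega)
  · intro n
    by_cases hn : n + 1 ≤ dep v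
    · simp only [hn, if_true]
      exact hq.ne_root (by rw [hq.dep_iterate _ _ (by omega)]; omega)
    · simp only [hn, if_false]
      rw [show n + 1 - dep v = (n - dep v) + 1 by omega, Function.iterate_succ_apply']
      exact hc1 _
  · intro n
    by_cases hn : n + 1 ≤ dep v
    · have hn' : n ≤ dep v := by omega
      simp only [hn, hn', if_true]
      rw [show dep v - n = (dep v - (n + 1)) + 1 by omega, Function.iterate_succ_apply']
    · simp only [hn, if_false]
      rw [show n + 1 - dep v = (n - dep v) + 1 by omega, Function.iterate_succ_apply', hc2]
      by_cases hn' : n ≤ dep v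
      · simp only [hn', if_true]
        rw [show n - dep v = 0 by omega, show dep v - n = 0 by omega]
        rfl
      · simp only [hn', if_false]

omit h in
theorem rootRay_adj (hq : IsRooted T.G o q dep) {ξ : ℕ → T.V} (hξ : IsRootRay o q ξ) (n : ℕ) :
    T.G.Adj (ξ n) (ξ (n + 1)) :=
  (hq.adj_iff _ _).2 (Or.inr ⟨hξ.succ_ne n, hξ.parent n⟩)

omit h in
theorem rootRay_ne (hq : IsRooted T.G o q dep) {ξ : ℕ → T.V} (hξ : IsRootRay o q ξ) {m n : ℕ}
    (hmn : m ≠ n) : ξ m ≠ ξ n := fun e => hmn (by rw [← hq.dep_ray hξ m, e, hq.dep_ray hξ])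

omit h in
/-- A ray with valence 2 from some vertex on is determined by this vertex. -/
theorem ray_eq_of_valence (hq : IsRooted T.G o q dep) {ξ η : ℕ → T.V} (hξ : IsRootRay o q ξ)
    (hη : IsRootRay o q η) {k : ℕ} (hk : ∀ m, k < m → T.valence (ξ m) = 2)
    (e : η (k + 1) = ξ (k + 1)) : η = ξ := by
  have up : ∀ m, η (k + 1 + m) = ξ (k + 1 + m) := by
    intro m
    induction m with
    | zero => exact e
    | succ m ih =>
      have h1 := rootRay_adj hq hη (k + 1 + m)
      rw [ih] at h1
      rcases eq_or_eq_of_valence (hk (k + 1 + m) (by omega))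
        (show T.G.Adj _ (ξ (k + m)) from by
          have := (rootRay_adj hq hξ (k + m)).symm
          rwa [show k + m + 1 = k + 1 + m by omega] at this)
        (rootRay_adj hq hξ (k + 1 + m)) (rootRay_ne hq hξ (by omega)) h1 with h2 | h2
      · have := hη.parent (k + 1 + m)
        have h3 := hq.dep_ray hη (k + 1 + m + 1)
        rw [h2, hq.dep_ray hξ] at h3
        omega
      · exact h2
  funext n
  exact hη.eq_of_le hξ (Nat.le_add_left n (k + 1)) (up n)

/-- A ray is eventually of valence 2 if its end is isolated. -/
theorem exists_valence_two (hq : IsRooted T.G o q dep) {e : T.G.end} {ξ : ℕ → T.V}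
    (hξ : IsRootRay o q ξ) (he : RayToEnd dep e ξ) (hi : IsIsolatedEnd T.G e) :
    ∃ k, ∀ m, k ≤ m → T.valence (ξ m) ≤ 2 := by
  classical
  obtain ⟨n, hn⟩ := (hq.isIsolatedEnd_iff T.locallyFinite hξ he).1 hi
  refine ⟨n, fun m hm => ?_⟩
  have : T.nbrs (ξ m) ⊆ {q (ξ m), ξ (m + 1)} := by
    intro u hu
    rw [Finset.mem_insert, Finset.mem_singleton]
    rcases (hq.adj_iff _ _).1 (mem_nbrs.1 hu) with ⟨-, h2⟩ | ⟨h2, h3⟩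
    · exact Or.inl h2.symm
    · right
      obtain ⟨η, hη, hη'⟩ := h.exists_rootRay hq u
      have h4 : dep u = m + 1 := by rw [← hq.dep_parent u h2, h3, hq.dep_ray hξ]
      rw [h4] at hη'
      have h5 : η m = ξ m := by rw [← hη.parent, hη', h3]
      rw [← hη', hn η hη (hη.eq_of_le hξ hm h5)]
  exact (Finset.card_le_card this).trans Finset.card_le_two

/-- The base is the last vertex of valence at least 3 on a ray to the isolated end. -/
theorem exists_isBaseRay : ∃ r, T.IsBaseRay r := by
  classical
  obtain ⟨e, he, -⟩ := h.isolated_end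
  obtain ⟨v₀⟩ := T.isTree.connected.nonempty
  obtain ⟨o, -, ho⟩ := h.branch v₀
  obtain ⟨q, hq⟩ := T.isTree.exists_isRooted o
  obtain ⟨ξ, hξ, hξe⟩ := hq.exists_ray T.locallyFinite e
  obtain ⟨k, hk⟩ := h.exists_valence_two hq hξ hξe he
  let b := Nat.findGreatest (fun m => 3 ≤ T.valence (ξ m)) k
  have hb : 3 ≤ T.valence (ξ b) :=
    Nat.findGreatest_spec (P := fun m => 3 ≤ T.valence (ξ m)) (Nat.zero_le k) (by rw [hξ.zero]; exact ho)
  refine ⟨fun i => ξ (b + i), fun i => rootRay_adj hq hξ _, fun i j hij => ?_, hb, fun i => ?_⟩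
  · by_contra hne
    exact rootRay_ne hq hξ (show b + i ≠ b + j by omega) hij
  · have h1 := h.two_le_valence (ξ (b + (i + 1)))
    have h2 : ¬ 3 ≤ T.valence (ξ (b + (i + 1))) := by
      by_cases hle : b + (i + 1) ≤ k
      · exact Nat.findGreatest_is_greatest (P := fun m => 3 ≤ T.valence (ξ m)) (n := k)
          (show b < b + (i + 1) by omega) hle
      · have := hk (b + (i + 1)) (by omega)
        omega
    change T.valence (ξ (b + (i + 1))) = 2
    omega

omit h in
theorem isRootRay_of_isBaseRay {r : ℕ → T.V} (hr : T.IsBaseRay r) (hq : IsRooted T.G (r 0) q dep) :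
    IsRootRay (r 0) q r := by
  have hne : ∀ n, r (n + 1) ≠ r 0 := fun n e => by have := hr.injective e; omega
  refine ⟨rfl, hne, fun n => ?_⟩
  induction n with
  | zero =>
    rcases (hq.adj_iff _ _).1 (hr.adj 0) with ⟨h1, -⟩ | ⟨-, h2⟩
    · exact absurd rfl h1
    · exact h2
  | succ n ih =>
    rcases (hq.adj_iff _ _).1 (hr.adj (n + 1)) with ⟨-, h2⟩ | ⟨-, h2⟩
    · rw [ih] at h2
      have := hr.injective h2
      omega
    · exact h2

/-- Every geodesic ray of valence 2 runs into the base ray. -/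
theorem eventually_eq_baseRay {r : ℕ → T.V} (hr : T.IsBaseRay r) {x : ℕ → T.V}
    (hx : ∀ i, T.G.Adj (x i) (x (i + 1))) (hnb : ∀ i, x (i + 2) ≠ x i)
    (hv : ∀ i, T.valence (x (i + 1)) = 2) : ∃ a b, ∀ i, x (a + i) = r (b + i) := by
  obtain ⟨q, hq⟩ := T.isTree.exists_isRooted (r 0)
  have hr' := isRootRay_of_isBaseRay hr hq
  have hdown : ∀ i, (x (i + 1) ≠ r 0 ∧ q (x (i + 1)) = x i) →
      (x (i + 2) ≠ r 0 ∧ q (x (i + 2)) = x (i + 1)) := by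
    rintro i ⟨h1, h2⟩
    rcases (hq.adj_iff _ _).1 (hx (i + 1)) with ⟨-, h3⟩ | h3
    · exact absurd (h3.symm.trans h2) (hnb i)
    · exact h3
  have hex : ∃ a, x (a + 1) ≠ r 0 ∧ q (x (a + 1)) = x a := by
    by_contra hno
    push Not at hno
    have : ∀ i, T.G.dist (r 0) (x i) + i = T.G.dist (r 0) (x 0) := by
      intro i
      induction i with
      | zero => rfl
      | succ i ih =>
        rcases (hq.adj_iff _ _).1 (hx i) with ⟨h1, h2⟩ | ⟨h1, h2⟩
        · have := hq.dep_parent _ h1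
          rw [h2] at this
          omega
        · exact absurd h2 (hno i h1)
    have := this (T.G.dist (r 0) (x 0) + 1)
    omega
  obtain ⟨a, ha⟩ := hex
  have hall : ∀ i, x (a + i + 1) ≠ r 0 ∧ q (x (a + i + 1)) = x (a + i) := by
    intro i
    induction i with
    | zero => exact ha
    | succ i ih => exact hdown _ ih
  -- continue the ray backwards to the root
  obtain ⟨η, hη, hηa⟩ := h.exists_rootRay hq (x a)
  set d := T.G.dist (r 0) (x a) with hd
  let ζ : ℕ → T.V := fun n => if n ≤ d then η n else x (a + (n - d))
  have hζ1 : ∀ i, ζ (d + i) = x (a + i) := by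
    intro i
    by_cases hi : d + i ≤ d
    · have : i = 0 := by omega
      subst this
      simp [ζ, hηa]
    · simp only [ζ, hi, if_false]
      congr 2
      omega
  have hζ : IsRootRay (r 0) q ζ := by
    refine ⟨by simp [ζ, hη.zero], fun n => ?_, fun n => ?_⟩
    · by_cases hn : n + 1 ≤ d
      · simp only [ζ, hn, if_true]; exact hη.succ_ne n
      · obtain ⟨i, rfl⟩ : ∃ i, n = d + i := ⟨n - d, by omega⟩
        rw [Nat.add_assoc, hζ1]
        exact (hall i).1
    · by_cases hn : n + 1 ≤ d
      · have hn' : n ≤ d := by omega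
        simp only [ζ, hn, hn', if_true]; exact hη.parent n
      · obtain ⟨i, rfl⟩ : ∃ i, n = d + i := ⟨n - d, by omega⟩
        rw [Nat.add_assoc, hζ1, hζ1]
        exact (hall i).2
  have hζv : ∀ m, d < m → T.valence (ζ m) = 2 := by
    intro m hm
    obtain ⟨i, rfl⟩ : ∃ i, m = d + (i + 1) := ⟨m - d - 1, by omega⟩
    rw [hζ1]
    exact hv _
  -- both rays have isolated ends, and there is only one isolated end
  obtain ⟨e1, he1⟩ := hq.exists_end hζ
  obtain ⟨e2, he2⟩ := hq.exists_end hr'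
  have i1 : IsIsolatedEnd T.G e1 := (hq.isIsolatedEnd_iff T.locallyFinite hζ he1).2
    ⟨d + 1, fun η hη e => ray_eq_of_valence hq hζ hη hζv e⟩
  have i2 : IsIsolatedEnd T.G e2 := (hq.isIsolatedEnd_iff T.locallyFinite hr' he2).2
    ⟨0 + 1, fun η hη e => ray_eq_of_valence hq hr' hη (fun m hm => by
      obtain ⟨i, rfl⟩ : ∃ i, m = i + 1 := ⟨m - 1, by omega⟩
      exact hr.valence_succ i) e⟩
  have := h.isolated_end.unique i1 i2
  subst this
  have := hq.ray_unique T.locallyFinite hζ hr' he1 he2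
  exact ⟨a, d, fun i => by rw [← hζ1, this]⟩

/-- The map sends the base ray into itself; the case that it moves the base ray down or fixes it
pointwise is left to metric arguments. -/
theorem exists_shift {r : ℕ → T.V} (hr : T.IsBaseRay r) : ∃ N, ∀ i, T.F (r i) = r (i + N) := by
  have hne : ∀ i, r i ≠ r (i + 2) := fun i e => by have := hr.injective e; omega
  have hval : ∀ i, T.valence (T.F (r (i + 1))) = 2 := fun i => by
    have h1 := valence_F_le (r (i + 1))
    rw [hr.valence_succ] at h1
    have := h.two_le_valence (T.F (r (i + 1)))
    omega
  have hnb : ∀ i, T.F (r (i + 2)) ≠ T.F (r i) := fun i =>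
    F_ne_of_valence (v := r (i + 1)) (by rw [hval, hr.valence_succ]) (hr.adj (i + 1))
      (hr.adj i).symm (hne i).symm
  -- the image of the base ray is a ray of valence 2, so that far out it is the base ray
  obtain ⟨a, b, hab⟩ := h.eventually_eq_baseRay hr (x := fun i => T.F (r i))
    (fun i => T.simplicial _ _ (hr.adj i)) hnb hval
  -- two consecutive steps on both rays determine the previous one, as the valence is 2
  have hback : ∀ j a' b' : ℕ, a = a' + j → b = b' + j → ∀ i, T.F (r (a' + i)) = r (b' + i) := by
    intro j
    induction j with
    | zero => rintro a' b' rfl rfl; exact hab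
    | succ j ih =>
      rintro a' b' h1 h2 i
      have ih' := ih (a' + 1) (b' + 1) (by omega) (by omega)
      cases i with
      | succ i =>
        have := ih' i
        rwa [show a' + 1 + i = a' + (i + 1) by omega, show b' + 1 + i = b' + (i + 1) by omega] at this
      | zero =>
        have e0 := ih' 0
        have e1 := ih' 1
        have := T.simplicial _ _ (hr.adj a').symm
        rw [Nat.add_zero] at e0
        rw [e0] at this
        rcases eq_or_eq_of_valence (hr.valence_succ b') (hr.adj b').symm (hr.adj (b' + 1)) (hne b') this
          with h3 | h3
        · exact h3
        · refine absurd ?_ (hnb a')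
          rw [h3]
          exact e1
  -- a shift down would map a vertex of valence 2 to the base
  rcases le_total a b with hle | hle
  · refine ⟨b - a, fun i => ?_⟩
    have := hback a 0 (b - a) (by omega) (by omega) i
    rwa [Nat.zero_add, Nat.add_comm] at this
  · rcases Nat.eq_or_lt_of_le hle with rfl | hlt
    · exact ⟨0, fun i => by simpa using hback b 0 0 (by omega) (by omega) i⟩
    · have := hback b (a - b) 0 (by omega) (by omega) 0
      obtain ⟨c, hc⟩ : ∃ c, a - b = c + 1 := ⟨a - b - 1, by omega⟩
      rw [hc] at this
      have h1 := hval c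
      simp only [Nat.add_zero] at this
      rw [this] at h1
      have := hr.valence_base
      omega

end IsPolynomialLike

end TreeMap

/-! ### The level tree of a polynomial-like tree -/

namespace TreeMap

/-- Levels relative to the base ray: `p v` is the neighbour of `v` in the direction of `∞`. -/
structure IsLevel (T : TreeMap) (r : ℕ → T.V) (p : T.V → T.V) (lv : T.V → ℤ) : Prop where
  adj_iff : ∀ u v, T.G.Adj u v ↔ p u = v ∨ p v = u
  lv_p : ∀ v, lv (p v) = lv v + 1
  lv_ray : ∀ i : ℕ, lv (r i) = i
  eq_ray : ∀ v, ∀ i : ℕ, lv v = i → v = r i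

variable {T : TreeMap} {r : ℕ → T.V} {p : T.V → T.V} {lv : T.V → ℤ}

/-- `p` goes up along the base ray and towards the base elsewhere. The other branches leave the ray
only at the base, so that the negative levels are those off the ray. -/
theorem IsBaseRay.exists_isLevel (hr : T.IsBaseRay r) : ∃ p lv, T.IsLevel r p lv := by
  classical
  obtain ⟨q, hq⟩ := T.isTree.exists_isRooted (r 0)
  have hr' := IsPolynomialLike.isRootRay_of_isBaseRay hr hq
  set dep := T.G.dist (r 0)
  have hdr : ∀ i, dep (r i) = i := hq.dep_ray hr'
  have hon : ∀ v, v ∈ Set.range r → v = r (dep v) := by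
    rintro _ ⟨i, rfl⟩; rw [hdr]
  let p : T.V → T.V := fun v => if v ∈ Set.range r then r (dep v + 1) else q v
  let lv : T.V → ℤ := fun v => if v ∈ Set.range r then (dep v : ℤ) else -dep v
  have p1 : ∀ i, p (r i) = r (i + 1) := fun i => by simp [p, hdr]
  have l1 : ∀ i : ℕ, lv (r i) = i := fun i => by simp [lv, hdr]
  have p2 : ∀ v, v ∉ Set.range r → p v = q v := fun v hv => if_neg hv
  have l2 : ∀ v, v ∉ Set.range r → lv v = -dep v := fun v hv => if_neg hv
  have hne : ∀ v, v ∉ Set.range r → v ≠ r 0 := fun v hv e => hv ⟨0, e.symm⟩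
  -- a vertex off the ray hangs below the base
  have hq0 : ∀ v, v ∉ Set.range r → ∀ i, q v = r i → i = 0 := by
    intro v hv i hi
    by_contra h0
    obtain ⟨j, rfl⟩ : ∃ j, i = j + 1 := ⟨i - 1, by omega⟩
    have hadj := (hq.adj_parent (hne v hv)).symm
    rw [hi] at hadj
    rcases eq_or_eq_of_valence (hr.valence_succ j) (hr.adj j).symm (hr.adj (j + 1))
      (fun e => by have := hr.injective e; omega) hadj with e | e
    · exact hv ⟨_, e.symm⟩
    · exact hv ⟨_, e.symm⟩
  refine ⟨p, lv, ⟨fun u v => ?_, fun v => ?_, l1, fun v i hi => ?_⟩⟩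
  · have key : ∀ u v, u ≠ r 0 → q u = v → p u = v ∨ p v = u := by
      rintro u v hu rfl
      by_cases h : u ∈ Set.range r
      · right
        obtain ⟨i, rfl⟩ := h
        obtain ⟨j, rfl⟩ : ∃ j, i = j + 1 := ⟨i - 1, by
          have : i ≠ 0 := fun e => hu (by rw [e])
          omega⟩
        rw [hr'.parent, p1]
      · exact Or.inl (p2 u h)
    have key' : ∀ u v, p u = v → T.G.Adj u v := by
      rintro u v rfl
      by_cases h : u ∈ Set.range r
      · obtain ⟨i, rfl⟩ := h
        rw [p1]; exact hr.adj i
      · rw [p2 u h]; exact hq.adj_parent (hne u h)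
    constructor
    · intro h
      rcases (hq.adj_iff u v).1 h with ⟨h1, h2⟩ | ⟨h1, h2⟩
      · exact key u v h1 h2
      · exact (key v u h1 h2).symm
    · rintro (h | h)
      · exact key' u v h
      · exact (key' v u h).symm
  · by_cases h : v ∈ Set.range r
    · obtain ⟨i, rfl⟩ := h
      rw [p1, l1, l1]; push_cast; rfl
    · have h1 := hq.dep_parent v (hne v h)
      rw [p2 v h, l2 v h]
      by_cases h' : q v ∈ Set.range r
      · obtain ⟨i, hi⟩ := h'
        have := hq0 v h i hi.symm
        subst this
        rw [← hi, l1]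
        rw [← hi, hdr] at h1
        omega
      · rw [l2 _ h']; omega
  · by_cases h : v ∈ Set.range r
    · obtain ⟨j, rfl⟩ := h
      rw [l1] at hi
      rw [Nat.cast_inj.1 hi]
    · rw [l2 v h] at hi
      exact absurd ((hq.dep_eq_zero v).1 (by omega)) (hne v h)

namespace IsLevel

variable (hL : T.IsLevel r p lv)
include hL

theorem lv_iterate (n : ℕ) (v : T.V) : lv (p^[n] v) = lv v + n := by
  induction n with
  | zero => simp
  | succ n ih => rw [Function.iterate_succ_apply', hL.lv_p, ih]; push_cast; ring

theorem exists_iterate_eq_ray (v : T.V) : ∃ n m, p^[n] v = r m ∧ 1 ≤ m := by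
  refine ⟨(1 - lv v).toNat, (lv v + (1 - lv v).toNat).toNat, hL.eq_ray _ _ ?_, ?_⟩
  · rw [hL.lv_iterate]; omega
  · omega

theorem not_mem_range {v : T.V} (h : lv v < 0) (i : ℕ) : v ≠ r i := by
  rintro rfl
  rw [hL.lv_ray] at h
  omega

theorem p_ray (i : ℕ) : p (r i) = r (i + 1) :=
  hL.eq_ray _ _ (by rw [hL.lv_p, hL.lv_ray]; push_cast; rfl)

variable {N : ℕ} (hF : ∀ i, T.F (r i) = r (i + N))

/-- No descending ray is mapped up along the base ray: the ray would have infinitely many branches,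
and they would yield too many preimages of some vertex. -/
theorem false_of_descending {D : ℕ} (h : T.IsPolynomialLike D) (hr : T.IsBaseRay r)
    {x : ℕ → T.V} (hx : ∀ i, p (x (i + 1)) = x i) (hx0 : lv (x 0) < 0) {j : ℕ}
    (hFx : ∀ i, T.F (x i) = r (j + i)) : False := by
  classical
  obtain ⟨dv, de, hd, hD⟩ := h.local_degree
  have : Nonempty T.V := ⟨x 0⟩
  have hlv : ∀ i : ℕ, lv (x i) = lv (x 0) - i := by
    intro i
    induction i with
    | zero => simp
    | succ i ih => have := hL.lv_p (x (i + 1)); rw [hx] at this; push_cast; omega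
  have hadj : ∀ i, T.G.Adj (x i) (x (i + 1)) := fun i => (hL.adj_iff _ _).2 (Or.inr (hx i))
  have hne : ∀ i k, i ≠ k → x i ≠ x k := fun i k hik e => by
    have := congrArg lv e
    rw [hlv i, hlv k] at this
    omega
  -- otherwise the ray would be part of the base ray from some vertex on
  have hinf : ∀ a, ∃ i, a ≤ i ∧ T.valence (x (i + 1)) ≠ 2 := by
    by_contra hno
    push Not at hno
    obtain ⟨a, ha⟩ := hno
    obtain ⟨b, c, hbc⟩ := h.eventually_eq_baseRay hr (x := fun i => x (a + i))
      (fun i => hadj _) (fun i => hne _ _ (by omega)) (fun i => ha (a + i) (by omega))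
    exact hL.not_mem_range (v := x (a + (b + 0))) (by rw [hlv]; omega) _ (hbc 0)
  -- side branches
  have hside : ∀ i, T.valence (x (i + 1)) ≠ 2 → ∃ y, p y = x (i + 1) ∧ y ≠ x (i + 2) := by
    intro i hi
    have h2 : 2 < (T.nbrs (x (i + 1))).card :=
      lt_of_le_of_ne (h.two_le_valence (x (i + 1))) hi.symm
    obtain ⟨y, hy⟩ : ((T.nbrs (x (i + 1))) \ {x i, x (i + 2)}).Nonempty := by
      rw [← Finset.card_pos]
      have := Finset.le_card_sdiff {x i, x (i + 2)} (T.nbrs (x (i + 1)))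
      have := Finset.card_le_two (a := x i) (b := x (i + 2))
      omega
    rw [Finset.mem_sdiff, Finset.mem_insert, Finset.mem_singleton] at hy
    rcases (hL.adj_iff _ _).1 (mem_nbrs.1 hy.1) with h1 | h1
    · exact absurd (Or.inl (by rw [← h1, hx])) hy.2
    · exact ⟨y, h1, fun e => hy.2 (Or.inr e)⟩
  -- lifts of the two directions of the base ray
  have hstep : ∀ w z, T.G.Adj (T.F w) z → z ≠ T.F (p w) → ∃ t, p t = w ∧ T.F t = z := by
    intro w z hz hne
    obtain ⟨t, h1, h2⟩ := T.isOpenMap w z hz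
    rcases (hL.adj_iff _ _).1 h1 with h3 | h3
    · exact absurd (by rw [h3, h2]) hne
    · exact ⟨t, h3, h2⟩
  have hrne : ∀ a b, a ≠ b → r a ≠ r b := fun a b hab e => hab (hr.injective e)
  have hup : ∀ k w m, T.F w = r (m + 1) → T.F (p w) = r m →
      ∃ z, p^[k] z = w ∧ T.F z = r (m + 1 + k) := by
    intro k
    induction k with
    | zero => intro w m h1 _; exact ⟨w, rfl, h1⟩
    | succ k ih =>
      intro w m h1 h2
      obtain ⟨t, h3, h4⟩ := hstep w (r (m + 2)) (by rw [h1]; exact hr.adj _)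
        (by rw [h2]; exact hrne _ _ (by omega))
      obtain ⟨z, h5, h6⟩ := ih t (m + 1) h4 (by rw [h3, h1])
      exact ⟨z, by rw [Function.iterate_succ_apply', h5, h3], by rw [h6]; congr 1; omega⟩
  have hdn : ∀ k w m, T.F w = r (m + k) → T.F (p w) = r (m + k + 1) →
      ∃ z, p^[k] z = w ∧ T.F z = r m := by
    intro k
    induction k with
    | zero => intro w m h1 _; exact ⟨w, rfl, h1⟩
    | succ k ih =>
      intro w m h1 h2
      obtain ⟨t, h3, h4⟩ := hstep w (r (m + k)) (by rw [h1]; exact (hr.adj _).symm)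
        (by rw [h2]; exact hrne _ _ (by omega))
      obtain ⟨z, h5, h6⟩ := ih t m h4 (by rw [h3, h1]; rfl)
      exact ⟨z, by rw [Function.iterate_succ_apply', h5, h3], h6⟩
  -- a vertex below a side branch determines the place of the branch
  have hinj : ∀ i i' y y' k k' z, p y = x (i + 1) → y ≠ x (i + 2) → p y' = x (i' + 1) →
      y' ≠ x (i' + 2) → p^[k] z = y → p^[k'] z = y' → i ≤ i' → i = i' := by
    intro i i' y y' k k' z h1 h2 h3 h4 h5 h6 hle
    by_contra hne'
    have e1 := hL.lv_iterate k z
    have e2 := hL.lv_iterate k' z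
    have e3 := hL.lv_p y
    have e4 := hL.lv_p y'
    rw [h5] at e1; rw [h6] at e2; rw [h1, hlv] at e3; rw [h3, hlv] at e4
    push_cast at e3 e4
    obtain ⟨c, rfl⟩ : ∃ c, i' = i + c + 1 := ⟨i' - i - 1, by omega⟩
    have hk : k = c + (k' + 1) := by push_cast at e4; omega
    have hit : ∀ c i, p^[c] (x (i + c)) = x i := by
      intro c
      induction c with
      | zero => intro i; rfl
      | succ c ih => intro i; rw [Function.iterate_succ_apply, ← Nat.add_assoc, hx, ih]
    apply h2
    rw [← h5, hk, Function.iterate_add_apply, Function.iterate_succ_apply', h6, h3,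
      show i + c + 1 + 1 = (i + 2) + c by omega, hit]
  -- the neighbours of `F (x (i + 1))` are its two neighbours on the base ray
  have hbranch : ∀ i, T.valence (x (i + 1)) ≠ 2 → ∃ y, p y = x (i + 1) ∧ y ≠ x (i + 2) ∧
      (T.F y = r (j + i) ∨ T.F y = r (j + i + 2)) := by
    intro i hi
    obtain ⟨y, h1, h2⟩ := hside i hi
    refine ⟨y, h1, h2, ?_⟩
    have h3 := T.simplicial _ _ ((hL.adj_iff (x (i + 1)) y).2 (Or.inr h1))
    rw [hFx] at h3
    exact eq_or_eq_of_valence (hr.valence_succ (j + i)) (hr.adj (j + i)).symm (hr.adj (j + i + 1))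
      (hrne _ _ (by omega)) h3
  let B : Set ℕ := {i | T.valence (x (i + 1)) ≠ 2}
  have hB : B.Infinite := Set.infinite_of_forall_exists_gt fun a => by
    obtain ⟨i, h1, h2⟩ := hinf (a + 1)
    exact ⟨i, h2, h1⟩
  choose! y hy1 hy2 hy3 using hbranch
  have hsplit : B = {i ∈ B | T.F (y i) = r (j + i)} ∪ {i ∈ B | T.F (y i) = r (j + i + 2)} := by
    ext i
    constructor
    · intro hi
      rcases hy3 i hi with h1 | h1
      · exact Or.inl ⟨hi, h1⟩
      · exact Or.inr ⟨hi, h1⟩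
    · rintro (hi | hi) <;> exact hi.1
  rw [hsplit, Set.infinite_union] at hB
  rcases hB with hB | hB
  · -- the side branches that are mapped down reach `r j`, which has finite fibre
    have hz : ∀ i, i ∈ {i ∈ B | T.F (y i) = r (j + i)} → ∃ z, p^[i] z = y i ∧ T.F z = r j := by
      rintro i ⟨h1, h2⟩
      exact hdn i (y i) j h2 (by rw [hy1 i h1, hFx]; rfl)
    choose! z hz1 hz2 using hz
    refine Set.infinite_of_injOn_mapsTo (f := z) (t := (T.fiber (r j) : Set T.V)) ?_ ?_ hB
      (T.fiber (r j)).finite_toSet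
    · intro i hi i' hi' e
      rcases le_total i i' with hle | hle
      · exact hinj i i' (y i) (y i') i i' (z i) (hy1 i hi.1) (hy2 i hi.1) (hy1 i' hi'.1) (hy2 i' hi'.1)
          (hz1 i hi) (by rw [e, hz1 i' hi']) hle
      · exact (hinj i' i (y i') (y i) i' i (z i) (hy1 i' hi'.1) (hy2 i' hi'.1) (hy1 i hi.1)
          (hy2 i hi.1) (by rw [e, hz1 i' hi']) (hz1 i hi) hle).symm
    · intro i hi
      rw [Finset.mem_coe, mem_fiber, hz2 i hi]
  · -- `D + 1` side branches that are mapped up reach a common vertex `r M`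
    obtain ⟨t, ht1, ht2⟩ := hB.exists_subset_card_eq (D + 1)
    let M := j + t.sup id + 2
    have hz : ∀ i, i ∈ t → ∃ z, p^[M - (j + i + 2)] z = y i ∧ T.F z = r M := by
      intro i hi
      obtain ⟨h1, h2⟩ := ht1 hi
      have h3 : i ≤ t.sup id := Finset.le_sup (f := id) hi
      obtain ⟨z, h4, h5⟩ := hup (M - (j + i + 2)) (y i) (j + i + 1) h2
        (by rw [hy1 i h1, hFx]; rfl)
      refine ⟨z, h4, ?_⟩
      rw [h5]
      congr 1
      simp only [M]
      omega
    choose! z hz1 hz2 using hz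
    have hcard : t.card ≤ (T.fiber (r M)).card := by
      refine Finset.card_le_card_of_injOn z (fun i hi => ?_) ?_
      · rw [Finset.mem_coe, mem_fiber, hz2 i hi]
      · intro i hi i' hi' e
        have a := ht1 hi
        have a' := ht1 hi'
        rcases le_total i i' with hle | hle
        · exact hinj i i' (y i) (y i') _ _ (z i) (hy1 i a.1) (hy2 i a.1) (hy1 i' a'.1)
            (hy2 i' a'.1) (hz1 i hi) (by rw [e, hz1 i' hi']) hle
        · exact (hinj i' i (y i') (y i) _ _ (z i) (hy1 i' a'.1) (hy2 i' a'.1) (hy1 i a.1)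
            (hy2 i a.1) (by rw [e, hz1 i' hi']) (hz1 i hi) hle).symm
    have h2 : (T.fiber (r M)).card ≤ D := by
      rw [← hD (r M), Finset.card_eq_sum_ones]
      exact Finset.sum_le_sum fun v _ => hd.one_le_vertex v
    omega

include hF in
/-- The map commutes with going up. At a vertex where it does not, some neighbour below is mapped to
the vertex above the image, and there the map does not commute with going up either; this gives a
descending ray whose image goes up and ends in the base ray. -/
theorem F_p {D : ℕ} (h : T.IsPolynomialLike D) (hr : T.IsBaseRay r) (v : T.V) :
    T.F (p v) = p (T.F v) := by
  by_contra hv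
  have hstep : ∀ w, T.F (p w) ≠ p (T.F w) → ∃ t, p t = w ∧ T.F t = p (T.F w) := by
    intro w hw
    obtain ⟨t, h1, h2⟩ := T.isOpenMap w (p (T.F w)) ((hL.adj_iff _ _).2 (Or.inl rfl))
    rcases (hL.adj_iff _ _).1 h1 with h3 | h3
    · exact absurd (by rw [h3, h2]) hw
    · exact ⟨t, h3, h2⟩
  have hkeep : ∀ w t, p t = w → T.F t = p (T.F w) → T.F (p t) ≠ p (T.F t) := by
    intro w t h1 h2 e
    rw [h1, h2] at e
    have := hL.lv_iterate 2 (T.F w)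
    simp only [Function.iterate_succ, Function.iterate_zero, Function.comp, id] at this
    rw [← e] at this
    omega
  choose! c hc1 hc2 using hstep
  let x : ℕ → T.V := fun i => c^[i] v
  have hx : ∀ i, T.F (p (x i)) ≠ p (T.F (x i)) := by
    intro i
    induction i with
    | zero => exact hv
    | succ i ih =>
      simp only [x, Function.iterate_succ_apply']
      exact hkeep _ _ (hc1 _ ih) (hc2 _ ih)
  have hx1 : ∀ i, p (x (i + 1)) = x i := fun i => by
    simp only [x, Function.iterate_succ_apply']; exact hc1 _ (hx i)
  have hx2 : ∀ i, T.F (x (i + 1)) = p (T.F (x i)) := fun i => by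
    simp only [x, Function.iterate_succ_apply']; exact hc2 _ (hx i)
  have hx3 : ∀ i, T.F (x i) = p^[i] (T.F v) := by
    intro i
    induction i with
    | zero => rfl
    | succ i ih => rw [hx2, ih, Function.iterate_succ_apply']
  obtain ⟨n, m, hnm, -⟩ := hL.exists_iterate_eq_ray (T.F v)
  have hv0 : lv v < 0 := by
    by_contra h0
    have e := hL.eq_ray v (lv v).toNat (by omega)
    apply hv
    rw [e, hL.p_ray, hF, hF, hL.p_ray]
    congr 1; omega
  have hlv : ∀ i : ℕ, lv (x i) = lv v - i := by
    intro i
    induction i with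
    | zero => simp [x]
    | succ i ih => have := hL.lv_p (x (i + 1)); rw [hx1] at this; push_cast; omega
  refine hL.false_of_descending h hr (x := fun i => x (n + i)) (fun i => hx1 _)
    (by rw [hlv]; omega) (j := m) fun i => ?_
  rw [hx3, Nat.add_comm n i, Function.iterate_add_apply, hnm]
  apply hL.eq_ray
  rw [hL.lv_iterate, hL.lv_ray]; push_cast; rfl

end IsLevel

open Classical in
/-- A local degree function in terms of levels: the edge above a vertex has the same degree as the
vertex. -/
theorem IsLevel.degree (hL : T.IsLevel r p lv) (hFp : ∀ v, T.F (p v) = p (T.F v))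
    {dv : T.V → ℕ} {de : Sym2 T.V → ℕ} (hd : T.IsLocalDegree dv de) :
    (∀ v, de s(v, p v) = dv v) ∧
    (∀ v w, p w = T.F v →
      ∑ u ∈ (T.nbrs v).filter (fun u => p u = v ∧ T.F u = w), dv u = dv v) ∧
    ∀ v, ∑ u ∈ (T.nbrs v).filter (fun u => p u = v), (dv u - 1) + (dv v - 1) =
      ∑ u ∈ T.nbrs v, (de s(v, u) - 1) := by
  have hpp : ∀ v, p (p v) ≠ v := fun v e => by
    have := hL.lv_iterate 2 v
    simp only [Function.iterate_succ, Function.iterate_zero, Function.comp, id] at this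
    rw [e] at this
    omega
  have h1 : ∀ v, de s(v, p v) = dv v := by
    intro v
    rw [hd.eq_sum v (p v) ((hL.adj_iff _ _).2 (Or.inl rfl))]
    have : (T.nbrs v).filter (fun w' => T.F w' = T.F (p v)) = {p v} := by
      ext u
      simp only [Finset.mem_filter, mem_nbrs, Finset.mem_singleton, hL.adj_iff]
      constructor
      · rintro ⟨h2 | h2, h3⟩
        · exact h2.symm
        · have h4 := hFp u
          rw [h2] at h4
          rw [hFp v, h4] at h3
          exact absurd h3.symm (hpp _)
      · rintro rfl; exact ⟨Or.inl rfl, rfl⟩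
    rw [this, Finset.sum_singleton]
  refine ⟨h1, fun v w hw => ?_, fun v => ?_⟩
  · obtain ⟨t, ht1, ht2⟩ := T.isOpenMap v w ((hL.adj_iff _ _).2 (Or.inr hw))
    rw [hd.eq_sum v t ht1]
    have : (T.nbrs v).filter (fun u => p u = v ∧ T.F u = w) =
        (T.nbrs v).filter (fun w' => T.F w' = T.F t) := by
      ext u
      simp only [Finset.mem_filter, mem_nbrs, ht2]
      refine and_congr_right fun hu => ⟨And.right, fun h2 => ⟨?_, h2⟩⟩
      rcases (hL.adj_iff _ _).1 hu with h3 | h3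
      · rw [← h3, hFp] at h2
        rw [← h2] at hw
        exact absurd hw (hpp _)
      · exact h3
    rw [← this]
    refine Finset.sum_congr rfl fun u hu => ?_
    have := (Finset.mem_filter.1 hu).2.1
    rw [← h1 u, this, Sym2.eq_swap]
  · rw [← Finset.sum_filter_add_sum_filter_not (T.nbrs v) (fun u => p u = v)]
    congr 1
    · refine Finset.sum_congr rfl fun u hu => ?_
      have := (Finset.mem_filter.1 hu).2
      rw [← h1 u, this, Sym2.eq_swap]
    · have : (T.nbrs v).filter (fun u => ¬ p u = v) = {p v} := by
        ext u
        simp only [Finset.mem_filter, mem_nbrs, Finset.mem_singleton, hL.adj_iff]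
        constructor
        · rintro ⟨h2 | h2, h3⟩
          · exact h2.symm
          · exact absurd h2 h3
        · rintro rfl; exact ⟨Or.inl rfl, hpp v⟩
      rw [this, Finset.sum_singleton, h1]

end TreeMap

/-- Every cubic metrized tree is described by a level tree. -/
theorem MetrizedTree.exists_models (T : MetrizedTree 3) : ∃ C ℓ i, Models C ℓ T i := by
  classical
  have h := T.polynomialLike
  obtain ⟨r, hr⟩ := h.exists_isBaseRay
  obtain ⟨p, lv, hL⟩ := hr.exists_isLevel
  obtain ⟨N, hN⟩ := h.exists_shift hr
  obtain ⟨dv, de, hd, hD⟩ := h.local_degree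
  have hFp := hL.F_p hN h hr
  -- for `N = 0` the edge above the base would be mapped to itself, but with thrice the length
  have hN1 : 1 ≤ N := by
    by_contra h0
    have : N = 0 := by omega
    subst this
    have h1 := T.len_map _ _ (hr.adj 0)
    have h2 := T.len_pos _ _ (hr.adj 0)
    rw [hN, hN] at h1
    push_cast at h1
    linarith
  have hFit : ∀ (n : ℕ) v, T.F (p^[n] v) = p^[n] (T.F v) := by
    intro n v
    induction n with
    | zero => rfl
    | succ n ih => rw [Function.iterate_succ_apply', hFp, ih, Function.iterate_succ_apply']
  have hlvF : ∀ v, lv (T.F v) = lv v + N := by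
    intro v
    obtain ⟨n, m, h1, -⟩ := hL.exists_iterate_eq_ray v
    have h2 := hFit n v
    rw [h1, hN] at h2
    have h3 := hL.lv_iterate n v
    have h4 := hL.lv_iterate n (T.F v)
    rw [h1, hL.lv_ray] at h3
    rw [← h2, hL.lv_ray] at h4
    push_cast at h4
    omega
  obtain ⟨d1, d2, d3⟩ := hL.degree hFp hd
  have hsub : ∀ v, {u | p u = v} = ((T.nbrs v).filter (fun u => p u = v) : Set T.V) := by
    intro v
    ext u
    simp only [Set.mem_ofPred_eq, Finset.coe_filter, TreeMap.mem_nbrs]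
    exact ⟨fun e => ⟨(hL.adj_iff _ _).2 (Or.inr e), e⟩, And.right⟩
  have hsub2 : ∀ v w, {u | p u = v ∧ T.F u = w} =
      ((T.nbrs v).filter (fun u => p u = v ∧ T.F u = w) : Set T.V) := by
    intro v w
    ext u
    simp only [Set.mem_ofPred_eq, Finset.coe_filter, TreeMap.mem_nbrs]
    exact ⟨fun e => ⟨(hL.adj_iff _ _).2 (Or.inr e.1), e⟩, And.right⟩
  have hrh : ∀ v, ∑ u ∈ (T.nbrs v).filter (fun u => p u = v), (dv u - 1) ≤ dv v - 1 := by
    intro v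
    have h1 := d3 v
    have h2 := hd.sum_le v
    rw [← h1] at h2
    omega
  have hle : ∀ u, dv u ≤ dv (p u) := by
    intro u
    have h2 := Finset.single_le_sum (f := fun u => dv u - 1) (fun _ _ => Nat.zero_le _)
      (show u ∈ (T.nbrs (p u)).filter (fun w => p w = p u) from Finset.mem_filter.2
        ⟨TreeMap.mem_nbrs.2 ((hL.adj_iff _ _).2 (Or.inr rfl)), rfl⟩)
    have h3 := h2.trans (hrh (p u))
    have := hd.one_le_vertex u
    have := hd.one_le_vertex (p u)
    omega
  -- a vertex of the ray is alone in its fibre, so its degree is the global degree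
  have hray : ∀ v, 0 ≤ lv v → dv v = 3 := by
    intro v hv
    have hv' := hL.eq_ray v (lv v).toNat (by omega)
    rw [hv']
    have h1 := hD (T.F (r (lv v).toNat))
    have h2 : T.fiber (T.F (r (lv v).toNat)) = {r (lv v).toNat} := by
      ext u
      rw [TreeMap.mem_fiber, Finset.mem_singleton]
      constructor
      · intro e
        apply hL.eq_ray
        have := congrArg lv e
        rw [hlvF, hlvF, hL.lv_ray] at this
        omega
      · rintro rfl; rfl
    rwa [h2, Finset.sum_singleton] at h1
  -- the base has at least two children, which share the degree 3
  have hchild : ∀ v, p v = r 0 → dv v ≤ 2 := by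
    intro v hv
    have hfilter : (T.nbrs (r 0)).filter (fun u => p u = r 0 ∧ T.F u = T.F v) =
        (T.nbrs (r 0)).erase (r 1) := by
      ext u
      rw [Finset.mem_filter, Finset.mem_erase, TreeMap.mem_nbrs]
      constructor
      · rintro ⟨h1, h2, -⟩
        refine ⟨?_, h1⟩
        rintro rfl
        have := hL.lv_p (r 1)
        rw [h2, hL.lv_ray, hL.lv_ray] at this
        simp at this
      · rintro ⟨h1, h2⟩
        rcases (hL.adj_iff _ _).1 h2 with h3 | h3
        · rw [hL.p_ray] at h3
          exact absurd h3.symm h1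
        · refine ⟨h2, h3, ?_⟩
          have e1 := hL.lv_p u
          have e2 := hL.lv_p v
          rw [h3, hL.lv_ray] at e1
          rw [hv, hL.lv_ray] at e2
          push_cast at e1 e2
          have e3 := hlvF u
          have e4 := hlvF v
          rw [hL.eq_ray (T.F u) (N - 1) (by omega), hL.eq_ray (T.F v) (N - 1) (by omega)]
    have h1 := d2 (r 0) (T.F v) (by rw [← hFp, hv])
    rw [hfilter, hray (r 0) (by rw [hL.lv_ray]; simp)] at h1
    have hvm : v ∈ (T.nbrs (r 0)).erase (r 1) := by
      rw [← hfilter, Finset.mem_filter, TreeMap.mem_nbrs]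
      exact ⟨(hL.adj_iff _ _).2 (Or.inr hv), hv, rfl⟩
    have h2 : 2 ≤ ((T.nbrs (r 0)).erase (r 1)).card := by
      have := Finset.pred_card_le_card_erase (s := T.nbrs (r 0)) (a := r 1)
      have h3 : 3 ≤ (T.nbrs (r 0)).card := hr.valence_base
      omega
    obtain ⟨u, hu, hne⟩ := Finset.exists_mem_ne
      (show 1 < ((T.nbrs (r 0)).erase (r 1)).card from h2) v
    have h3 : dv v + dv u ≤ 3 := by
      rw [← h1, ← Finset.sum_pair hne.symm]
      refine Finset.sum_le_sum_of_subset fun x hx => ?_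
      rcases Finset.mem_insert.1 hx with rfl | hx
      · exact hvm
      · rw [Finset.mem_singleton.1 hx]; exact hu
    have := hd.one_le_vertex u
    omega
  have hlow : ∀ n : ℕ, ∀ v, lv v = -(n : ℤ) - 1 → dv v ≤ 2 := by
    intro n
    induction n with
    | zero =>
      intro v hv
      exact hchild v (hL.eq_ray _ _ (by rw [hL.lv_p, hv]; simp))
    | succ n ih =>
      intro v hv
      exact (hle v).trans (ih (p v) (by rw [hL.lv_p, hv]; push_cast; ring))
  let C : CTree :=
    { V := T.V
      N := N
      p := p
      F := T.F
      lv := lv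
      deg := dv
      N_pos := hN1
      lv_p := hL.lv_p
      lv_F := hlvF
      F_p := hFp
      exists_base := ⟨r 0, hL.lv_ray 0⟩
      eq_of_lv_eq := fun u v h0 huv => by
        rw [hL.eq_ray u (lv u).toNat (by omega), hL.eq_ray v (lv u).toNat (by omega)]
      deg_ray := hray
      one_le_deg := hd.one_le_vertex
      deg_le_two := fun v hv => hlow (-lv v - 1).toNat v (by omega)
      finite_children := fun v => by rw [hsub]; exact Finset.finite_toSet _
      cover := fun v w hw => by
        rw [hsub2, finsum_mem_coe_finset]
        exact d2 v w hw
      rh := fun v => by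
        rw [hsub, finsum_mem_coe_finset]
        exact hrh v }
  -- an edge length depends only on the level, since `F` moves all edges onto the base ray
  have hlen : ∀ n : ℕ, ∀ u v, lv u = lv v → -(n : ℤ) ≤ lv u →
      T.len s(u, p u) = T.len s(v, p v) := by
    intro n
    induction n with
    | zero =>
      intro u v huv h0
      rw [hL.eq_ray u (lv u).toNat (by omega), hL.eq_ray v (lv u).toNat (by omega)]
    | succ n ih =>
      intro u v huv h0
      have h1 := ih (T.F u) (T.F v) (by rw [hlvF, hlvF, huv])
        (by rw [hlvF]; push_cast at h0; omega)
      rw [← hFp, ← hFp, T.len_map _ _ ((hL.adj_iff _ _).2 (Or.inl rfl)),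
        T.len_map _ _ ((hL.adj_iff _ _).2 (Or.inl rfl))] at h1
      push_cast at h1
      linarith
  have hex : ∀ k : ℤ, ∃ v, lv v = k := by
    have hdown : ∀ n : ℕ, ∃ v, lv v = -(n : ℤ) := by
      intro n
      induction n with
      | zero => exact ⟨r 0, hL.lv_ray 0⟩
      | succ n ih =>
        obtain ⟨v, hv⟩ := ih
        obtain ⟨u, hu⟩ := C.exists_child v
        refine ⟨u, ?_⟩
        have : lv (p u) = lv u + 1 := hL.lv_p u
        have hu' : p u = v := hu
        rw [hu', hv] at this
        push_cast
        omega
    intro k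
    rcases le_total 0 k with hk | hk
    · exact ⟨r k.toNat, by rw [hL.lv_ray]; omega⟩
    · obtain ⟨v, hv⟩ := hdown (-k).toNat
      exact ⟨v, by omega⟩
  choose s hs using hex
  refine ⟨C, fun k => T.len s(s k, p (s k)), id, Function.bijective_id, fun u v => hL.adj_iff u v,
    fun v => rfl, fun k => T.len_pos _ _ ((hL.adj_iff _ _).2 (Or.inl rfl)), fun k => ?_, fun v => ?_⟩
  · have h1 := hlen (-(k + N)).toNat (s (k + N)) (T.F (s k)) (by rw [hlvF, hs, hs])
      (by rw [hs]; omega)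
    change T.len s(s (k + N), p (s (k + N))) = 3 * T.len s(s k, p (s k))
    rw [h1, ← hFp, T.len_map _ _ ((hL.adj_iff _ _).2 (Or.inl rfl))]
    norm_num
  · exact hlen (-lv v).toNat v (s (lv v)) (by rw [hs]) (by omega)

/-! ### Base rays and isometries in terms of level trees -/

namespace TreeMap

/-- The base ray is unique. -/
theorem IsBaseRay.unique {T : TreeMap} {D : ℕ} (h : T.IsPolynomialLike D) {r r' : ℕ → T.V}
    (hr : T.IsBaseRay r) (hr' : T.IsBaseRay r') : r' = r := by
  have hne : ∀ {s : ℕ → T.V}, T.IsBaseRay s → ∀ i, s i ≠ s (i + 2) :=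
    fun hs i e => by have := hs.injective e; omega
  obtain ⟨a, b, hab⟩ := h.eventually_eq_baseRay hr hr'.adj
    (fun i => (hne hr' i).symm) hr'.valence_succ
  induction a generalizing b with
  | zero =>
    cases b with
    | zero => funext i; simpa using hab i
    | succ b =>
      have h1 := hab 0
      have h2 := hr'.valence_base
      simp only [Nat.add_zero] at h1
      rw [h1, hr.valence_succ] at h2
      omega
  | succ a ih =>
    cases b with
    | zero =>
      have h1 := hab 0
      have h2 := hr.valence_base
      simp only [Nat.add_zero] at h1
      rw [← h1, hr'.valence_succ] at h2
      omega
    | succ b =>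
      refine ih b fun i => ?_
      cases i with
      | succ i =>
        have := hab i
        rwa [show a + 1 + i = a + (i + 1) by omega, show b + 1 + i = b + (i + 1) by omega] at this
      | zero =>
        have e0 := hab 0
        have e1 := hab 1
        simp only [Nat.add_zero] at e0
        have hadj := (hr'.adj a).symm
        rw [e0] at hadj
        rcases eq_or_eq_of_valence (hr.valence_succ b) (hr.adj b).symm (hr.adj (b + 1))
          (hne hr b) hadj with h3 | h3
        · exact h3
        · exact absurd (h3.trans e1.symm) (hne hr' a)

end TreeMap

namespace CTree

variable (C : CTree)

theorem exists_level (k : ℤ) : ∃ v, C.lv v = k := by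
  have hdown : ∀ n : ℕ, ∃ v, C.lv v = -(n : ℤ) := by
    intro n
    induction n with
    | zero => exact ⟨C.base, by rw [C.lv_base]; simp⟩
    | succ n ih =>
      obtain ⟨v, hv⟩ := ih
      obtain ⟨u, hu⟩ := C.exists_child v
      refine ⟨u, ?_⟩
      have := C.lv_p u
      rw [hu, hv] at this
      push_cast
      omega
  rcases le_total 0 k with hk | hk
  · exact ⟨C.ray k.toNat, by rw [C.lv_ray]; omega⟩
  · obtain ⟨v, hv⟩ := hdown (-k).toNat
    exact ⟨v, by omega⟩

theorem two_le_children_base : 2 ≤ (C.children C.base).card := by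
  have hN := C.N_pos
  have h1 : C.children C.base = C.fib C.base (C.ray (C.N - 1)) := by
    ext u
    rw [mem_children, mem_fib]
    refine ⟨fun h => ⟨h, C.eq_ray ?_⟩, And.left⟩
    have := C.lv_p u
    rw [h, lv_base] at this
    rw [C.lv_F]
    omega
  have h2 := C.sum_fib (v := C.base) (w := C.ray (C.N - 1)) (by
    rw [C.p_ray, ← C.ray_zero, C.F_ray]; congr 1; omega)
  rw [C.deg_ray C.base (by rw [lv_base]), ← h1] at h2
  have h3 : ∑ u ∈ C.children C.base, C.deg u ≤ ∑ u ∈ C.children C.base, 2 :=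
    Finset.sum_le_sum fun u hu => C.deg_le_two u (by
      have := C.lv_p u
      rw [C.mem_children.1 hu, lv_base] at this
      omega)
  rw [h2, Finset.sum_const, smul_eq_mul] at h3
  omega

theorem card_children_F_le (v : C.V) : (C.children (C.F v)).card ≤ (C.children v).card := by
  classical
  refine (Finset.card_le_card (t := (C.children v).image C.F) fun w hw => ?_).trans
    Finset.card_image_le
  obtain ⟨u, h1, h2⟩ := C.exists_lift (C.mem_children.1 hw)
  exact Finset.mem_image.2 ⟨u, C.mem_children.2 h1, h2⟩

theorem two_le_children_of_iterate {v : C.V} {n : ℕ} (h : C.F^[n] v = C.base) :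
    2 ≤ (C.children v).card := by
  induction n generalizing v with
  | zero => rw [show v = C.base from h]; exact C.two_le_children_base
  | succ n ih => exact (ih (v := C.F v) h).trans (C.card_children_F_le v)

theorem iterate_F_eq_base {v : C.V} {n : ℕ} (h : C.lv v = -(n * C.N : ℤ)) : C.F^[n] v = C.base :=
  C.eq_ray (i := 0) (by rw [C.lv_iterate_F, h]; simp)

theorem two_le_children_of_lv {v : C.V} {n : ℕ} (h : C.lv v = -(n * C.N : ℤ)) :
    2 ≤ (C.children v).card :=
  C.two_le_children_of_iterate (C.iterate_F_eq_base h)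

theorem eq_ray_of_p_eq {u : C.V} {i : ℕ} (h : C.p u = C.ray (i + 1)) : u = C.ray i :=
  C.eq_ray (by have := C.lv_p u; rw [h, C.lv_ray] at this; push_cast at this; omega)

theorem children_ray (i : ℕ) : C.children (C.ray (i + 1)) = {C.ray i} := by
  ext u
  rw [mem_children, Finset.mem_singleton]
  exact ⟨C.eq_ray_of_p_eq, fun h => by rw [h, C.p_ray]⟩

theorem p_p_ne (v : C.V) : C.p (C.p v) ≠ v := fun e => by
  have h1 := C.lv_p (C.p v)
  rw [e, C.lv_p] at h1
  omega

/-- A map between level trees that preserves the whole structure. -/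
structure IsIso (C C' : CTree) (f : C.V → C'.V) : Prop where
  bij : Function.Bijective f
  N_eq : C.N = C'.N
  map_p : ∀ v, f (C.p v) = C'.p (f v)
  map_F : ∀ v, f (C.F v) = C'.F (f v)
  map_lv : ∀ v, C'.lv (f v) = C.lv v

theorem IsIso.adj {C C' : CTree} {f : C.V → C'.V} (h : IsIso C C' f) (u v : C.V) :
    C'.G.Adj (f u) (f v) ↔ C.G.Adj u v := by
  rw [adj_iff, adj_iff, ← h.map_p, ← h.map_p, h.bij.1.eq_iff, h.bij.1.eq_iff]

theorem IsIso.comp {C C' C'' : CTree} {f : C.V → C'.V} {g : C'.V → C''.V} (hg : IsIso C' C'' g)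
    (hf : IsIso C C' f) : IsIso C C'' (g ∘ f) :=
  ⟨hg.bij.comp hf.bij, hf.N_eq.trans hg.N_eq, fun v => by simp [hf.map_p, hg.map_p],
    fun v => by simp [hf.map_F, hg.map_F], fun v => by simp [hf.map_lv, hg.map_lv]⟩

theorem IsIso.exists_inv {C C' : CTree} {f : C.V → C'.V} (h : IsIso C C' f) :
    ∃ g, IsIso C' C g ∧ (∀ v, g (f v) = v) ∧ ∀ v, f (g v) = v := by
  let e := Equiv.ofBijective f h.bij
  have e1 : ∀ v, e.symm (f v) = v := e.symm_apply_apply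
  have e2 : ∀ v, f (e.symm v) = v := e.apply_symm_apply
  refine ⟨e.symm, ⟨e.symm.bijective, h.N_eq.symm, fun v => h.bij.1 ?_, fun v => h.bij.1 ?_,
    fun v => ?_⟩, e1, e2⟩
  · rw [e2, h.map_p, e2]
  · rw [e2, h.map_F, e2]
  · rw [← h.map_lv, e2]

end CTree

namespace Models

variable {C : CTree} {ℓ : ℤ → ℝ} {T : MetrizedTree 3} {i : C.V → T.V}

theorem nbrs_eq [DecidableEq T.V] (h : Models C ℓ T i) (v : C.V) :
    T.nbrs (i v) = insert (i (C.p v)) ((C.children v).image i) := by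
  ext w
  obtain ⟨w, rfl⟩ := h.bij.2 w
  rw [TreeMap.mem_nbrs, h.adj, CTree.adj_iff, Finset.mem_insert, Finset.mem_image, h.bij.1.eq_iff]
  refine or_congr eq_comm ⟨fun hw => ⟨w, C.mem_children.2 hw, rfl⟩, ?_⟩
  rintro ⟨u, hu, e⟩
  rw [← h.bij.1 e]
  exact C.mem_children.1 hu

theorem notMem_image [DecidableEq T.V] (h : Models C ℓ T i) (v : C.V) :
    i (C.p v) ∉ (C.children v).image i := by
  rw [Finset.mem_image]
  rintro ⟨u, hu, e⟩
  rw [h.bij.1 e, C.mem_children] at hu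
  exact C.p_p_ne _ hu

theorem valence_eq (h : Models C ℓ T i) (v : C.V) : T.valence (i v) = (C.children v).card + 1 := by
  classical
  rw [TreeMap.valence, h.nbrs_eq, Finset.card_insert_of_notMem (h.notMem_image v),
    Finset.card_image_of_injective _ h.bij.1]

theorem isBaseRay (h : Models C ℓ T i) : T.IsBaseRay fun k => i (C.ray k) where
  adj k := (h.adj _ _).2 (Or.inl (C.p_ray k))
  injective a b e := by
    have := congrArg C.lv (h.bij.1 e)
    rw [C.lv_ray, C.lv_ray] at this
    exact_mod_cast this
  valence_base := by
    rw [h.valence_eq]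
    have := C.two_le_children_base
    rw [C.ray_zero]
    omega
  valence_succ k := by rw [h.valence_eq, C.children_ray]; rfl

theorem eq_of_isBaseRay (h : Models C ℓ T i) {r : ℕ → T.V} (hr : T.IsBaseRay r) :
    r = fun k => i (C.ray k) := h.isBaseRay.unique T.polynomialLike hr

/-- Isometric trees have isomorphic descriptions. -/
theorem exists_isIso {C' : CTree} {ℓ' : ℤ → ℝ} {T' : MetrizedTree 3} {i' : C'.V → T'.V}
    (h : Models C ℓ T i) (h' : Models C' ℓ' T' i') (e : T.G ≃g T'.G)
    (hF : ∀ v, e (T.F v) = T'.F (e v))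
    (hl : ∀ u w, T.G.Adj u w → T'.len s(e u, e w) = T.len s(u, w)) :
    ∃ f, CTree.IsIso C C' f ∧ (∀ v, i' (f v) = e (i v)) ∧ ℓ = ℓ' := by
  classical
  have hval : ∀ v, T'.valence (e v) = T.valence v := by
    intro v
    rw [TreeMap.valence, TreeMap.valence, ← Finset.card_image_of_injective (T.nbrs v) e.injective]
    congr 1
    ext w
    obtain ⟨w, rfl⟩ := e.surjective w
    rw [TreeMap.mem_nbrs, e.map_adj_iff, Finset.mem_image]
    constructor
    · intro hw; exact ⟨w, TreeMap.mem_nbrs.2 hw, rfl⟩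
    · rintro ⟨u, hu, hu'⟩
      rw [← e.injective hu']; exact TreeMap.mem_nbrs.1 hu
  have hray : (fun k => e (i (C.ray k))) = fun k => i' (C'.ray k) := h'.eq_of_isBaseRay
    { adj := fun k => e.map_adj_iff.2 (h.isBaseRay.adj k)
      injective := e.injective.comp h.isBaseRay.injective
      valence_base := by rw [hval]; exact h.isBaseRay.valence_base
      valence_succ := fun k => by rw [hval]; exact h.isBaseRay.valence_succ k }
  choose f hf using fun v => h'.bij.2 (e (i v))
  have hfr : ∀ k, f (C.ray k) = C'.ray k := fun k => h'.bij.1 (by rw [hf]; exact congrFun hray k)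
  have hbij : Function.Bijective f := by
    constructor
    · intro u v huv
      apply h.bij.1
      apply e.injective
      rw [← hf, ← hf, huv]
    · intro w
      obtain ⟨a, ha⟩ := e.surjective (i' w)
      obtain ⟨v, rfl⟩ := h.bij.2 a
      exact ⟨v, h'.bij.1 (by rw [hf, ha])⟩
  have hadj : ∀ u v, C'.G.Adj (f u) (f v) ↔ C.G.Adj u v := fun u v => by
    rw [← h'.adj, hf, hf, e.map_adj_iff, h.adj]
  -- distances to the base determine the levels
  have hdep : ∀ n v, (C.lv v).natAbs ≤ n → C'.lv (f v) = C.lv v := by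
    intro n
    induction n with
    | zero =>
      intro v hv
      rw [C.eq_ray (v := v) (i := 0) (by omega), hfr, C.lv_ray, C'.lv_ray]
    | succ n ih =>
      intro v hv
      rcases lt_or_ge (C.lv v) 0 with h0 | h0
      · have h1 := ih (C.p v) (by rw [C.lv_p]; omega)
        have h2 := (hadj v (C.p v)).2 (Or.inl rfl)
        have h3 : ∀ k : ℕ, C'.lv (f v) ≠ k := fun k hk => by
          have := C'.eq_ray hk
          rw [← hfr] at this
          rw [hbij.1 this, C.lv_ray] at h0
          omega
        rw [C.lv_p] at h1
        rcases h2 with h2 | h2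
        · have := C'.lv_p (f v)
          rw [h2] at this
          omega
        · have := C'.lv_p (f (C.p v))
          rw [h2, h1] at this
          by_cases hn : C.lv v = -1
          · exact absurd (show C'.lv (f v) = (1 : ℕ) by push_cast; omega) (h3 1)
          · -- `f` is injective, so `f v` is not the parent of `f (p v)`
            have h4 := ih (C.p (C.p v)) (by rw [C.lv_p, C.lv_p]; omega)
            have h5 := (hadj (C.p v) (C.p (C.p v))).2 (Or.inl rfl)
            rw [C.lv_p, C.lv_p] at h4
            rcases h5 with h5 | h5
            · have := hbij.1 (h2.symm.trans h5)
              exact absurd this.symm (C.p_p_ne v)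
            · have := C'.lv_p (f (C.p (C.p v)))
              rw [h5, h4, h1] at this
              omega
      · have h1 : C.lv v = ((C.lv v).toNat : ℕ) := by omega
        rw [C.eq_ray h1, hfr, C.lv_ray, C'.lv_ray]
  have hlv : ∀ v, C'.lv (f v) = C.lv v := fun v => hdep _ v le_rfl
  have hp : ∀ v, f (C.p v) = C'.p (f v) := by
    intro v
    rcases (hadj v (C.p v)).2 (Or.inl rfl) with h2 | h2
    · exact h2.symm
    · have := C'.lv_p (f (C.p v))
      rw [h2, hlv, hlv, C.lv_p] at this
      omega
  have hfF : ∀ v, f (C.F v) = C'.F (f v) := fun v => h'.bij.1 (by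
    rw [hf, ← h'.map_F, hf, ← h.map_F, hF])
  refine ⟨f, ⟨hbij, ?_, hp, hfF, hlv⟩, hf, ?_⟩
  · have h1 := hlv (C.F C.base)
    rw [hfF, C'.lv_F, hlv, C.lv_F] at h1
    omega
  · funext k
    obtain ⟨v, hv⟩ := C.exists_level k
    have h1 := hl _ _ ((h.adj _ _).2 (Or.inl (rfl : C.p v = C.p v)))
    rw [h.len, ← hf, ← hf, hp, h'.len, hlv, hv] at h1
    exact h1.symm

/-- Trees with isomorphic descriptions are isometric. -/
theorem equivalent {C' : CTree} {T' : MetrizedTree 3} {i' : C'.V → T'.V}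
    (h : Models C ℓ T i) (h' : Models C' ℓ T' i') {f : C.V → C'.V} (hf : CTree.IsIso C C' f) :
    MetrizedTree.Equivalent T T' := by
  let a := Equiv.ofBijective i h.bij
  let b := Equiv.ofBijective i' h'.bij
  let c := Equiv.ofBijective f hf.bij
  have ha : ∀ v, a.symm (i v) = v := a.symm_apply_apply
  have hc : ∀ v, (a.symm.trans (c.trans b)) (i v) = i' (f v) := fun v => by
    change i' (f (a.symm (i v))) = _
    rw [ha]
  have hadj : ∀ u v, T'.G.Adj (i' (f u)) (i' (f v)) ↔ T.G.Adj (i u) (i v) := fun u v => by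
    rw [h'.adj, hf.adj, h.adj]
  refine ⟨⟨a.symm.trans (c.trans b), ?_⟩, ?_, ?_⟩
  · intro u v
    obtain ⟨u, rfl⟩ := h.bij.2 u
    obtain ⟨v, rfl⟩ := h.bij.2 v
    rw [hc, hc, hadj]
  · intro v
    obtain ⟨v, rfl⟩ := h.bij.2 v
    change (a.symm.trans (c.trans b)) _ = T'.F ((a.symm.trans (c.trans b)) _)
    rw [hc, h.map_F, hc, hf.map_F, h'.map_F]
  · intro u w huw
    obtain ⟨u, rfl⟩ := h.bij.2 u
    obtain ⟨w, rfl⟩ := h.bij.2 w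
    change T'.len s((a.symm.trans (c.trans b)) _, (a.symm.trans (c.trans b)) _) = _
    rw [hc, hc]
    rcases (h.adj _ _).1 huw with rfl | rfl
    · rw [hf.map_p, h'.len, h.len, hf.map_lv]
    · rw [Sym2.eq_swap, hf.map_p, h'.len, Sym2.eq_swap, h.len, hf.map_lv]

theorem scaled (h : Models C ℓ T i) (c : {c : ℝ // 0 < c}) :
    Models C (fun k => c.1 * ℓ k) (T.scale c) i :=
  ⟨h.bij, h.adj, h.map_F, fun k => mul_pos c.2 (h.pos k), fun k => by rw [h.scale]; ring,
    fun v => congrArg (c.1 * ·) (h.len v)⟩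

end Models

/-! ### The polynomial-like tree of a level tree -/

namespace CTree

variable (C : CTree)

open Classical in
/-- The degree of an edge is that of its lower vertex, which is the smaller one. -/
noncomputable def edgeDeg : Sym2 C.V → ℕ :=
  Sym2.lift ⟨fun u v => min (C.deg u) (C.deg v), fun _ _ => min_comm _ _⟩

theorem edgeDeg_p (v : C.V) : C.edgeDeg s(v, C.p v) = C.deg v := min_eq_left (C.deg_le_parent v)

theorem nbrs_toTreeMap [DecidableEq C.V] (v : C.V) :
    C.toTreeMap.nbrs v = insert (C.p v) (C.children v) := by
  ext w
  rw [TreeMap.mem_nbrs, Finset.mem_insert, mem_children]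
  exact or_congr eq_comm Iff.rfl

theorem p_notMem_children (v : C.V) : C.p v ∉ C.children v := fun h =>
  C.p_p_ne v (C.mem_children.1 h)

theorem isLocalDegree : C.toTreeMap.IsLocalDegree C.deg C.edgeDeg := by
  classical
  refine ⟨C.one_le_deg, fun e he => ?_, fun v => ?_, fun v w hvw => ?_⟩
  · induction e with
    | _ u v => exact le_min (C.one_le_deg u) (C.one_le_deg v)
  · have h1 : ∑ w ∈ C.toTreeMap.nbrs v, (C.edgeDeg s(v, w) - 1) =
        (C.deg v - 1) + ∑ u ∈ C.children v, (C.deg u - 1) := by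
      rw [nbrs_toTreeMap, Finset.sum_insert (C.p_notMem_children v), edgeDeg_p]
      congr 1
      refine Finset.sum_congr rfl fun u hu => ?_
      rw [← C.mem_children.1 hu, Sym2.eq_swap, edgeDeg_p]
    rw [h1]
    have := C.sum_children v
    omega
  · have hlv : ∀ u, C.p u = v → C.F u ≠ C.F (C.p v) := fun u hu e => by
      have h1 := congrArg C.lv e
      have h2 := C.lv_p u
      rw [C.lv_F, C.lv_F, C.lv_p] at h1
      rw [hu] at h2
      omega
    rcases hvw with rfl | hw
    · have : (C.toTreeMap.nbrs v).filter (fun w' => C.F w' = C.F (C.p v)) = {C.p v} := by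
        ext u
        rw [nbrs_toTreeMap, Finset.mem_filter, Finset.mem_insert, mem_children, Finset.mem_singleton]
        constructor
        · rintro ⟨h1 | h1, h2⟩
          · exact h1
          · exact absurd h2 (hlv u h1)
        · rintro rfl; exact ⟨Or.inl rfl, rfl⟩
      change C.deg v = ∑ w' ∈ (C.toTreeMap.nbrs v).filter (fun w' => C.F w' = C.F (C.p v)), _
      rw [this, Finset.sum_singleton, edgeDeg_p]
    · have : (C.toTreeMap.nbrs v).filter (fun w' => C.F w' = C.F w) = C.fib v (C.F w) := by
        ext u
        rw [nbrs_toTreeMap, Finset.mem_filter, Finset.mem_insert, mem_children, mem_fib]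
        constructor
        · rintro ⟨rfl | h1, h2⟩
          · exact absurd h2.symm (hlv w hw)
          · exact ⟨h1, h2⟩
        · rintro ⟨h1, h2⟩; exact ⟨Or.inr h1, h2⟩
      change C.deg v = ∑ w' ∈ (C.toTreeMap.nbrs v).filter (fun w' => C.F w' = C.F w), _
      rw [this, ← C.sum_fib (v := v) (w := C.F w) (by rw [← C.F_p, hw])]
      refine Finset.sum_congr rfl fun u hu => ?_
      rw [← (C.mem_fib.1 hu).1, Sym2.eq_swap, edgeDeg_p]

/-- The sum of the degrees over the fibre of `w` is the sum over the fibre of `p w`, so that it suffices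
to count preimages of vertices high up on the ray. -/
theorem hasGlobalDegree : C.toTreeMap.HasGlobalDegree C.deg 3 := by
  classical
  have hmem : ∀ u w, u ∈ C.toTreeMap.fiber w ↔ C.F u = w := fun u w => TreeMap.mem_fiber
  have hup : ∀ w, (C.N : ℤ) ≤ C.lv w → ∑ v ∈ C.toTreeMap.fiber w, C.deg v = 3 := by
    intro w hw
    have : C.toTreeMap.fiber w = {C.ray (C.lv w - C.N).toNat} := by
      ext u
      rw [hmem, Finset.mem_singleton]
      constructor
      · rintro rfl
        apply C.eq_ray
        rw [C.lv_F] at hw ⊢; omega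
      · rintro rfl
        rw [C.F_ray]
        exact (C.eq_ray (by push_cast; omega)).symm
    rw [this, Finset.sum_singleton, C.deg_ray _ (by rw [C.lv_ray]; omega)]
  have : ∀ n : ℕ, ∀ w, (C.N : ℤ) - n ≤ C.lv w → ∑ v ∈ C.toTreeMap.fiber w, C.deg v = 3 := by
    intro n
    induction n with
    | zero => intro w hw; exact hup w (by simpa using hw)
    | succ n ih =>
      intro w hw
      rw [← ih (C.p w) (by rw [C.lv_p]; push_cast at hw; omega),
        ← Finset.sum_fiberwise_of_maps_to (g := C.p) (t := C.toTreeMap.fiber (C.p w))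
          (fun u hu => by rw [hmem] at *; rw [C.F_p, hu])]
      refine Finset.sum_congr rfl fun v hv => ?_
      rw [hmem] at hv
      rw [← C.sum_fib hv.symm]
      refine Finset.sum_congr ?_ fun _ _ => rfl
      ext u
      rw [Finset.mem_filter, hmem, mem_fib, and_comm]
  exact fun w => this (C.N - C.lv w).toNat w (by omega)

theorem isRootRay_ray : IsRootRay C.base C.toBase C.ray where
  zero := rfl
  succ_ne n e := by
    have := congrArg C.lv e
    rw [C.lv_ray, C.lv_base] at this
    omega
  parent n := by
    have h : 0 < C.lv (C.ray (n + 1)) := by rw [C.lv_ray]; omega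
    rw [toBase, if_pos h, C.lv_ray]
    congr 1
    omega

/-- A ray from the base goes up the base ray or descends. -/
theorem lv_of_rootRay {η : ℕ → C.V} (hη : IsRootRay C.base C.toBase η) :
    (∀ n : ℕ, C.lv (η n) = n) ∨ ∀ n : ℕ, C.lv (η n) = -(n : ℤ) := by
  have habs : ∀ n, (C.lv (η n)).natAbs = n := fun n => C.isRooted.dep_ray hη n
  have hadj : ∀ n, C.G.Adj (η n) (η (n + 1)) := fun n =>
    (C.isRooted.adj_iff _ _).2 (Or.inr ⟨hη.succ_ne n, hη.parent n⟩)
  have hstep : ∀ n, C.lv (η (n + 1)) = C.lv (η n) + 1 ∨ C.lv (η (n + 1)) = C.lv (η n) - 1 := by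
    intro n
    rcases hadj n with h | h
    · left; rw [← h, C.lv_p]
    · right; rw [← h, C.lv_p]; ring
  have h1 := habs 1
  have h0 := habs 0
  rcases (show C.lv (η 1) = 1 ∨ C.lv (η 1) = -1 by omega) with h | h
  · left
    intro n
    induction n with
    | zero => omega
    | succ n ih =>
      rcases Nat.eq_zero_or_pos n with rfl | hn
      · simpa using h
      · have := habs (n + 1)
        have := hstep n
        push_cast
        omega
  · right
    intro n
    induction n with
    | zero => omega
    | succ n ih =>
      rcases Nat.eq_zero_or_pos n with rfl | hn
      · simpa using h
      · have := habs (n + 1)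
        have := hstep n
        push_cast
        omega

/-- The end of the base ray is isolated since no other ray follows the base ray beyond the base. A descending
ray meets branch points on all levels that are multiples of `N`, so that its end is not isolated. -/
theorem existsUnique_isolatedEnd : ∃! e : C.G.end, IsIsolatedEnd C.G e := by
  have hq := C.isRooted
  have hray : ∀ η, IsRootRay C.base C.toBase η → (∀ n : ℕ, C.lv (η n) = n) → η = C.ray :=
    fun η hη h => funext fun n => C.eq_ray (h n)
  obtain ⟨e, he⟩ := hq.exists_end C.isRootRay_ray
  refine ⟨e, (hq.isIsolatedEnd_iff C.neighborSet_finite C.isRootRay_ray he).2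
    ⟨1, fun η hη h1 => ?_⟩, fun e' he' => ?_⟩
  · rcases C.lv_of_rootRay hη with h | h
    · exact hray η hη h
    · have := h 1
      rw [h1, C.lv_ray] at this
      omega
  · obtain ⟨η, hη, hη'⟩ := hq.exists_ray C.neighborSet_finite e'
    obtain ⟨n, hn⟩ := (hq.isIsolatedEnd_iff C.neighborSet_finite hη hη').1 he'
    rcases C.lv_of_rootRay hη with h | h
    · rw [hray η hη h] at hη'
      exact IsRooted.end_unique hη' he
    · -- beyond each vertex of a descending ray there is another descending ray
      exfalso
      let m := (n + 1) * C.N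
      have hm : n ≤ m := by
        have := C.N_pos
        calc n ≤ (n + 1) * 1 := by omega
          _ ≤ m := Nat.mul_le_mul_left _ this
      have h2 := C.two_le_children_of_lv (v := η m) (n := n + 1) (by rw [h]; push_cast [m]; ring)
      obtain ⟨u, hu, hne⟩ := Finset.exists_mem_ne (show 1 < (C.children (η m)).card from h2)
        (η (m + 1))
      rw [C.mem_children] at hu
      choose c hc using C.exists_child
      have hclv : ∀ k : ℕ, C.lv (c^[k] u) = -(m + 1 + k : ℕ) := by
        intro k
        induction k with
        | zero =>
          have := C.lv_p u
          rw [hu, h] at this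
          push_cast
          simp only [Function.iterate_zero, id]
          omega
        | succ k ih =>
          have := C.lv_p (c (c^[k] u))
          rw [hc, ih] at this
          rw [Function.iterate_succ_apply']
          push_cast at *
          omega
      have hlow : ∀ v, C.lv v < 0 → C.toBase v = C.p v := fun v hv => if_neg (by omega)
      let ζ : ℕ → C.V := fun k => if k ≤ m then η k else c^[k - (m + 1)] u
      have hζ : IsRootRay C.base C.toBase ζ := by
        refine ⟨by simp [ζ, hη.zero], fun k => ?_, fun k => ?_⟩
        · by_cases hk : k + 1 ≤ m
          · simp only [ζ, hk, if_true]; exact hη.succ_ne k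
          · simp only [ζ, hk, if_false]
            intro e
            have := hclv (k + 1 - (m + 1))
            rw [e, C.lv_base] at this
            omega
        · by_cases hk : k + 1 ≤ m
          · have hk' : k ≤ m := by omega
            simp only [ζ, hk, hk', if_true]; exact hη.parent k
          · simp only [ζ, hk, if_false]
            rw [hlow _ (by rw [hclv]; omega)]
            by_cases hk' : k ≤ m
            · have : k = m := by omega
              subst this
              simp [hu]
            · simp only [hk', if_false]
              rw [show k + 1 - (m + 1) = (k - (m + 1)) + 1 by omega, Function.iterate_succ_apply', hc]
      have := hn ζ hζ (by simp [ζ, hm])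
      apply hne
      rw [← this]
      simp [ζ]

theorem isPolynomialLike (hb : ∀ v, ∃ w, C.toTreeMap.grandOrbit v w ∧ 2 ≤ (C.children w).card) :
    C.toTreeMap.IsPolynomialLike 3 := by
  classical
  have hval : ∀ v, C.toTreeMap.valence v = (C.children v).card + 1 := fun v => by
    rw [TreeMap.valence, nbrs_toTreeMap, Finset.card_insert_of_notMem (C.p_notMem_children v)]
  refine ⟨C.existsUnique_isolatedEnd, ⟨_, _, C.isLocalDegree, C.hasGlobalDegree⟩, fun v => ?_,
    fun v => ?_⟩
  · obtain ⟨u, hu⟩ := C.exists_child v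
    have : 0 < (C.children v).card := Finset.card_pos.2 ⟨u, C.mem_children.2 hu⟩
    rw [hval]
    omega
  · obtain ⟨w, h1, h2⟩ := hb v
    exact ⟨w, h1, by rw [hval]; omega⟩

/-- The metrized tree of a level tree and the lengths of the edges above each level. -/
noncomputable def metrize (hb : ∀ v, ∃ w, C.toTreeMap.grandOrbit v w ∧ 2 ≤ (C.children w).card)
    (ℓ : ℤ → ℝ) (hpos : ∀ k, 0 < ℓ k) (hs : ∀ k, ℓ (k + C.N) = 3 * ℓ k) : MetrizedTree 3 where
  toTreeMap := C.toTreeMap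
  polynomialLike := C.isPolynomialLike hb
  len := Sym2.lift ⟨fun u v => ℓ (min (C.lv u) (C.lv v)), fun u v => congrArg ℓ (min_comm _ _)⟩
  len_pos := fun u w _ => hpos _
  len_map := fun u w h => by
    change ℓ (min (C.lv (C.F u)) (C.lv (C.F w))) = _ * ℓ (min (C.lv u) (C.lv w))
    rw [C.lv_F, C.lv_F, min_add_add_right, hs]
    norm_num

theorem models_metrize (hb : ∀ v, ∃ w, C.toTreeMap.grandOrbit v w ∧ 2 ≤ (C.children w).card)
    (ℓ : ℤ → ℝ) (hpos : ∀ k, 0 < ℓ k) (hs : ∀ k, ℓ (k + C.N) = 3 * ℓ k) :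
    Models C ℓ (C.metrize hb ℓ hpos hs) id where
  bij := Function.bijective_id
  adj _ _ := Iff.rfl
  map_F _ := rfl
  pos := hpos
  scale := hs
  len v := by
    change ℓ (min (C.lv v) (C.lv (C.p v))) = _
    rw [C.lv_p, min_eq_left (by omega)]

theorem exists_models (hb : ∀ v, ∃ w, C.toTreeMap.grandOrbit v w ∧ 2 ≤ (C.children w).card)
    (ℓ : ℤ → ℝ) (hpos : ∀ k, 0 < ℓ k) (hs : ∀ k, ℓ (k + C.N) = 3 * ℓ k) :
    ∃ T i, Models C ℓ T i := ⟨_, _, C.models_metrize hb ℓ hpos hs⟩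

end CTree

/-! ### The spine and the local degrees -/

namespace CTree

variable (C : CTree)

/-- The tree has a vertex of local degree at least 2 on level `-k`. These vertices form the spine,
which starts at the base. -/
def HasSp (k : ℕ) : Prop := ∃ v, C.lv v = -(k : ℤ) ∧ 2 ≤ C.deg v

theorem hasSp_zero : C.HasSp 0 := ⟨C.base, by simp [lv_base], by
  rw [C.deg_ray _ (by rw [lv_base])]; omega⟩

variable {C}

theorem HasSp.mono {k l : ℕ} (h : C.HasSp l) (hkl : k ≤ l) : C.HasSp k := by
  obtain ⟨d, rfl⟩ := Nat.exists_eq_add_of_le hkl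
  clear hkl
  induction d with
  | zero => exact h
  | succ d ih =>
    obtain ⟨v, h1, h2⟩ := h
    exact ih ⟨C.p v, by rw [C.lv_p, h1]; push_cast; ring, h2.trans (C.deg_le_parent v)⟩

theorem children_base_eq_fib : C.children C.base = C.fib C.base (C.ray (C.N - 1)) := by
  ext u
  rw [mem_children, mem_fib]
  refine ⟨fun h => ⟨h, C.eq_ray ?_⟩, And.left⟩
  have := C.lv_p u
  have := C.N_pos
  rw [h, lv_base] at *
  rw [C.lv_F]
  omega

theorem p_ray_pred : C.p (C.ray (C.N - 1)) = C.F C.base := by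
  have := C.N_pos
  rw [C.p_ray, ← C.ray_zero, C.F_ray]
  congr 1
  omega

theorem sum_children_base : ∑ u ∈ C.children C.base, C.deg u = 3 := by
  rw [children_base_eq_fib, C.sum_fib p_ray_pred, C.deg_ray _ (by rw [lv_base])]

theorem eq_of_spine_siblings {u w : C.V} (hp : C.p u = C.p w) (hl : C.lv u < 0)
    (hu : 2 ≤ C.deg u) (hw : 2 ≤ C.deg w) : u = w := by
  classical
  by_contra hne
  have hsub : ({u, w} : Finset C.V) ⊆ C.children (C.p u) := by
    intro x hx
    rcases Finset.mem_insert.1 hx with rfl | hx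
    · exact C.mem_children.2 rfl
    · rw [Finset.mem_singleton.1 hx]; exact C.mem_children.2 hp.symm
  by_cases h0 : C.lv (C.p u) < 0
  · have h1 := (Finset.sum_le_sum_of_subset (f := fun x => C.deg x - 1) hsub).trans
      (C.sum_children (C.p u))
    rw [Finset.sum_pair hne] at h1
    have := C.deg_le_two _ h0
    omega
  · have h1 := C.lv_p u
    have h2 : C.p u = C.base := C.eq_ray (i := 0) (by push_cast; omega)
    rw [h2] at hsub
    have h3 := Finset.sum_le_sum_of_subset (f := fun x => C.deg x) hsub
    rw [Finset.sum_pair hne, sum_children_base] at h3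
    omega

/-- There is at most one spine vertex on each level. -/
theorem eq_of_spine {u w : C.V} (hl : C.lv u = C.lv w) (hu : 2 ≤ C.deg u) (hw : 2 ≤ C.deg w) :
    u = w := by
  obtain ⟨n, hn⟩ : ∃ n : ℕ, -(n : ℤ) ≤ C.lv u := ⟨(-C.lv u).toNat, by omega⟩
  induction n generalizing u w with
  | zero => exact C.eq_of_lv_eq _ _ (by simpa using hn) hl
  | succ n ih =>
    rcases lt_or_ge (C.lv u) 0 with h0 | h0
    · refine eq_of_spine_siblings (ih ?_ (hu.trans (C.deg_le_parent u))
        (hw.trans (C.deg_le_parent w)) ?_) h0 hu hw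
      · rw [C.lv_p, C.lv_p, hl]
      · rw [C.lv_p]; push_cast at hn; omega
    · exact C.eq_of_lv_eq _ _ h0 hl

/-- Below a vertex of degree 1 the map is injective on siblings. -/
theorem F_injOn_children {v u w : C.V} (hv : C.deg v = 1) (hu : C.p u = v) (hw : C.p w = v)
    (h : C.F u = C.F w) : u = w := by
  classical
  by_contra hne
  have hsub : ({u, w} : Finset C.V) ⊆ C.fib v (C.F u) := by
    intro x hx
    rcases Finset.mem_insert.1 hx with rfl | hx
    · exact C.mem_fib.2 ⟨hu, rfl⟩
    · rw [Finset.mem_singleton.1 hx]; exact C.mem_fib.2 ⟨hw, h.symm⟩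
  have h1 := Finset.sum_le_sum_of_subset (f := fun x => C.deg x) hsub
  rw [Finset.sum_pair hne, C.sum_fib (by rw [← C.F_p, hu]), hv] at h1
  have := C.one_le_deg u
  have := C.one_le_deg w
  omega

theorem exists_level_dvd_le (v : C.V) (l : ℤ) : ∃ n : ℕ, -(n * C.N : ℤ) ≤ l ∧
    -(n * C.N : ℤ) ≤ C.lv v := by
  have h := C.N_pos
  refine ⟨(-l).toNat + (-C.lv v).toNat, ?_⟩
  have h1 : (((-l).toNat + (-C.lv v).toNat : ℕ) : ℤ) ≤ ((-l).toNat + (-C.lv v).toNat : ℕ) * C.N :=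
    le_mul_of_one_le_right (by omega) (by exact_mod_cast h)
  constructor <;> omega

theorem exists_descendant (v : C.V) (n : ℕ) : ∃ u, C.p^[n] u = v := by
  induction n with
  | zero => exact ⟨v, rfl⟩
  | succ n ih =>
    obtain ⟨u, hu⟩ := ih
    obtain ⟨w, hw⟩ := C.exists_child u
    exact ⟨w, by rw [Function.iterate_succ_apply, hw, hu]⟩

/-- The local degree function is determined by its local properties. Below a vertex of degree 1 it is
constant, and a value above 1 would contradict the bound for the children at the branch points
there. The degree of a spine vertex `v` is a sum over the children that are mapped to a given child of
`F v`; if none of these is on the spine, then the sum is known, and otherwise it comes from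
the next spine vertex. -/
theorem deg_unique {f : C.V → ℕ} (h1 : ∀ v, 1 ≤ f v)
    (hcov : ∀ v w, C.p w = C.F v → ∑ u ∈ C.fib v w, f u = f v)
    (hrh : ∀ v, ∑ u ∈ C.children v, (f u - 1) ≤ f v - 1) (v : C.V) : f v = C.deg v := by
  classical
  -- `f` is constant below a vertex of degree 1
  have hdeg1 : ∀ n v, C.deg (C.p^[n] v) = 1 → C.deg v = 1 := by
    intro n
    induction n with
    | zero => exact fun v h => h
    | succ n ih =>
      intro v h
      have h2 := ih (C.p v) h
      have h3 := C.deg_le_parent v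
      have := C.one_le_deg v
      omega
  have hconst1 : ∀ v, C.deg (C.p v) = 1 → f v = f (C.p v) := by
    intro v hv
    have : C.fib (C.p v) (C.F v) = {v} := by
      ext u
      rw [mem_fib, Finset.mem_singleton]
      exact ⟨fun h => F_injOn_children hv h.1 rfl h.2, fun h => by rw [h]; exact ⟨rfl, rfl⟩⟩
    rw [← hcov (C.p v) (C.F v) (by rw [C.F_p]), this, Finset.sum_singleton]
  have hconst : ∀ n v, C.deg (C.p^[n] v) = 1 → f v = f (C.p^[n] v) := by
    intro n
    induction n with
    | zero => exact fun v _ => rfl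
    | succ n ih =>
      intro v h
      rw [hconst1 v (hdeg1 n _ h)]
      exact ih (C.p v) h
  have hone : ∀ v, C.deg v = 1 → f v = 1 := by
    intro v hv
    obtain ⟨n, hn, -⟩ := C.exists_level_dvd_le v (C.lv v)
    obtain ⟨u, hu⟩ := C.exists_descendant v (C.lv v + n * C.N).toNat
    have hlv := C.lv_iterate (C.lv v + n * C.N).toNat u
    rw [hu] at hlv
    have hbr := C.two_le_children_of_lv (v := u) (n := n) (by omega)
    have hfu := hconst _ u (by rw [hu]; exact hv)
    have hdu := hdeg1 _ u (by rw [hu]; exact hv)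
    rw [hu] at hfu
    have hch : ∀ w ∈ C.children u, f w - 1 = f v - 1 := fun w hw => by
      rw [hconst1 w (by rw [C.mem_children.1 hw, hdu]), C.mem_children.1 hw, hfu]
    have h2 := hrh u
    rw [Finset.sum_congr rfl hch, Finset.sum_const, smul_eq_mul, hfu] at h2
    have h3 := Nat.mul_le_mul_right (f v - 1) hbr
    have := h1 v
    omega
  -- induction on the number of levels above the next level divisible by `N`: there the image is a
  -- branch point, so that some fibre avoids the spine
  have hspine : ∀ n : ℕ, ∀ v, 2 ≤ C.deg v → C.lv v < 0 → (∃ m : ℕ, 1 ≤ m ∧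
      C.lv v = -(m * C.N : ℤ) + n) → f v = C.deg v := by
    intro n
    induction n with
    | zero =>
      rintro v hv hv0 ⟨m, hm, hlv⟩
      have hbr := C.two_le_children_of_lv (v := C.F v) (n := m - 1) (by
        rw [C.lv_F, hlv, Nat.cast_sub hm]; push_cast; ring)
      obtain ⟨w1, hw1, w2, hw2, hne⟩ := Finset.one_lt_card.1 hbr
      rw [mem_children] at hw1 hw2
      by_cases hex : ∃ w, C.p w = C.F v ∧ ∀ u ∈ C.fib v w, C.deg u = 1
      · obtain ⟨w, hw, hu⟩ := hex
        rw [← hcov v w hw, ← C.sum_fib hw]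
        exact Finset.sum_congr rfl fun u hu' => by rw [hone u (hu u hu'), hu u hu']
      · push Not at hex
        obtain ⟨u1, hu1, hd1⟩ := hex w1 hw1
        obtain ⟨u2, hu2, hd2⟩ := hex w2 hw2
        rw [mem_fib] at hu1 hu2
        have := C.one_le_deg u1
        have := C.one_le_deg u2
        have hl := C.lv_p u1
        rw [hu1.1] at hl
        have := eq_of_spine_siblings (hu1.1.trans hu2.1.symm) (by omega)
          (by omega) (by omega)
        exact absurd (hu1.2.symm.trans ((congrArg C.F this).trans hu2.2)) hne
    | succ n ih =>
      rintro v hv hv0 ⟨m, hm, hlv⟩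
      by_cases hex : ∃ w, C.p w = C.F v ∧ ∀ u ∈ C.fib v w, C.deg u = 1
      · obtain ⟨w, hw, hu⟩ := hex
        rw [← hcov v w hw, ← C.sum_fib hw]
        exact Finset.sum_congr rfl fun u hu' => by rw [hone u (hu u hu'), hu u hu']
      · push Not at hex
        obtain ⟨w, hw⟩ := C.exists_child (C.F v)
        obtain ⟨u, hu, hd⟩ := hex w hw
        have hu' := C.mem_fib.1 hu
        have hd1 := C.one_le_deg u
        have hfib : C.fib v w = {u} := by
          have h2 := C.sum_fib hw
          have h3 := C.deg_le_two v hv0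
          rw [← Finset.add_sum_erase _ _ hu] at h2
          have h4 : (C.fib v w).erase u = ∅ := by
            by_contra hne
            obtain ⟨x, hx⟩ := Finset.nonempty_of_ne_empty hne
            have := Finset.single_le_sum (f := fun x => C.deg x) (fun _ _ => Nat.zero_le _) hx
            have := C.one_le_deg x
            omega
          rw [← Finset.insert_erase hu, h4]; rfl
        have hlu := C.lv_p u
        rw [hu'.1] at hlu
        have e1 := hcov v w hw
        have e2 := C.sum_fib hw
        rw [hfib, Finset.sum_singleton] at e1 e2
        rw [← e1, ← e2]
        exact ih u (by omega) (by omega) ⟨m, hm, by push_cast at hlv; omega⟩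
  have hneg : ∀ v, C.lv v < 0 → f v = C.deg v := by
    intro v hv
    rcases Nat.lt_or_ge (C.deg v) 2 with h2 | h2
    · have h3 : C.deg v = 1 := by have := C.one_le_deg v; omega
      rw [hone v h3, h3]
    · obtain ⟨m, hm, -⟩ := C.exists_level_dvd_le v (C.lv v)
      refine hspine (C.lv v + m * C.N).toNat v h2 hv ⟨m, ?_, by omega⟩
      rcases Nat.eq_zero_or_pos m with rfl | h
      · simp at hm; omega
      · exact h
  have hbase : f C.base = C.deg C.base := by
    rw [← hcov _ _ p_ray_pred, ← C.sum_fib p_ray_pred]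
    refine Finset.sum_congr rfl fun u hu => hneg u ?_
    have h2 := C.lv_p u
    rw [(C.mem_fib.1 hu).1, lv_base] at h2
    omega
  have hray : ∀ i, f (C.ray i) = C.deg (C.ray i) := by
    intro i
    induction i with
    | zero => exact hbase
    | succ i ih =>
      have h2 : C.p (C.ray (i + C.N)) = C.F (C.ray (i + 1)) := by
        rw [C.p_ray, C.F_ray]; congr 1; omega
      have h3 : C.fib (C.ray (i + 1)) (C.ray (i + C.N)) = {C.ray i} := by
        ext u
        rw [mem_fib, Finset.mem_singleton]
        exact ⟨fun h => C.eq_ray_of_p_eq h.1, fun h => by rw [h, C.p_ray, C.F_ray]; exact ⟨rfl, rfl⟩⟩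
      rw [← hcov _ _ h2, ← C.sum_fib h2, h3, Finset.sum_singleton, Finset.sum_singleton, ih]
  rcases lt_or_ge (C.lv v) 0 with h | h
  · exact hneg v h
  · rw [C.eq_ray (v := v) (i := (C.lv v).toNat) (by omega)]
    exact hray _

theorem IsIso.map_children [DecidableEq C.V] {C' : CTree} [DecidableEq C'.V] {f : C.V → C'.V}
    (h : IsIso C C' f) (v : C.V) :
    C'.children (f v) = (C.children v).image f := by
  ext w
  obtain ⟨w, rfl⟩ := h.bij.2 w
  rw [mem_children, ← h.map_p, h.bij.1.eq_iff, Finset.mem_image]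
  exact ⟨fun hw => ⟨w, C.mem_children.2 hw, rfl⟩, fun ⟨u, hu, e⟩ => by
    rw [← h.bij.1 e]; exact C.mem_children.1 hu⟩

theorem IsIso.map_fib [DecidableEq C.V] {C' : CTree} [DecidableEq C'.V] {f : C.V → C'.V}
    (h : IsIso C C' f) (v w : C.V) :
    C'.fib (f v) (f w) = (C.fib v w).image f := by
  ext u
  obtain ⟨u, rfl⟩ := h.bij.2 u
  rw [mem_fib, ← h.map_p, h.bij.1.eq_iff, ← h.map_F, h.bij.1.eq_iff, Finset.mem_image]
  exact ⟨fun hw => ⟨u, C.mem_fib.2 hw, rfl⟩, fun ⟨u, hu, e⟩ => by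
    rw [← h.bij.1 e]; exact C.mem_fib.1 hu⟩

/-- Isomorphisms preserve the local degrees. -/
theorem IsIso.map_deg {C' : CTree} {f : C.V → C'.V} (h : IsIso C C' f) (v : C.V) :
    C'.deg (f v) = C.deg v := by
  classical
  refine deg_unique (f := fun v => C'.deg (f v)) (fun v => C'.one_le_deg _) (fun v w hw => ?_)
    (fun v => ?_) v
  · rw [← C'.sum_fib (v := f v) (w := f w) (by rw [← h.map_p, ← h.map_F, hw]), h.map_fib,
      Finset.sum_image fun _ _ _ _ e => h.bij.1 e]
  · have := C'.sum_children (f v)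
    rwa [h.map_children, Finset.sum_image fun _ _ _ _ e => h.bij.1 e] at this

theorem IsIso.hasSp {C' : CTree} {f : C.V → C'.V} (h : IsIso C C' f) {k : ℕ} (hk : C.HasSp k) :
    C'.HasSp k := by
  obtain ⟨v, h1, h2⟩ := hk
  exact ⟨f v, by rw [h.map_lv, h1], by rw [h.map_deg]; exact h2⟩

variable (C)

/-- The critical multiplicity of a vertex. -/
noncomputable def crit (v : C.V) : ℕ := C.deg v - 1 - ∑ u ∈ C.children v, (C.deg u - 1)

/-- The spine ends on level `-k`. -/
def HasDepth (k : ℕ) : Prop := C.HasSp k ∧ ¬ C.HasSp (k + 1)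

theorem hasSp_or_hasDepth : (∀ k, C.HasSp k) ∨ ∃ k, C.HasDepth k := by
  by_contra! h
  obtain ⟨⟨k, hk⟩, h2⟩ := h
  refine hk ?_
  induction k with
  | zero => exact absurd C.hasSp_zero hk
  | succ k ih =>
    by_contra hk'
    exact hk' (by
      by_contra h3
      by_cases h4 : C.HasSp k
      · exact h2 k ⟨h4, h3⟩
      · exact h4 (ih h4))

variable {C}

theorem HasDepth.le_iff {k l : ℕ} (h : C.HasDepth k) : C.HasSp l ↔ l ≤ k :=
  ⟨fun hl => by by_contra hlk; exact h.2 (hl.mono (by omega)), fun hl => h.1.mono hl⟩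

theorem HasDepth.unique {k l : ℕ} (h : C.HasDepth k) (h' : C.HasDepth l) : k = l :=
  le_antisymm (h'.le_iff.1 h.1) (h.le_iff.1 h'.1)

/-- The contribution of the children to the critical multiplicity comes from the spine. -/
theorem sum_children_eq (v : C.V) (hv : C.lv v ≤ 0) :
    ((∃ u, C.p u = v ∧ 2 ≤ C.deg u) → ∑ u ∈ C.children v, (C.deg u - 1) = 1) ∧
    ((¬ ∃ u, C.p u = v ∧ 2 ≤ C.deg u) → ∑ u ∈ C.children v, (C.deg u - 1) = 0) := by
  have hlv : ∀ u, C.p u = v → C.lv u < 0 := fun u hu => by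
    have := C.lv_p u; rw [hu] at this; omega
  constructor
  · rintro ⟨u, hu, hd⟩
    have h3 := C.deg_le_two u (hlv u hu)
    rw [Finset.sum_eq_single_of_mem u (C.mem_children.2 hu)]
    · omega
    · intro w hw hne
      have h4 := C.mem_children.1 hw
      by_contra h5
      exact hne (eq_of_spine_siblings (h4.trans hu.symm) (hlv w h4) (by omega) hd)
  · intro hne
    push Not at hne
    exact Finset.sum_eq_zero fun u hu => by
      have := hne u (C.mem_children.1 hu); omega

theorem exists_spine_child_iff {v : C.V} {k : ℕ} (h2 : 2 ≤ C.deg v) (hl : C.lv v = -(k : ℤ)) :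
    (∃ u, C.p u = v ∧ 2 ≤ C.deg u) ↔ C.HasSp (k + 1) := by
  constructor
  · rintro ⟨u, rfl, hd⟩
    exact ⟨u, by have := C.lv_p u; push_cast; omega, hd⟩
  · rintro ⟨u, hu, hd⟩
    have h3 := C.lv_p u
    refine ⟨u, ?_, hd⟩
    exact eq_of_spine (by push_cast at hu; omega) (hd.trans (C.deg_le_parent u)) h2

theorem crit_of_deg_one {v : C.V} (h : C.deg v = 1) : C.crit v = 0 := by simp [crit, h]

theorem crit_ray_succ (i : ℕ) : C.crit (C.ray (i + 1)) = 0 := by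
  rw [crit, C.children_ray, Finset.sum_singleton, C.deg_ray _ (by rw [lv_ray]; omega),
    C.deg_ray _ (by rw [lv_ray]; omega)]

theorem crit_base : C.crit C.base + (∑ u ∈ C.children C.base, (C.deg u - 1)) = 2 := by
  have h1 := C.sum_children C.base
  rw [C.deg_ray _ (by rw [lv_base])] at h1
  rw [crit, C.deg_ray _ (by rw [lv_base])]
  omega

theorem crit_base_of_hasSp (h : C.HasSp 1) : C.crit C.base = 1 := by
  have h0 := C.deg_ray C.base (by rw [lv_base])
  have h1 := (sum_children_eq C.base (by rw [lv_base])).1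
    ((exists_spine_child_iff (k := 0) (by omega) (by simp [lv_base])).2 h)
  have := C.crit_base
  omega

theorem crit_base_of_not_hasSp (h : ¬ C.HasSp 1) : C.crit C.base = 2 := by
  have h0 := C.deg_ray C.base (by rw [lv_base])
  have h1 := (sum_children_eq C.base (by rw [lv_base])).2
    (fun h' => h ((exists_spine_child_iff (k := 0) (by omega) (by simp [lv_base])).1 h'))
  have := C.crit_base
  omega

theorem crit_spine {v : C.V} {k : ℕ} (h2 : 2 ≤ C.deg v) (hl : C.lv v = -(k : ℤ)) (hk : 1 ≤ k) :
    (C.HasSp (k + 1) → C.crit v = 0) ∧ (¬ C.HasSp (k + 1) → C.crit v = 1) := by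
  have h3 := C.deg_le_two v (by omega)
  have h4 := sum_children_eq v (by omega)
  rw [exists_spine_child_iff h2 hl] at h4
  unfold crit
  constructor <;> intro h
  · rw [h4.1 h]; omega
  · rw [h4.2 h]; omega

/-- The critical vertices are the base and the end of the spine. -/
theorem crit_pos {v : C.V} (h : 0 < C.crit v) :
    v = C.base ∨ ∃ k : ℕ, 1 ≤ k ∧ C.HasDepth k ∧ C.lv v = -(k : ℤ) ∧ 2 ≤ C.deg v := by
  have h2 : 2 ≤ C.deg v := by
    by_contra h2
    have := C.one_le_deg v
    rw [crit_of_deg_one (by omega)] at h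
    omega
  rcases lt_trichotomy (C.lv v) 0 with h0 | h0 | h0
  · refine Or.inr ⟨(-C.lv v).toNat, by omega, ⟨⟨v, by omega, h2⟩, fun h3 => ?_⟩, by omega, h2⟩
    rw [(crit_spine (k := (-C.lv v).toNat) h2 (by omega) (by omega)).1 h3] at h
    omega
  · exact Or.inl (C.eq_ray (i := 0) (by simpa using h0))
  · rw [C.eq_ray (v := v) (i := (C.lv v - 1).toNat + 1) (by omega), crit_ray_succ] at h
    omega

end CTree

/-! ### Escape types -/

/-- A critical set with one element. -/
theorem TreeMap.hasEscapeType_single {T : TreeMap} {p : Multiset ℕ} {a : T.V} {m : T.V → ℕ}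
    (hex : ∃ dv de, T.IsLocalDegree dv de) (hm : ∀ dv de, T.IsLocalDegree dv de → T.critMult dv de = m)
    (ha : ∀ v, 0 < m v ↔ v = a) : T.HasEscapeType p ↔ p = {m a} := by
  classical
  have key : ∀ C : Finset T.V, (∀ v, v ∈ C ↔ 0 < m v) → C = {a} := fun C hC => by
    ext v; rw [hC, ha, Finset.mem_singleton]
  have hsum : (({a} : Finset T.V).image (Quotient.mk T.grandOrbit)).val.map (fun o =>
      ∑ v ∈ ({a} : Finset T.V).filter (fun v => Quotient.mk T.grandOrbit v = o), m v) = {m a} := by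
    simp [Finset.filter_singleton]
  constructor
  · rintro ⟨dv, de, h, C, h1, h2⟩
    rw [hm dv de h] at h1 h2
    rw [key C h1] at h2
    rw [← h2, ← hsum]
  · rintro rfl
    obtain ⟨dv, de, h⟩ := hex
    refine ⟨dv, de, h, {a}, fun v => ?_, ?_⟩
    · rw [hm dv de h, ha, Finset.mem_singleton]
    · rw [hm dv de h, ← hsum]

/-- A critical set with two elements. -/
theorem TreeMap.hasEscapeType_pair {T : TreeMap} {p : Multiset ℕ} {a b : T.V} {m : T.V → ℕ}
    (hex : ∃ dv de, T.IsLocalDegree dv de) (hm : ∀ dv de, T.IsLocalDegree dv de → T.critMult dv de = m)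
    (hab : a ≠ b) (ha : ∀ v, 0 < m v ↔ v = a ∨ v = b) :
    (T.grandOrbit a b → (T.HasEscapeType p ↔ p = {m a + m b})) ∧
    (¬ T.grandOrbit a b → (T.HasEscapeType p ↔ p = {m a, m b})) := by
  classical
  have key : ∀ C : Finset T.V, (∀ v, v ∈ C ↔ 0 < m v) → C = {a, b} := fun C hC => by
    ext v; rw [hC, ha, Finset.mem_insert, Finset.mem_singleton]
  have aux : ∀ q : Multiset ℕ, (({a, b} : Finset T.V).image (Quotient.mk T.grandOrbit)).val.map
      (fun o => ∑ v ∈ ({a, b} : Finset T.V).filter (fun v => Quotient.mk T.grandOrbit v = o), m v)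
        = q → (T.HasEscapeType p ↔ p = q) := by
    intro q hsum
    constructor
    · rintro ⟨dv, de, h, C, h1, h2⟩
      rw [hm dv de h] at h1 h2
      rw [key C h1] at h2
      rw [← h2, ← hsum]
    · rintro rfl
      obtain ⟨dv, de, h⟩ := hex
      refine ⟨dv, de, h, {a, b}, fun v => ?_, ?_⟩
      · rw [hm dv de h, ha, Finset.mem_insert, Finset.mem_singleton]
      · rw [hm dv de h, ← hsum]
  constructor
  · intro h
    have hq : Quotient.mk T.grandOrbit a = Quotient.mk T.grandOrbit b := Quotient.sound h
    refine aux _ ?_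
    simp [Finset.filter_insert, Finset.filter_singleton, hq, Finset.sum_pair hab]
  · intro h
    have hq : Quotient.mk T.grandOrbit a ≠ Quotient.mk T.grandOrbit b := fun e =>
      h (Quotient.exact e)
    refine aux _ ?_
    have h1 : ({a, b} : Finset T.V).image (Quotient.mk T.grandOrbit) =
        {Quotient.mk T.grandOrbit a, Quotient.mk T.grandOrbit b} := by simp
    rw [h1, Finset.insert_val_of_notMem (by simpa using hq)]
    simp [Finset.filter_insert, Finset.filter_singleton, hq, hq.symm]

namespace Models

variable {C : CTree} {ℓ : ℤ → ℝ} {T : MetrizedTree 3} {i : C.V → T.V}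

/-- Each local degree function of the metrized tree is that of the level tree. -/
theorem degree (h : Models C ℓ T i) {dv : T.V → ℕ} {de : Sym2 T.V → ℕ}
    (hd : T.IsLocalDegree dv de) (v : C.V) :
    dv (i v) = C.deg v ∧ T.critMult dv de (i v) = C.crit v := by
  classical
  let a := Equiv.ofBijective i h.bij
  have ha : ∀ v, a.symm (i v) = v := a.symm_apply_apply
  have hL : T.IsLevel (fun k => i (C.ray k)) (fun x => i (C.p (a.symm x)))
      (fun x => C.lv (a.symm x)) := by
    refine ⟨fun x y => ?_, fun x => ?_, fun k => ?_, fun x k hx => ?_⟩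
    · obtain ⟨x, rfl⟩ := h.bij.2 x
      obtain ⟨y, rfl⟩ := h.bij.2 y
      rw [h.adj, ha, ha, C.adj_iff, h.bij.1.eq_iff, h.bij.1.eq_iff]
    · rw [ha, C.lv_p]
    · rw [ha, C.lv_ray]
    · obtain ⟨x, rfl⟩ := h.bij.2 x
      rw [ha] at hx
      rw [C.eq_ray hx]
  have hFp : ∀ x, T.F (i (C.p (a.symm x))) = i (C.p (a.symm (T.F x))) := by
    intro x
    obtain ⟨x, rfl⟩ := h.bij.2 x
    rw [ha, h.map_F, C.F_p, h.map_F, ha]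
  obtain ⟨-, d2, d3⟩ := hL.degree hFp hd
  have hch : ∀ v, (T.nbrs (i v)).filter (fun u => i (C.p (a.symm u)) = i v) =
      (C.children v).image i := by
    intro v
    ext u
    obtain ⟨u, rfl⟩ := h.bij.2 u
    rw [Finset.mem_filter, TreeMap.mem_nbrs, ha, h.bij.1.eq_iff, Finset.mem_image]
    constructor
    · rintro ⟨-, h2⟩; exact ⟨u, C.mem_children.2 h2, rfl⟩
    · rintro ⟨w, hw, e⟩
      rw [h.bij.1 e, C.mem_children] at hw
      exact ⟨(h.adj _ _).2 (Or.inr hw), hw⟩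
  have hsum : ∀ v, ∑ u ∈ C.children v, (dv (i u) - 1) + (dv (i v) - 1) =
      ∑ u ∈ T.nbrs (i v), (de s(i v, u) - 1) := fun v => by
    rw [← d3 (i v), hch, Finset.sum_image fun _ _ _ _ e => h.bij.1 e]
  have hdeg : ∀ v, dv (i v) = C.deg v := by
    refine CTree.deg_unique (f := fun v => dv (i v)) (fun v => hd.one_le_vertex _) (fun v w hw => ?_)
      (fun v => ?_)
    · rw [← d2 (i v) (i w) (by rw [ha, hw, h.map_F])]
      have : (T.nbrs (i v)).filter (fun u => i (C.p (a.symm u)) = i v ∧ T.F u = i w) =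
          (C.fib v w).image i := by
        ext u
        obtain ⟨u, rfl⟩ := h.bij.2 u
        rw [← Finset.filter_filter, Finset.mem_filter, hch, Finset.mem_image, Finset.mem_image,
          h.map_F, h.bij.1.eq_iff]
        constructor
        · rintro ⟨⟨w', hw', e⟩, h2⟩
          rw [h.bij.1 e] at hw'
          exact ⟨u, C.mem_fib.2 ⟨C.mem_children.1 hw', h2⟩, rfl⟩
        · rintro ⟨w', hw', e⟩
          rw [h.bij.1 e, C.mem_fib] at hw'
          exact ⟨⟨u, C.mem_children.2 hw'.1, rfl⟩, hw'.2⟩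
      rw [this, Finset.sum_image fun _ _ _ _ e => h.bij.1 e]
    · have h1 := hsum v
      have h2 := hd.sum_le (i v)
      have := hd.one_le_vertex (i v)
      omega
  refine ⟨hdeg v, ?_⟩
  have h1 := hsum v
  have h2 : ∑ u ∈ C.children v, (dv (i u) - 1) = ∑ u ∈ C.children v, (C.deg u - 1) :=
    Finset.sum_congr rfl fun u _ => by rw [hdeg]
  rw [h2, hdeg] at h1
  rw [TreeMap.critMult, ← h1, hdeg, CTree.crit]
  omega

theorem iterate_F (h : Models C ℓ T i) (n : ℕ) (v : C.V) : T.F^[n] (i v) = i (C.F^[n] v) := by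
  induction n with
  | zero => rfl
  | succ n ih => rw [Function.iterate_succ_apply', ih, h.map_F, Function.iterate_succ_apply']

theorem grandOrbit_iff (h : Models C ℓ T i) (u v : C.V) :
    T.grandOrbit (i u) (i v) ↔ ∃ n m : ℕ, C.F^[n] u = C.F^[m] v := by
  change (∃ n m : ℕ, T.F^[n] (i u) = T.F^[m] (i v)) ↔ _
  simp only [h.iterate_F, h.bij.1.eq_iff]

theorem critMult_eq (h : Models C ℓ T i) : ∃ m : T.V → ℕ, (∀ v, m (i v) = C.crit v) ∧
    ∀ dv de, T.IsLocalDegree dv de → T.critMult dv de = m := by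
  let a := Equiv.ofBijective i h.bij
  have ha : ∀ v, a.symm (i v) = v := a.symm_apply_apply
  refine ⟨fun x => C.crit (a.symm x), fun v => congrArg C.crit (ha v), fun dv de hd => ?_⟩
  funext x
  obtain ⟨x, rfl⟩ := h.bij.2 x
  rw [ha]
  exact (h.degree hd x).2

/-- If the spine is infinite, then the base is the only critical vertex. -/
theorem hasEscapeType_of_hasSp (h : Models C ℓ T i) (hs : ∀ k, C.HasSp k) (p : Multiset ℕ) :
    T.HasEscapeType p ↔ p = {1} := by
  obtain ⟨dv, de, hd, -⟩ := T.polynomialLike.local_degree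
  obtain ⟨m, hm, hm'⟩ := h.critMult_eq
  have h1 := CTree.crit_base_of_hasSp (hs 1)
  rw [TreeMap.hasEscapeType_single ⟨dv, de, hd⟩ hm' (a := i C.base), hm, h1]
  intro v
  obtain ⟨v, rfl⟩ := h.bij.2 v
  rw [hm, h.bij.1.eq_iff]
  constructor
  · intro hv
    rcases CTree.crit_pos hv with h2 | ⟨k, -, hk, -⟩
    · exact h2
    · exact absurd (hs _) hk.2
  · rintro rfl; omega

/-- If the spine ends on level `-k`, then its end is in the grand orbit of the base if and only if
`N` divides `k`. -/
theorem hasEscapeType_of_hasDepth (h : Models C ℓ T i) {k : ℕ} (hk : C.HasDepth k)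
    (p : Multiset ℕ) :
    (C.N ∣ k → (T.HasEscapeType p ↔ p = {2})) ∧ (¬ C.N ∣ k → (T.HasEscapeType p ↔ p = {1, 1})) := by
  obtain ⟨dv, de, hd, -⟩ := T.polynomialLike.local_degree
  obtain ⟨m, hm, hm'⟩ := h.critMult_eq
  rcases Nat.eq_zero_or_pos k with rfl | hk0
  · refine ⟨fun _ => ?_, fun h0 => absurd (dvd_zero _) h0⟩
    have h1 := CTree.crit_base_of_not_hasSp hk.2
    rw [TreeMap.hasEscapeType_single ⟨dv, de, hd⟩ hm' (a := i C.base), hm, h1]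
    intro v
    obtain ⟨v, rfl⟩ := h.bij.2 v
    rw [hm, h.bij.1.eq_iff]
    constructor
    · intro hv
      rcases CTree.crit_pos hv with h2 | ⟨k, hk1, hk2, -⟩
      · exact h2
      · have := hk.unique hk2
        omega
    · rintro rfl; omega
  · obtain ⟨s, hs, hs2⟩ := hk.1
    have h1 := CTree.crit_base_of_hasSp (hk.1.mono hk0)
    have h2 := (CTree.crit_spine hs2 hs hk0).2 hk.2
    have hne : C.base ≠ s := by
      rintro rfl
      rw [C.lv_base] at hs
      omega
    have h3 := TreeMap.hasEscapeType_pair (p := p) ⟨dv, de, hd⟩ hm' (a := i C.base) (b := i s)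
      (fun e => hne (h.bij.1 e)) (by
        intro v
        obtain ⟨v, rfl⟩ := h.bij.2 v
        rw [hm, h.bij.1.eq_iff, h.bij.1.eq_iff]
        constructor
        · intro hv
          rcases CTree.crit_pos hv with h2 | ⟨l, -, hl1, hl2, hl3⟩
          · exact Or.inl h2
          · rw [hl1.unique hk] at hl2
            exact Or.inr (CTree.eq_of_spine (hl2.trans hs.symm) hl3 hs2)
        · rintro (rfl | rfl) <;> omega)
    rw [hm, hm, h1, h2, h.grandOrbit_iff] at h3
    refine ⟨fun hdvd => h3.1 ?_, fun hdvd => h3.2 ?_⟩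
    · obtain ⟨n, rfl⟩ := hdvd
      exact ⟨0, n, (C.iterate_F_eq_base (by rw [hs]; push_cast; ring)).symm⟩
    · rintro ⟨a, b, hab⟩
      apply hdvd
      have h4 := congrArg C.lv hab
      rw [C.lv_iterate_F, C.lv_iterate_F, C.lv_base, hs] at h4
      have h5 : (k : ℤ) = C.N * (b - a) := by linarith
      exact Int.natCast_dvd_natCast.1 ⟨_, h5⟩

end Models

/-! ### Grand orbits of branch points -/

namespace CTree

variable {C : CTree}

theorem two_le_children_of_spine_end {v : C.V} {k : ℕ} (h2 : 2 ≤ C.deg v) (hl : C.lv v = -(k : ℤ))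
    (hk : ¬ C.HasSp (k + 1)) : 2 ≤ (C.children v).card := by
  rcases Nat.eq_zero_or_pos k with rfl | hk0
  · rw [C.eq_ray (v := v) (i := 0) (by simpa using hl)]
    exact C.two_le_children_base
  · obtain ⟨w, hw⟩ := C.exists_child (C.F v)
    have h3 := C.sum_fib hw
    have h4 : ∀ u ∈ C.fib v w, C.deg u = 1 := fun u hu => by
      by_contra h5
      have := C.one_le_deg u
      exact hk ((exists_spine_child_iff h2 hl).1 ⟨u, (C.mem_fib.1 hu).1, by omega⟩)
    rw [Finset.sum_congr rfl h4, Finset.sum_const, smul_eq_mul, mul_one] at h3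
    calc 2 ≤ (C.fib v w).card := by omega
      _ ≤ _ := Finset.card_le_card fun u hu => C.mem_children.2 (C.mem_fib.1 hu).1

/-- Except for the end of the spine, a branch point below the base is mapped to a branch point. -/
theorem two_le_children_F {v : C.V} (hv : 2 ≤ (C.children v).card) (h0 : C.lv v < 0)
    (hd : ∀ k : ℕ, C.HasDepth k → C.lv v = -(k : ℤ) → ¬ 2 ≤ C.deg v) :
    2 ≤ (C.children (C.F v)).card := by
  obtain ⟨u1, hu1, u2, hu2, hne⟩ := Finset.one_lt_card.1 hv
  rw [mem_children] at hu1 hu2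
  by_cases hF : C.F u1 = C.F u2
  · have h2 : 2 ≤ C.deg v := by
      by_contra h2
      have := C.one_le_deg v
      exact hne (F_injOn_children (by omega) hu1 hu2 hF)
    have hk : C.HasSp ((-C.lv v).toNat + 1) := by
      by_contra hk
      exact hd (-C.lv v).toNat ⟨⟨v, by omega, h2⟩, hk⟩ (by omega) h2
    obtain ⟨s, hs, hs2⟩ := (exists_spine_child_iff h2 (by omega)).2 hk
    -- the spine child is alone in its fibre
    have hsF : C.F s ≠ C.F u1 := by
      intro e
      have hfib := C.sum_fib (v := v) (w := C.F s) (by rw [← C.F_p, hs])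
      have h3 := C.deg_le_two v h0
      have aux : ∀ u, C.p u = v → C.F u = C.F s → u = s := by
        intro u hu1 hu2
        by_contra hne
        classical
        have hsub : ({u, s} : Finset C.V) ⊆ C.fib v (C.F s) := by
          intro x hx
          rcases Finset.mem_insert.1 hx with rfl | hx
          · exact C.mem_fib.2 ⟨hu1, hu2⟩
          · rw [Finset.mem_singleton.1 hx]; exact C.mem_fib.2 ⟨hs, rfl⟩
        have h1 := Finset.sum_le_sum_of_subset (f := fun x => C.deg x) hsub
        rw [Finset.sum_pair hne, hfib] at h1
        have := C.one_le_deg u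
        omega
      exact hne ((aux u1 hu1 e.symm).trans (aux u2 hu2 (hF.symm.trans e.symm)).symm)
    exact Finset.one_lt_card.2 ⟨C.F s, C.mem_children.2 (by rw [← C.F_p, hs]), C.F u1,
      C.mem_children.2 (by rw [← C.F_p, hu1]), hsF⟩
  · exact Finset.one_lt_card.2 ⟨C.F u1, C.mem_children.2 (by rw [← C.F_p, hu1]), C.F u2,
      C.mem_children.2 (by rw [← C.F_p, hu2]), hF⟩

/-- The forward orbit of a branch point passes through the base or the end of the spine. -/
theorem exists_iterate_of_two_le {v : C.V} (hv : 2 ≤ (C.children v).card) :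
    ∃ n, C.F^[n] v = C.base ∨ ∃ k : ℕ, C.HasDepth k ∧ C.lv (C.F^[n] v) = -(k : ℤ) := by
  obtain ⟨m, hm⟩ : ∃ m : ℕ, -(m : ℤ) ≤ C.lv v := ⟨(-C.lv v).toNat, by omega⟩
  induction m generalizing v with
  | zero =>
    refine ⟨0, Or.inl ?_⟩
    rcases eq_or_ne (C.lv v) 0 with h | h
    · exact C.eq_ray (i := 0) (by simpa using h)
    · push_cast at hm
      rw [C.eq_ray (v := v) (i := (C.lv v - 1).toNat + 1) (by omega), C.children_ray] at hv
      simp at hv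
  | succ m ih =>
    rcases lt_or_ge (C.lv v) 0 with h0 | h0
    · by_cases hd : ∀ k : ℕ, C.HasDepth k → C.lv v = -(k : ℤ) → ¬ 2 ≤ C.deg v
      · have := C.N_pos
        obtain ⟨n, hn⟩ := ih (two_le_children_F hv h0 hd) (by rw [C.lv_F]; push_cast at hm; omega)
        exact ⟨n + 1, hn⟩
      · push Not at hd
        obtain ⟨k, h1, h2, -⟩ := hd
        exact ⟨0, Or.inr ⟨k, h1, h2⟩⟩
    · exact ih hv (by omega)

/-- Each grand orbit contains a branch point. -/
def IsBranched (C : CTree) : Prop :=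
  ∀ v, ∃ w, C.toTreeMap.grandOrbit v w ∧ 2 ≤ (C.children w).card

/-- The levels of the branch points are congruent modulo `N` to 0 or to the level of the end of the spine,
whereas each residue class is to contain one. -/
theorem IsBranched.N_eq (h : C.IsBranched) :
    C.N = 1 ∨ C.N = 2 ∧ ∃ k, C.HasDepth k ∧ ¬ 2 ∣ k := by
  have hN := C.N_pos
  have key : ∀ r : ℤ, (C.N : ℤ) ∣ r ∨ ∃ k : ℕ, C.HasDepth k ∧ (C.N : ℤ) ∣ r + k := by
    intro r
    obtain ⟨v, hv⟩ := C.exists_level r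
    obtain ⟨w, ⟨a, b, hab⟩, hw⟩ := h v
    have h1 := congrArg C.lv hab
    change C.lv (C.F^[a] v) = C.lv (C.F^[b] w) at h1
    rw [C.lv_iterate_F, C.lv_iterate_F, hv] at h1
    obtain ⟨n, hn⟩ := exists_iterate_of_two_le hw
    rcases hn with hn | ⟨k, hk, hn⟩
    · have h2 := congrArg C.lv hn
      rw [C.lv_iterate_F, C.lv_base] at h2
      exact Or.inl ⟨b - a - n, by linarith⟩
    · rw [C.lv_iterate_F] at hn
      exact Or.inr ⟨k, hk, b - a - n, by linarith⟩
  by_cases h1 : C.N = 1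
  · exact Or.inl h1
  · right
    have hk1 : ¬ (C.N : ℤ) ∣ 1 := fun hd => h1 (by
      have := Int.le_of_dvd one_pos hd; omega)
    rcases key 1 with h2 | ⟨k, hk, h2⟩
    · exact absurd h2 hk1
    have h3 : C.N = 2 := by
      rcases key 2 with h3 | ⟨l, hl, h3⟩
      · have := Int.le_of_dvd two_pos h3
        omega
      · rw [hl.unique hk] at h3
        exact absurd (by have := dvd_sub h3 h2; ring_nf at this; exact this) hk1
    refine ⟨h3, k, hk, fun h4 => ?_⟩
    rw [h3] at h2
    omega

theorem isBranched_of_N_eq_one (h : C.N = 1) : C.IsBranched := fun v => by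
  refine ⟨C.base, ⟨(-C.lv v).toNat, (C.lv v).toNat, ?_⟩, C.two_le_children_base⟩
  have : ((C.N : ℕ) : ℤ) = 1 := by rw [h]; rfl
  exact C.eq_of_lv_eq _ _ (by change 0 ≤ C.lv (C.F^[_] v); rw [C.lv_iterate_F, this]; omega) (by
    change C.lv (C.F^[_] v) = C.lv (C.F^[_] C.base)
    rw [C.lv_iterate_F, C.lv_iterate_F, C.lv_base, this]; omega)

theorem isBranched_of_N_eq_two (h : C.N = 2) {k : ℕ} (hk : C.HasDepth k) (hodd : ¬ 2 ∣ k) :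
    C.IsBranched := fun v => by
  have hN : ((C.N : ℕ) : ℤ) = 2 := by rw [h]; rfl
  obtain ⟨s, hs, hs2⟩ := hk.1
  obtain ⟨w, hw, hr⟩ : ∃ w, 2 ≤ (C.children w).card ∧ (2 : ℤ) ∣ C.lv v - C.lv w := by
    rcases Int.emod_two_eq_zero_or_one (C.lv v) with h0 | h0
    · exact ⟨C.base, C.two_le_children_base, by rw [C.lv_base]; omega⟩
    · exact ⟨s, two_le_children_of_spine_end hs2 hs hk.2, by rw [hs]; omega⟩
  obtain ⟨c, hc⟩ := hr
  refine ⟨w, ⟨(-C.lv v).toNat + (-c).toNat, (-C.lv v).toNat + c.toNat, ?_⟩, hw⟩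
  exact C.eq_of_lv_eq _ _ (by change 0 ≤ C.lv (C.F^[_] v); rw [C.lv_iterate_F, hN]; push_cast; omega)
    (by
      change C.lv (C.F^[_] v) = C.lv (C.F^[_] w)
      rw [C.lv_iterate_F, C.lv_iterate_F, hN]; push_cast; omega)

end CTree

theorem Models.isBranched {C : CTree} {ℓ : ℤ → ℝ} {T : MetrizedTree 3} {i : C.V → T.V}
    (h : Models C ℓ T i) : C.IsBranched := fun v => by
  obtain ⟨x, hx, hx'⟩ := T.polynomialLike.branch (i v)
  obtain ⟨w, rfl⟩ := h.bij.2 x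
  exact ⟨w, (h.grandOrbit_iff v w).1 hx, by rw [h.valence_eq] at hx'; omega⟩

/-! ### Isomorphisms of the upper parts of level trees -/

/-- Maps that take values in a finite set at each point have a pointwise limit along an
ultrafilter. -/
theorem exists_ultralimit {ι X Y : Type*} (U : Ultrafilter ι) (σ : ι → X → Y)
    (h : ∀ x, ∃ B : Set Y, B.Finite ∧ ∀ᶠ n in (U : Filter ι), σ n x ∈ B) :
    ∃ g : X → Y, ∀ x, ∀ᶠ n in (U : Filter ι), σ n x = g x := by
  have key : ∀ x, ∃ y, ∀ᶠ n in (U : Filter ι), σ n x = y := by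
    intro x
    obtain ⟨B, hB, hx⟩ := h x
    have h1 : (⋃ y ∈ B, {n | σ n x = y}) ∈ U := by
      filter_upwards [hx] with n hn
      simpa using hn
    obtain ⟨y, -, hy⟩ := (Ultrafilter.finite_biUnion_mem_iff hB).1 h1
    exact ⟨y, hy⟩
  choose g hg using key
  exact ⟨g, hg⟩

namespace CTree

/-- `f` is an isomorphism between the parts of `C` and `C'` on the levels `≥ -k`. -/
structure IsPIso (C C' : CTree) (f : C.V → C'.V) (k : ℕ) : Prop where
  N_eq : C.N = C'.N
  map_lv : ∀ v, -(k : ℤ) ≤ C.lv v → C'.lv (f v) = C.lv v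
  map_p : ∀ v, -(k : ℤ) ≤ C.lv v → f (C.p v) = C'.p (f v)
  map_F : ∀ v, -(k : ℤ) ≤ C.lv v → f (C.F v) = C'.F (f v)
  map_deg : ∀ v, -(k : ℤ) ≤ C.lv v → C'.deg (f v) = C.deg v
  inj : ∀ u v, -(k : ℤ) ≤ C.lv u → -(k : ℤ) ≤ C.lv v → f u = f v → u = v
  surj : ∀ w, -(k : ℤ) ≤ C'.lv w → ∃ v, -(k : ℤ) ≤ C.lv v ∧ f v = w

theorem lv_p_ge {C : CTree} {k : ℤ} {v : C.V} (h : k ≤ C.lv v) : k ≤ C.lv (C.p v) := by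
  rw [C.lv_p]; omega

theorem lv_F_ge {C : CTree} {k : ℤ} {v : C.V} (h : k ≤ C.lv v) : k ≤ C.lv (C.F v) := by
  rw [C.lv_F]; omega

theorem IsIso.isPIso {C C' : CTree} {f : C.V → C'.V} (h : IsIso C C' f) (k : ℕ) : IsPIso C C' f k where
  N_eq := h.N_eq
  map_lv v _ := h.map_lv v
  map_p v _ := h.map_p v
  map_F v _ := h.map_F v
  map_deg v _ := h.map_deg v
  inj _ _ _ _ e := h.bij.1 e
  surj w hw := by
    obtain ⟨v, rfl⟩ := h.bij.2 w
    exact ⟨v, by rwa [h.map_lv] at hw, rfl⟩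

theorem IsIso.refl (C : CTree) : IsIso C C id :=
  ⟨Function.bijective_id, rfl, fun _ => rfl, fun _ => rfl, fun _ => rfl⟩

namespace IsPIso

variable {C C' C'' : CTree} {f : C.V → C'.V} {k : ℕ}

theorem mono (h : IsPIso C C' f k) {l : ℕ} (hl : l ≤ k) : IsPIso C C' f l where
  N_eq := h.N_eq
  map_lv v hv := h.map_lv v (by omega)
  map_p v hv := h.map_p v (by omega)
  map_F v hv := h.map_F v (by omega)
  map_deg v hv := h.map_deg v (by omega)
  inj u v hu hv e := h.inj u v (by omega) (by omega) e
  surj w hw := by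
    obtain ⟨v, hv, rfl⟩ := h.surj w (by omega)
    exact ⟨v, by rwa [h.map_lv v hv] at hw, rfl⟩

theorem comp {g : C'.V → C''.V} (hg : IsPIso C' C'' g k) (hf : IsPIso C C' f k) :
    IsPIso C C'' (g ∘ f) k := by
  have key : ∀ v, -(k : ℤ) ≤ C.lv v → -(k : ℤ) ≤ C'.lv (f v) := fun v hv => by
    rwa [hf.map_lv v hv]
  refine ⟨hf.N_eq.trans hg.N_eq, fun v hv => ?_, fun v hv => ?_, fun v hv => ?_, fun v hv => ?_,
    fun u v hu hv e => ?_, fun w hw => ?_⟩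
  · rw [Function.comp, hg.map_lv _ (key v hv), hf.map_lv v hv]
  · rw [Function.comp, Function.comp, hf.map_p v hv, hg.map_p _ (key v hv)]
  · rw [Function.comp, Function.comp, hf.map_F v hv, hg.map_F _ (key v hv)]
  · rw [Function.comp, hg.map_deg _ (key v hv), hf.map_deg v hv]
  · exact hf.inj u v hu hv (hg.inj _ _ (key u hu) (key v hv) e)
  · obtain ⟨v, hv, rfl⟩ := hg.surj w hw
    obtain ⟨u, hu, rfl⟩ := hf.surj v hv
    exact ⟨u, hu, rfl⟩

theorem exists_inv (h : IsPIso C C' f k) : ∃ g, IsPIso C' C g k ∧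
    (∀ v, -(k : ℤ) ≤ C.lv v → g (f v) = v) ∧ ∀ v, -(k : ℤ) ≤ C'.lv v → f (g v) = v := by
  have h1 : ∀ w, ∃ v, -(k : ℤ) ≤ C'.lv w → -(k : ℤ) ≤ C.lv v ∧ f v = w := by
    intro w
    by_cases hw : -(k : ℤ) ≤ C'.lv w
    · obtain ⟨v, hv⟩ := h.surj w hw
      exact ⟨v, fun _ => hv⟩
    · exact ⟨C.base, fun h => absurd h hw⟩
  choose g hg using h1
  have key : ∀ v, -(k : ℤ) ≤ C.lv v → -(k : ℤ) ≤ C'.lv (f v) := fun v hv => by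
    rwa [h.map_lv v hv]
  have hgf : ∀ v, -(k : ℤ) ≤ C.lv v → g (f v) = v := fun v hv =>
    h.inj _ _ (hg _ (key v hv)).1 hv (hg _ (key v hv)).2
  refine ⟨g, ⟨h.N_eq.symm, fun w hw => ?_, fun w hw => ?_, fun w hw => ?_, fun w hw => ?_,
    fun u v hu hv e => ?_, fun v hv => ⟨f v, key v hv, hgf v hv⟩⟩, hgf, fun w hw => (hg w hw).2⟩
  all_goals try obtain ⟨v, hv, rfl⟩ := h.surj w hw
  · rw [hgf v hv, h.map_lv v hv]
  · rw [← h.map_p v hv, hgf _ (lv_p_ge hv), hgf v hv]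
  · rw [← h.map_F v hv, hgf _ (lv_F_ge hv), hgf v hv]
  · rw [hgf v hv, h.map_deg v hv]
  · rw [← (hg u hu).2, ← (hg v hv).2, e]

theorem map_ray (h : IsPIso C C' f k) (i : ℕ) : f (C.ray i) = C'.ray i :=
  C'.eq_ray (by rw [h.map_lv _ (by rw [C.lv_ray]; omega), C.lv_ray])

theorem map_base (h : IsPIso C C' f k) : f C.base = C'.base := h.map_ray 0

theorem hasSp (h : IsPIso C C' f k) {l : ℕ} (hl : l ≤ k) : C.HasSp l ↔ C'.HasSp l := by
  constructor
  · rintro ⟨v, h1, h2⟩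
    exact ⟨f v, by rw [h.map_lv v (by omega), h1], by rw [h.map_deg v (by omega)]; exact h2⟩
  · rintro ⟨w, h1, h2⟩
    obtain ⟨v, hv, rfl⟩ := h.surj w (by omega)
    rw [h.map_lv v hv] at h1
    rw [h.map_deg v hv] at h2
    exact ⟨v, h1, h2⟩

/-- An isomorphism on the levels `≥ -k` exists on the level `-(k + 1)` too if there the spine
vertices, if any, correspond: corresponding fibres then have the same number of vertices of
each degree. -/
theorem extend (h : IsPIso C C' f k)
    (hs : ∀ s, C.lv s = -(k + 1 : ℤ) → 2 ≤ C.deg s →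
      ∃ s', C'.lv s' = -(k + 1 : ℤ) ∧ 2 ≤ C'.deg s' ∧ C'.F s' = f (C.F s))
    (hs' : C'.HasSp (k + 1) → C.HasSp (k + 1)) :
    ∃ g, IsPIso C C' g (k + 1) ∧ ∀ v, -(k : ℤ) ≤ C.lv v → g v = f v := by
  classical
  have key : ∀ v, -(k : ℤ) ≤ C.lv v → -(k : ℤ) ≤ C'.lv (f v) := fun v hv => by
    rwa [h.map_lv v hv]
  have hN := C.N_pos
  -- a bijection between corresponding fibres that respects the degrees
  have hfib : ∀ v w, C.lv v = -(k : ℤ) → C.p w = C.F v → ∃ e : C.V → C'.V,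
      Set.BijOn e (C.fib v w) (C'.fib (f v) (f w)) ∧ ∀ u ∈ C.fib v w, C'.deg (e u) = C.deg u := by
    intro v w hv hw
    have hlw := C.lv_p w
    rw [hw, C.lv_F] at hlw
    have hw' : -(k : ℤ) ≤ C.lv w := by omega
    have s1 := C.sum_fib hw
    have s2 := C'.sum_fib (v := f v) (w := f w) (by rw [← h.map_p w hw', hw, h.map_F v (by omega)])
    rw [h.map_deg v (by omega), ← s1] at s2
    have hlv : ∀ u ∈ C.fib v w, C.lv u = -(k + 1 : ℤ) := fun u hu => by
      have := C.lv_p u; rw [(C.mem_fib.1 hu).1, hv] at this; omega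
    have hlv' : ∀ u ∈ C'.fib (f v) (f w), C'.lv u = -(k + 1 : ℤ) := fun u hu => by
      have := C'.lv_p u
      rw [(C'.mem_fib.1 hu).1, h.map_lv v (by omega), hv] at this; omega
    have hp' : ∀ s', C'.lv s' = -(k + 1 : ℤ) → 2 ≤ C'.deg s' → ∀ s, C.lv s = -(k + 1 : ℤ) →
        2 ≤ C.deg s → C'.p s' = f (C.p s) := by
      intro s' h1 h2 s h3 h4
      refine eq_of_spine ?_ (h2.trans (C'.deg_le_parent s')) ?_
      · rw [h.map_lv _ (by rw [C.lv_p]; omega), C.lv_p, C'.lv_p, h1, h3]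
      · rw [h.map_deg _ (by rw [C.lv_p]; omega)]
        exact h4.trans (C.deg_le_parent s)
    by_cases hsp : ∃ s ∈ C.fib v w, 2 ≤ C.deg s
    · obtain ⟨s, hsm, hs2⟩ := hsp
      obtain ⟨s', l', d', F'⟩ := hs s (hlv s hsm) hs2
      have hs'm : s' ∈ C'.fib (f v) (f w) := by
        rw [mem_fib, F', hp' s' l' d' s (hlv s hsm) hs2, (C.mem_fib.1 hsm).1, (C.mem_fib.1 hsm).2]
        exact ⟨rfl, rfl⟩
      have e1 : ∀ u ∈ (C.fib v w).erase s, C.deg u = 1 := fun u hu => by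
        by_contra hd
        have := C.one_le_deg u
        have hu' := Finset.mem_of_mem_erase hu
        exact Finset.ne_of_mem_erase hu
          (eq_of_spine ((hlv u hu').trans (hlv s hsm).symm) (by omega) hs2)
      have e2 : ∀ u ∈ (C'.fib (f v) (f w)).erase s', C'.deg u = 1 := fun u hu => by
        by_contra hd
        have := C'.one_le_deg u
        have hu' := Finset.mem_of_mem_erase hu
        exact Finset.ne_of_mem_erase hu
          (eq_of_spine ((hlv' u hu').trans (hlv' s' hs'm).symm) (by omega) d')
      have hds : C.deg s = 2 := le_antisymm (C.deg_le_two s (by have := hlv s hsm; omega)) hs2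
      have hds' : C'.deg s' = 2 := le_antisymm (C'.deg_le_two s' (by omega)) d'
      rw [← Finset.add_sum_erase _ _ hsm, ← Finset.add_sum_erase _ _ hs'm, Finset.sum_congr rfl e1,
        Finset.sum_congr rfl e2, hds, hds', Finset.sum_const, Finset.sum_const] at s2
      have hcard : ((C.fib v w).erase s).card = ((C'.fib (f v) (f w)).erase s').card := by
        simp only [smul_eq_mul, mul_one] at s2; omega
      obtain ⟨e, he⟩ : ∃ e : C.V → C'.V, Set.BijOn e ((C.fib v w).erase s : Finset _)
          ((C'.fib (f v) (f w)).erase s' : Finset _) := by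
        have : Nonempty C'.V := ⟨s'⟩
        exact (Finset.finite_toSet _).exists_bijOn_of_encard_eq (by
          rw [Set.encard_coe_eq_coe_finsetCard, Set.encard_coe_eq_coe_finsetCard, hcard])
      have hes : ∀ u, u ≠ s → Function.update e s s' u = e u := fun u hu => Function.update_of_ne hu _ _
      refine ⟨Function.update e s s', ?_, fun u hu => ?_⟩
      · have h1 : Set.BijOn (Function.update e s s') ((C.fib v w).erase s : Finset _)
            ((C'.fib (f v) (f w)).erase s' : Finset _) :=
          he.congr fun u hu => (hes u (Finset.ne_of_mem_erase hu)).symm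
        have h2 := h1.insert (a := s) (by rw [Function.update_self]; simp)
        rw [Function.update_self] at h2
        rwa [← Finset.coe_insert, ← Finset.coe_insert, Finset.insert_erase hsm,
          Finset.insert_erase hs'm] at h2
      · by_cases hus : u = s
        · rw [hus, Function.update_self, hds, hds']
        · have hu' := Finset.mem_erase.2 ⟨hus, hu⟩
          rw [hes u hus, e1 u hu', e2 _ (he.mapsTo hu')]
    · push Not at hsp
      have e1 : ∀ u ∈ C.fib v w, C.deg u = 1 := fun u hu => by
        have := C.one_le_deg u
        have := hsp u hu
        omega
      have e2 : ∀ u ∈ C'.fib (f v) (f w), C'.deg u = 1 := fun u hu => by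
        by_contra hd
        have hd1 := C'.one_le_deg u
        obtain ⟨s, hs1, hs2⟩ := hs' ⟨u, by push_cast; exact hlv' u hu, by omega⟩
        push_cast at hs1
        obtain ⟨s', l', d', F'⟩ := hs s hs1 hs2
        have hus : s' = u := eq_of_spine (l'.trans (hlv' u hu).symm) d' (by omega)
        have h1 := hp' s' l' d' s hs1 hs2
        rw [hus, (C'.mem_fib.1 hu).1] at h1
        rw [hus, (C'.mem_fib.1 hu).2] at F'
        have := hsp s (C.mem_fib.2 ⟨(h.inj _ _ (by omega) (by rw [C.lv_p]; omega) h1).symm,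
          (h.inj _ _ hw' (by rw [C.lv_F]; omega) F').symm⟩)
        omega
      rw [Finset.sum_congr rfl e1, Finset.sum_congr rfl e2, Finset.sum_const, Finset.sum_const] at s2
      obtain ⟨e, he⟩ : ∃ e : C.V → C'.V, Set.BijOn e (C.fib v w) (C'.fib (f v) (f w)) :=
        have : Nonempty C'.V := ⟨C'.base⟩
        (Finset.finite_toSet _).exists_bijOn_of_encard_eq (by
          simp only [smul_eq_mul, mul_one] at s2
          rw [Set.encard_coe_eq_coe_finsetCard, Set.encard_coe_eq_coe_finsetCard, s2])
      exact ⟨e, he, fun u hu => by rw [e1 u hu, e2 _ (he.mapsTo hu)]⟩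
  have hfib' : ∀ v w, ∃ e : C.V → C'.V, C.lv v = -(k : ℤ) → C.p w = C.F v →
      Set.BijOn e (C.fib v w) (C'.fib (f v) (f w)) ∧ ∀ u ∈ C.fib v w, C'.deg (e u) = C.deg u := by
    intro v w
    by_cases hv : C.lv v = -(k : ℤ) ∧ C.p w = C.F v
    · obtain ⟨e, he⟩ := hfib v w hv.1 hv.2
      exact ⟨e, fun _ _ => he⟩
    · exact ⟨f, fun h1 h2 => absurd ⟨h1, h2⟩ hv⟩
  choose e he using hfib'
  -- the bijections between the fibres give the map on the level `-(k + 1)`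
  let g : C.V → C'.V := fun u => if -(k : ℤ) ≤ C.lv u then f u else e (C.p u) (C.F u) u
  have hg1 : ∀ u, -(k : ℤ) ≤ C.lv u → g u = f u := fun u hu => if_pos hu
  have hg2 : ∀ u, C.lv u = -(k + 1 : ℤ) → g u = e (C.p u) (C.F u) u :=
    fun u hu => if_neg (by omega)
  have hcase : ∀ u, -((k + 1 : ℕ) : ℤ) ≤ C.lv u → -(k : ℤ) ≤ C.lv u ∨ C.lv u = -(k + 1 : ℤ) :=
    fun u hu => by push_cast at hu; omega
  have hcase' : ∀ u, -((k + 1 : ℕ) : ℤ) ≤ C'.lv u → -(k : ℤ) ≤ C'.lv u ∨ C'.lv u = -(k + 1 : ℤ) :=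
    fun u hu => by push_cast at hu; omega
  have hE : ∀ u, C.lv u = -(k + 1 : ℤ) → Set.BijOn (e (C.p u) (C.F u)) (C.fib (C.p u) (C.F u))
      (C'.fib (f (C.p u)) (f (C.F u))) ∧
      ∀ x ∈ C.fib (C.p u) (C.F u), C'.deg (e (C.p u) (C.F u) x) = C.deg x := fun u hu =>
    he _ _ (by rw [C.lv_p, hu]; ring) (C.F_p u).symm
  have hmem : ∀ u, u ∈ C.fib (C.p u) (C.F u) := fun u => C.mem_fib.2 ⟨rfl, rfl⟩
  have hgm : ∀ u, C.lv u = -(k + 1 : ℤ) → C'.p (g u) = f (C.p u) ∧ C'.F (g u) = f (C.F u) ∧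
      C'.deg (g u) = C.deg u := fun u hu => by
    rw [hg2 u hu]
    obtain ⟨h1, h2⟩ := C'.mem_fib.1 ((hE u hu).1.mapsTo (hmem u))
    exact ⟨h1, h2, (hE u hu).2 u (hmem u)⟩
  have hplv : ∀ u, C.lv u = -(k + 1 : ℤ) → -(k : ℤ) ≤ C.lv (C.p u) := fun u hu => by
    rw [C.lv_p]; omega
  have hFlv : ∀ u, C.lv u = -(k + 1 : ℤ) → -(k : ℤ) ≤ C.lv (C.F u) := fun u hu => by
    rw [C.lv_F]; omega
  have hglv : ∀ u, -((k + 1 : ℕ) : ℤ) ≤ C.lv u → C'.lv (g u) = C.lv u := by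
    intro u hu
    rcases hcase u hu with hu | hu
    · rw [hg1 u hu, h.map_lv u hu]
    · have h1 := C'.lv_p (g u)
      rw [(hgm u hu).1, h.map_lv _ (hplv u hu), C.lv_p] at h1
      omega
  refine ⟨g, ⟨h.N_eq, hglv, fun u hu => ?_, fun u hu => ?_, fun u hu => ?_, fun u v hu hv huv => ?_,
    fun w hw => ?_⟩, hg1⟩
  · rcases hcase u hu with hu | hu
    · rw [hg1 u hu, hg1 _ (lv_p_ge hu), h.map_p u hu]
    · rw [(hgm u hu).1, hg1 _ (hplv u hu)]
  · rcases hcase u hu with hu | hu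
    · rw [hg1 u hu, hg1 _ (lv_F_ge hu), h.map_F u hu]
    · rw [(hgm u hu).2.1, hg1 _ (hFlv u hu)]
  · rcases hcase u hu with hu | hu
    · rw [hg1 u hu, h.map_deg u hu]
    · exact (hgm u hu).2.2
  · have hl : C.lv u = C.lv v := by rw [← hglv u hu, ← hglv v hv, huv]
    rcases hcase u hu with hu | hu
    · rw [hg1 u hu, hg1 v (by omega)] at huv
      exact h.inj u v hu (by omega) huv
    · have hv' : C.lv v = -(k + 1 : ℤ) := by omega
      have hp : C.p u = C.p v := h.inj _ _ (hplv u hu) (hplv v hv') (by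
        rw [← (hgm u hu).1, ← (hgm v hv').1, huv])
      have hF : C.F u = C.F v := h.inj _ _ (hFlv u hu) (hFlv v hv') (by
        rw [← (hgm u hu).2.1, ← (hgm v hv').2.1, huv])
      rw [hg2 u hu, hg2 v hv', hp, hF] at huv
      refine (hE v hv').1.injOn ?_ (hmem v) huv
      rw [← hp, ← hF]; exact hmem u
  · rcases hcase' w hw with hw | hw
    · obtain ⟨v, hv, rfl⟩ := h.surj w hw
      exact ⟨v, by push_cast; omega, hg1 v hv⟩
    · obtain ⟨v, hv, hvp⟩ := h.surj (C'.p w) (by rw [C'.lv_p]; omega)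
      have hN' := C'.N_pos
      obtain ⟨z, hz, hzF⟩ := h.surj (C'.F w) (by rw [C'.lv_F]; omega)
      have hlv : C.lv v = -(k : ℤ) := by rw [← h.map_lv v hv, hvp, C'.lv_p, hw]; ring
      have hzv : C.p z = C.F v := h.inj _ _ (lv_p_ge hz) (lv_F_ge hv) (by
        rw [h.map_p z hz, h.map_F v hv, hvp, hzF, C'.F_p])
      obtain ⟨hb, -⟩ := he v z hlv hzv
      obtain ⟨u, hu, huw⟩ := hb.surjOn (a := w) (by
        rw [Finset.mem_coe, mem_fib, hvp, hzF]; exact ⟨rfl, rfl⟩)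
      obtain ⟨hup, huF⟩ := C.mem_fib.1 hu
      have hlu : C.lv u = -(k + 1 : ℤ) := by have := C.lv_p u; rw [hup, hlv] at this; omega
      exact ⟨u, by push_cast; omega, by rw [hg2 u hlu, hup, huF, huw]⟩

/-- Below the spine the extension is always possible. -/
theorem extend_of_not_hasSp (h : IsPIso C C' f k) (h1 : ¬ C.HasSp (k + 1)) (h2 : ¬ C'.HasSp (k + 1))
    (l : ℕ) : ∃ g, IsPIso C C' g l := by
  rcases le_total l k with hl | hl
  · exact ⟨f, h.mono hl⟩
  · obtain ⟨d, rfl⟩ := Nat.exists_eq_add_of_le hl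
    clear hl
    induction d with
    | zero => exact ⟨f, h⟩
    | succ d ih =>
      obtain ⟨g, hg⟩ := ih
      obtain ⟨g', hg', -⟩ := hg.extend (fun s hs1 hs2 =>
          absurd (HasSp.mono (l := k + d + 1) ⟨s, by push_cast at hs1 ⊢; exact hs1, hs2⟩ (by omega)) h1)
        (fun h3 => absurd (h3.mono (by omega)) h2)
      exact ⟨g', hg'⟩

end IsPIso

theorem exists_isPIso_zero (C C' : CTree) (h : C.N = C'.N) : ∃ f, IsPIso C C' f 0 := by
  have h1 : ∀ v, -((0 : ℕ) : ℤ) ≤ C.lv v → v = C.ray (C.lv v).toNat := fun v hv =>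
    C.eq_ray (by omega)
  have key : ∀ v, -((0 : ℕ) : ℤ) ≤ C.lv v → ((C.lv v).toNat : ℤ) = C.lv v := fun v hv => by omega
  refine ⟨fun v => C'.ray (C.lv v).toNat, h, fun v hv => ?_, fun v hv => ?_, fun v hv => ?_,
    fun v hv => ?_, fun u v hu hv e => ?_, fun w hw => ?_⟩
  · rw [C'.lv_ray, key v hv]
  · refine (C'.eq_ray ?_).symm
    rw [C'.lv_p, C'.lv_ray, C.lv_p]; omega
  · refine (C'.eq_ray ?_).symm
    rw [C'.lv_F, C'.lv_ray, C.lv_F, ← h]; omega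
  · rw [C'.deg_ray _ (by rw [C'.lv_ray]; omega), C.deg_ray _ (by omega)]
  · have e1 := congrArg C'.lv e
    rw [C'.lv_ray, C'.lv_ray, key u hu, key v hv] at e1
    exact C.eq_of_lv_eq u v (by omega) e1
  · refine ⟨C.ray (C'.lv w).toNat, by rw [C.lv_ray]; omega, ?_⟩
    refine (C'.eq_ray ?_).symm
    rw [C.lv_ray]; omega

/-- Level trees whose upper parts are isomorphic are isomorphic, by compactness. -/
theorem exists_isIso_of_isPIso {C C' : CTree} (h : ∀ k, ∃ f, IsPIso C C' f k) :
    ∃ f, IsIso C C' f := by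
  choose f hf using h
  have hlev : ∀ v : C.V, ∀ᶠ n : ℕ in (hyperfilter ℕ : Filter ℕ), -(n : ℤ) ≤ C.lv v := fun v =>
    Nat.hyperfilter_le_atTop ((eventually_ge_atTop (-C.lv v).toNat).mono fun n hn => by omega)
  have hlev' : ∀ v : C'.V, ∀ᶠ n : ℕ in (hyperfilter ℕ : Filter ℕ), -(n : ℤ) ≤ C'.lv v := fun v =>
    Nat.hyperfilter_le_atTop ((eventually_ge_atTop (-C'.lv v).toNat).mono fun n hn => by omega)
  obtain ⟨g, hg⟩ := exists_ultralimit (hyperfilter ℕ) f fun v =>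
    ⟨_, C'.finite_level (C.lv v).natAbs, (hlev v).mono fun n hn => by
      change (C'.lv _).natAbs ≤ _
      rw [(hf n).map_lv v hn]⟩
  choose f' hf' hff' hf'f using fun n => (hf n).exists_inv
  obtain ⟨g', hg'⟩ := exists_ultralimit (hyperfilter ℕ) f' fun v =>
    ⟨_, C.finite_level (C'.lv v).natAbs, (hlev' v).mono fun n hn => by
      change (C.lv _).natAbs ≤ _
      rw [(hf' n).map_lv v hn]⟩
  refine ⟨g, ⟨⟨fun u v e => ?_, fun w => ⟨g' w, ?_⟩⟩, (hf 0).N_eq, fun v => ?_, fun v => ?_,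
    fun v => ?_⟩⟩
  · obtain ⟨n, h1, h2, h3, h4⟩ := ((hg u).and ((hg v).and ((hlev u).and (hlev v)))).exists
    exact (hf n).inj u v h3 h4 (by rw [h1, h2, e])
  · obtain ⟨n, h1, h2, h3⟩ := ((hg' w).and ((hg (g' w)).and (hlev' w))).exists
    rw [← h2, ← h1, hf'f n w h3]
  · obtain ⟨n, h1, h2, h3⟩ := ((hg v).and ((hg (C.p v)).and (hlev v))).exists
    rw [← h1, ← h2, (hf n).map_p v h3]
  · obtain ⟨n, h1, h2, h3⟩ := ((hg v).and ((hg (C.F v)).and (hlev v))).exists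
    rw [← h1, ← h2, (hf n).map_F v h3]
  · obtain ⟨n, h1, h3⟩ := ((hg v).and (hlev v)).exists
    rw [← h1, (hf n).map_lv v h3]

/-- Below the spine a level tree is determined by its upper part. -/
theorem IsPIso.exists_isIso {C C' : CTree} {f : C.V → C'.V} {k : ℕ} (h : IsPIso C C' f k)
    (h1 : ¬ C.HasSp (k + 1)) (h2 : ¬ C'.HasSp (k + 1)) : ∃ g, IsIso C C' g :=
  exists_isIso_of_isPIso (h.extend_of_not_hasSp h1 h2)

end CTree

/-! ### Universal vertices, and level trees with a prescribed spine -/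

/-- Names for the vertices of all level trees: `ray n` is the vertex of level `n` on the base ray,
and `node v w b` is the `b`-th child of `v` that is mapped to `w`. -/
inductive VertexName where
  | ray (n : ℕ)
  | node (v w : VertexName) (b : ℕ)

namespace VertexName

/-- The level. -/
def lv : VertexName → ℤ
  | ray n => n
  | node v _ _ => lv v - 1

/-- The neighbour in the direction of `∞`. -/
def parent : VertexName → VertexName
  | ray n => ray (n + 1)
  | node v _ _ => v

/-- The image under the map that raises the levels by `N`. -/
def image (N : ℕ) : VertexName → VertexName
  | ray n => ray (n + N)
  | node _ w _ => w

variable (N : ℕ) (S : Set VertexName)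

open Classical in
/-- The local degree, if `S` is the set of spine vertices below the base. -/
noncomputable def deg : VertexName → ℕ
  | ray _ => 3
  | node v w b => if node v w b ∈ S then 2 else 1

open Classical in
/-- The number of children of `v` that are mapped to `w`: it is `deg v`, unless the child with index
0 is on the spine and counts twice. -/
noncomputable def mult (v w : VertexName) : ℕ := if node v w 0 ∈ S then deg S v - 1 else deg S v

/-- The vertices of the level tree with spine `S`. -/
def Valid : VertexName → Prop
  | ray _ => True
  | node v w b => (Valid v ∧ Valid w) ∧ lv v ≤ 0 ∧ parent w = image N v ∧ b < mult S v w

/-- The sets `S` which are spines. -/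
structure IsSpine : Prop where
  exists_eq : ∀ x ∈ S, ∃ v w, x = node v w 0 ∧ 2 ≤ deg S v
  unique : ∀ v w w', node v w 0 ∈ S → node v w' 0 ∈ S → w = w'

variable {N S}

theorem lv_parent (v : VertexName) : lv (parent v) = lv v + 1 := by
  cases v <;> simp [parent, lv]

theorem lv_image {v : VertexName} (hv : Valid N S v) : lv (image N v) = lv v + N := by
  induction v with
  | ray n => simp [image, lv]
  | node v w b hv' hw' =>
    have h1 := lv_parent w
    rw [hv.2.2.1, hv' hv.1.1] at h1
    simp only [image, lv]
    omega

theorem image_parent {v : VertexName} (hv : Valid N S v) :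
    image N (parent v) = parent (image N v) := by
  cases v with
  | ray n => simp only [image, parent]; congr 1; omega
  | node v w b => exact hv.2.2.1.symm

theorem valid_parent {v : VertexName} (hv : Valid N S v) : Valid N S (parent v) := by
  cases v with
  | ray n => trivial
  | node v w b => exact hv.1.1

theorem valid_image {v : VertexName} (hv : Valid N S v) : Valid N S (image N v) := by
  cases v with
  | ray n => trivial
  | node v w b => exact hv.1.2

theorem eq_ray_of_valid {v : VertexName} (hv : Valid N S v) (h : 0 ≤ lv v) :
    v = ray (lv v).toNat := by
  cases v with
  | ray n => simp [lv]
  | node v w b =>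
    have := hv.2.1
    simp only [lv] at h
    omega

theorem ray_notMem (hS : IsSpine S) (n : ℕ) : ray n ∉ S := fun h => by
  obtain ⟨v, w, h, -⟩ := hS.exists_eq _ h
  cases h

theorem deg_eq_two {v : VertexName} (h : v ∈ S) (hS : IsSpine S) : deg S v = 2 := by
  cases v with
  | ray n => exact absurd h (ray_notMem hS n)
  | node v w b => simp [deg, h]

theorem two_le_deg_iff {v : VertexName} (hv : Valid N S v) (h : lv v < 0) : 2 ≤ deg S v ↔ v ∈ S := by
  cases v with
  | ray n => simp only [lv] at h; omega
  | node v w b =>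
    by_cases hm : node v w b ∈ S <;> simp [deg, hm]

theorem one_le_deg (v : VertexName) : 1 ≤ deg S v := by
  cases v with
  | ray n => simp [deg]
  | node v w b => by_cases hm : node v w b ∈ S <;> simp [deg, hm]

theorem deg_le_three (v : VertexName) : deg S v ≤ 3 := by
  cases v with
  | ray n => simp [deg]
  | node v w b => by_cases hm : node v w b ∈ S <;> simp [deg, hm]

theorem mult_pos (hS : IsSpine S) (v w : VertexName) : 0 < mult S v w := by
  by_cases h : node v w 0 ∈ S
  · obtain ⟨v', w', h1, h2⟩ := hS.exists_eq _ h
    cases h1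
    rw [mult, if_pos h]; omega
  · rw [mult, if_neg h]
    exact one_le_deg v

theorem valid_node_zero (hS : IsSpine S) {v w : VertexName} (hv : Valid N S v) (hw : Valid N S w)
    (hl : lv v ≤ 0) (h : parent w = image N v) : Valid N S (node v w 0) :=
  ⟨⟨hv, hw⟩, hl, h, mult_pos hS v w⟩

/-- The children of `v` are named after those of the image of `v`, which are finite in number by induction
on the level. -/
theorem finite_children (hN : 1 ≤ N) {v : VertexName} (hv : Valid N S v) :
    {u | Valid N S u ∧ parent u = v}.Finite := by
  obtain ⟨n, hn⟩ : ∃ n : ℕ, 1 - (n : ℤ) ≤ lv v := ⟨(1 - lv v).toNat, by omega⟩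
  induction n generalizing v with
  | zero =>
    refine (Set.finite_singleton (ray (lv v - 1).toNat)).subset ?_
    rintro u ⟨hu, rfl⟩
    rw [lv_parent] at hn ⊢
    rw [Set.mem_singleton_iff, add_sub_cancel_right]
    exact eq_ray_of_valid hu (by push_cast at hn; omega)
  | succ n ih =>
    have h1 := ih (valid_image hv) (by rw [lv_image hv]; push_cast at hn; omega)
    refine (((h1.prod (Set.finite_Iio 3)).image fun x => node v x.1 x.2).union
      (Set.finite_singleton (ray (lv v - 1).toNat))).subset ?_
    rintro u ⟨hu, rfl⟩
    cases u with
    | ray n => right; simp [parent, lv]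
    | node v w b =>
      left
      refine ⟨(w, b), ⟨⟨hu.1.2, hu.2.2.1⟩, ?_⟩, rfl⟩
      have h2 := hu.2.2.2
      have h3 := deg_le_three (S := S) v
      change b < 3
      unfold mult at h2
      split_ifs at h2 <;> omega

/-- The level tree with spine `S`. -/
@[reducible] noncomputable def tree (N : ℕ) (hN : 1 ≤ N) (S : Set VertexName) (hS : IsSpine S) : CTree where
  V := {v // Valid N S v}
  N := N
  p v := ⟨parent v.1, valid_parent v.2⟩
  F v := ⟨image N v.1, valid_image v.2⟩
  lv v := lv v.1
  deg v := deg S v.1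
  N_pos := hN
  lv_p v := lv_parent v.1
  lv_F v := lv_image v.2
  F_p v := Subtype.ext (image_parent v.2)
  exists_base := ⟨⟨ray 0, trivial⟩, rfl⟩
  eq_of_lv_eq u v h0 h := Subtype.ext (by
    rw [eq_ray_of_valid u.2 h0, eq_ray_of_valid v.2 (h ▸ h0), h])
  deg_ray v h := by rw [eq_ray_of_valid v.2 h]; rfl
  one_le_deg v := one_le_deg v.1
  deg_le_two v h := by
    obtain ⟨v, hv⟩ := v
    cases v with
    | ray n => simp only [lv] at h; omega
    | node v w b => by_cases hm : node v w b ∈ S <;> simp [deg, hm]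
  finite_children v := by
    refine Set.Finite.of_finite_image (f := Subtype.val) ((finite_children hN v.2).subset ?_)
      Subtype.val_injective.injOn
    rintro u ⟨w, hw, rfl⟩
    exact ⟨w.2, congrArg Subtype.val hw⟩
  cover := by
    classical
    rintro ⟨v, hv⟩ ⟨w, hw⟩ h
    have h' : parent w = image N v := congrArg Subtype.val h
    rcases le_or_gt (lv v) 0 with hl | hl
    · -- the children `node v w b` with `b < mult S v w`, where the one on the spine counts twice
      have hval : ∀ b, b < mult S v w → Valid N S (node v w b) := fun b hb => ⟨⟨hv, hw⟩, hl, h', hb⟩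
      let φ : ℕ → {v // Valid N S v} := fun b =>
        if hb : b < mult S v w then ⟨node v w b, hval b hb⟩ else ⟨v, hv⟩
      have hφ : ∀ b, b < mult S v w → (φ b).1 = node v w b := fun b hb => by
        simp only [φ, dif_pos hb]
      rw [show {u : {v // Valid N S v} | (⟨parent u.1, valid_parent u.2⟩ : {v // Valid N S v}) =
          ⟨v, hv⟩ ∧ (⟨image N u.1, valid_image u.2⟩ : {v // Valid N S v}) = ⟨w, hw⟩} =
          φ '' (Finset.range (mult S v w) : Set ℕ) from ?_]
      · rw [finsum_mem_image, finsum_mem_coe_finset]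
        · have h1 : ∀ b ∈ Finset.range (mult S v w), deg S (φ b).1 = if b = 0 ∧ node v w 0 ∈ S then 2 else 1 := by
            intro b hb
            rw [hφ b (Finset.mem_range.1 hb), deg]
            by_cases hb0 : b = 0
            · subst hb0; simp
            · have hnm : node v w b ∉ S := fun hm => by
                obtain ⟨v', w', h2, -⟩ := hS.exists_eq _ hm
                cases h2
                exact hb0 rfl
              rw [if_neg hnm, if_neg fun h => hb0 h.1]
          rw [Finset.sum_congr rfl h1]
          by_cases hm : node v w 0 ∈ S
          · obtain ⟨v', w', h2, h3⟩ := hS.exists_eq _ hm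
            cases h2
            obtain ⟨d, hd⟩ : ∃ d, deg S v = d + 2 := Nat.exists_eq_add_of_le' h3
            have : mult S v w = d + 1 := by rw [mult, if_pos hm, hd]; rfl
            rw [this, Finset.sum_range_succ']
            simp [hm, hd]
          · simp [hm, mult]
        · intro a ha b hb hab
          have h1 := congrArg Subtype.val hab
          rw [hφ a (Finset.mem_range.1 ha), hφ b (Finset.mem_range.1 hb)] at h1
          exact (node.inj h1).2.2
      · ext ⟨u, hu⟩
        simp only [Set.mem_ofPred_eq, Set.mem_image, Finset.coe_range, Set.mem_Iio, Subtype.mk.injEq]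
        constructor
        · rintro ⟨h1, h2⟩
          cases u with
          | ray n =>
            have := congrArg lv h1
            simp only [parent, lv] at this
            omega
          | node v' w' b =>
            simp only [parent] at h1
            simp only [image] at h2
            subst h1 h2
            exact ⟨b, hu.2.2.2, Subtype.ext (hφ b hu.2.2.2)⟩
        · rintro ⟨b, hb, h1⟩
          have h2 := congrArg Subtype.val h1
          rw [hφ b hb] at h2
          change node v w b = u at h2
          subst h2
          exact ⟨rfl, rfl⟩
    · -- above the base each vertex has one child
      obtain ⟨n, rfl⟩ : ∃ n, v = ray (n + 1) := ⟨(lv v).toNat - 1, by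
        rw [Nat.sub_add_cancel (by omega)]; exact eq_ray_of_valid hv hl.le⟩
      have hw2 : w = ray (n + N) := by
        have h1 := lv_parent w
        rw [h'] at h1
        simp only [image, lv] at h1
        push_cast at h1
        rw [eq_ray_of_valid hw (by omega)]
        congr 1
        omega
      subst hw2
      rw [show {u : {v // Valid N S v} | (⟨parent u.1, valid_parent u.2⟩ : {v // Valid N S v}) =
          ⟨ray (n + 1), hv⟩ ∧ (⟨image N u.1, valid_image u.2⟩ : {v // Valid N S v}) = ⟨ray (n + N), hw⟩}
          = {⟨ray n, trivial⟩} from ?_, finsum_mem_singleton]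
      · rfl
      · ext ⟨u, hu⟩
        simp only [Set.mem_ofPred_eq, Set.mem_singleton_iff, Subtype.mk.injEq]
        constructor
        · rintro ⟨h1, -⟩
          cases u with
          | ray m => simp only [parent, ray.injEq] at h1; rw [Nat.succ_injective h1]
          | node v' w' b =>
            simp only [parent] at h1
            have := hu.2.1
            rw [h1, lv] at this
            omega
        · intro h1
          have h2 : u = ray n := congrArg Subtype.val h1
          subst h2
          exact ⟨rfl, rfl⟩
  rh := by
    rintro ⟨v, hv⟩
    -- at most one child has degree at least 2
    have huniq : ∀ u u' : {v // Valid N S v}, parent u.1 = v → parent u'.1 = v →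
        deg S u.1 - 1 ≠ 0 → deg S u'.1 - 1 ≠ 0 → u = u' := by
      rintro ⟨u, hu⟩ ⟨u', hu'⟩ h1 h2 h3 h4
      have aux : ∀ x, Valid N S x → parent x = v → deg S x - 1 ≠ 0 →
          (∃ n, x = ray n ∧ v = ray (n + 1)) ∨ lv v ≤ 0 ∧ ∃ w, x = node v w 0 ∧ node v w 0 ∈ S := by
        intro x hx h5 h6
        cases x with
        | ray n => exact Or.inl ⟨n, rfl, h5.symm⟩
        | node v' w b =>
          right
          simp only [parent] at h5
          subst h5
          refine ⟨hx.2.1, w, ?_⟩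
          by_cases hm : node v' w b ∈ S
          · obtain ⟨v2, w2, h7, -⟩ := hS.exists_eq _ hm
            cases h7
            exact ⟨rfl, hm⟩
          · simp [deg, hm] at h6
      apply Subtype.ext
      rcases aux u hu h1 h3 with ⟨n, rfl, hn⟩ | ⟨hl, w, rfl, hw⟩ <;>
        rcases aux u' hu' h2 h4 with ⟨n', rfl, hn'⟩ | ⟨hl', w', rfl, hw'⟩
      · rw [hn] at hn'
        rw [Nat.succ_injective (ray.inj hn')]
      · rw [hn, lv] at hl'; omega
      · rw [hn', lv] at hl; omega
      · exact congrArg (node v · 0) (hS.unique _ _ _ hw hw')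
    by_cases hex : ∃ u : {v // Valid N S v}, parent u.1 = v ∧ deg S u.1 - 1 ≠ 0
    · obtain ⟨u, hu, hd⟩ := hex
      have : ∑ᶠ x ∈ {x : {v // Valid N S v} | (⟨parent x.1, valid_parent x.2⟩ : {v // Valid N S v}) =
          ⟨v, hv⟩}, (deg S x.1 - 1) = deg S u.1 - 1 := by
        classical
        refine (finsum_eq_single _ u fun x hne => ?_).trans (finsum_eq_if.trans
          (if_pos (Subtype.ext hu)))
        rw [finsum_eq_if]
        refine ite_eq_right_iff.2 fun hx => ?_
        by_contra h
        exact hne (huniq x u (congrArg Subtype.val hx) hu h hd)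
      change ∑ᶠ x ∈ {x : {v // Valid N S v} | (⟨parent x.1, valid_parent x.2⟩ : {v // Valid N S v}) =
          ⟨v, hv⟩}, (deg S x.1 - 1) ≤ _
      rw [this]
      obtain ⟨u, hu'⟩ := u
      cases u with
      | ray n =>
        have hu : ray (n + 1) = v := hu
        subst hu
        exact le_rfl
      | node v' w b =>
        simp only [parent] at hu
        subst hu
        by_cases hm : node v' w b ∈ S
        · obtain ⟨v2, w2, h7, h8⟩ := hS.exists_eq _ hm
          cases h7
          have := deg_eq_two hm hS
          change deg S (node v' w 0) - 1 ≤ deg S v' - 1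
          omega
        · simp [deg, hm] at hd
    · push Not at hex
      refine (le_of_eq ?_).trans (Nat.zero_le _)
      exact finsum_mem_eq_zero_of_forall_eq_zero fun x hx => hex x (congrArg Subtype.val hx)

section

variable {hN : 1 ≤ N} {S' : Set VertexName} {hS : IsSpine S} {hS' : IsSpine S'}

theorem hasSp_tree {k : ℕ} (hk : 1 ≤ k) :
    (tree N hN S hS).HasSp k ↔ ∃ x ∈ S, Valid N S x ∧ lv x = -(k : ℤ) := by
  constructor
  · rintro ⟨⟨v, hv⟩, h1, h2⟩
    have h1 : lv v = -(k : ℤ) := h1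
    exact ⟨v, (two_le_deg_iff hv (by omega)).1 h2, hv, h1⟩
  · rintro ⟨x, hx, hv, hl⟩
    exact ⟨⟨x, hv⟩, hl, (deg_eq_two hx hS).ge⟩

/-- Spines that agree on the levels `≥ -k` belong to trees that agree there. -/
theorem exists_isPIso_tree {k : ℕ}
    (h : ∀ x, Valid N S x → -(k : ℤ) ≤ lv x → (x ∈ S ↔ x ∈ S')) :
    ∃ f, CTree.IsPIso (tree N hN S hS) (tree N hN S' hS') f k ∧
      ∀ x (hx : Valid N S x), -(k : ℤ) ≤ lv x → (f ⟨x, hx⟩).1 = x := by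
  classical
  have hdeg : ∀ x, Valid N S x → -(k : ℤ) ≤ lv x → deg S' x = deg S x := by
    intro x hx hl
    cases x with
    | ray n => rfl
    | node v w b => unfold deg; simp only [h _ hx hl]
  have hmult : ∀ v w, Valid N S v → Valid N S w → lv v ≤ 0 → parent w = image N v →
      -(k : ℤ) ≤ lv v - 1 → mult S' v w = mult S v w := by
    intro v w hv hw hl hp hk
    unfold mult
    rw [hdeg v hv (by omega)]
    simp only [h _ (valid_node_zero hS hv hw hl hp) hk]
  have hlow : ∀ (Z : Set VertexName) v w b, Valid N Z (node v w b) → -(k : ℤ) ≤ lv v - 1 →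
      -(k : ℤ) ≤ lv v ∧ -(k : ℤ) ≤ lv w := by
    intro Z v w b hx hl
    have h1 := lv_parent w
    rw [hx.2.2.1, lv_image hx.1.1] at h1
    omega
  have hval : ∀ x, -(k : ℤ) ≤ lv x → (Valid N S x ↔ Valid N S' x) := by
    intro x
    induction x with
    | ray n => exact fun _ => Iff.rfl
    | node v w b hv hw =>
      intro hl
      constructor
      · intro hx
        obtain ⟨h1, h2⟩ := hlow S v w b hx hl
        exact ⟨⟨(hv h1).1 hx.1.1, (hw h2).1 hx.1.2⟩, hx.2.1, hx.2.2.1, by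
          rw [hmult v w hx.1.1 hx.1.2 hx.2.1 hx.2.2.1 hl]; exact hx.2.2.2⟩
      · intro hx
        obtain ⟨h1, h2⟩ := hlow S' v w b hx hl
        have hv' := (hv h1).2 hx.1.1
        have hw' := (hw h2).2 hx.1.2
        exact ⟨⟨hv', hw'⟩, hx.2.1, hx.2.2.1, by
          rw [← hmult v w hv' hw' hx.2.1 hx.2.2.1 hl]; exact hx.2.2.2⟩
  let f : {x // Valid N S x} → {x // Valid N S' x} := fun x =>
    if hx : Valid N S' x.1 then ⟨x.1, hx⟩ else ⟨ray 0, trivial⟩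
  have hf : ∀ x : {x // Valid N S x}, -(k : ℤ) ≤ lv x.1 → (f x).1 = x.1 := fun x hx => by
    simp only [f, dif_pos ((hval x.1 hx).1 x.2)]
  refine ⟨f, ⟨rfl, fun x hx => ?_, fun x hx => ?_, fun x hx => ?_, fun x hx => ?_,
    fun x y hx hy e => ?_, fun y hy => ?_⟩, fun x hx hl => hf ⟨x, hx⟩ hl⟩
  · exact congrArg lv (hf x hx)
  · apply Subtype.ext
    change (f ⟨parent x.1, _⟩).1 = parent (f x).1
    rw [hf x hx, hf]
    change -(k : ℤ) ≤ lv (parent x.1)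
    rw [lv_parent]
    change -(k : ℤ) ≤ lv x.1 at hx
    omega
  · apply Subtype.ext
    change (f ⟨image N x.1, _⟩).1 = image N (f x).1
    rw [hf x hx, hf]
    change -(k : ℤ) ≤ lv (image N x.1)
    rw [lv_image x.2]
    change -(k : ℤ) ≤ lv x.1 at hx
    omega
  · change deg S' (f x).1 = deg S x.1
    rw [hf x hx, hdeg x.1 x.2 hx]
  · apply Subtype.ext
    rw [← hf x hx, ← hf y hy, e]
  · have h1 := (hval y.1 hy).2 y.2
    exact ⟨⟨y.1, h1⟩, hy, Subtype.ext (hf ⟨y.1, h1⟩ hy)⟩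

/-- A spine of finite length can be extended by any vertex below its end. -/
theorem exists_extension_tree {k : ℕ} (hk : (tree N hN S hS).HasDepth k)
    {v w : (tree N hN S hS).V} (hv : (tree N hN S hS).lv v = -(k : ℤ))
    (hd : 2 ≤ (tree N hN S hS).deg v)
    (hw : (tree N hN S hS).p w = (tree N hN S hS).F v) (hpos : ∀ x ∈ S, Valid N S x) :
    ∃ S', ∃ hS' : IsSpine S', (∀ x ∈ S', Valid N S' x) ∧ (tree N hN S' hS').HasDepth (k + 1) ∧
      ∃ f, CTree.IsPIso (tree N hN S hS) (tree N hN S' hS') f k ∧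
        ∃ s, (tree N hN S' hS').lv s = -((k + 1 : ℕ) : ℤ) ∧ 2 ≤ (tree N hN S' hS').deg s ∧
          (tree N hN S' hS').F s = f w := by
  classical
  set x : VertexName := node v.1 w.1 0 with hx
  have hv' : lv v.1 = -(k : ℤ) := hv
  have hd' : 2 ≤ deg S v.1 := hd
  have hw' : parent w.1 = image N v.1 := congrArg Subtype.val hw
  have hlx : lv x = -(k : ℤ) - 1 := by rw [hx, lv, hv']
  have hxv : Valid N S x := valid_node_zero hS v.2 w.2 (by omega) hw'
  have hSlv : ∀ y ∈ S, -(k : ℤ) ≤ lv y := by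
    intro y hy
    by_contra hlt
    exact hk.2 (CTree.HasSp.mono (l := (-lv y).toNat)
      ((hasSp_tree (by omega)).2 ⟨y, hy, hpos y hy, by omega⟩) (by omega))
  have hmem : ∀ y, -(k : ℤ) ≤ lv y → (y ∈ insert x S ↔ y ∈ S) := fun y hy => by
    rw [Set.mem_insert_iff, or_iff_right]
    rintro rfl
    omega
  have hdeg : ∀ y, -(k : ℤ) ≤ lv y → deg (insert x S) y = deg S y := fun y hy => by
    cases y with
    | ray n => rfl
    | node a b c => unfold deg; simp only [hmem _ hy]
  have hsp : IsSpine (insert x S) := by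
    refine ⟨?_, ?_⟩
    · rintro y (rfl | hy)
      · exact ⟨v.1, w.1, rfl, by rw [hdeg _ (by omega)]; exact hd'⟩
      · obtain ⟨a, b, rfl, h2⟩ := hS.exists_eq y hy
        refine ⟨a, b, rfl, ?_⟩
        have := hSlv _ hy
        rw [lv] at this
        rwa [hdeg _ (by omega)]
    · have aux : ∀ a b, node a b 0 ∈ S → a ≠ v.1 := by
        rintro a b hab rfl
        have := hSlv _ hab
        rw [lv] at this
        omega
      rintro a b b' (h1 | h1) (h2 | h2)
      · rw [hx, node.injEq] at h1 h2; rw [h1.2.1, h2.2.1]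
      · rw [hx, node.injEq] at h1; exact absurd h1.1 (aux _ _ h2)
      · rw [hx, node.injEq] at h2; exact absurd h2.1 (aux _ _ h1)
      · exact hS.unique a b b' h1 h2
  obtain ⟨f, hf, hf'⟩ := exists_isPIso_tree (hN := hN) (hS := hS) (hS' := hsp) (k := k)
    (fun y _ hl => (hmem y hl).symm)
  have hlw : -(k : ℤ) ≤ lv w.1 := by
    have h1 := lv_parent w.1
    rw [hw', lv_image v.2] at h1
    omega
  have hfv : Valid N (insert x S) v.1 := by rw [← hf' v.1 v.2 (by omega)]; exact (f v).2
  have hfw : Valid N (insert x S) w.1 := by rw [← hf' w.1 w.2 hlw]; exact (f w).2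
  have hxv' : Valid N (insert x S) x := valid_node_zero hsp hfv hfw (by omega) hw'
  refine ⟨insert x S, hsp, ?_, ⟨?_, ?_⟩, f, hf, ⟨x, hxv'⟩, ?_, ?_, ?_⟩
  · rintro y (rfl | hy)
    · exact hxv'
    · have := hf' y (hpos y hy) (hSlv y hy)
      rw [← this]
      exact (f _).2
  · exact (hasSp_tree (by omega)).2 ⟨x, Set.mem_insert _ _, hxv', by rw [hlx]; push_cast; ring⟩
  · rw [hasSp_tree (by omega)]
    rintro ⟨y, rfl | hy, -, hl⟩
    · rw [hlx] at hl; push_cast at hl; omega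
    · have := hSlv y hy; push_cast at hl; omega
  · change lv x = _
    rw [hlx]; push_cast; ring
  · exact (deg_eq_two (Set.mem_insert _ _) hsp).ge
  · exact Subtype.ext (hf' w.1 w.2 hlw).symm

/-- The truncation of `C` below level `-k`: a tree with the same part above this level, but with no
spine below it. It is built as `tree` of a set of names, one step of the spine at a time. -/
theorem exists_isPIso_truncated (C : CTree) (k : ℕ) :
    ∃ S, ∃ hS : IsSpine S, (∀ x ∈ S, Valid C.N S x) ∧
      (∃ f, CTree.IsPIso C (tree C.N C.N_pos S hS) f k) ∧
      ¬ (tree C.N C.N_pos S hS).HasSp (k + 1) := by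
  induction k with
  | zero =>
    have hS : IsSpine (∅ : Set VertexName) := ⟨by simp, by simp⟩
    refine ⟨∅, hS, by simp, CTree.exists_isPIso_zero _ _ rfl, ?_⟩
    rw [hasSp_tree (by omega)]
    simp
  | succ k ih =>
    obtain ⟨S, hS, hpos, ⟨f, hf⟩, hk⟩ := ih
    by_cases hC : C.HasSp (k + 1)
    · obtain ⟨s, hs1, hs2⟩ := hC
      have hlp : C.lv (C.p s) = -(k : ℤ) := by rw [C.lv_p, hs1]; push_cast; ring
      have hlF : -(k : ℤ) ≤ C.lv (C.F s) := by
        have := C.N_pos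
        rw [C.lv_F, hs1]; push_cast; omega
      have hd : (tree C.N C.N_pos S hS).HasDepth k :=
        ⟨(hf.hasSp le_rfl).1 (CTree.HasSp.mono ⟨s, hs1, hs2⟩ (Nat.le_succ k)), hk⟩
      obtain ⟨S', hS', hpos', hd', g, hg, s', h1, h2, h3⟩ := exists_extension_tree hd
        (v := f (C.p s)) (w := f (C.F s)) (by rw [hf.map_lv _ (by omega), hlp])
        (by rw [hf.map_deg _ (by omega)]; exact hs2.trans (C.deg_le_parent s))
        (by rw [← hf.map_p _ hlF, ← hf.map_F _ (by omega), C.F_p]) hpos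
      obtain ⟨e, he, -⟩ := (hg.comp hf).extend (fun t ht1 ht2 => ⟨s', by push_cast at h1; exact h1, h2, by
        rw [h3, CTree.eq_of_spine (C := C) (u := t) (w := s) (by rw [ht1, hs1]; push_cast; ring) ht2 hs2]; rfl⟩)
        (fun _ => ⟨s, hs1, hs2⟩)
      exact ⟨S', hS', hpos', ⟨e, he⟩, hd'.2⟩
    · obtain ⟨e, he, -⟩ := hf.extend (fun t ht1 ht2 => absurd ⟨t, by push_cast; exact ht1, ht2⟩ hC)
        (fun h => absurd h hk)
      exact ⟨S, hS, hpos, ⟨e, he⟩, fun h => hk (h.mono (by omega))⟩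

end

end VertexName

namespace CTree

/-- The spine can be cut off at any level. -/
theorem exists_truncation (C : CTree) (k : ℕ) :
    ∃ C' f, IsPIso C C' f k ∧ ¬ C'.HasSp (k + 1) := by
  obtain ⟨S, hS, -, ⟨f, hf⟩, hk⟩ := VertexName.exists_isPIso_truncated C k
  exact ⟨_, f, hf, hk⟩

/-- A spine that ends can be extended by one step, with any prescribed image of the new spine vertex. -/
theorem exists_extension {C : CTree} {k : ℕ} (hk : C.HasDepth k) {v w : C.V}
    (hv : C.lv v = -(k : ℤ)) (hd : 2 ≤ C.deg v) (hw : C.p w = C.F v) :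
    ∃ C' f, IsPIso C C' f k ∧ C'.HasDepth (k + 1) ∧
      ∃ s, C'.lv s = -((k + 1 : ℕ) : ℤ) ∧ 2 ≤ C'.deg s ∧ C'.F s = f w := by
  obtain ⟨S, hS, hpos, ⟨f, hf⟩, hk'⟩ := VertexName.exists_isPIso_truncated C k
  have hlw : -(k : ℤ) ≤ C.lv w := by
    have h1 := C.lv_p w
    have := C.N_pos
    rw [hw, C.lv_F] at h1
    omega
  obtain ⟨S', hS', -, hd', g, hg, s, h1, h2, h3⟩ := VertexName.exists_extension_tree
    ⟨(hf.hasSp le_rfl).1 hk.1, hk'⟩ (v := f v) (w := f w) (by rw [hf.map_lv _ (by omega), hv])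
    (by rw [hf.map_deg _ (by omega)]; exact hd)
    (by rw [← hf.map_p _ hlw, hw, hf.map_F _ (by omega)]) hpos
  exact ⟨_, g ∘ f, hg.comp hf, hd', s, h1, h2, h3⟩

open VertexName in
/-- Compactness of the space of level trees: the limit of the spines, as sets of names, along an ultrafilter
is the spine of a limiting tree. -/
theorem exists_limit (U : Ultrafilter ℕ) (hU : (U : Filter ℕ) ≤ atTop) (C : ℕ → CTree) (N : ℕ)
    (hN : ∀ n, (C n).N = N) :
    ∃ C' : CTree, C'.N = N ∧ ∀ k, ∀ᶠ n in (U : Filter ℕ), ∃ f, IsPIso C' (C n) f k := by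
  classical
  have hN1 : 1 ≤ N := hN 0 ▸ (C 0).N_pos
  have hex : ∀ n, ∃ S, ∃ hS : IsSpine S, ∃ f, IsPIso (C n) (VertexName.tree N hN1 S hS) f n := by
    intro n
    have h := hN n
    subst h
    obtain ⟨S, hS, -, hf, -⟩ := VertexName.exists_isPIso_truncated (C n) n
    exact ⟨S, hS, hf⟩
  choose S hS f hf using hex
  let L : Set VertexName := {x | ∀ᶠ n in (U : Filter ℕ), x ∈ S n}
  have hL : ∀ x, ∀ᶠ n in (U : Filter ℕ), (x ∈ L ↔ x ∈ S n) := by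
    intro x
    by_cases hx : x ∈ L
    · exact Filter.Eventually.mono (show ∀ᶠ n in (U : Filter ℕ), x ∈ S n from hx) fun n hn =>
        iff_of_true hx hn
    · have h1 : ∀ᶠ n in (U : Filter ℕ), ¬ x ∈ S n := Ultrafilter.eventually_not.2 hx
      exact h1.mono fun n hn => iff_of_false hx hn
  have hLs : IsSpine L := by
    refine ⟨fun x hx => ?_, fun v w w' h1 h2 => ?_⟩
    · obtain ⟨n, hn⟩ := (show ∀ᶠ n in (U : Filter ℕ), x ∈ S n from hx).exists
      obtain ⟨v, w, rfl, -⟩ := (hS n).exists_eq x hn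
      refine ⟨v, w, rfl, ?_⟩
      obtain ⟨m, hm1, hm2⟩ := ((show ∀ᶠ n in (U : Filter ℕ), node v w 0 ∈ S n from hx).and (hL v)).exists
      obtain ⟨v', w', e, h3⟩ := (hS m).exists_eq _ hm1
      cases e
      cases v with
      | ray n => simp [VertexName.deg]
      | node a b c =>
        by_cases h4 : node a b c ∈ L
        · simp [VertexName.deg, h4]
        · rw [hm2] at h4
          simp [VertexName.deg, h4] at h3
    · obtain ⟨n, h3, h4⟩ := ((show ∀ᶠ n in (U : Filter ℕ), _ ∈ S n from h1).and
        (show ∀ᶠ n in (U : Filter ℕ), _ ∈ S n from h2)).exists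
      exact (hS n).unique v w w' h3 h4
  refine ⟨tree N hN1 L hLs, rfl, fun k => ?_⟩
  have hfin := ((VertexName.tree N hN1 L hLs).finite_level k).image Subtype.val
  have h1 : ∀ᶠ n in (U : Filter ℕ), ∀ x ∈ Subtype.val '' {v | ((VertexName.tree N hN1 L hLs).lv v).natAbs ≤ k},
      (x ∈ L ↔ x ∈ S n) := (Filter.eventually_all_finite hfin).2 fun x _ => hL x
  filter_upwards [h1, hU (eventually_ge_atTop k)] with n hn hkn
  obtain ⟨g, hg, -⟩ := VertexName.exists_isPIso_tree (N := N) (hN := hN1) (hS := hLs) (hS' := hS n) (k := k)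
    (fun x hx hl => by
      rcases lt_or_ge (VertexName.lv x) 0 with h0 | h0
      · exact hn x ⟨⟨x, hx⟩, show (VertexName.lv x).natAbs ≤ k by omega, rfl⟩
      · rw [eq_ray_of_valid hx h0]
        exact iff_of_false (ray_notMem hLs _) (ray_notMem (hS n) _))
  obtain ⟨e, he, -⟩ := ((hf n).mono hkn).exists_inv
  exact ⟨_, he.comp hg⟩

end CTree

/-! ### Trees with two critical grand orbits: the two halves -/

namespace CTree

/-- If `F` moves the levels by 2, the vertices of even level, and likewise those of odd level, form
a level tree on which `F` moves the levels by 1. Here `ε = 0` or `1` is the parity of the levels;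
the base of the half is the vertex of level `ε`. -/
@[reducible] noncomputable def half (C : CTree) (hN : C.N = 2) (ε : ℤ) (hε : ε = 0 ∨ ε = 1) : CTree where
  V := {v : C.V // 2 ∣ C.lv v - ε}
  N := 1
  p v := ⟨C.p (C.p v.1), by have := v.2; rw [C.lv_p, C.lv_p]; omega⟩
  F v := ⟨C.F v.1, by have := v.2; rw [C.lv_F, hN]; omega⟩
  lv v := (C.lv v.1 - ε) / 2
  deg v := C.deg v.1
  N_pos := le_rfl
  lv_p v := by have := v.2; change (C.lv (C.p (C.p v.1)) - ε) / 2 = _; rw [C.lv_p, C.lv_p]; omega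
  lv_F v := by have := v.2; change (C.lv (C.F v.1) - ε) / 2 = _; rw [C.lv_F, hN]; omega
  F_p v := Subtype.ext (by change C.F (C.p (C.p v.1)) = _; rw [C.F_p, C.F_p])
  exists_base := by
    obtain ⟨v, hv⟩ := C.exists_level ε
    exact ⟨⟨v, by rw [hv]; omega⟩, by change (C.lv v - ε) / 2 = 0; rw [hv]; omega⟩
  eq_of_lv_eq u v h0 h := Subtype.ext (C.eq_of_lv_eq _ _ (by omega) (by
    have := u.2; have := v.2; omega))
  deg_ray v h := C.deg_ray _ (by omega)
  one_le_deg v := C.one_le_deg _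
  deg_le_two v h := C.deg_le_two _ (by have := v.2; omega)
  finite_children v := by
    classical
    refine Set.Finite.of_finite_image (f := Subtype.val)
      (((C.children v.1).biUnion C.children).finite_toSet.subset ?_) Subtype.val_injective.injOn
    rintro u ⟨w, hw, rfl⟩
    rw [Finset.mem_coe, Finset.mem_biUnion]
    exact ⟨C.p w.1, C.mem_children.2 (congrArg Subtype.val hw), C.mem_children.2 rfl⟩
  cover v w h := by
    classical
    have h' : C.p (C.p w.1) = C.F v.1 := congrArg Subtype.val h
    rw [← finsum_mem_image (f := fun x => C.deg x) (g := Subtype.val) Subtype.val_injective.injOn]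
    have : Subtype.val '' {u : {v : C.V // 2 ∣ C.lv v - ε} |
        (⟨C.p (C.p u.1), by have := u.2; rw [C.lv_p, C.lv_p]; omega⟩ : {v : C.V // 2 ∣ C.lv v - ε}) = v ∧
        (⟨C.F u.1, by have := u.2; rw [C.lv_F, hN]; omega⟩ : {v : C.V // 2 ∣ C.lv v - ε}) = w} =
        ((C.fib v.1 (C.p w.1)).biUnion fun x => C.fib x w.1 : Finset C.V) := by
      ext u
      rw [Finset.mem_coe, Finset.mem_biUnion]
      constructor
      · rintro ⟨u, ⟨h1, h2⟩, rfl⟩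
        have h1 : C.p (C.p u.1) = v.1 := congrArg Subtype.val h1
        have h2 : C.F u.1 = w.1 := congrArg Subtype.val h2
        exact ⟨C.p u.1, C.mem_fib.2 ⟨h1, by rw [C.F_p, h2]⟩, C.mem_fib.2 ⟨rfl, h2⟩⟩
      · rintro ⟨x, hx, hu⟩
        rw [mem_fib] at hx hu
        obtain ⟨rfl, h2⟩ := hu
        have hlv := v.2
        rw [← hx.1, C.lv_p, C.lv_p] at hlv
        exact ⟨⟨u, by omega⟩, ⟨Subtype.ext hx.1, Subtype.ext h2⟩, rfl⟩
    rw [this, finsum_mem_coe_finset, Finset.sum_biUnion]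
    · rw [← C.sum_fib h']
      exact Finset.sum_congr rfl fun x hx => C.sum_fib (by rw [(C.mem_fib.1 hx).2])
    · intro a _ b _ hab
      refine Finset.disjoint_left.2 fun u ha hb => hab ?_
      rw [← (C.mem_fib.1 ha).1, ← (C.mem_fib.1 hb).1]
  rh v := by
    classical
    rw [← finsum_mem_image (f := fun x => C.deg x - 1) (g := Subtype.val)
      Subtype.val_injective.injOn]
    have : Subtype.val '' {u : {v : C.V // 2 ∣ C.lv v - ε} |
        (⟨C.p (C.p u.1), by have := u.2; rw [C.lv_p, C.lv_p]; omega⟩ : {v : C.V // 2 ∣ C.lv v - ε}) = v} =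
        ((C.children v.1).biUnion C.children : Finset C.V) := by
      ext u
      rw [Finset.mem_coe, Finset.mem_biUnion]
      constructor
      · rintro ⟨u, h1, rfl⟩
        have h1 : C.p (C.p u.1) = v.1 := congrArg Subtype.val h1
        exact ⟨C.p u.1, C.mem_children.2 h1, C.mem_children.2 rfl⟩
      · rintro ⟨x, hx, hu⟩
        rw [mem_children] at hx hu
        subst hu
        have hlv := v.2
        rw [← hx, C.lv_p, C.lv_p] at hlv
        exact ⟨⟨u, by omega⟩, Subtype.ext hx, rfl⟩
    rw [this, finsum_mem_coe_finset, Finset.sum_biUnion]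
    · exact (Finset.sum_le_sum fun x _ => C.sum_children x).trans (C.sum_children v.1)
    · intro a _ b _ hab
      refine Finset.disjoint_left.2 fun u ha hb => hab ?_
      rw [← C.mem_children.1 ha, ← C.mem_children.1 hb]

variable {C : CTree}

/-- The half of the even levels. -/
@[reducible] noncomputable def even (C : CTree) (hN : C.N = 2) : CTree := C.half hN 0 (Or.inl rfl)

/-- The half of the odd levels. -/
@[reducible] noncomputable def odd (C : CTree) (hN : C.N = 2) : CTree := C.half hN 1 (Or.inr rfl)

theorem even_hasSp (hN : C.N = 2) {k : ℕ} : (C.even hN).HasSp k ↔ C.HasSp (2 * k) := by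
  constructor
  · rintro ⟨v, h1, h2⟩
    have h1 : (C.lv v.1 - 0) / 2 = -(k : ℤ) := h1
    have := v.2
    exact ⟨v.1, by push_cast; omega, h2⟩
  · rintro ⟨v, h1, h2⟩
    push_cast at h1
    exact ⟨⟨v, by omega⟩, by change (C.lv v - 0) / 2 = _; omega, h2⟩

theorem odd_hasSp (hN : C.N = 2) {k : ℕ} : (C.odd hN).HasSp k ↔ C.HasSp (2 * k - 1) := by
  rcases Nat.eq_zero_or_pos k with rfl | hk
  · exact iff_of_true (hasSp_zero _) C.hasSp_zero
  constructor
  · rintro ⟨v, h1, h2⟩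
    have h1 : (C.lv v.1 - 1) / 2 = -(k : ℤ) := h1
    have := v.2
    exact ⟨v.1, by omega, h2⟩
  · rintro ⟨v, h1, h2⟩
    exact ⟨⟨v, by omega⟩, by change (C.lv v - 1) / 2 = _; omega, h2⟩

theorem even_hasDepth (hN : C.N = 2) {k : ℕ} (h : C.HasDepth (2 * k + 1)) : (C.even hN).HasDepth k := by
  rw [HasDepth, even_hasSp, even_hasSp, h.le_iff, h.le_iff]; omega

theorem odd_hasDepth (hN : C.N = 2) {k : ℕ} (h : C.HasDepth (2 * k + 1)) :
    (C.odd hN).HasDepth (k + 1) := by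
  rw [HasDepth, odd_hasSp, odd_hasSp, h.le_iff, h.le_iff]; omega

/-- As long as the spine goes on, vertices of odd level have only one child: above the base this is
clear, and the image of a vertex of odd level has odd level as well. -/
theorem exists_unique_child (hN : C.N = 2) {k : ℕ} (hk : C.HasSp (2 * k)) {x : C.V}
    (hx : 2 ∣ C.lv x - 1) (hl : 1 - 2 * (k : ℤ) ≤ C.lv x) :
    ∃ u, C.p u = x ∧ C.deg u = C.deg x ∧ ∀ u', C.p u' = x → u' = u := by
  obtain ⟨n, hn⟩ : ∃ n : ℕ, 1 - (n : ℤ) ≤ C.lv x := ⟨(1 - C.lv x).toNat, by omega⟩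
  induction n generalizing x with
  | zero =>
    obtain ⟨i, rfl⟩ : ∃ i : ℕ, x = C.ray (i + 1) := ⟨(C.lv x - 1).toNat, C.eq_ray (by omega)⟩
    refine ⟨C.ray i, C.p_ray i, ?_, fun u hu => C.eq_ray_of_p_eq hu⟩
    rw [C.deg_ray _ (by rw [lv_ray]; omega), C.deg_ray _ (by rw [lv_ray]; omega)]
  | succ n ih =>
    by_cases hn' : 1 - (n : ℤ) ≤ C.lv x
    · exact ih hx hl hn'
    by_cases h1 : 1 ≤ C.lv x
    · exact ih hx hl (by omega)
    have hlF := C.lv_F x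
    rw [hN] at hlF
    obtain ⟨w, hw, -, hwu⟩ := ih (x := C.F x) (by omega) (by omega) (by omega)
    have hsum := C.sum_fib hw
    have hmem : ∀ u, C.p u = x → u ∈ C.fib x w := fun u hu =>
      C.mem_fib.2 ⟨hu, hwu _ (by rw [← C.F_p, hu])⟩
    obtain ⟨u, hu⟩ : ∃ u, C.p u = x ∧ C.deg x ≤ C.deg u := by
      by_cases hd : 2 ≤ C.deg x
      · obtain ⟨u, hu, hu2⟩ := (exists_spine_child_iff (k := (-C.lv x).toNat) hd (by omega)).2
          (hk.mono (by omega))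
        exact ⟨u, hu, (C.deg_le_two x (by omega)).trans hu2⟩
      · obtain ⟨u, hu⟩ := C.exists_child x
        have := C.one_le_deg u
        exact ⟨u, hu, by omega⟩
    have hle := C.deg_le_parent u
    rw [hu.1] at hle
    refine ⟨u, hu.1, le_antisymm hle hu.2, fun u' hu' => ?_⟩
    by_contra hne
    classical
    have hsub : ({u', u} : Finset C.V) ⊆ C.fib x w := by
      intro y hy
      rcases Finset.mem_insert.1 hy with rfl | hy
      · exact hmem _ hu'
      · rw [Finset.mem_singleton.1 hy]; exact hmem _ hu.1
    have h2 := Finset.sum_le_sum_of_subset (f := fun x => C.deg x) hsub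
    rw [Finset.sum_pair hne, hsum] at h2
    have := C.one_le_deg u'
    omega

/-- As long as the spine goes on, the parent map identifies both halves. -/
theorem exists_isPIso_even_odd (hN : C.N = 2) {k : ℕ} (hk : C.HasSp (2 * k)) :
    ∃ f, IsPIso (C.even hN) (C.odd hN) f k := by
  let f : (C.even hN).V → (C.odd hN).V := fun v =>
    ⟨C.p v.1, by have := v.2; rw [C.lv_p]; omega⟩
  have hlow : ∀ v : (C.even hN).V, -(k : ℤ) ≤ (C.even hN).lv v → 1 - 2 * (k : ℤ) ≤ C.lv (C.p v.1) := by
    intro v hv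
    change -(k : ℤ) ≤ (C.lv v.1 - 0) / 2 at hv
    rw [C.lv_p]
    omega
  refine ⟨f, rfl, fun v hv => ?_, fun v hv => rfl, fun v hv => ?_, fun v hv => ?_,
    fun u v hu hv e => ?_, fun w hw => ?_⟩
  · change (C.lv (C.p v.1) - 1) / 2 = (C.lv v.1 - 0) / 2
    rw [C.lv_p]; congr 1; omega
  · exact Subtype.ext (C.F_p v.1).symm
  · obtain ⟨u, h1, h2, h3⟩ := exists_unique_child hN hk (f v).2 (hlow v hv)
    change C.deg (C.p v.1) = C.deg v.1
    rw [h3 v.1 rfl, h2]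
    exact congrArg C.deg h1
  · obtain ⟨x, h1, h2, h3⟩ := exists_unique_child hN hk (f u).2 (hlow u hu)
    exact Subtype.ext ((h3 _ rfl).trans (h3 _ (congrArg Subtype.val e).symm).symm)
  · obtain ⟨u, hu⟩ := C.exists_child w.1
    have h1 := C.lv_p u
    have h2 := w.2
    change -(k : ℤ) ≤ (C.lv w.1 - 1) / 2 at hw
    rw [hu] at h1
    exact ⟨⟨u, by omega⟩, by change -(k : ℤ) ≤ (C.lv u - 0) / 2; omega, Subtype.ext hu⟩

/-- Isomorphisms of upper parts restrict to the halves. -/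
theorem IsPIso.half {C' : CTree} (hN : C.N = 2) (hN' : C'.N = 2) {ε : ℤ} (hε : ε = 0 ∨ ε = 1)
    {f : C.V → C'.V} {k l : ℕ} (h : IsPIso C C' f l) (hl : 2 * (k : ℤ) - ε ≤ l) :
    ∃ g : (C.half hN ε hε).V → (C'.half hN' ε hε).V, IsPIso (C.half hN ε hε) (C'.half hN' ε hε) g k ∧
      ∀ v, -(k : ℤ) ≤ (C.half hN ε hε).lv v → (g v).1 = f v.1 := by
  classical
  have hlow : ∀ {C : CTree} (hN : C.N = 2) (v : (C.half hN ε hε).V),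
      -(k : ℤ) ≤ (C.half hN ε hε).lv v → -(l : ℤ) ≤ C.lv v.1 := by
    intro C hN v hv
    change -(k : ℤ) ≤ (C.lv v.1 - ε) / 2 at hv
    have := v.2
    omega
  let g : (C.half hN ε hε).V → (C'.half hN' ε hε).V := fun v =>
    if hv : 2 ∣ C'.lv (f v.1) - ε then ⟨f v.1, hv⟩ else (C'.half hN' ε hε).base
  have hg : ∀ v, -(k : ℤ) ≤ (C.half hN ε hε).lv v → (g v).1 = f v.1 := fun v hv => by
    simp only [g]
    rw [dif_pos]
    rw [h.map_lv _ (hlow hN v hv)]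
    exact v.2
  refine ⟨g, ⟨rfl, fun v hv => ?_, fun v hv => ?_, fun v hv => ?_, fun v hv => ?_,
    fun u v hu hv e => ?_, fun w hw => ?_⟩, hg⟩
  · change (C'.lv (g v).1 - ε) / 2 = (C.lv v.1 - ε) / 2
    rw [hg v hv, h.map_lv _ (hlow hN v hv)]
  · apply Subtype.ext
    change _ = C'.p (C'.p (g v).1)
    rw [hg _ (lv_p_ge hv), hg v hv]
    change f (C.p (C.p v.1)) = _
    rw [h.map_p _ (lv_p_ge (hlow hN v hv)), h.map_p _ (hlow hN v hv)]
  · apply Subtype.ext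
    change _ = C'.F (g v).1
    rw [hg _ (lv_F_ge hv), hg v hv]
    exact h.map_F _ (hlow hN v hv)
  · change C'.deg (g v).1 = C.deg v.1
    rw [hg v hv, h.map_deg _ (hlow hN v hv)]
  · refine Subtype.ext (h.inj _ _ (hlow hN u hu) (hlow hN v hv) ?_)
    rw [← hg u hu, ← hg v hv, e]
  · obtain ⟨v, hv, hvw⟩ := h.surj w.1 (hlow hN' w hw)
    have hlv := h.map_lv v hv
    have hw2 := w.2
    rw [hvw] at hlv
    rw [hlv] at hw2
    have hv' : -(k : ℤ) ≤ (C.lv v - ε) / 2 := by rw [← hlv]; exact hw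
    exact ⟨⟨v, hw2⟩, hv', Subtype.ext ((hg ⟨v, hw2⟩ hv').trans hvw)⟩

/-- A tree with two critical grand orbits is determined by its odd half: the even vertices above the
end of the spine are the only children of odd ones, and below the end of the spine nothing is left
to choose. -/
theorem exists_isIso_of_odd {C' : CTree} (hN : C.N = 2) (hN' : C'.N = 2) {k : ℕ}
    (hk : C.HasDepth (2 * k + 1)) (hk' : C'.HasDepth (2 * k + 1)) {φ : (C.odd hN).V → (C'.odd hN').V}
    (hφ : IsIso (C.odd hN) (C'.odd hN') φ) : ∃ f, IsIso C C' f := by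
  classical
  have hc : ∀ x : (C'.odd hN').V, ∃ u, 1 - 2 * (k : ℤ) ≤ C'.lv x.1 →
      C'.p u = x.1 ∧ C'.deg u = C'.deg x.1 ∧ ∀ u', C'.p u' = x.1 → u' = u := by
    intro x
    by_cases hx : 1 - 2 * (k : ℤ) ≤ C'.lv x.1
    · obtain ⟨u, hu⟩ := exists_unique_child hN' (hk'.1.mono (by omega)) x.2 hx
      exact ⟨u, fun _ => hu⟩
    · exact ⟨x.1, fun h => absurd h hx⟩
  choose c hc using hc
  have hlv : ∀ v, C'.lv (φ v).1 = C.lv v.1 := by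
    intro v
    have h1 : (C'.lv (φ v).1 - 1) / 2 = (C.lv v.1 - 1) / 2 := hφ.map_lv v
    have := v.2
    have := (φ v).2
    omega
  have hpp : ∀ v : (C.odd hN).V, C'.p (C'.p (φ v).1) = (φ ((C.odd hN).p v)).1 := fun v =>
    congrArg Subtype.val (hφ.map_p v).symm
  have hFF : ∀ v : (C.odd hN).V, C'.F (φ v).1 = (φ ((C.odd hN).F v)).1 := fun v =>
    congrArg Subtype.val (hφ.map_F v).symm
  have hodd : ∀ v, ¬ 2 ∣ C.lv v - 1 → 2 ∣ C.lv (C.p v) - 1 := fun v hv => by rw [C.lv_p]; omega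
  let f : C.V → C'.V := fun v =>
    if hv : 2 ∣ C.lv v - 1 then (φ ⟨v, hv⟩).1 else c (φ ⟨C.p v, hodd v hv⟩)
  have hf1 : ∀ v (hv : 2 ∣ C.lv v - 1), f v = (φ ⟨v, hv⟩).1 := fun v hv => dif_pos hv
  have hf2 : ∀ v (hv : ¬ 2 ∣ C.lv v - 1), f v = c (φ ⟨C.p v, hodd v hv⟩) := fun v hv => dif_neg hv
  have hc' : ∀ v (hv : ¬ 2 ∣ C.lv v - 1), -((2 * k + 1 : ℕ) : ℤ) ≤ C.lv v →
      C'.p (c (φ ⟨C.p v, hodd v hv⟩)) = (φ ⟨C.p v, hodd v hv⟩).1 ∧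
      C'.deg (c (φ ⟨C.p v, hodd v hv⟩)) = C'.deg (φ ⟨C.p v, hodd v hv⟩).1 ∧
      ∀ u', C'.p u' = (φ ⟨C.p v, hodd v hv⟩).1 → u' = c (φ ⟨C.p v, hodd v hv⟩) := by
    intro v hv hl
    apply hc
    rw [hlv]
    change _ ≤ C.lv (C.p v)
    rw [C.lv_p]
    push_cast at hl
    omega
  have hPp : ∀ v, -((2 * k + 1 : ℕ) : ℤ) ≤ C.lv v → f (C.p v) = C'.p (f v) := by
    intro v hl
    by_cases hv : 2 ∣ C.lv v - 1
    · have hv2 : ¬ 2 ∣ C.lv (C.p v) - 1 := by rw [C.lv_p]; omega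
      rw [hf1 v hv, hf2 _ hv2]
      exact ((hc' _ hv2 (lv_p_ge hl)).2.2 _ (hpp ⟨v, hv⟩)).symm
    · rw [hf2 v hv, (hc' v hv hl).1, hf1 _ (hodd v hv)]
  have hP : IsPIso C C' f (2 * k + 1) := by
    refine ⟨hN.trans hN'.symm, fun v hl => ?_, hPp, fun v hl => ?_, fun v hl => ?_,
      fun u v hu hv e => ?_, fun w hl => ?_⟩
    · by_cases hv : 2 ∣ C.lv v - 1
      · rw [hf1 v hv, hlv]
      · have h1 := C'.lv_p (f v)
        rw [← hPp v hl, hf1 _ (hodd v hv), hlv] at h1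
        have h2 := C.lv_p v
        change C.lv (C.p v) = _ at h1
        omega
    · by_cases hv : 2 ∣ C.lv v - 1
      · have hv2 : 2 ∣ C.lv (C.F v) - 1 := by rw [C.lv_F, hN]; omega
        rw [hf1 v hv, hf1 _ hv2]
        exact (hFF ⟨v, hv⟩).symm
      · have hv2 : ¬ 2 ∣ C.lv (C.F v) - 1 := by rw [C.lv_F, hN]; omega
        rw [hf2 _ hv2]
        refine ((hc' _ hv2 (lv_F_ge hl)).2.2 _ ?_).symm
        rw [← C'.F_p, ← hPp v hl, hf1 _ (hodd v hv), hFF]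
        congr 2
        exact Subtype.ext (C.F_p v)
    · by_cases hv : 2 ∣ C.lv v - 1
      · rw [hf1 v hv]; exact hφ.map_deg ⟨v, hv⟩
      · rw [hf2 v hv, (hc' v hv hl).2.1]
        have h1 : C'.deg (φ ⟨C.p v, hodd v hv⟩).1 = C.deg (C.p v) := hφ.map_deg ⟨C.p v, hodd v hv⟩
        have h2 := hodd v hv
        obtain ⟨u, h3, h4, h5⟩ := exists_unique_child hN (hk.1.mono (show 2 * k ≤ 2 * k + 1 by omega))
          h2 (by rw [C.lv_p]; push_cast at hl; omega)
        rw [h1, h5 v rfl, h4, h3]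
    · have huv : C.lv u = C.lv v ∨ C.lv u ≠ C.lv v := em _
      by_cases hu2 : 2 ∣ C.lv u - 1 <;> by_cases hv2 : 2 ∣ C.lv v - 1
      · rw [hf1 u hu2, hf1 v hv2] at e
        exact congrArg Subtype.val (hφ.bij.1 (Subtype.ext e))
      · rw [hf1 u hu2] at e
        have h1 := (hc' v hv2 hv).1
        rw [← hf2 v hv2, ← e] at h1
        have h2 := C'.lv_p (φ ⟨u, hu2⟩).1
        rw [h1, hlv, hlv] at h2
        change C.lv (C.p v) = C.lv u + 1 at h2
        rw [C.lv_p] at h2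
        omega
      · rw [hf1 v hv2] at e
        have h1 := (hc' u hu2 hu).1
        rw [← hf2 u hu2, e] at h1
        have h2 := C'.lv_p (φ ⟨v, hv2⟩).1
        rw [h1, hlv, hlv] at h2
        change C.lv (C.p u) = C.lv v + 1 at h2
        rw [C.lv_p] at h2
        omega
      · have h1 : f (C.p u) = f (C.p v) := by rw [hPp u hu, hPp v hv, e]
        rw [hf1 _ (hodd u hu2), hf1 _ (hodd v hv2)] at h1
        have h2 : C.p u = C.p v := congrArg Subtype.val (hφ.bij.1 (Subtype.ext h1))
        obtain ⟨x, h3, h4, h5⟩ := exists_unique_child hN (hk.1.mono (show 2 * k ≤ 2 * k + 1 by omega))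
          (hodd u hu2) (by rw [C.lv_p]; push_cast at hu; omega)
        exact (h5 u rfl).trans (h5 v h2.symm).symm
    · by_cases hw : 2 ∣ C'.lv w - 1
      · obtain ⟨v, hv⟩ := hφ.bij.2 ⟨w, hw⟩
        have h1 : (φ v).1 = w := congrArg Subtype.val hv
        refine ⟨v.1, ?_, (hf1 v.1 v.2).trans h1⟩
        rw [← hlv, h1]; exact hl
      · have hw2 : 2 ∣ C'.lv (C'.p w) - 1 := by rw [C'.lv_p]; omega
        obtain ⟨x, hx⟩ := hφ.bij.2 ⟨C'.p w, hw2⟩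
        have h1 : (φ x).1 = C'.p w := congrArg Subtype.val hx
        obtain ⟨v, hv⟩ := C.exists_child x.1
        have h2 := C.lv_p v
        rw [hv, ← hlv, h1, C'.lv_p] at h2
        have hv2 : ¬ 2 ∣ C.lv v - 1 := by omega
        refine ⟨v, by omega, ?_⟩
        rw [hf2 v hv2]
        refine ((hc' v hv2 (by omega)).2.2 w ?_).symm
        rw [← h1]
        congr 2
        exact Subtype.ext hv.symm
  exact hP.exists_isIso hk.2 hk'.2

theorem exists_hasDepth_zero (N : ℕ) (hN : 1 ≤ N) : ∃ C : CTree, C.N = N ∧ C.HasDepth 0 := by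
  have hS : VertexName.IsSpine (∅ : Set VertexName) := ⟨by simp, by simp⟩
  refine ⟨VertexName.tree N hN ∅ hS, rfl, hasSp_zero _, ?_⟩
  rw [VertexName.hasSp_tree le_rfl]
  simp

/-- Each tree with one critical grand orbit and a spine of finite positive length is an odd half:
the steps of its spine are cut in two. -/
theorem exists_odd {k : ℕ} {Y : CTree} (hY : Y.N = 1) (hk : Y.HasDepth (k + 1)) :
    ∃ (C : CTree) (hN : C.N = 2), C.HasDepth (2 * k + 1) ∧ ∃ f, IsIso Y (C.odd hN) f := by
  induction k generalizing Y with
  | zero =>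
    obtain ⟨C₀, hN₀, hd₀⟩ := exists_hasDepth_zero 2 (by omega)
    obtain ⟨w, hw⟩ := C₀.exists_child (C₀.F C₀.base)
    obtain ⟨C, f, hf, hd, s, hs1, hs2, hs3⟩ := exists_extension hd₀ (v := C₀.base)
      (by simp [lv_base]) (by rw [C₀.deg_ray _ (by rw [lv_base])]; omega) hw
    have hN : C.N = 2 := hf.N_eq.symm.trans hN₀
    refine ⟨C, hN, hd, ?_⟩
    have hdo := odd_hasDepth hN (k := 0) hd
    obtain ⟨g, hg⟩ := exists_isPIso_zero Y (C.odd hN) hY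
    obtain ⟨s', hs1', hs2'⟩ := hdo.1
    obtain ⟨g', hg', -⟩ := hg.extend (fun t ht1 ht2 => ⟨s', hs1', hs2', by
      have e1 := (C.odd hN).lv_F s'
      have e2 := Y.lv_F t
      have e3 := hg.map_lv (Y.F t) (by rw [e2, ht1, hY]; norm_num)
      have e4 : (C.odd hN).lv ((C.odd hN).F s') = 0 := by rw [e1, hs1']; rfl
      have e5 : (C.odd hN).lv (g (Y.F t)) = 0 := by rw [e3, e2, ht1, hY]; rfl
      exact (C.odd hN).eq_of_lv_eq _ _ e4.ge (e4.trans e5.symm)⟩) (fun _ => hk.1)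
    exact hg'.exists_isIso hk.2 hdo.2
  | succ k ih =>
    obtain ⟨Y₀, g, hg, hk₀⟩ := Y.exists_truncation (k + 1)
    have hd₀ : Y₀.HasDepth (k + 1) := ⟨(hg.hasSp le_rfl).1 (hk.1.mono (by omega)), hk₀⟩
    obtain ⟨C₀, hN₀, hdC₀, e, he⟩ := ih (hg.N_eq.symm.trans hY) hd₀
    have hψ := (he.isPIso (k + 1)).comp hg
    set ψ := e ∘ g
    obtain ⟨s, hs1, hs2⟩ := hk.1
    have hlp : Y.lv (Y.p s) = -((k + 1 : ℕ) : ℤ) := by rw [Y.lv_p, hs1]; push_cast; ring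
    have hlF : Y.lv (Y.F s) = -((k + 1 : ℕ) : ℤ) := by rw [Y.lv_F, hs1, hY]; push_cast; ring
    set z := ψ (Y.F s) with hz
    set σ := ψ (Y.p s) with hσ
    have hlσ : C₀.lv σ.1 = -((2 * k + 1 : ℕ) : ℤ) := by
      have h1 := hψ.map_lv (Y.p s) (by omega)
      change (C₀.lv σ.1 - 1) / 2 = _ at h1
      have := σ.2
      rw [hlp] at h1
      push_cast at h1 ⊢
      omega
    have hdσ : 2 ≤ C₀.deg σ.1 := by
      have h1 : C₀.deg σ.1 = Y.deg (Y.p s) := hψ.map_deg (Y.p s) (by omega)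
      rw [h1]; exact hs2.trans (Y.deg_le_parent s)
    have hpz : C₀.p (C₀.p z.1) = C₀.F σ.1 := by
      have h1 : (C₀.odd hN₀).p z = (C₀.odd hN₀).F σ := by
        rw [hz, hσ, ← hψ.map_p _ (by omega), ← hψ.map_F _ (by omega), Y.F_p]
      exact congrArg Subtype.val h1
    have hlz : C₀.lv z.1 = -((2 * k + 1 : ℕ) : ℤ) := by
      have h1 := congrArg C₀.lv hpz
      rw [C₀.lv_p, C₀.lv_p, C₀.lv_F, hlσ, hN₀] at h1
      push_cast at h1 ⊢
      omega
    -- two steps are added to the spine of `C₀`; the new vertex `σ₂` of odd level is mapped to `z`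
    obtain ⟨C₁, f₁, hf₁, hd₁, σ₁, h11, h12, h13⟩ := exists_extension hdC₀ hlσ hdσ hpz
    obtain ⟨C₂, f₂, hf₂, hd₂, σ₂, h21, h22, h23⟩ := exists_extension hd₁ h11 h12 (w := f₁ z.1) (by
      rw [h13, hf₁.map_p _ (by omega)])
    have hN₁ : C₁.N = 2 := hf₁.N_eq.symm.trans hN₀
    have hN : C₂.N = 2 := hf₂.N_eq.symm.trans hN₁
    obtain ⟨h, hh, hh'⟩ := ((hf₂.mono (Nat.le_succ _)).comp hf₁).half hN₀ hN (ε := 1) (Or.inr rfl)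
      (k := k + 1) (by push_cast; omega)
    refine ⟨C₂, hN, hd₂, ?_⟩
    have hdo := odd_hasDepth hN (k := k + 1) hd₂
    obtain ⟨g', hg', -⟩ := (hh.comp hψ).extend (fun t ht1 ht2 => by
        have hts : t = s := eq_of_spine (by rw [ht1, hs1]; push_cast; ring) ht2 hs2
        refine ⟨⟨σ₂, by rw [h21]; push_cast; omega⟩, ?_, h22, ?_⟩
        · change (C₂.lv σ₂ - 1) / 2 = _
          rw [h21]; push_cast; omega
        · apply Subtype.ext
          change C₂.F σ₂ = (h (ψ (Y.F t))).1
          rw [hts, h23, hh' _ (by rw [hψ.map_lv _ (by omega), hlF])]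
          rfl)
      (fun _ => hk.1)
    exact hg'.exists_isIso hk.2 hdo.2

end CTree

/-! ### Coordinates on a rooted tree completed by its ends -/

section EndCoordinates

variable {V : Type*} {G : SimpleGraph V} {o : V} {q : V → V} {dep : V → ℕ} {R : G.end → ℕ → V}

/-- `v` lies on the geodesic from the root to `u`. -/
def IsAncestor (q : V → V) (dep : V → ℕ) (v u : V) : Prop := ∃ n, n ≤ dep u ∧ q^[n] u = v

open Classical in
/-- The indicator of the vertices `u` that have `v` as an ancestor or are `v` itself. -/
noncomputable def ancestorIndicator (q : V → V) (dep : V → ℕ) (v u : V) : ℝ :=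
  if IsAncestor q dep v u then 1 else 0

open Classical in
/-- The coordinate with index `v` of a point is the weight of the vertices behind `v`, as seen from
the root; for an end it tells whether its ray `R e` from the root passes through `v`. -/
noncomputable def endCoord (q : V → V) (dep : V → ℕ) (R : G.end → ℕ → V) : EndCompletion G → V → ℝ
  | .point x, v => ∑ᶠ u, x.1 u * ancestorIndicator q dep v u
  | .endpt e, v => if R e (dep v) = v then 1 else 0

theorem IsRootRay.isAncestor (h : IsRooted G o q dep) {ξ : ℕ → V} (hξ : IsRootRay o q ξ) (n m : ℕ) :
    IsAncestor q dep (ξ m) (ξ (m + n)) := ⟨n, by rw [h.dep_ray hξ]; omega, hξ.iterate n m⟩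

theorem endCoord_point {x : Realization G} {s : Finset V} (hs : ∀ u, x.1 u ≠ 0 → u ∈ s) (v : V) :
    endCoord q dep R (.point x) v = ∑ u ∈ s, x.1 u * ancestorIndicator q dep v u :=
  finsum_eq_sum_of_support_subset _ fun u hu => hs u (left_ne_zero_of_mul hu)

open Classical in
theorem exists_support (x : Realization G) : ∃ s : Finset V, (∀ u, x.1 u ≠ 0 → u ∈ s) ∧
    ∑ u ∈ s, x.1 u = 1 := by
  obtain ⟨-, ⟨a, b, -, hab⟩, hsum⟩ := x.2
  have hs : ∀ u, x.1 u ≠ 0 → u ∈ ({a, b} : Finset V) := fun u hu => by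
    rw [Finset.mem_insert, Finset.mem_singleton]; exact hab u hu
  exact ⟨{a, b}, hs, by rw [← hsum, finsum_eq_sum_of_support_subset _ fun u hu => hs u hu]⟩

theorem exists_pos_coord (x : Realization G) : ∃ u, 0 < x.1 u := by
  by_contra! h
  have h0 : ∀ u, x.1 u = 0 := fun u => le_antisymm (h u) (x.2.1 u)
  have := x.2.2.2
  simp [h0] at this

namespace IsRooted

theorem isAncestor_of_isAncestor_child (h : IsRooted G o q dep) {u w a : V} (hw : w ≠ o) (hq : q w = u)
    (ha : IsAncestor q dep w a) : IsAncestor q dep u a ∧ a ≠ u := by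
  obtain ⟨n, hn, rfl⟩ := ha
  have h1 := h.dep_iterate a n hn
  have h2 := h.dep_parent _ hw
  refine ⟨⟨n + 1, by omega, by rw [Function.iterate_succ_apply', hq]⟩, ?_⟩
  rintro rfl
  rw [hq] at h2
  omega

theorem exists_child_isAncestor (h : IsRooted G o q dep) {u a : V} (ha : IsAncestor q dep u a)
    (hne : a ≠ u) : ∃ w, w ≠ o ∧ q w = u ∧ IsAncestor q dep w a := by
  obtain ⟨n, hn, hu⟩ := ha
  cases n with
  | zero => exact absurd hu hne
  | succ n =>
    rw [Function.iterate_succ_apply'] at hu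
    exact ⟨q^[n] a, h.ne_root (by rw [h.dep_iterate a n (by omega)]; omega), hu, n, by omega, rfl⟩

theorem eq_of_isAncestor (h : IsRooted G o q dep) {w w' a : V} (hd : dep w = dep w')
    (hw : IsAncestor q dep w a) (hw' : IsAncestor q dep w' a) : w = w' := by
  obtain ⟨n, hn, rfl⟩ := hw
  obtain ⟨m, hm, rfl⟩ := hw'
  rw [h.dep_iterate a n hn, h.dep_iterate a m hm] at hd
  rw [show n = m by omega]

theorem finite_successors (h : IsRooted G o q dep)
    (hf : ∀ v, (G.neighborSet v).Finite) (u : V) : {w | w ≠ o ∧ q w = u}.Finite :=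
  (hf u).subset fun _ hw => (h.adj_iff _ _).2 (Or.inr hw)

/-- The barycentric coordinates are differences of the coordinates `endCoord`. -/
theorem recover_indicator (h : IsRooted G o q dep)
    {c : Finset V} (u a : V) (hc : ∀ w, w ∈ c ↔ w ≠ o ∧ q w = u) [Decidable (a = u)] :
    ancestorIndicator q dep u a - ∑ w ∈ c, ancestorIndicator q dep w a = if a = u then 1 else 0 := by
  classical
  have hdep : ∀ w ∈ c, dep w = dep u + 1 := fun w hw => by
    rw [← h.dep_parent w ((hc w).1 hw).1, ((hc w).1 hw).2]
  by_cases hau : a = u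
  · subst hau
    have h1 : ancestorIndicator q dep a a = 1 := if_pos ⟨0, Nat.zero_le _, rfl⟩
    rw [Finset.sum_eq_zero, h1, if_pos rfl, sub_zero]
    intro w hw
    refine if_neg fun ha => ?_
    exact (h.isAncestor_of_isAncestor_child ((hc w).1 hw).1 ((hc w).1 hw).2 ha).2 rfl
  · rw [if_neg hau]
    by_cases ha : IsAncestor q dep u a
    · obtain ⟨w, hw1, hw2, hw3⟩ := h.exists_child_isAncestor ha hau
      have hw := (hc w).2 ⟨hw1, hw2⟩
      rw [Finset.sum_eq_single_of_mem w hw, ancestorIndicator, ancestorIndicator, if_pos ha,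
        if_pos hw3, sub_self]
      intro w' hw' hne
      exact if_neg fun ha' => hne (h.eq_of_isAncestor ((hdep _ hw').trans (hdep _ hw).symm) ha' hw3)
    · rw [Finset.sum_eq_zero, ancestorIndicator, if_neg ha, sub_zero]
      exact fun w hw => if_neg fun ha' =>
        ha (h.isAncestor_of_isAncestor_child ((hc w).1 hw).1 ((hc w).1 hw).2 ha').1

theorem recover_point (h : IsRooted G o q dep)
    {c : Finset V} (x : Realization G) (u : V)
    (hc : ∀ w, w ∈ c ↔ w ≠ o ∧ q w = u) :
    endCoord q dep R (.point x) u - ∑ w ∈ c, endCoord q dep R (.point x) w = x.1 u := by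
  classical
  obtain ⟨s, hs, -⟩ := exists_support x
  simp only [endCoord_point hs]
  rw [Finset.sum_comm, ← Finset.sum_sub_distrib]
  have : ∀ a ∈ s, x.1 a * ancestorIndicator q dep u a -
      ∑ w ∈ c, x.1 a * ancestorIndicator q dep w a = if a = u then x.1 a else 0 := fun a _ => by
    rw [← Finset.mul_sum, ← mul_sub, h.recover_indicator u a hc, mul_ite, mul_one, mul_zero]
  rw [Finset.sum_congr rfl this, Finset.sum_ite_eq']
  split_ifs with hu
  · rfl
  · by_contra hne
    exact hu (hs u (Ne.symm hne))

theorem recover_endpt (h : IsRooted G o q dep)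
    (hR : ∀ e, IsRootRay o q (R e) ∧ RayToEnd dep e (R e)) {c : Finset V} (e : G.end) (u : V) (hc : ∀ w, w ∈ c ↔ w ≠ o ∧ q w = u) :
    endCoord q dep R (.endpt e) u - ∑ w ∈ c, endCoord q dep R (.endpt e) w = 0 := by
  classical
  obtain ⟨hr, -⟩ := hR e
  have hdep : ∀ w ∈ c, dep w = dep u + 1 := fun w hw => by
    rw [← h.dep_parent w ((hc w).1 hw).1, ((hc w).1 hw).2]
  have hq : ∀ w ∈ c, R e (dep w) = w → R e (dep u) = u := fun w hw e1 => by
    rw [hdep w hw] at e1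
    rw [← hr.parent, e1, ((hc w).1 hw).2]
  by_cases hu : R e (dep u) = u
  · have hw : R e (dep u + 1) ∈ c := (hc _).2 ⟨hr.succ_ne _, by rw [hr.parent, hu]⟩
    rw [Finset.sum_eq_single_of_mem _ hw]
    · simp only [endCoord, h.dep_ray hr, hu]
      simp
    · intro w hw' hne
      refine if_neg fun e1 => hne ?_
      rw [← e1, hdep w hw']
  · have h1 : ∀ w ∈ c, endCoord q dep R (.endpt e) w = 0 := fun w hw =>
      if_neg fun e1 => hu (hq w hw e1)
    rw [Finset.sum_eq_zero h1, sub_zero]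
    exact if_neg hu

/-- The coordinates recover the weights of a point and the ray to an end. -/
theorem endCoord_injective (h : IsRooted G o q dep)
    (hf : ∀ v, (G.neighborSet v).Finite)
    (hR : ∀ e, IsRootRay o q (R e) ∧ RayToEnd dep e (R e)) : Function.Injective (endCoord q dep R) := by
  classical
  have hpt : ∀ (x : Realization G) (e : G.end),
      endCoord q dep R (.point x) ≠ endCoord q dep R (.endpt e) := by
    intro x e he
    obtain ⟨u, hu⟩ := exists_pos_coord x
    have hc : ∀ w, w ∈ (h.finite_successors hf u).toFinset ↔ w ≠ o ∧ q w = u := fun w => by simp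
    have h1 := h.recover_point (R := R) x u hc
    rw [he, h.recover_endpt hR e u hc] at h1
    exact hu.ne h1
  rintro (x | e) (x' | e') he
  · congr 1
    apply Subtype.ext
    funext u
    have hc : ∀ w, w ∈ (h.finite_successors hf u).toFinset ↔ w ≠ o ∧ q w = u := fun w => by simp
    rw [← h.recover_point (R := R) x u hc, ← h.recover_point (R := R) x' u hc, he]
  · exact absurd he (hpt x e')
  · exact absurd he.symm (hpt x' e)
  · congr 1
    refine IsRooted.end_unique (dep := dep) (hR e).2 (ξ := R e) ?_
    have : R e = R e' := by
      funext n
      have h1 := congrFun he (R e n)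
      simp only [endCoord, h.dep_ray (hR e).1] at h1
      by_contra hne
      simp [Ne.symm hne] at h1
    rw [this]
    exact (hR e').2

/-- Near a point whose weight at `a` is positive all weights live on `a` and its neighbours. -/
theorem continuous_endCoord_point (hf : ∀ v, (G.neighborSet v).Finite) (v : V) :
    Continuous fun x : Realization G => endCoord q dep R (.point x) v := by
  classical
  rw [continuous_iff_continuousAt]
  intro x₀
  obtain ⟨a, ha⟩ := exists_pos_coord x₀
  let s : Finset V := insert a (hf a).toFinset
  have hcont : ∀ u, Continuous fun x : Realization G => x.1 u := fun u =>
    (continuous_apply u).comp continuous_subtype_val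
  have hev : ∀ᶠ x : Realization G in 𝓝 x₀,
      ∑ u ∈ s, x.1 u * ancestorIndicator q dep v u = endCoord q dep R (.point x) v := by
    filter_upwards [(hcont a).continuousAt.eventually (lt_mem_nhds ha)] with x hx
    refine (endCoord_point (fun u hu => ?_) v).symm
    obtain ⟨-, ⟨b, c, hbc, hs⟩, -⟩ := x.2
    simp only [s, Finset.mem_insert, Set.Finite.mem_toFinset, SimpleGraph.mem_neighborSet]
    rcases hbc with rfl | hbc
    · left
      rcases hs a hx.ne' with rfl | rfl <;> rcases hs u hu with rfl | rfl <;> rfl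
    · rcases hs a hx.ne' with rfl | rfl <;> rcases hs u hu with rfl | rfl
      · exact Or.inl rfl
      · exact Or.inr hbc
      · exact Or.inr hbc.symm
      · exact Or.inl rfl
  refine ContinuousAt.congr ?_ hev
  exact (continuous_finsetSum s fun u _ => (hcont u).mul continuous_const).continuousAt

/-- Near an end the coordinate with index `v` is constant. -/
theorem exists_eq_endCoord (h : IsRooted G o q dep)
    (hf : ∀ v, (G.neighborSet v).Finite)
    (hR : ∀ e, IsRootRay o q (R e) ∧ RayToEnd dep e (R e)) (e : G.end) (v : V) : ∃ K : Finset V,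
    (∀ x : Realization G, (∃ w ∈ endComponent G e K, x.1 w ≠ 0) →
      endCoord q dep R (.point x) v = endCoord q dep R (.endpt e) v) ∧
    ∀ e', endComponent G e' K = endComponent G e K →
      endCoord q dep R (.endpt e') v = endCoord q dep R (.endpt e) v := by
  classical
  obtain ⟨hr, hre⟩ := hR e
  let K : Finset V := (h.finite_ball hf (dep v)).toFinset
  have hK : ∀ w, w ∈ K ↔ dep w < dep v + 1 := fun w => by simp [K]
  have hmem := hre K (dep v + 1) fun w hw => (hK w).1 hw
  -- vertices in the component lie below the same vertex of depth `dep v + 1`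
  have hcomp : ∀ w ∈ endComponent G e K, dep v + 1 ≤ dep w ∧
      q^[dep w - (dep v + 1)] w = R e (dep v + 1) := by
    intro w hw
    have h1 := h.anc_eq_of_mem (n := dep v + 1) (fun x hx => by rw [hK] at hx; omega) hw hmem
    rw [h.dep_ray hr, Nat.sub_self] at h1
    obtain ⟨hw', -⟩ := hw
    rw [Finset.mem_coe, hK] at hw'
    exact ⟨by omega, h1⟩
  have hanc : ∀ w, dep v ≤ dep w → q^[dep w - dep v] w = R e (dep v) →
      ancestorIndicator q dep v w = if R e (dep v) = v then 1 else 0 := by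
    intro w hw h1
    unfold ancestorIndicator
    congr 1
    refine propext ⟨?_, fun h2 => ⟨_, Nat.sub_le _ _, h1.trans h2⟩⟩
    rintro ⟨n, hn, h2⟩
    have h3 := h.dep_iterate w n hn
    rw [h2] at h3
    rw [← h1, show dep w - dep v = n by omega, h2]
  have hin : ∀ w ∈ endComponent G e K, dep v ≤ dep w ∧ q^[dep w - dep v] w = R e (dep v) := by
    intro w hw
    obtain ⟨h1, h2⟩ := hcomp w hw
    refine ⟨by omega, ?_⟩
    rw [show dep w - dep v = (dep w - (dep v + 1)) + 1 by omega, Function.iterate_succ_apply', h2,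
      hr.parent]
  refine ⟨K, ?_, ?_⟩
  · rintro x ⟨w, hw, hxw⟩
    obtain ⟨s, hs, hs1⟩ := exists_support x
    have hall : ∀ u, x.1 u ≠ 0 → dep v ≤ dep u ∧ q^[dep u - dep v] u = R e (dep v) := by
      intro u hu
      by_cases huw : u = w
      · rw [huw]; exact hin w hw
      have hadj : G.Adj w u := by
        obtain ⟨-, ⟨b, c, hbc, hs⟩, -⟩ := x.2
        rcases hbc with rfl | hbc
        · exact absurd (by rcases hs u hu with rfl | rfl <;> rcases hs w hxw with rfl | rfl <;> rfl) huw
        · rcases hs w hxw with rfl | rfl <;> rcases hs u hu with rfl | rfl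
          · exact absurd rfl huw
          · exact hbc
          · exact hbc.symm
          · exact absurd rfl huw
      obtain ⟨h1, h2⟩ := hcomp w hw
      rcases (h.adj_iff _ _).1 hadj with ⟨h3, rfl⟩ | ⟨h3, rfl⟩
      · have h4 := h.dep_parent w h3
        refine ⟨by omega, ?_⟩
        rw [← Function.iterate_succ_apply q, show (dep (q w) - dep v).succ = dep w - dep v by omega]
        exact (hin w hw).2
      · have h4 := h.dep_parent u h3
        refine ⟨by omega, ?_⟩
        rw [show dep u - dep v = (dep (q u) - dep v) + 1 by omega, Function.iterate_succ_apply]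
        exact (hin _ hw).2
    rw [endCoord_point hs]
    have h2 : ∀ u ∈ s, x.1 u * ancestorIndicator q dep v u =
        x.1 u * (if R e (dep v) = v then 1 else 0) := fun u _ => by
      by_cases hu : x.1 u = 0
      · rw [hu, zero_mul, zero_mul]
      · rw [hanc u (hall u hu).1 (hall u hu).2]
    rw [Finset.sum_congr rfl h2, ← Finset.sum_mul, hs1, one_mul]
    rfl
  · intro e' he'
    have h1 := h.ray_eq_of_endComponent_eq (hR e').1 hr (hR e').2 hre (n := dep v + 1) hK he'
    have h2 := (hR e').1.eq_of_le hr (Nat.le_succ (dep v)) h1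
    simp only [endCoord, h2]

/-- The vertices behind the vertex number `n` of the ray to an end lie in a small neighbourhood
of the end. -/
theorem mem_endComponent_of_isAncestor (h : IsRooted G o q dep)
    {e : G.end} {ξ : ℕ → V} (hξ : IsRootRay o q ξ)
    (he : RayToEnd dep e ξ) {K : Finset V} {n : ℕ} (hK : ∀ v ∈ K, dep v < n) {u : V}
    (hu : IsAncestor q dep (ξ n) u) : u ∈ endComponent G e K := by
  obtain ⟨m, hm, hmu⟩ := hu
  induction m generalizing u with
  | zero => rw [show u = ξ n from hmu]; exact he K n hK
  | succ m ih =>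
    have hd := h.dep_iterate u (m + 1) hm
    rw [hmu, h.dep_ray hξ] at hd
    have hne : u ≠ o := h.ne_root (by omega)
    have h1 := h.dep_parent u hne
    have h2 := ih (u := q u) (by omega) hmu
    have hu' : u ∉ (K : Set V) := fun hu' => by have := hK u hu'; omega
    exact SimpleGraph.ComponentCompl.mem_of_adj _ _ h2 hu' (h.adj_parent hne).symm

/-- The coordinates define the topology of the completed tree: locally the weights of a point are
combinations of coordinates, and the coordinates along the ray to an end are indicators of a
neighbourhood basis of the end. -/
theorem isInducing_endCoord (h : IsRooted G o q dep)
    (hf : ∀ v, (G.neighborSet v).Finite)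
    (hR : ∀ e, IsRootRay o q (R e) ∧ RayToEnd dep e (R e)) : IsInducing (endCoord q dep R) := by
  classical
  refine ⟨le_antisymm ?_ ?_⟩
  · rw [← continuous_iff_le_induced]
    refine continuous_pi fun v => continuous_def.2 fun O hO => ⟨?_, fun e he => ?_⟩
    · exact hO.preimage (continuous_endCoord_point (R := R) hf v)
    · obtain ⟨K, h1, h2⟩ := h.exists_eq_endCoord hf hR e v
      refine ⟨K, fun x hx => ?_, fun e' he' => ?_⟩
      · change endCoord q dep R (.point x) v ∈ O
        rw [h1 x hx]; exact he
      · change endCoord q dep R (.endpt e') v ∈ O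
        rw [h2 e' he']; exact he
  · intro U hU
    -- each point of `U` has a neighbourhood given by the coordinates
    suffices hloc : ∀ y ∈ U, ∃ W : Set (V → ℝ), IsOpen W ∧ endCoord q dep R y ∈ W ∧
        ∀ z, endCoord q dep R z ∈ W → z ∈ U by
      choose! W hW1 hW2 hW3 using hloc
      refine isOpen_induced_iff.2 ⟨⋃ y ∈ U, W y, isOpen_biUnion hW1, ?_⟩
      ext z
      simp only [Set.mem_preimage, Set.mem_iUnion]
      exact ⟨fun ⟨y, hy, hz⟩ => hW3 y hy z hz, fun hz => ⟨z, hz, hW2 z hz⟩⟩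
    have happ : ∀ v : V, Continuous fun θ : V → ℝ => θ v := fun v => continuous_apply v
    rintro (x | e) hy
    · let c : V → Finset V := fun u => (h.finite_successors hf u).toFinset
      have hc : ∀ u w, w ∈ c u ↔ w ≠ o ∧ q w = u := fun u w => by simp [c]
      let rec_ : (V → ℝ) → V → ℝ := fun θ u => θ u - ∑ w ∈ c u, θ w
      have hrec : Continuous rec_ := continuous_pi fun u =>
        (happ u).sub (continuous_finsetSum _ fun w _ => happ w)
      obtain ⟨a, ha⟩ := exists_pos_coord x
      obtain ⟨O, hO, hOU⟩ := isOpen_induced_iff.1 hU.1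
      refine ⟨rec_ ⁻¹' (O ∩ {θ | 0 < θ a}), (hO.inter (isOpen_lt continuous_const (happ a))).preimage
        hrec, ?_, ?_⟩
      · have : rec_ (endCoord q dep R (.point x)) = x.1 := funext fun u => h.recover_point x u (hc u)
        rw [Set.mem_preimage, this]
        exact ⟨(Set.ext_iff.1 hOU x).2 hy, ha⟩
      · rintro (z | e) ⟨hz1, hz2⟩
        · have : rec_ (endCoord q dep R (.point z)) = z.1 :=
            funext fun u => h.recover_point z u (hc u)
          rw [this] at hz1
          exact (Set.ext_iff.1 hOU z).1 hz1
        · have : rec_ (endCoord q dep R (.endpt e)) a = 0 := h.recover_endpt hR e a (hc a)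
          exact absurd this (ne_of_gt hz2)
    · obtain ⟨K, hK1, hK2⟩ := hU.2 e hy
      obtain ⟨hr, hre⟩ := hR e
      have hK : ∀ v ∈ K, dep v < K.sup dep + 1 := fun v hv => Nat.lt_succ_of_le (Finset.le_sup hv)
      refine ⟨{θ | 0 < θ (R e (K.sup dep + 1))}, isOpen_lt continuous_const (happ _), ?_, ?_⟩
      · change 0 < endCoord q dep R (.endpt e) _
        simp [endCoord, h.dep_ray hr]
      · rintro (z | e') hz
        · refine hK1 z ?_
          by_contra! hne
          obtain ⟨s, hs, -⟩ := exists_support z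
          have hz : 0 < endCoord q dep R (.point z) (R e (K.sup dep + 1)) := hz
          rw [endCoord_point hs, Finset.sum_eq_zero] at hz
          · exact lt_irrefl _ hz
          · intro u _
            by_cases hu : IsAncestor q dep (R e (K.sup dep + 1)) u
            · rw [hne u (h.mem_endComponent_of_isAncestor hr hre hK hu), zero_mul]
            · rw [ancestorIndicator, if_neg hu, mul_zero]
        · refine hK2 e' ?_
          have hz : 0 < endCoord q dep R (.endpt e') (R e (K.sup dep + 1)) := hz
          simp only [endCoord, h.dep_ray hr] at hz
          have h1 : R e' (K.sup dep + 1) = R e (K.sup dep + 1) := by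
            by_contra hne
            rw [if_neg hne] at hz
            exact lt_irrefl _ hz
          exact IsRooted.endComponent_eq (hR e').2 hre hK h1

end IsRooted

end EndCoordinates

/-! ### The tree of trees with one critical grand orbit -/

namespace CTree

/-- The part of `C` of level at least `-k` is isomorphic to that of `C'`. -/
def Agree (k : ℕ) (C C' : CTree) : Prop := ∃ f, IsPIso C C' f k

namespace Agree

variable {k : ℕ} {C C' C'' : CTree}

theorem symm (h : Agree k C C') : Agree k C' C := by
  obtain ⟨f, hf⟩ := h
  obtain ⟨g, hg, -⟩ := hf.exists_inv
  exact ⟨g, hg⟩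

theorem trans (h : Agree k C C') (h' : Agree k C' C'') : Agree k C C'' := by
  obtain ⟨f, hf⟩ := h
  obtain ⟨g, hg⟩ := h'
  exact ⟨_, hg.comp hf⟩

theorem mono {l : ℕ} (h : Agree k C C') (hl : l ≤ k) : Agree l C C' := by
  obtain ⟨f, hf⟩ := h
  exact ⟨f, hf.mono hl⟩

theorem hasSp (h : Agree k C C') {l : ℕ} (hl : l ≤ k) : C.HasSp l ↔ C'.HasSp l := by
  obtain ⟨f, hf⟩ := h
  exact hf.hasSp hl

end Agree

theorem IsIso.agree {C C' : CTree} {f : C.V → C'.V} (h : IsIso C C' f) (k : ℕ) : Agree k C C' :=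
  ⟨f, h.isPIso k⟩

end CTree

open CTree

/-- `rep` lists, up to isomorphism and without repetitions, the level trees with `N = 1` whose spine
is finite; `dep v` is the length of the spine of `rep v`. -/
structure IsClassification {V : Type*} (rep : V → CTree) (dep : V → ℕ) : Prop where
  N_eq : ∀ v, (rep v).N = 1
  hasDepth : ∀ v, (rep v).HasDepth (dep v)
  eq_of_isIso : ∀ u v f, IsIso (rep u) (rep v) f → u = v
  exists_isIso : ∀ (C : CTree) (k : ℕ), C.N = 1 → C.HasDepth k → ∃ v f, IsIso C (rep v) f

/-- `C` extends the tree `rep v` truncated at the end of its spine. -/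
def Extends {V : Type*} (rep : V → CTree) (dep : V → ℕ) (v : V) (C : CTree) : Prop :=
  Agree (dep v) (rep v) C

namespace IsClassification

variable {V : Type*} {rep : V → CTree} {dep : V → ℕ}

theorem eq_of_agree (h : IsClassification rep dep) {u v : V} (hd : dep u = dep v)
    (ha : Agree (dep v) (rep u) (rep v)) : u = v := by
  obtain ⟨f, hf⟩ := ha
  obtain ⟨g, hg⟩ := hf.exists_isIso (by rw [← hd]; exact (h.hasDepth u).2) (h.hasDepth v).2
  exact h.eq_of_isIso _ _ g hg

theorem eq_of_extends (h : IsClassification rep dep) {u v : V} {C : CTree} (hd : dep u = dep v)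
    (hu : Extends rep dep u C) (hv : Extends rep dep v C) : u = v := by
  refine h.eq_of_agree hd ?_
  unfold Extends at hu
  rw [hd] at hu
  exact hu.trans hv.symm

theorem dep_eq (h : IsClassification rep dep) {v : V} {C : CTree} {k : ℕ} {f : C.V → (rep v).V}
    (hf : IsIso C (rep v) f) (hk : C.HasDepth k) : dep v = k := by
  obtain ⟨g, hg, -⟩ := hf.exists_inv
  refine (h.hasDepth v).unique ⟨hf.hasSp hk.1, fun h1 => hk.2 (hg.hasSp h1)⟩

theorem hasSp_of_extends (h : IsClassification rep dep) {v : V} {C : CTree}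
    (hv : Extends rep dep v C) : C.HasSp (dep v) :=
  (hv.hasSp le_rfl).1 (h.hasDepth v).1

theorem exists_extends (h : IsClassification rep dep) {C : CTree} (hN : C.N = 1) {k : ℕ}
    (hk : C.HasSp k) : ∃ v, dep v = k ∧ Extends rep dep v C := by
  obtain ⟨C', f, hf, hk'⟩ := C.exists_truncation k
  have hd : C'.HasDepth k := ⟨(hf.hasSp le_rfl).1 hk, hk'⟩
  obtain ⟨v, g, hg⟩ := h.exists_isIso C' k (hf.N_eq.symm.trans hN) hd
  have hv := h.dep_eq hg hd
  refine ⟨v, hv, ?_⟩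
  unfold Extends
  rw [hv]
  exact ((hg.agree k).symm).trans (Agree.symm ⟨f, hf⟩)

theorem extends_trans (h : IsClassification rep dep) {u v : V} {C : CTree}
    (huv : Extends rep dep u (rep v)) (hv : Extends rep dep v C) : Extends rep dep u C :=
  Agree.trans huv (hv.mono ((h.hasDepth v).le_iff.1 (h.hasSp_of_extends huv)))

/-- Truncation of the spine by one step, which gives the parent in the tree of all `rep v`. -/
theorem exists_parent (h : IsClassification rep dep) (v : V) :
    ∃ u, dep u = dep v - 1 ∧ Extends rep dep u (rep v) :=
  h.exists_extends (h.N_eq v) ((h.hasDepth v).1.mono (Nat.sub_le _ _))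

theorem surjective_dep (h : IsClassification rep dep) : Function.Surjective dep := by
  intro k
  induction k with
  | zero =>
    obtain ⟨C, hN, hC⟩ := exists_hasDepth_zero 1 le_rfl
    obtain ⟨v, f, hf⟩ := h.exists_isIso C 0 hN hC
    exact ⟨v, h.dep_eq hf hC⟩
  | succ k ih =>
    obtain ⟨v, rfl⟩ := ih
    obtain ⟨s, hs, hs2⟩ := (h.hasDepth v).1
    obtain ⟨w, hw⟩ := (rep v).exists_child ((rep v).F s)
    obtain ⟨C, f, hf, hC, -⟩ := exists_extension (h.hasDepth v) hs hs2 hw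
    obtain ⟨u, g, hg⟩ := h.exists_isIso C _ (hf.N_eq.symm.trans (h.N_eq v)) hC
    exact ⟨u, h.dep_eq hg hC⟩

theorem infinite (h : IsClassification rep dep) : Infinite V := Infinite.of_surjective dep h.surjective_dep

/-- A tree `rep w` that extends `rep v` by one step is determined by the image of the new spine
vertex. -/
theorem finite_extends (h : IsClassification rep dep) (v : V) :
    {w | dep w = dep v + 1 ∧ Extends rep dep v (rep w)}.Finite := by
  have key : ∀ w : V, ∃ x, dep w = dep v + 1 ∧ Extends rep dep v (rep w) →
      (rep v).lv x = -(dep v : ℤ) ∧ ∃ f, IsPIso (rep v) (rep w) f (dep v) ∧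
      ∃ s, (rep w).lv s = -(dep v + 1 : ℤ) ∧ 2 ≤ (rep w).deg s ∧ (rep w).F s = f x := by
    intro w
    by_cases hw : dep w = dep v + 1 ∧ Extends rep dep v (rep w)
    · obtain ⟨hd, f, hf⟩ := hw
      obtain ⟨s, hs, hs2⟩ := (h.hasDepth w).1
      have hl : (rep w).lv ((rep w).F s) = -(dep v : ℤ) := by
        rw [(rep w).lv_F, hs, h.N_eq, hd]; push_cast; ring
      obtain ⟨x, hx, hfx⟩ := hf.surj ((rep w).F s) hl.ge
      refine ⟨x, fun _ => ⟨?_, f, hf, s, ?_, hs2, hfx.symm⟩⟩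
      · rw [← hf.map_lv x hx, hfx, hl]
      · rw [hs, hd]; push_cast; ring
    · exact ⟨(rep v).base, fun h => absurd h hw⟩
  choose x hx using key
  refine Set.Finite.of_finite_image (f := x) (((rep v).finite_level (dep v)).subset ?_) ?_
  · rintro _ ⟨w, hw, rfl⟩
    have := (hx w hw).1
    change ((rep v).lv (x w)).natAbs ≤ dep v
    omega
  · intro w hw w' hw' hxx
    obtain ⟨hl, f, hf, s, hs, hs2, hsf⟩ := hx w hw
    obtain ⟨hl', f', hf', s', hs', hs2', hsf'⟩ := hx w' hw'
    obtain ⟨g, hg, hgf, -⟩ := hf.exists_inv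
    obtain ⟨e, he, -⟩ := (hf'.comp hg).extend (fun t ht ht2 => by
      have : t = s := eq_of_spine (by rw [ht, hs]) ht2 hs2
      subst this
      refine ⟨s', hs', hs2', ?_⟩
      rw [hsf', hsf, Function.comp_apply, hgf _ hl.ge, hxx])
      (fun _ => ⟨s, by rw [hs]; push_cast; ring, hs2⟩)
    refine h.eq_of_agree (hw.1.trans hw'.1.symm) ?_
    rw [hw'.1]
    exact ⟨e, he⟩

/-- The trees `rep v` are the vertices of a locally finite rooted tree, in which the ancestors of
a tree are its truncations. -/
theorem exists_isRooted (h : IsClassification rep dep) :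
    ∃ (P : SimpleGraph V) (o : V) (q : V → V), IsRooted P o q dep ∧
      (∀ v, (P.neighborSet v).Finite) ∧
      ∀ u v, IsAncestor q dep u v ↔ Extends rep dep u (rep v) := by
  choose q hqd hq using h.exists_parent
  obtain ⟨o, ho⟩ := h.surjective_dep 0
  have hz : ∀ v, dep v = 0 ↔ v = o := fun v => by
    refine ⟨fun hv => h.eq_of_agree (hv.trans ho.symm) ?_, fun e => by rw [e, ho]⟩
    rw [ho]
    exact exists_isPIso_zero _ _ ((h.N_eq v).trans (h.N_eq o).symm)
  have hpar : ∀ v, v ≠ o → dep (q v) + 1 = dep v := fun v hv => by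
    have := mt (hz v).1 hv
    have := hqd v
    omega
  let P : SimpleGraph V :=
    { Adj := fun u v => (u ≠ o ∧ q u = v) ∨ (v ≠ o ∧ q v = u)
      symm := ⟨fun u v => Or.symm⟩
      loopless := ⟨fun v hv => by
        rcases hv with ⟨h1, h2⟩ | ⟨h1, h2⟩ <;>
        · have := hpar v h1
          rw [h2] at this
          omega⟩ }
  have hroot : IsRooted P o q dep := ⟨hz, hpar, fun _ _ => Iff.rfl⟩
  have hext : ∀ n u, n ≤ dep u → Extends rep dep (q^[n] u) (rep u) := by
    intro n u hn
    induction n with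
    | zero => exact (IsIso.refl (rep u)).agree _
    | succ n ih =>
      rw [Function.iterate_succ_apply']
      exact h.extends_trans (hq _) (ih (by omega))
  refine ⟨P, o, q, hroot, fun v => ?_, fun u v => ⟨?_, fun huv => ?_⟩⟩
  · refine ((Set.finite_singleton (q v)).union (h.finite_extends v)).subset ?_
    rintro w (⟨-, hw⟩ | ⟨h1, rfl⟩)
    · exact Or.inl hw.symm
    · exact Or.inr ⟨(hpar w h1).symm, hq w⟩
  · rintro ⟨n, hn, rfl⟩
    exact hext n v hn
  · have hle := (h.hasDepth v).le_iff.1 (h.hasSp_of_extends huv)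
    refine ⟨dep v - dep u, Nat.sub_le _ _, h.eq_of_extends ?_ (hext _ _ (Nat.sub_le _ _)) huv⟩
    rw [hroot.dep_iterate v _ (Nat.sub_le _ _)]
    omega

end IsClassification

/-! ### Classes of trees and their strata -/

namespace CTree

/-- The lengths of `N` consecutive edges of the ray determine all lengths. -/
theorem eq_mul_of_scale {N : ℕ} (hN : 1 ≤ N) {ℓ ℓ' : ℤ → ℝ} (h : ∀ k, ℓ (k + N) = 3 * ℓ k)
    (h' : ∀ k, ℓ' (k + N) = 3 * ℓ' k) {c : ℝ} (hc : ∀ j : ℕ, j < N → ℓ' j = c * ℓ j) (k : ℤ) :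
    ℓ' k = c * ℓ k := by
  have key : ∀ (m : ℤ) (j : ℕ), j < N → ℓ' (j + N * m) = c * ℓ (j + N * m) := by
    intro m j hj
    induction m using Int.induction_on with
    | zero => simpa using hc j hj
    | succ m ih =>
      rw [show (j : ℤ) + N * (m + 1) = (j + N * m) + N by ring, h, h', ih]; ring
    | pred m ih =>
      have h1 := h (j + N * (-(m : ℤ) - 1))
      have h2 := h' (j + N * (-(m : ℤ) - 1))
      rw [show (j : ℤ) + N * (-(m : ℤ) - 1) + N = j + N * (-(m : ℤ)) by ring] at h1 h2
      linear_combination (ih - h2 + c * h1) / 3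
  have hN' : (0 : ℤ) < N := by omega
  have h1 := Int.emod_nonneg k hN'.ne'
  have h2 := Int.emod_lt_of_pos k hN'
  have h3 := key (k / N) (k % N).toNat (by omega)
  rw [Int.toNat_of_nonneg h1, Int.emod_add_mul_ediv] at h3
  exact h3

end CTree

namespace Models

variable {C : CTree} {ℓ : ℤ → ℝ} {T : MetrizedTree 3} {i : C.V → T.V}

theorem of_equivalent (h : Models C ℓ T i) {T' : MetrizedTree 3} (he : MetrizedTree.Equivalent T T') :
    ∃ i', Models C ℓ T' i' := by
  obtain ⟨e, hF, hl⟩ := he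
  refine ⟨fun v => e (i v), e.bijective.comp h.bij, fun u v => ?_, fun v => ?_, h.pos, h.scale,
    fun v => ?_⟩
  · rw [e.map_adj_iff, h.adj]
  · rw [← hF, h.map_F]
  · rw [hl _ _ ((h.adj _ _).2 (Or.inl rfl)), h.len]

/-- A model of a tree gives models of all trees in the same class of `ℙ𝒯₃`. -/
theorem of_mk_eq (h : Models C ℓ T i) {T' : MetrizedTree 3}
    (he : ProjTreeSpace.mk T = ProjTreeSpace.mk T') :
    ∃ c : ℝ, 0 < c ∧ ∃ i', Models C (fun k => c * ℓ k) T' i' := by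
  obtain ⟨c, hc⟩ := Quotient.exact he.symm
  exact ⟨c.1, c.2, (h.scaled c).of_equivalent (Quotient.exact hc)⟩

theorem mk_eq (h : Models C ℓ T i) {C' : CTree} {ℓ' : ℤ → ℝ} {T' : MetrizedTree 3} {i' : C'.V → T'.V}
    (h' : Models C' ℓ' T' i') {f : C.V → C'.V} (hf : CTree.IsIso C C' f)
    {c : ℝ} (hc : 0 < c) (hℓ : ∀ k, ℓ' k = c * ℓ k) : ProjTreeSpace.mk T = ProjTreeSpace.mk T' := by
  have h1 := h.scaled ⟨c, hc⟩
  rw [show (fun k => c * ℓ k) = ℓ' from funext fun k => (hℓ k).symm] at h1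
  exact (Quotient.sound ⟨⟨c, hc⟩, Quotient.sound (h1.equivalent h' hf)⟩ :
    ProjTreeSpace.mk T' = ProjTreeSpace.mk T).symm

theorem exists_isIso_of_mk_eq (h : Models C ℓ T i) {C' : CTree} {ℓ' : ℤ → ℝ} {T' : MetrizedTree 3}
    {i' : C'.V → T'.V} (h' : Models C' ℓ' T' i') (he : ProjTreeSpace.mk T = ProjTreeSpace.mk T') :
    (∃ f, CTree.IsIso C C' f) ∧ ∃ c, 0 < c ∧ ∀ k, ℓ' k = c * ℓ k := by
  obtain ⟨c, hc, j, hj⟩ := h.of_mk_eq he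
  obtain ⟨f, hf, -, hℓ⟩ := hj.exists_isIso h' SimpleGraph.Iso.refl (fun _ => rfl) (fun _ _ _ => rfl)
  exact ⟨⟨f, hf⟩, c, hc, fun k => (congrFun hℓ k).symm⟩

theorem N_eq (h : Models C ℓ T i) :
    C.N = 1 ∨ ∃ k, C.N = 2 ∧ C.HasDepth (2 * k + 1) := by
  rcases h.isBranched.N_eq with h1 | ⟨h1, k, hk, hodd⟩
  · exact Or.inl h1
  · refine Or.inr ⟨k / 2, h1, ?_⟩
    rwa [show 2 * (k / 2) + 1 = k by omega]

theorem scale_one (h : Models C ℓ T i) (hN : C.N = 1) (k : ℤ) : ℓ (k + 1) = 3 * ℓ k := by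
  have := h.scale k
  rwa [hN] at this

end Models

namespace ProjTreeSpace

/-- The type of the escaping critical points is well defined on `ℙ𝒯₃`. -/
theorem mem_stratum_iff {C : CTree} {ℓ : ℤ → ℝ} {T : MetrizedTree 3} {i : C.V → T.V}
    (h : Models C ℓ T i) (p : Multiset ℕ) : mk T ∈ stratum 3 p ↔ T.HasEscapeType p := by
  refine ⟨?_, fun hp => ⟨T, rfl, hp⟩⟩
  rintro ⟨T', he, hp⟩
  obtain ⟨c, -, i', h'⟩ := h.of_mk_eq he.symm
  rcases C.hasSp_or_hasDepth with hs | ⟨k, hk⟩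
  · rw [h.hasEscapeType_of_hasSp hs, ← h'.hasEscapeType_of_hasSp hs]; exact hp
  · by_cases hd : C.N ∣ k
    · rw [(h.hasEscapeType_of_hasDepth hk p).1 hd, ← (h'.hasEscapeType_of_hasDepth hk p).1 hd]
      exact hp
    · rw [(h.hasEscapeType_of_hasDepth hk p).2 hd, ← (h'.hasEscapeType_of_hasDepth hk p).2 hd]
      exact hp

variable {C : CTree} {ℓ : ℤ → ℝ} {T : MetrizedTree 3} {i : C.V → T.V}

theorem mem_stratum_of_hasSp (h : Models C ℓ T i) (hs : ∀ k, C.HasSp k) (p : Multiset ℕ) :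
    mk T ∈ stratum 3 p ↔ p = {1} := by
  rw [mem_stratum_iff h, h.hasEscapeType_of_hasSp hs]

theorem mem_stratum_of_N_eq_one (h : Models C ℓ T i) {k : ℕ} (hk : C.HasDepth k) (hN : C.N = 1)
    (p : Multiset ℕ) : mk T ∈ stratum 3 p ↔ p = {2} := by
  rw [mem_stratum_iff h, (h.hasEscapeType_of_hasDepth hk p).1 (by rw [hN]; exact one_dvd k)]

theorem mem_stratum_of_N_eq_two (h : Models C ℓ T i) {k : ℕ} (hk : C.HasDepth (2 * k + 1))
    (hN : C.N = 2) (p : Multiset ℕ) : mk T ∈ stratum 3 p ↔ p = {1, 1} := by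
  rw [mem_stratum_iff h, (h.hasEscapeType_of_hasDepth hk p).2 (by rw [hN]; omega)]

theorem exists_mk (t : ProjTreeSpace 3) : ∃ T, mk T = t := by
  obtain ⟨x, rfl⟩ := Quotient.exists_rep t
  obtain ⟨T, rfl⟩ := Quotient.exists_rep x
  exact ⟨T, rfl⟩

/-- The tree `mk T` of the stratum `{2}` is modelled by a level tree with `N = 1` and finite spine. -/
theorem exists_model (t : stratum 3 {2}) : ∃ C ℓ T i, ∃ k : ℕ, mk T = t.1 ∧ Models C ℓ T i ∧
    C.N = 1 ∧ C.HasDepth k := by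
  obtain ⟨⟨t, T, rfl, hT⟩, rfl⟩ : ∃ s : stratum 3 {2}, s = t := ⟨t, rfl⟩
  obtain ⟨C, ℓ, i, h⟩ := T.exists_models
  have hT' : mk T ∈ stratum 3 {2} := ⟨T, rfl, hT⟩
  rcases C.hasSp_or_hasDepth with hs | ⟨k, hk⟩
  · rw [mem_stratum_of_hasSp h hs] at hT'
    simp at hT'
  · rcases h.N_eq with hN | ⟨k', hN, hk'⟩
    · exact ⟨C, ℓ, T, i, k, rfl, h, hN, hk⟩
    · rw [mem_stratum_of_N_eq_two h hk' hN] at hT'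
      have := congrArg Multiset.card hT'
      simp at this

theorem exists_models_of_N_eq_one {C : CTree} (hN : C.N = 1) : ∃ T i, Models C (fun k => 3 ^ k) T i :=
  C.exists_models (CTree.isBranched_of_N_eq_one hN) _ (fun k => by positivity) fun k => by
    rw [hN]; push_cast; rw [zpow_add_one₀ (by norm_num)]; ring

/-- If `N = 1`, then the metric is unique up to a factor. -/
theorem mk_eq_of_N_eq_one (h : Models C ℓ T i) (hN : C.N = 1) {C' : CTree} {ℓ' : ℤ → ℝ}
    {T' : MetrizedTree 3} {i' : C'.V → T'.V}
    (h' : Models C' ℓ' T' i') {f : C.V → C'.V} (hf : CTree.IsIso C C' f) : mk T = mk T' := by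
  refine h.mk_eq h' hf (div_pos (h'.pos 0) (h.pos 0)) (CTree.eq_mul_of_scale (N := 1) le_rfl
    (h.scale_one hN) (h'.scale_one (hf.N_eq.symm.trans hN)) fun j hj => ?_)
  rw [show j = 0 by omega]
  exact (div_mul_cancel₀ _ (h.pos 0).ne').symm

/-- If `N = 2`, then the metric is determined up to a factor by the ratio of the lengths of two
consecutive edges. -/
theorem mk_eq_of_N_eq_two (h : Models C ℓ T i) (hN : C.N = 2) {C' : CTree} {ℓ' : ℤ → ℝ}
    {T' : MetrizedTree 3} {i' : C'.V → T'.V}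
    (h' : Models C' ℓ' T' i') {f : C.V → C'.V} (hf : CTree.IsIso C C' f)
    (hr : ℓ 1 / (ℓ 0 + ℓ 1) = ℓ' 1 / (ℓ' 0 + ℓ' 1)) : mk T = mk T' := by
  have h0 := h.pos 0
  have h1 := h.pos 1
  have h0' := h'.pos 0
  have h1' := h'.pos 1
  rw [div_eq_div_iff (by positivity) (by positivity)] at hr
  refine h.mk_eq h' hf (div_pos h0' h0) (CTree.eq_mul_of_scale C.N_pos
    h.scale (by rw [hf.N_eq]; exact h'.scale) fun j hj => ?_)
  rw [hN] at hj
  interval_cases j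
  · exact (div_mul_cancel₀ _ h0.ne').symm
  · rw [div_mul_eq_mul_div, eq_div_iff h0.ne']
    push_cast
    linarith

/-- A level tree in the class `t`. -/
noncomputable def rep (t : stratum 3 {2}) : CTree := (exists_model t).choose

theorem rep_spec (t : stratum 3 {2}) : ∃ ℓ T i, ∃ k : ℕ, mk T = t.1 ∧ Models (rep t) ℓ T i ∧
    (rep t).N = 1 ∧ (rep t).HasDepth k := (exists_model t).choose_spec

/-- The depth at which the spine of a level tree in the class `t` ends. -/
noncomputable def dep (t : stratum 3 {2}) : ℕ := (rep_spec t).choose_spec.choose_spec.choose_spec.choose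

theorem rep_dep_spec (t : stratum 3 {2}) : ∃ ℓ T i, mk T = t.1 ∧ Models (rep t) ℓ T i ∧
    (rep t).N = 1 ∧ (rep t).HasDepth (dep t) :=
  ⟨_, _, _, (rep_spec t).choose_spec.choose_spec.choose_spec.choose_spec⟩

theorem isClassification : IsClassification rep dep where
  N_eq t := by
    obtain ⟨-, -, -, -, -, h, -⟩ := rep_dep_spec t
    exact h
  hasDepth t := by
    obtain ⟨-, -, -, -, -, -, h⟩ := rep_dep_spec t
    exact h
  eq_of_isIso t t' f hf := by
    obtain ⟨ℓ, T, i, ht, h, hN, -⟩ := rep_dep_spec t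
    obtain ⟨ℓ', T', i', ht', h', -⟩ := rep_dep_spec t'
    exact Subtype.ext (by rw [← ht, ← ht']; exact mk_eq_of_N_eq_one h hN h' hf)
  exists_isIso C k hN hk := by
    obtain ⟨T, i, h⟩ := exists_models_of_N_eq_one hN
    obtain ⟨ℓ', T', i', ht', h', -⟩ := rep_dep_spec ⟨mk T, (mem_stratum_of_N_eq_one h hk hN _).2 rfl⟩
    exact ⟨_, (h.exists_isIso_of_mk_eq h' ht'.symm).1⟩

end ProjTreeSpace

/-! ### Coordinates on the space of trees -/

open CTree

section Coordinates

variable {V : Type*} (rep : V → CTree) (dep : V → ℕ)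

open Classical in
/-- The indicator of the level trees that extend `rep v`. -/
noncomputable def extendsIndicator (C : CTree) (v : V) : ℝ := if Extends rep dep v C then 1 else 0

open Classical in
/-- The coordinate with index `v` tells whether a tree extends `rep v`.  A tree with two grand orbits
of critical points lies on the edge between the classes of its halves. The weight of the even half
is the share of the edges above the even levels, which shrink to points as the tree tends to
the odd half. -/
noncomputable def levelCoord (C : CTree) (ℓ : ℤ → ℝ) (v : V) : ℝ :=
  if hN : C.N = 2 then
    (ℓ 0 * extendsIndicator rep dep (C.even hN) v + ℓ 1 * extendsIndicator rep dep (C.odd hN) v) /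
      (ℓ 0 + ℓ 1)
  else extendsIndicator rep dep C v

variable {rep dep}

theorem extendsIndicator_congr {C C' : CTree} {v : V} (h : Agree (dep v) C C') :
    extendsIndicator rep dep C v = extendsIndicator rep dep C' v := by
  unfold extendsIndicator
  congr 1
  exact propext ⟨fun h' => Agree.trans h' h, fun h' => Agree.trans h' h.symm⟩

theorem CTree.Agree.half {C C' : CTree} (hN : C.N = 2) (hN' : C'.N = 2) {ε : ℤ} (hε : ε = 0 ∨ ε = 1)
    {k : ℕ} (h : Agree (2 * k) C C') : Agree k (C.half hN ε hε) (C'.half hN' ε hε) := by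
  obtain ⟨f, hf⟩ := h
  obtain ⟨g, hg, -⟩ := hf.half hN hN' hε (k := k) (by rcases hε with rfl | rfl <;> push_cast <;> omega)
  exact ⟨g, hg⟩

theorem levelCoord_congr {C C' : CTree} {v : V} (h : Agree (2 * dep v) C C') (ℓ : ℤ → ℝ) :
    levelCoord rep dep C ℓ v = levelCoord rep dep C' ℓ v := by
  have hNN : C.N = C'.N := by
    obtain ⟨f, hf⟩ := h
    exact hf.N_eq
  unfold levelCoord
  by_cases hN : C.N = 2
  · rw [dif_pos hN, dif_pos (hNN.symm.trans hN),
      extendsIndicator_congr (h.half hN (hNN.symm.trans hN) (Or.inl rfl)),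
      extendsIndicator_congr (h.half hN (hNN.symm.trans hN) (Or.inr rfl))]
  · rw [dif_neg hN, dif_neg (fun e => hN (hNN.trans e)), extendsIndicator_congr (h.mono (by omega))]

theorem levelCoord_smul {c : ℝ} (hc : c ≠ 0) (C : CTree) (ℓ : ℤ → ℝ) (v : V) :
    levelCoord rep dep C (fun k => c * ℓ k) v = levelCoord rep dep C ℓ v := by
  unfold levelCoord
  split_ifs with hN
  · simp only
    rw [mul_assoc, mul_assoc, ← mul_add, ← mul_add, mul_div_mul_left _ _ hc]
  · rfl

theorem levelCoord_of_N_eq_one {C : CTree} (hN : C.N = 1) (ℓ : ℤ → ℝ) (v : V) :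
    levelCoord rep dep C ℓ v = extendsIndicator rep dep C v := by
  rw [levelCoord, dif_neg (by omega)]

end Coordinates

namespace ProjTreeSpace

theorem exists_models (t : ProjTreeSpace 3) : ∃ C ℓ T i, mk T = t ∧ Models C ℓ T i := by
  obtain ⟨T, rfl⟩ := exists_mk t
  obtain ⟨C, ℓ, i, h⟩ := T.exists_models
  exact ⟨C, ℓ, T, i, rfl, h⟩

/-- The coordinates of a point of `ℙ𝒯₃`. -/
noncomputable def coord (t : ProjTreeSpace 3) : stratum 3 {2} → ℝ :=
  levelCoord rep dep (exists_models t).choose (exists_models t).choose_spec.choose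

theorem coord_mk {C : CTree} {ℓ : ℤ → ℝ} {T : MetrizedTree 3} {i : C.V → T.V} (h : Models C ℓ T i) :
    coord (mk T) = levelCoord rep dep C ℓ := by
  obtain ⟨T', i', ht, h'⟩ := (exists_models (mk T)).choose_spec.choose_spec
  obtain ⟨⟨f, hf⟩, c, hc, hℓ⟩ := h.exists_isIso_of_mk_eq h' ht.symm
  funext v
  unfold coord
  rw [show (exists_models (mk T)).choose_spec.choose = fun k => c * ℓ k from funext hℓ,
    levelCoord_smul hc.ne', levelCoord_congr (hf.agree _)]

theorem stratum_unique {t : ProjTreeSpace 3} {p p' : Multiset ℕ} (h : t ∈ stratum 3 p)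
    (h' : t ∈ stratum 3 p') : p = p' := by
  obtain ⟨C, ℓ, T, i, rfl, hT⟩ := exists_models t
  rcases C.hasSp_or_hasDepth with hs | ⟨k, hk⟩
  · rw [mem_stratum_of_hasSp hT hs] at h h'
    rw [h, h']
  · rcases hT.N_eq with hN | ⟨k', hN, hk'⟩
    · rw [mem_stratum_of_N_eq_one hT hk hN] at h h'
      rw [h, h']
    · rw [mem_stratum_of_N_eq_two hT hk' hN] at h h'
      rw [h, h']

end ProjTreeSpace

/-! ### The bijection between the completed tree and the space of trees -/

theorem Realization.eq_or_eq {V : Type*} {G : SimpleGraph V} (x : Realization G) {u w v : V}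
    (huw : u ≠ w) (hu : x.1 u ≠ 0) (hw : x.1 w ≠ 0) (hv : x.1 v ≠ 0) : v = u ∨ v = w := by
  obtain ⟨-, ⟨a, b, -, h⟩, -⟩ := x.2
  have h1 := h u hu
  have h2 := h w hw
  have h3 := h v hv
  grind

theorem Realization.exists_edge {V : Type*} {G : SimpleGraph V} {u w : V} (h : G.Adj u w) {s : ℝ}
    (h0 : 0 ≤ s) (h1 : s ≤ 1) : ∃ x : Realization G, x.1 u = s ∧ x.1 w = 1 - s := by
  classical
  have hne : w ≠ u := h.ne.symm
  refine ⟨⟨fun v => if v = u then s else if v = w then 1 - s else 0, fun v => ?_, ⟨u, w, Or.inr h,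
    fun v hv => ?_⟩, ?_⟩, by simp, by simp [hne]⟩
  · change 0 ≤ if v = u then s else if v = w then 1 - s else 0
    split_ifs <;> linarith
  · grind
  · rw [finsum_eq_sum_of_support_subset (s := {u, w}) _ fun v hv => ?_, Finset.sum_pair hne.symm]
    · simp [hne]
    · rw [Function.mem_support] at hv
      simp only [Finset.coe_insert, Finset.coe_singleton, Set.mem_insert_iff, Set.mem_singleton_iff]
      grind

theorem Realization.cases {V : Type*} {G : SimpleGraph V} (x : Realization G) :
    (∃ v, x = Realization.vertex G v) ∨
    ∃ u w, G.Adj u w ∧ 0 < x.1 u ∧ 0 < x.1 w ∧ x.1 u + x.1 w = 1 := by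
  classical
  obtain ⟨h0, ⟨a, b, hab, h⟩, hsum⟩ := x.2
  have hvertex : ∀ v, (∀ w, x.1 w ≠ 0 → w = v) → x = Realization.vertex G v := by
    intro v hv
    have h1 : x.1 v = 1 := by
      rw [← hsum, finsum_eq_single _ v fun w hw => by_contra fun h => hw (hv w h)]
    refine Subtype.ext (funext fun w => ?_)
    change x.1 w = (Pi.single v 1 : V → ℝ) w
    by_cases hw : w = v
    · rw [hw, h1, Pi.single_eq_same]
    · rw [Pi.single_eq_of_ne hw]
      exact by_contra fun h => hw (hv w h)
  by_cases ha : x.1 a = 0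
  · exact Or.inl ⟨b, hvertex b fun w hw => (h w hw).resolve_left fun e => hw (e ▸ ha)⟩
  by_cases hb : x.1 b = 0
  · exact Or.inl ⟨a, hvertex a fun w hw => (h w hw).resolve_right fun e => hw (e ▸ hb)⟩
  rcases hab with rfl | hab
  · exact Or.inl ⟨a, hvertex a fun w hw => (h w hw).elim id id⟩
  refine Or.inr ⟨a, b, hab, (h0 a).lt_of_ne' ha, (h0 b).lt_of_ne' hb, ?_⟩
  rw [← hsum, finsum_eq_sum_of_support_subset (s := {a, b}) _ fun w hw => ?_,
    Finset.sum_pair hab.ne]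
  rw [Function.mem_support] at hw
  simpa using h w hw

theorem Realization.vertex_apply {V : Type*} [DecidableEq V] (G : SimpleGraph V) (v w : V) :
    (Realization.vertex G v).1 w = if w = v then 1 else 0 := by
  unfold Realization.vertex
  simp only [Pi.single_apply]
  congr

namespace ProjTreeSpace

/-- The point of the completion of `P` that corresponds to a point of `ℙ𝒯₃`.  A tree with
two grand orbits of critical points corresponds to the point of an edge of `P` whose end `u` away
from the root is its odd half. -/
inductive Corresponds {P : SimpleGraph (stratum 3 {2})} (q : stratum 3 {2} → stratum 3 {2})
    (R : P.end → ℕ → stratum 3 {2}) : EndCompletion P → ProjTreeSpace 3 → Prop where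
  | vertex (v : stratum 3 {2}) : Corresponds q R (.point (Realization.vertex P v)) v.1
  | edge {C : CTree} {ℓ : ℤ → ℝ} {T : MetrizedTree 3} {i : C.V → T.V} (h : Models C ℓ T i)
      (hN : C.N = 2) {k : ℕ} (hk : C.HasDepth (2 * k + 1)) {u : stratum 3 {2}}
      {φ : (C.odd hN).V → (rep u).V} (hφ : IsIso (C.odd hN) (rep u) φ) {x : Realization P}
      (hx : x.1 u = ℓ 1 / (ℓ 0 + ℓ 1)) (hx' : x.1 (q u) = ℓ 0 / (ℓ 0 + ℓ 1)) :
      Corresponds q R (.point x) (mk T)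
  | endpt {C : CTree} {ℓ : ℤ → ℝ} {T : MetrizedTree 3} {i : C.V → T.V} (h : Models C ℓ T i)
      (hN : C.N = 1) {e : P.end} (he : ∀ n, Extends rep dep (R e n) C) :
      Corresponds q R (.endpt e) (mk T)

section

variable {P : SimpleGraph (stratum 3 {2})} {o : stratum 3 {2}} {q : stratum 3 {2} → stratum 3 {2}}
  {R : P.end → ℕ → stratum 3 {2}}

/-- A point of the completion corresponds to at most one tree. -/
theorem Corresponds.unique (hP : IsRooted P o q dep)
    (hR : ∀ e, IsRootRay o q (R e) ∧ RayToEnd dep e (R e)) {y y' : EndCompletion P}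
    {t t' : ProjTreeSpace 3} (h : Corresponds q R y t) (h' : Corresponds q R y' t') (hy : y = y') :
    t = t' := by
  classical
  have hne : ∀ u, dep u ≠ 0 → u ≠ q u := fun u hu e => by
    have := hP.dep_parent u (hP.ne_root hu)
    rw [← e] at this
    omega
  have hdep : ∀ {C : CTree} (hN : C.N = 2) {k : ℕ} (_ : C.HasDepth (2 * k + 1)) {u : stratum 3 {2}}
      {φ : (C.odd hN).V → (rep u).V} (_ : IsIso (C.odd hN) (rep u) φ), dep u = k + 1 :=
    fun {C} hN {k} hk {u φ} hφ => isClassification.dep_eq hφ (odd_hasDepth hN hk)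
  -- a vertex has no two positive weights
  have hve : ∀ (v u : stratum 3 {2}) (x : Realization P) {ℓ : ℤ → ℝ}, (∀ k, 0 < ℓ k) → dep u ≠ 0 →
      x.1 u = ℓ 1 / (ℓ 0 + ℓ 1) → x.1 (q u) = ℓ 0 / (ℓ 0 + ℓ 1) → x ≠ Realization.vertex P v := by
    rintro v u x ℓ hℓ hu hx hx' rfl
    have h0 := hℓ 0
    have h1 := hℓ 1
    rw [Realization.vertex_apply] at hx hx'
    split_ifs at hx hx' with e1 e2
    · exact hne u hu (e1.trans e2.symm)
    · have : 0 < ℓ 0 / (ℓ 0 + ℓ 1) := by positivity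
      linarith
    all_goals
      have : 0 < ℓ 1 / (ℓ 0 + ℓ 1) := by positivity
      linarith
  cases h with
  | vertex v =>
    cases h' with
    | vertex v' =>
      have h1 := congrArg (fun x : Realization P => x.1 v) (EndCompletion.point.inj hy)
      simp only [Realization.vertex_apply] at h1
      by_cases hv : v = v'
      · rw [hv]
      · simp [hv] at h1
    | edge h hN hk hφ hx hx' =>
      exact absurd (EndCompletion.point.inj hy).symm
        (hve v _ _ h.pos (by rw [hdep hN hk hφ]; omega) hx hx')
    | endpt h hN he => cases hy
  | @edge C ℓ T i h hN k hk u φ hφ x hx hx' =>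
    have hu := hdep hN hk hφ
    cases h' with
    | vertex v' =>
      exact absurd (EndCompletion.point.inj hy) (hve v' _ _ h.pos (by omega) hx hx')
    | @edge C' ℓ' T' i' h' hN' k' hk' u' φ' hφ' x' hy1 hy2 =>
      have hu' := hdep hN' hk' hφ'
      obtain rfl : x = x' := EndCompletion.point.inj hy
      have h0 := h.pos 0
      have h1 := h.pos 1
      have h0' := h'.pos 0
      have h1' := h'.pos 1
      have p1 : x.1 u ≠ 0 := by rw [hx]; positivity
      have p2 : x.1 (q u) ≠ 0 := by rw [hx']; positivity
      have p3 : x.1 u' ≠ 0 := by rw [hy1]; positivity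
      have p4 : x.1 (q u') ≠ 0 := by rw [hy2]; positivity
      obtain rfl : u' = u := by
        rcases Realization.eq_or_eq x (hne u (by omega)) p1 p2 p3 with e | e
        · exact e
        · have a1 := hP.dep_parent u (hP.ne_root (by omega))
          have a2 := hP.dep_parent u' (hP.ne_root (by omega))
          rcases Realization.eq_or_eq x (hne u (by omega)) p1 p2 p4 with e' | e'
          · rw [e'] at a2
            rw [← e] at a1
            omega
          · exact absurd (e.trans e'.symm) (hne u' (by omega))
      obtain rfl : k = k' := by omega
      obtain ⟨g, hg, -⟩ := hφ'.exists_inv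
      obtain ⟨f, hf⟩ := exists_isIso_of_odd hN hN' hk hk' (hg.comp hφ)
      exact mk_eq_of_N_eq_two h hN h' hf (hx.symm.trans hy1)
    | endpt h hN he => cases hy
  | endpt h hN he =>
    cases h' with
    | vertex v' => cases hy
    | edge h hN hk hφ hx hx' => cases hy
    | endpt h' hN' he' =>
      obtain rfl := EndCompletion.endpt.inj hy
      obtain ⟨f, hf⟩ := exists_isIso_of_isPIso fun k => by
        have h1 := (he k).symm.trans (he' k)
        rwa [hP.dep_ray (hR _).1] at h1
      exact mk_eq_of_N_eq_one h hN h' hf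

/-- Each tree corresponds to a point: the truncations of a level tree with infinite spine form a ray. -/
theorem corresponds_total_right (hP : IsRooted P o q dep) (hf : ∀ v, (P.neighborSet v).Finite)
    (hR : ∀ e, IsRootRay o q (R e) ∧ RayToEnd dep e (R e))
    (hanc : ∀ u v, IsAncestor q dep u v ↔ Extends rep dep u (rep v)) (t : ProjTreeSpace 3) :
    ∃ y, Corresponds q R y t := by
  obtain ⟨C, ℓ, T, i, rfl, h⟩ := exists_models t
  rcases h.N_eq with hN | ⟨k, hN, hk⟩
  · rcases C.hasSp_or_hasDepth with hs | ⟨k, hk⟩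
    · choose ξ hξ hext using fun n => isClassification.exists_extends hN (hs n)
      have hray : IsRootRay o q ξ := by
        have hne : ∀ n, ξ (n + 1) ≠ o := fun n => hP.ne_root (by rw [hξ]; omega)
        have hpar : ∀ n, dep (q (ξ (n + 1))) = n := fun n => by
          have := hP.dep_parent _ (hne n)
          rw [hξ] at this
          omega
        refine ⟨(hP.dep_eq_zero _).1 (hξ 0), hne, fun n => ?_⟩
        refine isClassification.eq_of_extends ((hpar n).trans (hξ n).symm) ?_ (hext n)
        exact isClassification.extends_trans ((hanc _ _).1 ⟨1, by rw [hξ]; omega, rfl⟩) (hext (n + 1))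
      obtain ⟨e, he⟩ := hP.exists_end hray
      have hRe : R e = ξ := hP.ray_unique hf (hR e).1 hray (hR e).2 he
      exact ⟨_, .endpt h hN (e := e) fun n => by rw [hRe]; exact hext n⟩
    · exact ⟨_, .vertex ⟨mk T, (mem_stratum_of_N_eq_one h hk hN _).2 rfl⟩⟩
  · obtain ⟨u, φ, hφ⟩ := isClassification.exists_isIso (C.odd hN) (k + 1) rfl (odd_hasDepth hN hk)
    have hu := isClassification.dep_eq hφ (odd_hasDepth hN hk)
    have h0 := h.pos 0
    have h1 := h.pos 1
    obtain ⟨x, hx, hx'⟩ := Realization.exists_edge (hP.adj_parent (hP.ne_root (v := u) (by omega)))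
      (s := ℓ 1 / (ℓ 0 + ℓ 1)) (by positivity) (by rw [div_le_one (by positivity)]; linarith)
    refine ⟨_, .edge h hN hk hφ hx (hx'.trans ?_)⟩
    field_simp
    ring

/-- Each point corresponds to a tree. For an end the tree is a limit of the vertices on the ray to it. -/
theorem corresponds_total_left (hP : IsRooted P o q dep)
    (hR : ∀ e, IsRootRay o q (R e) ∧ RayToEnd dep e (R e))
    (hanc : ∀ u v, IsAncestor q dep u v ↔ Extends rep dep u (rep v)) (y : EndCompletion P) :
    ∃ t, Corresponds q R y t := by
  rcases y with x | e
  · rcases Realization.cases x with ⟨v, rfl⟩ | ⟨a, b, hab, ha, hb, hsum⟩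
    · exact ⟨_, .vertex v⟩
    · obtain ⟨u, hu, h0, h1, hs⟩ : ∃ u, u ≠ o ∧ 0 < x.1 u ∧ 0 < x.1 (q u) ∧
          x.1 u + x.1 (q u) = 1 := by
        rcases (hP.adj_iff _ _).1 hab with ⟨h, rfl⟩ | ⟨h, rfl⟩
        · exact ⟨a, h, ha, hb, hsum⟩
        · exact ⟨b, h, hb, ha, by linarith⟩
      obtain ⟨k, hk⟩ : ∃ k, dep u = k + 1 := ⟨_, (hP.dep_parent u hu).symm⟩
      obtain ⟨C, hN, hC, f, hf⟩ := exists_odd (isClassification.N_eq u)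
        (hk ▸ isClassification.hasDepth u)
      obtain ⟨g, hg, -⟩ := hf.exists_inv
      let ℓ : ℤ → ℝ := fun k => 3 ^ (k / 2) * if k % 2 = 0 then x.1 (q u) else x.1 u
      obtain ⟨T, i, h⟩ := C.exists_models (isBranched_of_N_eq_two hN hC (by omega)) ℓ
        (fun k => by simp only [ℓ]; split_ifs <;> positivity) fun k => by
          rw [hN]
          simp only [ℓ]
          rw [show (k + (2 : ℕ)) / 2 = k / 2 + 1 by omega, show (k + (2 : ℕ)) % 2 = k % 2 by omega,
            zpow_add_one₀ (by norm_num)]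
          ring
      have e0 : ℓ 0 = x.1 (q u) := by simp [ℓ]
      have e1 : ℓ 1 = x.1 u := by simp [ℓ]
      refine ⟨_, .edge h hN hC hg ?_ ?_⟩
      · rw [e0, e1, add_comm, hs, div_one]
      · rw [e0, e1, add_comm, hs, div_one]
  · have hr := (hR e).1
    obtain ⟨C, hN, hC⟩ := exists_limit (hyperfilter ℕ) Nat.hyperfilter_le_atTop
      (fun n => rep (R e n)) 1 fun n => isClassification.N_eq _
    obtain ⟨T, i, h⟩ := exists_models_of_N_eq_one hN
    refine ⟨_, .endpt h hN fun k => ?_⟩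
    have hlarge : ∀ᶠ n in (hyperfilter ℕ : Filter ℕ), k ≤ n :=
      Nat.hyperfilter_le_atTop (eventually_ge_atTop k)
    obtain ⟨n, hn, hkn⟩ := ((hC k).and hlarge).exists
    have h1 : Extends rep dep (R e k) (rep (R e n)) := by
      rw [← hanc]
      have := hr.isAncestor hP (n - k) k
      rwa [Nat.add_sub_cancel' hkn] at this
    unfold Extends at h1 ⊢
    rw [hP.dep_ray hr] at h1 ⊢
    exact h1.trans (Agree.symm hn)

/-- Corresponding points have the same coordinates. -/
theorem Corresponds.coord_eq (hP : IsRooted P o q dep)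
    (hR : ∀ e, IsRootRay o q (R e) ∧ RayToEnd dep e (R e))
    (hanc : ∀ u v, IsAncestor q dep u v ↔ Extends rep dep u (rep v)) {y : EndCompletion P}
    {t : ProjTreeSpace 3} (h : Corresponds q R y t) : coord t = endCoord q dep R y := by
  classical
  have hind : ∀ u v, ancestorIndicator q dep v u = extendsIndicator rep dep (rep u) v := fun u v => by
    unfold ancestorIndicator extendsIndicator
    congr 1
    exact propext (hanc v u)
  funext w
  cases h with
  | vertex v =>
    obtain ⟨ℓ, T, i, ht, h, hN, -⟩ := rep_dep_spec v
    rw [← ht, coord_mk h, levelCoord_of_N_eq_one hN, endCoord_point (s := {v}) fun u hu => ?_]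
    · rw [Finset.sum_singleton, Realization.vertex_apply, if_pos rfl, one_mul, hind]
    · rw [Finset.mem_singleton]
      by_contra hne
      rw [Realization.vertex_apply, if_neg hne] at hu
      exact hu rfl
  | @edge C ℓ T i h hN k hk u φ hφ x hx hx' =>
    have h0 := h.pos 0
    have h1 := h.pos 1
    have hu := isClassification.dep_eq hφ (odd_hasDepth hN hk)
    have huo : u ≠ o := hP.ne_root (by omega)
    have hd := hP.dep_parent u huo
    have hne : u ≠ q u := fun e => by rw [← e] at hd; omega
    -- the even half is the parent of the odd half
    have hev : ∀ l, Agree l (C.even hN) (rep (q u)) := by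
      obtain ⟨v, ψ, hψ⟩ := isClassification.exists_isIso (C.even hN) k rfl (even_hasDepth hN hk)
      have hv := isClassification.dep_eq hψ (even_hasDepth hN hk)
      obtain rfl : v = q u := by
        refine isClassification.eq_of_extends (C := rep u) (by omega) ?_
          ((hanc _ _).1 ⟨1, by omega, rfl⟩)
        unfold Extends
        rw [hv]
        exact (hψ.agree k).symm.trans
          (Agree.trans (exists_isPIso_even_odd hN (hk.1.mono (by omega))) (hφ.agree k))
      exact hψ.agree
    rw [coord_mk h, levelCoord, dif_pos hN, extendsIndicator_congr (hev _),
      extendsIndicator_congr (hφ.agree _), endCoord_point (s := {u, q u}) fun v hv => ?_]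
    · rw [Finset.sum_pair hne, hx, hx', hind, hind]
      ring
    · rw [Finset.mem_insert, Finset.mem_singleton]
      exact Realization.eq_or_eq x hne (by rw [hx]; positivity) (by rw [hx']; positivity) hv
  | @endpt C ℓ T i h hN e he =>
    rw [coord_mk h, levelCoord_of_N_eq_one hN]
    have hiff : Extends rep dep w C ↔ R e (dep w) = w :=
      ⟨fun hw => isClassification.eq_of_extends (hP.dep_ray (hR e).1 _) (he _) hw, fun hw => hw ▸ he _⟩
    by_cases hw : Extends rep dep w C
    · rw [extendsIndicator, if_pos hw]
      exact (if_pos (hiff.1 hw)).symm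
    · rw [extendsIndicator, if_neg hw]
      exact (if_neg (mt hiff.2 hw)).symm

/-- The points of `ℙ𝒯₃` correspond to those of the completion of `P`, and have the same coordinates. -/
theorem exists_equiv (hP : IsRooted P o q dep) (hf : ∀ v, (P.neighborSet v).Finite)
    (hR : ∀ e, IsRootRay o q (R e) ∧ RayToEnd dep e (R e))
    (hanc : ∀ u v, IsAncestor q dep u v ↔ Extends rep dep u (rep v)) :
    ∃ Φ : EndCompletion P ≃ ProjTreeSpace 3, (∀ y, coord (Φ y) = endCoord q dep R y) ∧
      ∀ y, Corresponds q R y (Φ y) := by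
  choose Φ hΦ using corresponds_total_left hP hR hanc
  have hbij : Function.Bijective Φ := by
    refine ⟨fun y y' hy => hP.endCoord_injective hf hR ?_, fun t => ?_⟩
    · rw [← (hΦ y).coord_eq hP hR hanc, ← (hΦ y').coord_eq hP hR hanc, hy]
    · obtain ⟨y, hy⟩ := corresponds_total_right hP hf hR hanc t
      exact ⟨y, (hΦ y).unique hP hR hy rfl⟩
  exact ⟨Equiv.ofBijective Φ hbij, fun y => (hΦ y).coord_eq hP hR hanc, hΦ⟩

theorem Corresponds.mem_stratum (hP : IsRooted P o q dep)
    (hR : ∀ e, IsRootRay o q (R e) ∧ RayToEnd dep e (R e)) {y : EndCompletion P}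
    {t : ProjTreeSpace 3} (h : Corresponds q R y t) :
    (∃ v, y = .point (Realization.vertex P v) ∧ t = v.1) ∨
    (∃ x, y = .point x ∧ t ∈ stratum 3 {1, 1}) ∨ ∃ e, y = .endpt e ∧ t ∈ stratum 3 {1} := by
  cases h with
  | vertex v => exact Or.inl ⟨v, rfl, rfl⟩
  | edge h hN hk hφ hx hx' =>
    exact Or.inr (Or.inl ⟨_, rfl, (mem_stratum_of_N_eq_two h hk hN _).2 rfl⟩)
  | endpt h hN he =>
    refine Or.inr (Or.inr ⟨_, rfl, (mem_stratum_of_hasSp h (fun k => ?_) _).2 rfl⟩)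
    have := isClassification.hasSp_of_extends (he k)
    rwa [hP.dep_ray (hR _).1] at this

end

end ProjTreeSpace

/-! ### Collapses of tree-like pseudo-metrics -/

/-- A pseudo-metric that satisfies the four point condition, as the path metrics on trees do. -/
structure IsTreeMetric {X : Type*} (d : X → X → ℝ) : Prop where
  self : ∀ x, d x x = 0
  symm : ∀ x y, d x y = d y x
  four : ∀ x y z t, d x y + d z t ≤ max (d x z + d y t) (d x t + d y z)

/-- The point `y` lies on the geodesic between `x` and `z`. -/
def Between {X : Type*} (d : X → X → ℝ) (x y z : X) : Prop := d x y + d y z = d x z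

namespace IsTreeMetric

variable {X : Type*} {d : X → X → ℝ}

theorem triangle (h : IsTreeMetric d) (x y z : X) : d x z ≤ d x y + d y z := by
  have := h.four x z y y
  rw [h.self, h.symm z y, max_self, add_zero] at this
  exact this

theorem nonneg (h : IsTreeMetric d) (x y : X) : 0 ≤ d x y := by
  have := h.triangle x y x
  rw [h.self, h.symm y x] at this
  linarith

theorem congr_left (h : IsTreeMetric d) {x y : X} (h0 : d x y = 0) (z : X) : d x z = d y z := by
  have h1 := h.triangle x y z
  have h2 := h.triangle y x z
  rw [h.symm y x] at h2
  linarith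

theorem congr_right (h : IsTreeMetric d) {x y : X} (h0 : d x y = 0) (z : X) : d z x = d z y := by
  rw [h.symm z x, h.symm z y, h.congr_left h0]

theorem between_comm (h : IsTreeMetric d) {x y z : X} (hb : Between d x y z) : Between d z y x := by
  unfold Between at *
  rw [h.symm z y, h.symm y x, h.symm z x]
  linarith

theorem between_of_le (h : IsTreeMetric d) {x y z : X} (hb : d x y + d y z ≤ d x z) :
    Between d x y z := le_antisymm hb (h.triangle x y z)

theorem extend (h : IsTreeMetric d) {u y z w : X} (h1 : Between d u y z) (h2 : Between d y u w)
    (h0 : 0 < d u y) : Between d z u w := by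
  have h4 := h.four z u y w
  unfold Between at h1 h2
  have := h.symm z y
  have := h.symm z u
  have := h.symm u y
  rcases le_max_iff.1 h4 with h3 | h3
  · linarith
  · exact h.between_of_le (by linarith)

theorem beyond (h : IsTreeMetric d) {a b y : X} (u : X) (hy : Between d a y b) :
    Between d u y a ∨ Between d u y b := by
  have h4 := h.four u y a b
  unfold Between at hy
  have := h.symm y a
  rcases le_max_iff.1 h4 with h1 | h1
  · exact Or.inl (h.between_of_le (by linarith))
  · exact Or.inr (h.between_of_le (by linarith))

theorem median_unique (h : IsTreeMetric d) {a b c m u : X} (h1 : Between d a m b)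
    (h2 : Between d a m c) (h3 : Between d b m c) (h1' : Between d a u b) (h2' : Between d a u c)
    (h3' : Between d b u c) : d m u = 0 := by
  have h4 := h.four m u a b
  unfold Between at h1 h2 h3 h1' h2' h3'
  have := h.symm m a
  have := h.symm u a
  have := h.symm m b
  have := h.symm u b
  refine le_antisymm ?_ (h.nonneg _ _)
  rcases le_max_iff.1 h4 with h5 | h5 <;> linarith

end IsTreeMetric

namespace CTree

variable {C : CTree} {ℓ : ℤ → ℝ}

theorem isTreeMetric_dst (h : ∀ i, 0 ≤ ℓ i) : IsTreeMetric (C.dst ℓ) :=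
  ⟨dst_self, dst_comm, dst_four h⟩

theorem between_p {u w : C.V} (h : C.join u w ≠ C.lv u) : Between (C.dst ℓ) u (C.p u) w := by
  unfold Between
  rw [dst_p, dst, dst, join_p_of_ne C h, C.lv_p, hgt_add_one]
  ring

theorem eq_of_join {u w : C.V} (hu : C.join u w = C.lv u) (hw : C.join u w = C.lv w) : u = w := by
  have h1 := (C.join_eq_lv_iff.1 hu).2
  rw [← hu, hw, anc_self] at h1
  exact h1.symm

theorem between_p_iff (h : ∀ i, 0 < ℓ i) {u c : C.V} :
    Between (C.dst ℓ) u c (C.p u) ↔ c = u ∨ c = C.p u := by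
  refine ⟨fun hc => ?_, ?_⟩
  · unfold Between at hc
    rw [dst_p, dst_comm c] at hc
    by_cases hj : C.join u c = C.lv u
    · have h1 : C.dst ℓ u c = 0 := by
        rw [dst, dst, join_p_of_eq C hj, hj, C.lv_p, hgt_add_one] at hc
        rw [dst, hj]
        linarith
      exact Or.inl (eq_of_dst_eq_zero h h1).symm
    · have h1 := between_p (ℓ := ℓ) hj
      unfold Between at h1
      rw [dst_p] at h1
      exact Or.inr (eq_of_dst_eq_zero (ℓ := ℓ) h (by linarith)).symm
  · rintro (rfl | rfl)
    · unfold Between; rw [dst_self]; ring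
    · unfold Between; rw [dst_self]; ring

/-- Adjacency is determined by the metric. -/
theorem adj_iff_between (h : ∀ i, 0 < ℓ i) {u w : C.V} :
    C.G.Adj u w ↔ u ≠ w ∧ ∀ c, Between (C.dst ℓ) u c w → c = u ∨ c = w := by
  have hd := C.isTreeMetric_dst (ℓ := ℓ) fun i => (h i).le
  refine ⟨fun ha => ⟨ha.ne, fun c hc => ?_⟩, fun ⟨hne, hc⟩ => ?_⟩
  · rcases ha with rfl | rfl
    · exact (between_p_iff h).1 hc
    · exact ((between_p_iff h).1 (hd.between_comm hc)).symm
  · by_cases hj : C.join u w = C.lv u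
    · have hj' : C.join w u ≠ C.lv w := fun e => hne (eq_of_join hj (by rw [C.join_comm, e]))
      rcases hc _ (hd.between_comm (between_p hj')) with e | e
      · exact Or.inr e
      · exact absurd (congrArg C.lv e) (by rw [C.lv_p]; omega)
    · rcases hc _ (between_p hj) with e | e
      · exact absurd (congrArg C.lv e) (by rw [C.lv_p]; omega)
      · exact Or.inl e

/-- Any three vertices have a median. -/
theorem exists_median (h : ∀ i, 0 ≤ ℓ i) (a b c : C.V) : ∃ m, Between (C.dst ℓ) a m b ∧
    Between (C.dst ℓ) a m c ∧ Between (C.dst ℓ) b m c := by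
  have hd := C.isTreeMetric_dst h
  -- `m` is the lowest vertex above two of the three vertices
  have key : ∀ a b c : C.V, C.join a b ≤ C.join a c → C.join a b ≤ C.join b c →
      ∃ m, Between (C.dst ℓ) a m b ∧ Between (C.dst ℓ) a m c ∧ Between (C.dst ℓ) b m c := by
    intro a b c h1 h2
    have hla := C.lv_le_join_left a b
    have hlb := C.lv_le_join_right a b
    have hm : C.anc a (C.join a b) = C.anc b (C.join a b) := (C.join_le_iff.1 le_rfl).2.2
    have hda := C.join_anc hla
    have hdb := C.join_anc hlb
    have hlv := C.lv_anc hla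
    have hdc := C.join_le_max (C.anc a (C.join a b)) a c
    rw [C.join_comm _ a, hda, max_eq_right h1] at hdc
    have hdc' := C.join_le_max (C.anc b (C.join a b)) b c
    rw [C.join_comm (C.anc b _) b, hdb, max_eq_right h2] at hdc'
    have e1 : C.dst ℓ a (C.anc a (C.join a b)) = hgt ℓ (C.join a b) - hgt ℓ (C.lv a) := by
      rw [dst, hda, hlv]; ring
    have e2 : C.dst ℓ b (C.anc a (C.join a b)) = hgt ℓ (C.join a b) - hgt ℓ (C.lv b) := by
      rw [hm, dst, hdb, C.lv_anc hlb]; ring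
    have e3 : C.dst ℓ (C.anc a (C.join a b)) c ≤
        2 * hgt ℓ (C.join a c) - hgt ℓ (C.join a b) - hgt ℓ (C.lv c) := by
      have := hgt_mono h hdc
      rw [dst, hlv]; linarith
    have e4 : C.dst ℓ (C.anc a (C.join a b)) c ≤
        2 * hgt ℓ (C.join b c) - hgt ℓ (C.join a b) - hgt ℓ (C.lv c) := by
      have := hgt_mono h hdc'
      rw [hm, dst, C.lv_anc hlb]; linarith
    refine ⟨C.anc a (C.join a b), hd.between_of_le ?_, hd.between_of_le ?_, hd.between_of_le ?_⟩
    · rw [e1, dst_comm _ b, e2, dst]; linarith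
    · have : C.dst ℓ a c =
          2 * hgt ℓ (C.join a c) - hgt ℓ (C.lv a) - hgt ℓ (C.lv c) := rfl
      rw [e1]; linarith
    · have : C.dst ℓ b c =
          2 * hgt ℓ (C.join b c) - hgt ℓ (C.lv b) - hgt ℓ (C.lv c) := rfl
      rw [e2]; linarith
  rcases le_total (C.join a b) (C.join a c) with h1 | h1
  · rcases le_total (C.join a b) (C.join b c) with h2 | h2
    · exact key a b c h1 h2
    · obtain ⟨m, h3, h4, h5⟩ := key b c a (by rw [C.join_comm b a]; exact h2)
        (by rw [C.join_comm c a]; exact h2.trans h1)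
      exact ⟨m, hd.between_comm h4, hd.between_comm h5, h3⟩
  · rcases le_total (C.join a c) (C.join b c) with h2 | h2
    · obtain ⟨m, h3, h4, h5⟩ := key a c b h1 (by rw [C.join_comm c b]; exact h2)
      exact ⟨m, h4, h3, hd.between_comm h5⟩
    · obtain ⟨m, h3, h4, h5⟩ := key b c a (by rw [C.join_comm b a]; exact h2.trans h1)
        (by rw [C.join_comm c a]; exact h2)
      exact ⟨m, hd.between_comm h4, hd.between_comm h5, h3⟩

end CTree

open CTree

/-- The level tree `C` with edge lengths `ℓ` is the collapse of `X` with the pseudo-metric `d` and the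
dynamics `F`; the map `j` picks representatives. -/
structure IsLevelCollapse {X : Type*} (d : X → X → ℝ) (F : X → X) (C : CTree) (ℓ : ℤ → ℝ)
    (j : C.V → X) : Prop where
  pos : ∀ k, 0 < ℓ k
  scale : ∀ k, ℓ (k + C.N) = 3 * ℓ k
  dist_eq : ∀ u w, d (j u) (j w) = C.dst ℓ u w
  map_F : ∀ u, d (F (j u)) (j (C.F u)) = 0
  fill : ∀ x, ∃ u w, Between d (j u) x (j w)

namespace IsLevelCollapse

variable {X : Type*} {d : X → X → ℝ} {F : X → X} {C : CTree} {ℓ : ℤ → ℝ} {j : C.V → X}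

/-- A point of `X` represents a vertex or an inner point of an edge of the collapse. -/
theorem vertex_or_edge (h : IsLevelCollapse d F C ℓ j) (hd : IsTreeMetric d) (x : X) :
    ∃ u, d (j u) x = 0 ∨
      Between d (j u) x (j (C.p u)) ∧ 0 < d (j u) x ∧ 0 < d x (j (C.p u)) := by
  have key : ∀ (n : ℕ) (u w : C.V), Between d (j u) x (j w) →
      2 * C.join u w - C.lv u - C.lv w ≤ n → ∃ u, d (j u) x = 0 ∨ Between d (j u) x (j (C.p u)) := by
    intro n
    induction n with
    | zero =>
      intro u w hb hn
      have h1 := C.lv_le_join_left u w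
      have h2 := C.lv_le_join_right u w
      obtain rfl := eq_of_join (u := u) (w := w) (by omega) (by omega)
      refine ⟨u, Or.inl ?_⟩
      unfold Between at hb
      rw [hd.self, hd.symm x] at hb
      linarith
    | succ n ih =>
      have step : ∀ u w, Between d (j u) x (j w) →
          2 * C.join u w - C.lv u - C.lv w ≤ (n + 1 : ℕ) → C.join u w ≠ C.lv u →
          ∃ u, d (j u) x = 0 ∨ Between d (j u) x (j (C.p u)) := by
        intro u w hb hn hj
        rcases hd.beyond (j (C.p u)) hb with h1 | h1
        · exact ⟨u, Or.inr (hd.between_comm h1)⟩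
        · refine ih _ _ h1 ?_
          rw [join_p_of_ne C hj, C.lv_p]
          push_cast at hn
          omega
      intro u w hb hn
      by_cases hj : C.join u w = C.lv u
      · by_cases hj' : C.join u w = C.lv w
        · refine ih u w hb ?_
          omega
        · refine step w u (hd.between_comm hb) ?_ (by rwa [C.join_comm w u])
          rw [C.join_comm w u]; omega
      · exact step u w hb hn hj
  obtain ⟨u, w, hb⟩ := h.fill x
  have h1 := C.lv_le_join_left u w
  have h2 := C.lv_le_join_right u w
  obtain ⟨v, hv⟩ := key (2 * C.join u w - C.lv u - C.lv w).toNat u w hb (by omega)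
  by_cases h3 : d (j v) x = 0
  · exact ⟨v, Or.inl h3⟩
  by_cases h4 : d (j (C.p v)) x = 0
  · exact ⟨_, Or.inl h4⟩
  refine ⟨v, Or.inr ⟨hv.resolve_left h3, (hd.nonneg _ _).lt_of_ne' h3, (hd.nonneg _ _).lt_of_ne' ?_⟩⟩
  rwa [hd.symm]

theorem between_iff (h : IsLevelCollapse d F C ℓ j) {u v w : C.V} :
    Between d (j u) (j v) (j w) ↔ Between (C.dst ℓ) u v w := by
  unfold Between
  rw [h.dist_eq, h.dist_eq, h.dist_eq]

variable {C' : CTree} {ℓ' : ℤ → ℝ} {j' : C'.V → X}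

/-- A branch point is the median of three points beyond its neighbours. -/
theorem exists_of_branch (h : IsLevelCollapse d F C ℓ j) (h' : IsLevelCollapse d F C' ℓ' j')
    (hd : IsTreeMetric d) {v : C.V} (hv : 2 ≤ (C.children v).card) : ∃ v', d (j v) (j' v') = 0 := by
  obtain ⟨a, ha, b, hb, hab⟩ := Finset.one_lt_card.1 hv
  rw [mem_children] at ha hb
  have hpos : ∀ u, 0 < d (j u) (j (C.p u)) := fun u => by rw [h.dist_eq, dst_p]; exact h.pos _
  have hpos' : ∀ u, 0 < d (j (C.p u)) (j u) := fun u => by rw [hd.symm]; exact hpos u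
  have hla := C.lv_p a
  have hlb := C.lv_p b
  have hlv := C.lv_p v
  rw [ha] at hla
  rw [hb] at hlb
  have b1 : Between d (j a) (j v) (j b) := by
    rw [h.between_iff, ← ha]
    refine between_p fun e => hab ?_
    exact eq_of_join e (by omega)
  have hup : ∀ u, C.p u = v → Between d (j u) (j v) (j (C.p v)) := fun u hu => by
    rw [h.between_iff, ← hu]
    refine between_p fun e => ?_
    have := C.lv_le_join_right u (C.p (C.p u))
    rw [e, C.lv_p, C.lv_p] at this
    omega
  have b2 := hup a ha
  have b3 := hup b hb
  have hbey : ∀ u, ∃ z, Between d (j v) (j u) (j' z) := fun u => by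
    obtain ⟨z, z', hz⟩ := h'.fill (j u)
    rcases hd.beyond (j v) hz with h1 | h1
    · exact ⟨_, h1⟩
    · exact ⟨_, h1⟩
  obtain ⟨x, hx⟩ := hbey a
  obtain ⟨y, hy⟩ := hbey b
  obtain ⟨z, hz⟩ := hbey (C.p v)
  have pa : 0 < d (j v) (j a) := by rw [← ha]; exact hpos' a
  have pb : 0 < d (j v) (j b) := by rw [← hb]; exact hpos' b
  have comb : ∀ {s t : C.V} {s' t' : C'.V}, Between d (j s) (j v) (j t) → Between d (j v) (j s) (j' s') →
      Between d (j v) (j t) (j' t') → 0 < d (j v) (j s) → 0 < d (j v) (j t) →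
      Between d (j' s') (j v) (j' t') := fun h1 h2 h3 h4 h5 =>
    hd.between_comm (hd.extend h3 (hd.between_comm (hd.extend h2 h1 h4)) h5)
  obtain ⟨m, m1, m2, m3⟩ := C'.exists_median (fun i => (h'.pos i).le) x y z
  rw [← h'.between_iff] at m1 m2 m3
  refine ⟨m, ?_⟩
  rw [hd.symm]
  exact hd.median_unique m1 m2 m3 (comb b1 hx hy pa pb) (comb b2 hx hz pa (hpos v))
    (comb b3 hy hz pb (hpos v))

/-- An inner point of an edge is not mapped to a vertex. -/
theorem exists_of_image (h : IsLevelCollapse d F C ℓ j) (hd : IsTreeMetric d)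
    (hF : ∀ x y, d (F x) (F y) ≤ 3 * d x y) {x : X} {w : C.V} (hw : d (F x) (j w) = 0) :
    ∃ v, d x (j v) = 0 := by
  obtain ⟨u, hu | ⟨hb, h1, h2⟩⟩ := h.vertex_or_edge hd x
  · exact ⟨u, by rw [hd.symm]; exact hu⟩
  exfalso
  have h3 := hF (j u) x
  have h4 := hF x (j (C.p u))
  rw [hd.congr_left (h.map_F u), hd.congr_right hw, h.dist_eq] at h3
  rw [hd.congr_left hw, hd.congr_right (h.map_F _), h.dist_eq, C.F_p] at h4
  unfold Between at hb
  have h5 : d (j u) (j (C.p u)) = ℓ (C.lv u) := by rw [h.dist_eq, dst_p]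
  have h6 : C.dst ℓ (C.F u) (C.p (C.F u)) = 3 * ℓ (C.lv u) := by rw [dst_p, C.lv_F, h.scale]
  have h7 := (C.isTreeMetric_dst (ℓ := ℓ) fun i => (h.pos i).le).between_of_le
    (x := C.F u) (y := w) (z := C.p (C.F u)) (by linarith)
  rcases (between_p_iff h.pos).1 h7 with rfl | rfl <;> linarith

theorem iterate_F (h : IsLevelCollapse d F C ℓ j) (hd : IsTreeMetric d)
    (hF : ∀ x y, d (F x) (F y) ≤ 3 * d x y) {x : X} {u : C.V} (hu : d x (j u) = 0) (n : ℕ) :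
    d (F^[n] x) (j (C.F^[n] u)) = 0 := by
  induction n with
  | zero => exact hu
  | succ n ih =>
    rw [Function.iterate_succ_apply', Function.iterate_succ_apply', ← hd.congr_right (h.map_F _)]
    have := hF (F^[n] x) (j (C.F^[n] u))
    rw [ih] at this
    exact le_antisymm (by linarith) (hd.nonneg _ _)

/-- Each vertex of one collapse is a vertex of the other: its grand orbit contains a branch point, which
is a vertex of both, and vertices are preserved by images and preimages. -/
theorem exists_eq (h : IsLevelCollapse d F C ℓ j) (h' : IsLevelCollapse d F C' ℓ' j')
    (hd : IsTreeMetric d) (hF : ∀ x y, d (F x) (F y) ≤ 3 * d x y) (hC : C.IsBranched) (u : C.V) :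
    ∃ u', d (j u) (j' u') = 0 := by
  obtain ⟨w, ⟨n, m, hnm⟩, hw⟩ := hC u
  obtain ⟨w', hw'⟩ := h.exists_of_branch h' hd hw
  have hnm : C.F^[n] u = C.F^[m] w := hnm
  have h1 : d (F^[n] (j u)) (j' (C'.F^[m] w')) = 0 := by
    rw [hd.congr_left (h.iterate_F hd hF (hd.self (j u)) n), hnm,
      ← hd.congr_left (h.iterate_F hd hF (hd.self (j w)) m)]
    exact h'.iterate_F hd hF hw' m
  have key : ∀ (n : ℕ) (x : X), (∃ v, d (F^[n] x) (j' v) = 0) → ∃ v, d x (j' v) = 0 := by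
    intro n
    induction n with
    | zero => exact fun x hx => hx
    | succ n ih =>
      rintro x hx
      obtain ⟨v, hv⟩ := ih (F x) hx
      exact h'.exists_of_image hd hF hv
  exact key n _ ⟨_, h1⟩

/-- Two collapses of the same pseudo-metric are isometric. -/
theorem exists_isometry (h : IsLevelCollapse d F C ℓ j) (h' : IsLevelCollapse d F C' ℓ' j')
    (hd : IsTreeMetric d) (hF : ∀ x y, d (F x) (F y) ≤ 3 * d x y) (hC : C.IsBranched)
    (hC' : C'.IsBranched) : ∃ f : C.V → C'.V, Function.Bijective f ∧ (∀ u, f (C.F u) = C'.F (f u)) ∧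
      ∀ u w, C'.dst ℓ' (f u) (f w) = C.dst ℓ u w := by
  choose f hf using h.exists_eq h' hd hF hC
  have hdist : ∀ u w, C'.dst ℓ' (f u) (f w) = C.dst ℓ u w := fun u w => by
    rw [← h'.dist_eq, ← h.dist_eq, ← hd.congr_left (hf u), ← hd.congr_right (hf w)]
  refine ⟨f, ⟨fun u w huw => ?_, fun u' => ?_⟩, fun u => ?_, hdist⟩
  · refine eq_of_dst_eq_zero h.pos ?_
    rw [← hdist, huw, dst_self]
  · obtain ⟨u, hu⟩ := h'.exists_eq h hd hF hC' u'
    refine ⟨u, eq_of_dst_eq_zero h'.pos ?_⟩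
    rw [← h'.dist_eq, ← hd.congr_left (hf u), hd.symm, hu]
  · refine eq_of_dst_eq_zero h'.pos ?_
    rw [← h'.dist_eq, ← hd.congr_left (hf _), ← hd.congr_left (h.map_F u)]
    have := h'.iterate_F hd hF (hf u) 1
    exact this

end IsLevelCollapse

theorem Models.isLevelCollapse {C : CTree} {ℓ : ℤ → ℝ} {T : MetrizedTree 3} {i : C.V → T.V}
    (h : Models C ℓ T i) {A : PointedDynamics} {d : A.V → A.V → ℝ} {j : T.V → A.V}
    (h1 : ∀ u w, T.dist u w = d (j u) (j w)) (h2 : ∀ u, d (A.F (j u)) (j (T.F u)) = 0)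
    (h3 : ∀ x, ∃ u w, d (j u) x + d x (j w) = d (j u) (j w)) :
    IsLevelCollapse d A.F C ℓ (fun v => j (i v)) where
  pos := h.pos
  scale := h.scale
  dist_eq u w := by rw [← h1, h.dist_eq]
  map_F u := by rw [← h.map_F]; exact h2 _
  fill x := by
    obtain ⟨u, w, hb⟩ := h3 x
    obtain ⟨u, rfl⟩ := h.bij.2 u
    obtain ⟨w, rfl⟩ := h.bij.2 w
    exact ⟨u, w, hb⟩

theorem Models.equivalent_of_isometry {C C' : CTree} {ℓ ℓ' : ℤ → ℝ} {T T' : MetrizedTree 3}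
    {i : C.V → T.V} {i' : C'.V → T'.V} (h : Models C ℓ T i) (h' : Models C' ℓ' T' i') {f : C.V → C'.V}
    (hf : Function.Bijective f) (hF : ∀ u, f (C.F u) = C'.F (f u))
    (hd : ∀ u w, C'.dst ℓ' (f u) (f w) = C.dst ℓ u w) : MetrizedTree.Equivalent T T' := by
  have hadj : ∀ u w, C'.G.Adj (f u) (f w) ↔ C.G.Adj u w := fun u w => by
    rw [adj_iff_between (C := C) h.pos, adj_iff_between (C := C') h'.pos, hf.1.ne_iff, hf.2.forall]
    unfold Between
    simp only [hd, hf.1.eq_iff]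
  have hlen : ∀ {C : CTree} {ℓ : ℤ → ℝ} {T : MetrizedTree 3} {i : C.V → T.V}, Models C ℓ T i →
      ∀ u w, C.G.Adj u w → T.len s(i u, i w) = C.dst ℓ u w := by
    intro C ℓ T i h u w huw
    rcases huw with rfl | rfl
    · rw [h.len, dst_p]
    · rw [Sym2.eq_swap, h.len, dst_comm, dst_p]
  let a := Equiv.ofBijective i h.bij
  let b := Equiv.ofBijective i' h'.bij
  let e : T.V ≃ T'.V := a.symm.trans ((Equiv.ofBijective f hf).trans b)
  have he : ∀ v, e (i v) = i' (f v) := fun v => by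
    change i' (f (a.symm (a v))) = _
    rw [a.symm_apply_apply]
  refine ⟨⟨e, fun {x y} => ?_⟩, fun x => ?_, fun x y hxy => ?_⟩
  · obtain ⟨u, rfl⟩ := h.bij.2 x
    obtain ⟨w, rfl⟩ := h.bij.2 y
    rw [he, he, h'.adj, hadj, h.adj]
  · obtain ⟨u, rfl⟩ := h.bij.2 x
    change e _ = T'.F (e _)
    rw [h.map_F, he, he, hF, h'.map_F]
  · obtain ⟨u, rfl⟩ := h.bij.2 x
    obtain ⟨w, rfl⟩ := h.bij.2 y
    rw [h.adj] at hxy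
    change T'.len s(e _, e _) = _
    rw [he, he, hlen h' _ _ ((hadj u w).2 hxy), hlen h _ _ hxy, hd]

/-- The collapse of a pseudo-metric is unique. -/
theorem MetrizedTree.IsCollapse.equivalent {A : PointedDynamics} {d : A.V → A.V → ℝ}
    (hd : IsTreeMetric d) (hF : ∀ x y, d (A.F x) (A.F y) ≤ 3 * d x y) {T T' : MetrizedTree 3}
    (h : IsCollapse A d T) (h' : IsCollapse A d T') : Equivalent T T' := by
  obtain ⟨j, h1, h2, h3⟩ := h
  obtain ⟨j', h1', h2', h3'⟩ := h'
  obtain ⟨C, ℓ, i, hm⟩ := T.exists_models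
  obtain ⟨C', ℓ', i', hm'⟩ := T'.exists_models
  obtain ⟨f, hf, hfF, hfd⟩ := (hm.isLevelCollapse h1 h2 h3).exists_isometry
    (hm'.isLevelCollapse h1' h2' h3') hd hF hm.isBranched hm'.isBranched
  exact hm.equivalent_of_isometry hm' hf hfF hfd

/-! ### Uniqueness of strong limits -/

namespace PointedDynamics

variable {A B D : PointedDynamics} {k : ℕ}

/-- The inverse isomorphism. -/
def TruncIso.symm (s : A.TruncIso B k) : B.TruncIso A k where
  iso := s.iso.symm
  map_base x hx := by
    have hb : A.base ∈ A.trunc k := by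
      change A.G.dist A.base A.base ≤ _
      rw [SimpleGraph.dist_self]; exact Nat.zero_le _
    have : s.iso ⟨A.base, hb⟩ = x := Subtype.ext ((s.map_base ⟨A.base, hb⟩ rfl).trans hx.symm)
    rw [← this, RelIso.symm_apply_apply]
  map_dynamics x y := by
    rw [s.map_dynamics, RelIso.apply_symm_apply, RelIso.apply_symm_apply]

/-- The composite isomorphism. -/
def TruncIso.trans (s : A.TruncIso B k) (t : B.TruncIso D k) : A.TruncIso D k where
  iso := s.iso.trans t.iso
  map_base x hx := t.map_base _ (s.map_base x hx)
  map_dynamics x y := (s.map_dynamics x y).trans (t.map_dynamics _ _)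

theorem mem_trunc {x : A.V} :
    x ∈ A.trunc k ↔ A.G.dist A.base x ≤ k * A.G.dist A.base (A.F A.base) := Iff.rfl

/-- An isomorphism of truncations does not increase distances to the base, since geodesics to the base
stay in the truncation. -/
theorem TruncIso.dist_le (hA : A.G.Connected) (hB : B.G.Connected) (s : A.TruncIso B k)
    (x : A.trunc k) : B.G.dist B.base (s.iso x).1 ≤ A.G.dist A.base x.1 := by
  have key : ∀ (m : ℕ) (x : A.trunc k), A.G.dist A.base x.1 = m → B.G.dist B.base (s.iso x).1 ≤ m := by
    intro m
    induction m with
    | zero =>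
      intro x hx
      rw [s.map_base x ((hA _ _).dist_eq_zero_iff.1 hx).symm, SimpleGraph.dist_self]
    | succ m ih =>
      intro x hx
      obtain ⟨p, hp⟩ := hA.exists_walk_length_eq_dist x.1 A.base
      rw [SimpleGraph.dist_comm, hx] at hp
      obtain ⟨x, hxk⟩ := x
      cases p with
      | nil => simp at hp
      | @cons _ y _ a p =>
        rw [SimpleGraph.Walk.length_cons] at hp
        have h1 := SimpleGraph.dist_le p
        have h2 : A.G.dist A.base x ≤ A.G.dist A.base y + 1 := by
          have := hA.dist_triangle (u := A.base) (v := y) (w := x)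
          rwa [SimpleGraph.dist_eq_one_iff_adj.2 a.symm] at this
        rw [SimpleGraph.dist_comm] at h1
        have hx' : A.G.dist A.base x = m + 1 := hx
        have hy : A.G.dist A.base y = m := by omega
        have hyk : y ∈ A.trunc k := by
          rw [mem_trunc] at hxk ⊢
          omega
        have h3 := ih ⟨y, hyk⟩ hy
        have h4 : B.G.Adj (s.iso ⟨y, hyk⟩).1 (s.iso ⟨x, hxk⟩).1 :=
          s.iso.map_adj_iff.2 (show (A.G.induce _).Adj ⟨y, hyk⟩ ⟨x, hxk⟩ from a.symm)
        have h5 := hB.dist_triangle (u := B.base) (v := (s.iso ⟨y, hyk⟩).1) (w := (s.iso ⟨x, hxk⟩).1)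
        rw [SimpleGraph.dist_eq_one_iff_adj.2 h4] at h5
        omega
  exact key _ x rfl

end PointedDynamics

namespace MetrizedTree

variable {D : ℕ}

theorem IsTruncLimit.comp {S : ℕ → MetrizedTree D} {r : ∀ n, ℕ → (S n).V} {A : PointedDynamics}
    {d : A.V → A.V → ℝ} (h : IsTruncLimit S r A d) {φ : ℕ → ℕ} (hφ : Tendsto φ atTop atTop) :
    IsTruncLimit (fun n => S (φ n)) (fun n => r (φ n)) A d :=
  ⟨h.connected, fun k hk ε hε => hφ.eventually (h.trunc_iso k hk ε hε)⟩

open PointedDynamics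

variable {S : ℕ → MetrizedTree D} {r : ∀ n, ℕ → (S n).V} {A B : PointedDynamics}
  {d : A.V → A.V → ℝ} {d' : B.V → B.V → ℝ}

theorem IsTruncLimit.exists_truncIso (h : IsTruncLimit S r A d) (h' : IsTruncLimit S r B d') {k : ℕ}
    (hk : 0 < k) {ε : ℝ} (hε : 0 < ε) : ∃ s : A.TruncIso B k,
      ∀ u w : A.trunc k, |d' (s.iso u).1 (s.iso w).1 - d u.1 w.1| < ε := by
  obtain ⟨n, ⟨s, hs⟩, t, ht⟩ :=
    ((h.trunc_iso k hk (ε / 2) (by positivity)).and (h'.trunc_iso k hk (ε / 2) (by positivity))).exists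
  refine ⟨s.trans t.symm, fun u w => ?_⟩
  have h1 := hs u w
  have h2 := ht (t.iso.symm (s.iso u)) (t.iso.symm (s.iso w))
  rw [RelIso.apply_symm_apply, RelIso.apply_symm_apply] at h2
  change |d' (t.iso.symm (s.iso u)).1 (t.iso.symm (s.iso w)).1 - _| < ε
  rw [abs_lt] at *
  constructor <;> linarith

/-- The limit of the finite subtrees is unique: a limit of the isomorphisms between the truncations of both
trees along an ultrafilter is an isometry. -/
theorem IsTruncLimit.exists_bijective (h : IsTruncLimit S r A d) (h' : IsTruncLimit S r B d')
    (hB : 1 ≤ B.G.dist B.base (B.F B.base)) (hfin : ∀ m, {y | B.G.dist B.base y ≤ m}.Finite) :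
    ∃ g : A.V → B.V, Function.Bijective g ∧ (∀ u, g (A.F u) = B.F (g u)) ∧
      ∀ u w, d' (g u) (g w) = d u w := by
  classical
  have hmem : ∀ {A : PointedDynamics}, 1 ≤ A.G.dist A.base (A.F A.base) → ∀ {x : A.V} {k : ℕ},
      A.G.dist A.base x ≤ k → x ∈ A.trunc k := fun {A} hA {x k} hx =>
    hx.trans (Nat.le_mul_of_pos_right _ hA)
  choose s hs using fun k : ℕ => h.exists_truncIso h' (k := k + 1) (Nat.succ_pos k)
    (ε := 1 / ((k : ℝ) + 1)) (by positivity)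
  -- if `F` fixed the base of `A`, then all truncations of `A` would be single points
  have hA : 1 ≤ A.G.dist A.base (A.F A.base) := by
    by_contra h0
    have h1 : B.base ∈ B.trunc (0 + 1) := hmem hB (by rw [SimpleGraph.dist_self]; omega)
    have h2 : B.F B.base ∈ B.trunc (0 + 1) := by rw [mem_trunc]; omega
    have h3 := (s 0).symm.dist_le h'.connected h.connected ⟨_, h2⟩
    have h4 : ((s 0).symm.iso ⟨_, h2⟩).1 = A.base := by
      have h5 := ((s 0).symm.iso ⟨_, h2⟩).2
      rw [mem_trunc] at h5
      refine ((h.connected _ _).dist_eq_zero_iff.1 ?_).symm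
      rw [show A.G.dist A.base (A.F A.base) = 0 by omega] at h5
      omega
    have h5 := (s 0).symm.map_base ⟨_, h1⟩ rfl
    have h6 := congrArg Subtype.val ((s 0).symm.iso.injective (Subtype.ext (h4.trans h5.symm)))
    have h6 : B.F B.base = B.base := h6
    rw [h6, SimpleGraph.dist_self] at hB
    omega
  let U : Ultrafilter ℕ := hyperfilter ℕ
  have hU : (U : Filter ℕ) ≤ atTop := Nat.hyperfilter_le_atTop
  let σ : ℕ → A.V → B.V := fun k x => if hx : x ∈ A.trunc (k + 1) then ((s k).iso ⟨x, hx⟩).1 else B.base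
  have hσ : ∀ {k x} (hx : x ∈ A.trunc (k + 1)), σ k x = ((s k).iso ⟨x, hx⟩).1 := fun hx => dif_pos hx
  have hlarge : ∀ x : A.V, ∀ᶠ k in (U : Filter ℕ), x ∈ A.trunc (k + 1) := fun x =>
    hU ((eventually_ge_atTop (A.G.dist A.base x)).mono fun k hk => hmem hA (by omega))
  obtain ⟨g, hg⟩ := exists_ultralimit U σ fun x => ⟨_, hfin (A.G.dist A.base x),
    (hlarge x).mono fun k hk => by
      change B.G.dist B.base (σ k x) ≤ _
      rw [hσ hk]
      exact (s k).dist_le h.connected h'.connected ⟨x, hk⟩⟩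
  have hdist : ∀ u w, d' (g u) (g w) = d u w := by
    intro u w
    refine sub_eq_zero.1 (abs_eq_zero.1 (le_antisymm (le_of_forall_pos_le_add fun ε hε => ?_)
      (abs_nonneg _)))
    rw [zero_add]
    obtain ⟨m, hm⟩ := exists_nat_one_div_lt hε
    obtain ⟨k, h1, h2, h3, h4, hk⟩ := ((hlarge u).and ((hlarge w).and ((hg u).and ((hg w).and
      (hU (eventually_ge_atTop m)))))).exists
    rw [← h3, ← h4, hσ h1, hσ h2]
    refine (hs k ⟨u, h1⟩ ⟨w, h2⟩).le.trans (le_trans ?_ hm.le)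
    have : (m : ℝ) ≤ k := by exact_mod_cast hk
    exact one_div_le_one_div_of_le (by positivity) (by linarith)
  have hinj : Function.Injective g := by
    intro u w huw
    obtain ⟨k, h1, h2, h3, h4⟩ := ((hlarge u).and ((hlarge w).and ((hg u).and (hg w)))).exists
    rw [hσ h1] at h3
    rw [hσ h2] at h4
    exact congrArg Subtype.val ((s k).iso.injective (Subtype.ext (h3.trans (huw.trans h4.symm))))
  refine ⟨g, ⟨hinj, fun y => ?_⟩, fun u => ?_, hdist⟩
  · -- the maps `σ k` agree with `g` on a finite ball
    let m := B.G.dist B.base y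
    have hpre : ∀ k, m ≤ k → ∃ x, ∃ hx : x ∈ A.trunc (k + 1), A.G.dist A.base x ≤ m ∧
        ((s k).iso ⟨x, hx⟩).1 = y := by
      intro k hk
      have hy : y ∈ B.trunc (k + 1) := hmem hB (by omega)
      refine ⟨((s k).symm.iso ⟨y, hy⟩).1, ((s k).symm.iso ⟨y, hy⟩).2,
        (s k).symm.dist_le h'.connected h.connected ⟨y, hy⟩, ?_⟩
      change ((s k).iso ((s k).iso.symm ⟨y, hy⟩)).1 = y
      rw [RelIso.apply_symm_apply]
    have hball : {x | A.G.dist A.base x ≤ m}.Finite := by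
      refine Set.Finite.of_finite_image ((hfin m).subset ?_) (f := σ m) ?_
      · rintro _ ⟨x, hx, rfl⟩
        have hx' : x ∈ A.trunc (m + 1) := hmem hA (Nat.le_succ_of_le hx)
        rw [hσ hx']
        exact ((s m).dist_le h.connected h'.connected ⟨x, hx'⟩).trans hx
      · intro x hx x' hx' he
        have h1 : x ∈ A.trunc (m + 1) := hmem hA (Nat.le_succ_of_le hx)
        have h2 : x' ∈ A.trunc (m + 1) := hmem hA (Nat.le_succ_of_le hx')
        rw [hσ h1, hσ h2] at he
        exact congrArg Subtype.val ((s m).iso.injective (Subtype.ext he))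
    have hall : ∀ᶠ k in (U : Filter ℕ), ∀ x ∈ {x | A.G.dist A.base x ≤ m}, σ k x = g x :=
      (eventually_all_finite hball).2 fun x _ => hg x
    obtain ⟨k, h1, hk⟩ := (hall.and (hU (eventually_ge_atTop m))).exists
    obtain ⟨x, hx, hxm, hxy⟩ := hpre k hk
    exact ⟨x, by rw [← h1 x hxm, hσ hx, hxy]⟩
  · obtain ⟨k, h1, h2, h3, h4⟩ :=
      ((hlarge u).and ((hlarge (A.F u)).and ((hg u).and (hg (A.F u))))).exists
    rw [← h3, ← h4, hσ h1, hσ h2]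
    exact (((s k).map_dynamics ⟨u, h1⟩ ⟨_, h2⟩).1 rfl).symm

theorem IsCollapse.map {T : MetrizedTree D} (h : IsCollapse A d T) {g : A.V → B.V}
    (hg : Function.Surjective g) (hF : ∀ u, g (A.F u) = B.F (g u))
    (hd : ∀ u w, d' (g u) (g w) = d u w) : IsCollapse B d' T := by
  obtain ⟨j, h1, h2, h3⟩ := h
  refine ⟨fun u => g (j u), fun u w => by rw [hd, h1], fun u => by rw [← hF, hd, h2], fun y => ?_⟩
  obtain ⟨x, rfl⟩ := hg y
  obtain ⟨u, w, hb⟩ := h3 x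
  exact ⟨u, w, by rw [hd, hd, hd, hb]⟩

end MetrizedTree

namespace CTree

/-- The dynamics of a level tree. -/
@[reducible] noncomputable def pointed (C : CTree) : PointedDynamics := ⟨C.V, C.G, C.F, C.base⟩

theorem dist_pointed (C : CTree) (v : C.V) : C.pointed.G.dist C.pointed.base v = (C.lv v).natAbs :=
  C.dist_base v

end CTree

/-- If the limit of the finite subtrees is a level tree, then all strong limits are the same. -/
theorem MetrizedTree.IsTruncLimit.equivalent {S : ℕ → MetrizedTree 3} {r : ∀ n, ℕ → (S n).V}
    {A : PointedDynamics} {d : A.V → A.V → ℝ} (h : IsTruncLimit S r A d) {T : MetrizedTree 3}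
    (hT : IsCollapse A d T) {C : CTree} {ℓ : ℤ → ℝ} (h0 : ∀ k, 0 ≤ ℓ k)
    (hs : ∀ k, ℓ (k + C.N) = 3 * ℓ k) (hC : IsTruncLimit S r C.pointed (C.dst ℓ))
    {T' : MetrizedTree 3} (hT' : IsCollapse C.pointed (C.dst ℓ) T') : Equivalent T T' := by
  obtain ⟨g, hg, hF, hd⟩ := h.exists_bijective hC (by
    change 1 ≤ C.G.dist C.base (C.F C.base)
    rw [C.dist_base, C.lv_F, C.lv_base]
    have := C.N_pos
    omega) fun m =>
    (C.finite_level m).subset fun v hv => (C.dist_pointed v).symm.le.trans hv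
  exact (hT.map hg.2 hF hd).equivalent (C.isTreeMetric_dst h0) (CTree.dst_F h0 hs) hT'

/-! ### Convergence of finite subtrees -/

namespace CTree

namespace IsPIso

variable {C C' : CTree} {f : C.V → C'.V} {k : ℕ}

theorem map_anc (h : IsPIso C C' f k) {v : C.V} (hv : -(k : ℤ) ≤ C.lv v) (j : ℤ) :
    f (C.anc v j) = C'.anc (f v) j := by
  have key : ∀ (n : ℕ) (v : C.V), -(k : ℤ) ≤ C.lv v → f (C.p^[n] v) = C'.p^[n] (f v) := by
    intro n
    induction n with
    | zero => exact fun _ _ => rfl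
    | succ n ih =>
      intro v hv
      rw [Function.iterate_succ_apply, Function.iterate_succ_apply, ih _ (lv_p_ge hv), h.map_p v hv]
  rw [anc, anc, h.map_lv v hv, key _ v hv]

theorem map_join (h : IsPIso C C' f k) {u w : C.V} (hu : -(k : ℤ) ≤ C.lv u)
    (hw : -(k : ℤ) ≤ C.lv w) : C'.join (f u) (f w) = C.join u w := by
  refine eq_of_forall_ge_iff fun j => ?_
  rw [join_le_iff, join_le_iff, h.map_lv u hu, h.map_lv w hw, ← h.map_anc hu, ← h.map_anc hw]
  refine and_congr_right fun h1 => and_congr_right fun h2 => ⟨fun e => ?_, fun e => by rw [e]⟩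
  exact h.inj _ _ (by rw [C.lv_anc h1]; omega) (by rw [C.lv_anc h2]; omega) e

theorem map_dst (h : IsPIso C C' f k) {u w : C.V} (hu : -(k : ℤ) ≤ C.lv u)
    (hw : -(k : ℤ) ≤ C.lv w) (ℓ : ℤ → ℝ) : C'.dst ℓ (f u) (f w) = C.dst ℓ u w := by
  rw [dst, dst, h.map_join hu hw, h.map_lv u hu, h.map_lv w hw]

end IsPIso

theorem mem_trunc_pointed {C : CTree} {k : ℕ} {v : C.V} :
    v ∈ C.pointed.trunc k ↔ (C.lv v).natAbs ≤ k * C.N := by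
  change C.G.dist C.base v ≤ k * C.G.dist C.base (C.F C.base) ↔ _
  rw [C.dist_base, C.dist_base, C.lv_F, C.lv_base, zero_add, Int.natAbs_natCast]

end CTree

open CTree

namespace Models

variable {C : CTree} {ℓ : ℤ → ℝ} {T : MetrizedTree 3} {i : C.V → T.V}

theorem dist_base (h : Models C ℓ T i) (v : C.V) : T.G.dist (i C.base) (i v) = (C.lv v).natAbs := by
  rw [← C.dist_base]
  let e : C.G ≃g T.G := ⟨Equiv.ofBijective i h.bij, fun {u w} => h.adj u w⟩
  refine le_antisymm ?_ ?_
  · obtain ⟨p, hp⟩ := C.isRooted.connected.exists_walk_length_eq_dist C.base v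
    rw [← hp, ← SimpleGraph.Walk.length_map e.toHom p]
    exact SimpleGraph.dist_le (p.map e.toHom)
  · obtain ⟨p, hp⟩ := T.isTree.connected.exists_walk_length_eq_dist (i C.base) (i v)
    have h1 := SimpleGraph.dist_le (p.map e.symm.toHom)
    rw [SimpleGraph.Walk.length_map, hp] at h1
    have h2 : ∀ w, e.symm (i w) = w := fun w => e.symm_apply_apply w
    change C.G.dist (e.symm (i C.base)) (e.symm (i v)) ≤ _ at h1
    rwa [h2, h2] at h1

theorem mem_trunc (h : Models C ℓ T i) {k : ℕ} {v : C.V} :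
    i v ∈ (T.pointed (i C.base)).trunc k ↔ (C.lv v).natAbs ≤ k * C.N := by
  change T.G.dist (i C.base) (i v) ≤ k * T.G.dist (i C.base) (T.F (i C.base)) ↔ _
  rw [h.map_F, h.dist_base, h.dist_base, C.lv_F, C.lv_base, zero_add, Int.natAbs_natCast]

/-- An isomorphism of the upper parts of level trees gives an isomorphism of truncations. -/
theorem exists_truncIso {C₀ : CTree} (h : Models C ℓ T i) {f : C₀.V → C.V} {k m : ℕ}
    (hf : IsPIso C₀ C f m) (hk : k * C₀.N ≤ m) :
    ∃ s : C₀.pointed.TruncIso (T.pointed (i (C.ray 0))) k, ∀ u, (s.iso u).1 = i (f u.1) := by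
  have hlv : ∀ x : C₀.pointed.trunc k, -(m : ℤ) ≤ C₀.lv x.1 := fun x => by
    have := mem_trunc_pointed.1 x.2
    omega
  let φ : C₀.pointed.trunc k → (T.pointed (i (C.ray 0))).trunc k := fun x => ⟨i (f x.1), by
    refine h.mem_trunc.2 ?_
    rw [hf.map_lv _ (hlv x), ← hf.N_eq]
    exact mem_trunc_pointed.1 x.2⟩
  have hφ : Function.Bijective φ := by
    refine ⟨fun x y hxy => Subtype.ext (hf.inj _ _ (hlv x) (hlv y) (h.bij.1 (congrArg Subtype.val hxy))),
      ?_⟩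
    rintro ⟨y, hy⟩
    obtain ⟨y, rfl⟩ := h.bij.2 y
    have hy' := h.mem_trunc.1 hy
    rw [← hf.N_eq] at hy'
    obtain ⟨x, hx, rfl⟩ := hf.surj y (by omega)
    exact ⟨⟨x, mem_trunc_pointed.2 (by rwa [← hf.map_lv x hx])⟩, rfl⟩
  have hadj : ∀ x y : C₀.pointed.trunc k, T.G.Adj (i (f x.1)) (i (f y.1)) ↔ C₀.G.Adj x.1 y.1 := by
    intro x y
    rw [h.adj, C.adj_iff, C₀.adj_iff, ← hf.map_p _ (hlv x), ← hf.map_p _ (hlv y)]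
    exact or_congr
      ⟨fun e => hf.inj _ _ (lv_p_ge (hlv x)) (hlv y) e, fun e => congrArg f e⟩
      ⟨fun e => hf.inj _ _ (lv_p_ge (hlv y)) (hlv x) e, fun e => congrArg f e⟩
  refine ⟨⟨⟨Equiv.ofBijective φ hφ, fun {x y} => hadj x y⟩, ?_, ?_⟩, fun _ => rfl⟩
  · intro x hx
    change i (f x.1) = i (C.ray 0)
    rw [show x.1 = C₀.base from hx, hf.map_base, C.ray_zero]
  · intro x y
    change C₀.F x.1 = y.1 ↔ T.F (i (f x.1)) = i (f y.1)
    rw [h.map_F, ← hf.map_F _ (hlv x), h.bij.1.eq_iff]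
    exact ⟨fun e => congrArg f e, fun e => hf.inj _ _ (lv_F_ge (hlv x)) (hlv y) e⟩

end Models

section Limits

variable {S : ℕ → MetrizedTree 3} {C : ℕ → CTree} {ℓ : ℕ → ℤ → ℝ} {i : ∀ n, (C n).V → (S n).V}
  {C₀ : CTree} {L : ℤ → ℝ}

/-- If the combinatorics stabilizes and the edge lengths converge, then the limiting level tree with the
limiting lengths is the limit of the finite subtrees. -/
theorem isTruncLimit_of_isPIso (h : ∀ n, Models (C n) (ℓ n) (S n) (i n))
    (hL : ∀ j, Tendsto (fun n => ℓ n j) atTop (𝓝 (L j)))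
    (hC : ∀ k, ∀ᶠ n in atTop, Agree k C₀ (C n)) :
    MetrizedTree.IsTruncLimit S (fun n k => i n ((C n).ray k)) C₀.pointed (C₀.dst L) := by
  refine ⟨C₀.isRooted.connected, fun k hk ε hε => ?_⟩
  have hfin : (C₀.pointed.trunc k).Finite :=
    (C₀.finite_level (k * C₀.N)).subset fun v hv => mem_trunc_pointed.1 hv
  have hconv : ∀ᶠ n in atTop, ∀ x ∈ (C₀.pointed.trunc k) ×ˢ (C₀.pointed.trunc k),
      |C₀.dst (ℓ n) x.1 x.2 - C₀.dst L x.1 x.2| < ε := by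
    refine (eventually_all_finite (hfin.prod hfin)).2 fun x _ => ?_
    have : Tendsto (fun n => C₀.dst (ℓ n) x.1 x.2) atTop (𝓝 (C₀.dst L x.1 x.2)) :=
      (((tendsto_hgt hL _).const_mul 2).sub (tendsto_hgt hL _)).sub (tendsto_hgt hL _)
    have := (Metric.tendsto_nhds.1 this) ε hε
    simpa only [Real.dist_eq] using this
  filter_upwards [hconv, hC (k * C₀.N)] with n hn ⟨f, hf⟩
  obtain ⟨s, hs⟩ := (h n).exists_truncIso hf le_rfl
  have hlv : ∀ x : C₀.pointed.trunc k, -((k * C₀.N : ℕ) : ℤ) ≤ C₀.lv x.1 := fun x => by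
    have := mem_trunc_pointed.1 x.2
    omega
  refine ⟨s, fun u w => ?_⟩
  rw [hs, hs, (h n).dist_eq, hf.map_dst (hlv u) (hlv w)]
  exact hn (u.1, w.1) ⟨u.2, w.2⟩

theorem Models.dist_ray {C : CTree} {ℓ : ℤ → ℝ} {T : MetrizedTree 3} {i : C.V → T.V}
    (h : Models C ℓ T i) (k : ℕ) : T.dist (i (C.ray 0)) (i (C.ray k)) = hgt ℓ k := by
  have hj : C.join (C.ray 0) (C.ray k) = k := by
    have h1 := C.join_anc (u := C.ray 0) (j := k) (by rw [C.lv_ray]; omega)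
    rwa [C.eq_ray (C.lv_anc (v := C.ray 0) (j := k) (by rw [C.lv_ray]; omega))] at h1
  rw [h.dist_eq, dst, hj, C.lv_ray, C.lv_ray, Nat.cast_zero, hgt_zero]
  ring

/-- If the combinatorics stabilizes and the edge lengths converge, then the sequence converges strongly,
unless the limiting metric is trivial. -/
theorem stronglyConvergent_of_isPIso (h : ∀ n, Models (C n) (ℓ n) (S n) (i n))
    (hL : ∀ j, Tendsto (fun n => ℓ n j) atTop (𝓝 (L j))) (hpos : 0 < hgt L 3)
    (hC : ∀ k, ∀ᶠ n in atTop, Agree k C₀ (C n)) :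
    MetrizedTree.StronglyConvergent S (fun n k => i n ((C n).ray k)) where
  isBaseRay n := (h n).isBaseRay
  dist_tendsto k _ _ := ⟨hgt L k, by simpa only [(h _).dist_ray] using tendsto_hgt hL k⟩
  dist_tendsto_pos := ⟨hgt L (3 : ℕ), hpos, by simpa only [(h _).dist_ray] using tendsto_hgt hL (3 : ℕ)⟩
  trunc_iso k _ := by
    have h1 := hC (k * C₀.N)
    filter_upwards [h1, (tendsto_add_atTop_nat 1).eventually h1] with n ⟨f, hf⟩ ⟨g, hg⟩
    obtain ⟨s, -⟩ := (h n).exists_truncIso hf le_rfl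
    obtain ⟨t, -⟩ := (h (n + 1)).exists_truncIso hg le_rfl
    exact ⟨s.symm.trans t⟩

end Limits

/-! ### Collapses of limiting trees -/

theorem Models.isCollapse {C : CTree} {ℓ : ℤ → ℝ} {T : MetrizedTree 3} {i : C.V → T.V}
    (h : Models C ℓ T i) {A : PointedDynamics} {d : A.V → A.V → ℝ} {j : C.V → A.V}
    (hj : IsLevelCollapse d A.F C ℓ j) : MetrizedTree.IsCollapse A d T := by
  let e := Equiv.ofBijective i h.bij
  have he : ∀ v, e.symm (i v) = v := fun v => e.symm_apply_apply v
  refine ⟨fun x => j (e.symm x), fun x y => ?_, fun x => ?_, fun x => ?_⟩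
  · obtain ⟨u, rfl⟩ := h.bij.2 x
    obtain ⟨w, rfl⟩ := h.bij.2 y
    beta_reduce
    rw [he, he, h.dist_eq, hj.dist_eq]
  · obtain ⟨u, rfl⟩ := h.bij.2 x
    beta_reduce
    rw [h.map_F, he, he, hj.map_F]
  · obtain ⟨u, w, hb⟩ := hj.fill x
    exact ⟨i u, i w, by beta_reduce; rw [he, he]; exact hb⟩

namespace CTree

variable {C : CTree} {ℓ : ℤ → ℝ}

theorem isLevelCollapse_id (hpos : ∀ k, 0 < ℓ k) (hs : ∀ k, ℓ (k + C.N) = 3 * ℓ k) :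
    IsLevelCollapse (C.dst ℓ) C.F C ℓ id where
  pos := hpos
  scale := hs
  dist_eq _ _ := rfl
  map_F _ := dst_self _
  fill x := ⟨x, x, by unfold Between; simp only [id, dst_self]; ring⟩

/-- The lengths of the edges of a half. -/
def halfLength (ℓ : ℤ → ℝ) (ε : ℤ) (k : ℤ) : ℝ := ℓ (2 * k + ε) + ℓ (2 * k + ε + 1)

theorem hgt_halfLength (ℓ : ℤ → ℝ) (ε k : ℤ) :
    hgt (halfLength ℓ ε) k = hgt ℓ (2 * k + ε) - hgt ℓ ε := by
  induction k using Int.induction_on with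
  | zero => rw [hgt_zero, mul_zero, zero_add, sub_self]
  | succ k ih =>
    rw [hgt_add_one, ih, halfLength, show 2 * ((k : ℤ) + 1) + ε = 2 * k + ε + 1 + 1 by ring,
      hgt_add_one, hgt_add_one]
    ring
  | pred k ih =>
    have h1 := hgt_add_one (halfLength ℓ ε) (-(k : ℤ) - 1)
    rw [sub_add_cancel, ih, halfLength,
      show 2 * -(k : ℤ) + ε = 2 * (-(k : ℤ) - 1) + ε + 1 + 1 by ring, hgt_add_one, hgt_add_one] at h1
    linarith

theorem half_anc (hN : C.N = 2) {ε : ℤ} (hε : ε = 0 ∨ ε = 1) (v : (C.half hN ε hε).V) {j : ℤ}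
    (hj : (C.half hN ε hε).lv v ≤ j) : ((C.half hN ε hε).anc v j).1 = C.anc v.1 (2 * j + ε) := by
  have key : ∀ (n : ℕ) (v : (C.half hN ε hε).V), ((C.half hN ε hε).p^[n] v).1 = C.p^[2 * n] v.1 := by
    intro n
    induction n with
    | zero => exact fun _ => rfl
    | succ n ih =>
      intro v
      rw [Function.iterate_succ_apply, ih]
      change C.p^[2 * n] (C.p (C.p v.1)) = _
      rw [show 2 * (n + 1) = 2 * n + 1 + 1 by ring, Function.iterate_succ_apply,
        Function.iterate_succ_apply]
  have hv := v.2
  have hl : (C.half hN ε hε).lv v = (C.lv v.1 - ε) / 2 := rfl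
  rw [anc, key, anc]
  congr 2
  omega

theorem half_join_le_iff (hN : C.N = 2) {ε : ℤ} (hε : ε = 0 ∨ ε = 1) (u w : (C.half hN ε hε).V)
    {j : ℤ} : (C.half hN ε hε).join u w ≤ j ↔ C.join u.1 w.1 ≤ 2 * j + ε := by
  have hu := u.2
  have hw := w.2
  have hlu : (C.half hN ε hε).lv u = (C.lv u.1 - ε) / 2 := rfl
  have hlw : (C.half hN ε hε).lv w = (C.lv w.1 - ε) / 2 := rfl
  rw [join_le_iff, join_le_iff]
  constructor
  · rintro ⟨h1, h2, h3⟩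
    have h3 := congrArg Subtype.val h3
    rw [half_anc hN hε u h1, half_anc hN hε w h2] at h3
    exact ⟨by omega, by omega, h3⟩
  · rintro ⟨h1, h2, h3⟩
    refine ⟨by omega, by omega, Subtype.ext ?_⟩
    rw [half_anc hN hε u (by omega), half_anc hN hε w (by omega), h3]

/-- A half is the collapse of the tree if the geodesics between its vertices turn at vertices of
the half or at the end of an edge of length zero. -/
theorem isLevelCollapse_half (h0 : ∀ k, 0 ≤ ℓ k) (hs : ∀ k, ℓ (k + C.N) = 3 * ℓ k) (hN : C.N = 2)
    {ε : ℤ} (hε : ε = 0 ∨ ε = 1) (hpos : 0 < ℓ 0 + ℓ 1)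
    (hJ : ∀ u w : (C.half hN ε hε).V, ¬ 2 ∣ C.join u.1 w.1 - ε → ℓ (C.join u.1 w.1) = 0) :
    IsLevelCollapse (C.dst ℓ) C.F (C.half hN ε hε) (halfLength ℓ ε) Subtype.val where
  pos k := by
    -- two consecutive edges do not both have length zero
    have hs2 : ∀ k, ℓ (k + 2) = 3 * ℓ k := fun k => by have := hs k; rwa [hN] at this
    have hstep : ∀ k, 0 < ℓ k + ℓ (k + 1) ↔ 0 < ℓ (k + 1) + ℓ (k + 1 + 1) := fun k => by
      have h1 := hs2 k
      rw [show k + 1 + 1 = k + 2 by ring, h1]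
      have h2 := h0 k
      have h3 := h0 (k + 1)
      constructor <;> intro h
      · rcases h2.lt_or_eq with h4 | h4
        · positivity
        · rw [← h4] at h ⊢; linarith
      · rcases h2.lt_or_eq with h4 | h4
        · positivity
        · rw [← h4] at h ⊢; linarith
    have hall : ∀ k : ℤ, 0 < ℓ k + ℓ (k + 1) := fun k => by
      induction k using Int.induction_on with
      | zero => simpa using hpos
      | succ k ih => exact (hstep _).1 ih
      | pred k ih => refine (hstep _).2 ?_; rwa [sub_add_cancel]
    exact hall _
  scale k := by
    have hs2 : ∀ k, ℓ (k + 2) = 3 * ℓ k := fun k => by have := hs k; rwa [hN] at this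
    change halfLength ℓ ε (k + ((1 : ℕ) : ℤ)) = _
    rw [halfLength, halfLength, show 2 * (k + ((1 : ℕ) : ℤ)) + ε = 2 * k + ε + 2 by push_cast; ring, hs2,
      show 2 * k + ε + 2 + 1 = 2 * k + ε + 1 + 2 by ring, hs2]
    ring
  dist_eq u w := by
    have h1 : C.join u.1 w.1 ≤ 2 * (C.half hN ε hε).join u w + ε :=
      (half_join_le_iff hN hε u w).1 le_rfl
    have h2 : ¬ C.join u.1 w.1 ≤ 2 * ((C.half hN ε hε).join u w - 1) + ε := fun h =>
      absurd ((half_join_le_iff hN hε u w).2 h) (by omega)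
    have hu := u.2
    have hw := w.2
    have hlu : (C.half hN ε hε).lv u = (C.lv u.1 - ε) / 2 := rfl
    have hlw : (C.half hN ε hε).lv w = (C.lv w.1 - ε) / 2 := rfl
    have hJ' : hgt ℓ (2 * (C.half hN ε hε).join u w + ε) = hgt ℓ (C.join u.1 w.1) := by
      by_cases he : C.join u.1 w.1 = 2 * (C.half hN ε hε).join u w + ε
      · rw [he]
      · have h3 := hgt_add_one ℓ (C.join u.1 w.1)
        rw [hJ u w (by omega), add_zero] at h3
        rw [← h3]
        congr 1
        omega
    rw [dst, dst, hgt_halfLength, hgt_halfLength, hgt_halfLength, hJ', hlu, hlw,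
      show 2 * ((C.lv u.1 - ε) / 2) + ε = C.lv u.1 by omega,
      show 2 * ((C.lv w.1 - ε) / 2) + ε = C.lv w.1 by omega]
    ring
  map_F u := dst_self _
  fill x := by
    by_cases hx : 2 ∣ C.lv x - ε
    · exact ⟨⟨x, hx⟩, ⟨x, hx⟩, by unfold Between; rw [dst_self]; ring⟩
    · obtain ⟨u, rfl⟩ := C.exists_child x
      have h1 := C.lv_p u
      have h2 := C.lv_p (C.p u)
      refine ⟨⟨u, by omega⟩, ⟨C.p (C.p u), by omega⟩, between_p (show C.join u (C.p (C.p u)) ≠ C.lv u from fun e => ?_)⟩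
      have := C.lv_le_join_right u (C.p (C.p u))
      omega

/-- If the spine is infinite, geodesics between vertices of even level turn at even level. -/
theorem two_dvd_join (hN : C.N = 2) (hC : ∀ k, C.HasSp k) {u w : C.V} (hu : 2 ∣ C.lv u)
    (hw : 2 ∣ C.lv w) : 2 ∣ C.join u w := by
  by_contra hJ
  have h1 := C.lv_le_join_left u w
  have h2 := C.lv_le_join_right u w
  have h3 := (C.join_le_iff.1 (le_refl (C.join u w))).2.2
  have hl := C.lv_anc h1
  obtain ⟨a, -, -, ha⟩ := exists_unique_child hN (hC (2 * (C.join u w).natAbs))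
    (x := C.anc u (C.join u w)) (by omega) (by omega)
  have e1 := ha (C.anc u (C.join u w - 1)) (by rw [C.p_anc (by omega), sub_add_cancel])
  have e2 := ha (C.anc w (C.join u w - 1)) (by rw [C.p_anc (by omega), sub_add_cancel, h3])
  have := C.join_le_iff.2 ⟨show C.lv u ≤ C.join u w - 1 by omega, by omega, e1.trans e2.symm⟩
  omega

/-- A level tree with possibly degenerate lengths, which arises as a limit, has a collapse with the same
coordinates. It is the tree itself or, for `N = 2`, one of its halves if a length is zero or if
the spine has become infinite. -/
theorem exists_isCollapse {V : Type*} {rep : V → CTree} {dep : V → ℕ} (h0 : ∀ k, 0 ≤ ℓ k)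
    (hs : ∀ k, ℓ (k + C.N) = 3 * ℓ k) (hpos : 0 < ℓ 0 + ℓ 1)
    (hC : C.N = 1 ∨ C.N = 2 ∧ ((∀ k, C.HasSp k) ∨ ∃ k, C.HasDepth (2 * k + 1))) :
    ∃ (T : MetrizedTree 3) (C' : CTree) (ℓ' : ℤ → ℝ) (i : C'.V → T.V), Models C' ℓ' T i ∧
      MetrizedTree.IsCollapse C.pointed (C.dst ℓ) T ∧
      levelCoord rep dep C' ℓ' = levelCoord rep dep C ℓ := by
  -- by scaling all lengths are positive if those of the edges above the levels `0, …, n - 1` are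
  have hposz : ∀ {n : ℕ}, 1 ≤ n → (∀ k, ℓ (k + n) = 3 * ℓ k) → (∀ j : ℕ, j < n → 0 < ℓ j) →
      ∀ k, 0 < ℓ k := by
    intro n hn hs hp k
    have key : ∀ (m : ℤ) (j : ℕ), j < n → 0 < ℓ (j + n * m) := by
      intro m j hj
      induction m using Int.induction_on with
      | zero => simpa using hp j hj
      | succ m ih =>
        rw [show (j : ℤ) + n * (m + 1) = (j + n * m) + n by ring, hs]; linarith
      | pred m ih =>
        have h1 := hs (j + n * (-(m : ℤ) - 1))
        rw [show (j : ℤ) + n * (-(m : ℤ) - 1) + n = j + n * (-(m : ℤ)) by ring] at h1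
        linarith
    have hn' : (0 : ℤ) < n := by omega
    have h1 := Int.emod_nonneg k hn'.ne'
    have h2 := Int.emod_lt_of_pos k hn'
    have h3 := key (k / n) (k % n).toNat (by omega)
    rwa [Int.toNat_of_nonneg h1, Int.emod_add_mul_ediv] at h3
  -- the tree itself is a metrized tree
  have hgood : C.IsBranched → (∀ k, 0 < ℓ k) → ∃ (T : MetrizedTree 3) (C' : CTree) (ℓ' : ℤ → ℝ)
      (i : C'.V → T.V), Models C' ℓ' T i ∧ MetrizedTree.IsCollapse C.pointed (C.dst ℓ) T ∧
      levelCoord rep dep C' ℓ' = levelCoord rep dep C ℓ := fun hb hp => by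
    obtain ⟨T, i, h⟩ := C.exists_models hb ℓ hp hs
    exact ⟨T, C, ℓ, i, h, h.isCollapse (A := C.pointed) (isLevelCollapse_id hp hs), rfl⟩
  rcases hC with hN | ⟨hN, hC⟩
  · refine hgood (isBranched_of_N_eq_one hN) (hposz C.N_pos hs fun j hj => ?_)
    rw [show j = 0 by omega]
    have h1 := hs 0
    rw [hN] at h1
    have h1 : ℓ 1 = 3 * ℓ 0 := h1
    push_cast
    linarith
  -- a half is the collapse
  have hhalf : ∀ {ε : ℤ} (hε : ε = 0 ∨ ε = 1),
      (∀ u w : (C.half hN ε hε).V, ¬ 2 ∣ C.join u.1 w.1 - ε → ℓ (C.join u.1 w.1) = 0) →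
      (∀ v, extendsIndicator rep dep (C.half hN ε hε) v = levelCoord rep dep C ℓ v) →
      ∃ (T : MetrizedTree 3) (C' : CTree) (ℓ' : ℤ → ℝ)
      (i : C'.V → T.V), Models C' ℓ' T i ∧ MetrizedTree.IsCollapse C.pointed (C.dst ℓ) T ∧
      levelCoord rep dep C' ℓ' = levelCoord rep dep C ℓ := fun {ε} hε hJ hv => by
    have hcol := isLevelCollapse_half h0 hs hN hε hpos hJ
    obtain ⟨T, i, h⟩ := (C.half hN ε hε).exists_models (isBranched_of_N_eq_one rfl) _ hcol.pos
      hcol.scale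
    refine ⟨T, _, _, i, h, h.isCollapse (A := C.pointed) hcol, funext fun v => ?_⟩
    rw [levelCoord_of_N_eq_one rfl, hv]
  have hs2 : ∀ k, ℓ (k + 2) = 3 * ℓ k := fun k => by have := hs k; rwa [hN] at this
  have hzero : ∀ ε, ℓ ε = 0 → ∀ k, 2 ∣ k - ε → ℓ k = 0 := by
    rintro ε he k ⟨m, hm⟩
    rw [show k = ε + 2 * m by omega]
    induction m using Int.induction_on generalizing k with
    | zero => simpa using he
    | succ m ih =>
      rw [show ε + 2 * ((m : ℤ) + 1) = (ε + 2 * m) + 2 by ring, hs2, ih (ε + 2 * m) (by ring), mul_zero]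
    | pred m ih =>
      have h1 := hs2 (ε + 2 * (-(m : ℤ) - 1))
      rw [show ε + 2 * (-(m : ℤ) - 1) + 2 = ε + 2 * (-(m : ℤ)) by ring, ih (ε + 2 * (-m)) (by ring)] at h1
      linarith
  by_cases hz0 : ℓ 0 = 0
  · -- the edges above even vertices are collapsed
    refine hhalf (Or.inr rfl) (fun u w hJ => hzero 0 hz0 _ (by omega)) fun v => ?_
    rw [levelCoord, dif_pos hN, hz0, zero_mul, zero_add, zero_add, mul_div_assoc, mul_div_cancel₀]
    rw [hz0, zero_add] at hpos
    exact hpos.ne'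
  -- the edges above odd vertices are collapsed
  by_cases hz1 : ℓ 1 = 0
  · refine hhalf (Or.inl rfl) (fun u w hJ => hzero 1 hz1 _ (by omega)) fun v => ?_
    rw [levelCoord, dif_pos hN, hz1, zero_mul, add_zero, add_zero, mul_div_assoc, mul_div_cancel₀ _ hz0]
  rcases hC with hC | ⟨k, hk⟩
  · -- both halves are the same
    refine hhalf (Or.inl rfl) (fun u w hJ => absurd ?_ hJ) fun v => ?_
    · have := u.2
      have := w.2
      have := two_dvd_join hN hC (u := u.1) (w := w.1) (by omega) (by omega)
      omega
    · have : Agree (dep v) (C.even hN) (C.odd hN) := exists_isPIso_even_odd hN (hC _)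
      rw [levelCoord, dif_pos hN, ← extendsIndicator_congr this, ← add_mul, mul_comm,
        mul_div_assoc, div_self hpos.ne', mul_one]
  · refine hgood (isBranched_of_N_eq_two hN hk (by omega)) (hposz C.N_pos hs fun j hj => ?_)
    rw [hN] at hj
    interval_cases j
    · exact (h0 _).lt_of_ne' hz0
    · exact (h0 _).lt_of_ne' hz1

end CTree

/-! ### The topology of the space of trees -/

open CTree

/-- The edge lengths that grow by the factor 3 every `N` edges (for `N = 1`, `2`), given the lengths of
the edges above levels 0 and 1. -/
noncomputable def scalingLength (N : ℕ) (x y : ℝ) (k : ℤ) : ℝ :=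
  if N = 1 then 3 ^ k * x else 3 ^ (k / 2) * if k % 2 = 0 then x else y

theorem scalingLength_add {N : ℕ} (hN : N = 1 ∨ N = 2) (x y : ℝ) (k : ℤ) :
    scalingLength N x y (k + N) = 3 * scalingLength N x y k := by
  rcases hN with rfl | rfl
  · simp only [scalingLength, if_true, Nat.cast_one]
    rw [zpow_add_one₀ (by norm_num)]; ring
  · simp only [scalingLength, if_neg (show ¬ 2 = 1 by decide)]
    rw [show (k + (2 : ℕ)) / 2 = k / 2 + 1 by omega, show (k + (2 : ℕ)) % 2 = k % 2 by omega,
      zpow_add_one₀ (by norm_num)]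
    ring

theorem Models.eq_scalingLength {C : CTree} {ℓ : ℤ → ℝ} {T : MetrizedTree 3} {i : C.V → T.V}
    (h : Models C ℓ T i) (k : ℤ) : ℓ k = scalingLength C.N (ℓ 0) (ℓ 1) k := by
  have hN : C.N = 1 ∨ C.N = 2 := h.N_eq.imp id fun ⟨_, h, _⟩ => h
  have := eq_mul_of_scale C.N_pos (scalingLength_add hN (ℓ 0) (ℓ 1)) h.scale (c := 1) (fun j hj => by
    rw [one_mul]
    rcases hN with hN | hN
    · rw [hN] at hj ⊢
      obtain rfl : j = 0 := by omega
      simp [scalingLength]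
    · rw [hN] at hj ⊢
      interval_cases j <;> simp [scalingLength]) k
  rwa [one_mul] at this

theorem tendsto_scalingLength {N : ℕ} {x y : ℕ → ℝ} {a b : ℝ} (hx : Tendsto x atTop (𝓝 a))
    (hy : Tendsto y atTop (𝓝 b)) (k : ℤ) :
    Tendsto (fun n => scalingLength N (x n) (y n) k) atTop (𝓝 (scalingLength N a b k)) := by
  unfold scalingLength
  split_ifs
  · exact hx.const_mul _
  · exact hx.const_mul _
  · exact hy.const_mul _

theorem tendsto_levelCoord {V : Type*} {rep : V → CTree} {dep : V → ℕ} (C : CTree) {ℓ : ℕ → ℤ → ℝ}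
    {L : ℤ → ℝ} (hL : ∀ j, Tendsto (fun n => ℓ n j) atTop (𝓝 (L j))) (hpos : L 0 + L 1 ≠ 0) (v : V) :
    Tendsto (fun n => levelCoord rep dep C (ℓ n) v) atTop (𝓝 (levelCoord rep dep C L v)) := by
  unfold levelCoord
  split_ifs with hN
  · exact (((hL 0).mul_const _).add ((hL 1).mul_const _)).div ((hL 0).add (hL 1)) hpos
  · exact tendsto_const_nhds

theorem hgt_one (ℓ : ℤ → ℝ) : hgt ℓ 1 = ℓ 0 := by
  have := hgt_add_one ℓ 0
  rwa [zero_add, hgt_zero, zero_add] at this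

theorem hgt_two (ℓ : ℤ → ℝ) : hgt ℓ 2 = ℓ 0 + ℓ 1 := by
  have := hgt_add_one ℓ 1
  rwa [hgt_one] at this

theorem hgt_three (ℓ : ℤ → ℝ) : hgt ℓ 3 = ℓ 0 + ℓ 1 + ℓ 2 := by
  have := hgt_add_one ℓ 2
  rwa [hgt_two] at this

namespace ProjTreeSpace

theorem mk_eq_of_equivalent {T T' : MetrizedTree 3} (h : MetrizedTree.Equivalent T T') :
    mk T = mk T' := congrArg (Quotient.mk _) (Quotient.sound h)

/-- Compactness: trees whose base edges have bounded and not too small lengths have a strongly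
convergent subsequence. -/
theorem exists_subseq_strongLimit {S : ℕ → MetrizedTree 3} {C : ℕ → CTree} {ℓ : ℕ → ℤ → ℝ}
    {i : ∀ n, (C n).V → (S n).V} (h : ∀ n, Models (C n) (ℓ n) (S n) (i n)) {a b : ℝ}
    (ha : Tendsto (fun n => ℓ n 0) atTop (𝓝 a)) (hb : Tendsto (fun n => ℓ n 1) atTop (𝓝 b))
    (hab : 0 < a + b) :
    ∃ φ : ℕ → ℕ, StrictMono φ ∧ ∃ (C₀ : CTree) (L : ℤ → ℝ) (T : MetrizedTree 3), (∀ k, 0 ≤ L k) ∧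
      (∀ k, L (k + C₀.N) = 3 * L k) ∧
      MetrizedTree.StronglyConvergent (fun n => S (φ n)) (fun n k => i (φ n) ((C (φ n)).ray k)) ∧
      MetrizedTree.IsTruncLimit (fun n => S (φ n)) (fun n k => i (φ n) ((C (φ n)).ray k))
        C₀.pointed (C₀.dst L) ∧
      MetrizedTree.IsCollapse C₀.pointed (C₀.dst L) T ∧
      ∀ v, Tendsto (fun n => coord (mk (S (φ n))) v) atTop (𝓝 (coord (mk T) v)) := by
  have hN12 : ∀ n, (C n).N = 1 ∨ (C n).N = 2 := fun n => (h n).N_eq.imp id fun ⟨_, h, _⟩ => h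
  obtain ⟨N, hN, φ₁, hφ₁, hNφ⟩ : ∃ N, (N = 1 ∨ N = 2) ∧ ∃ φ : ℕ → ℕ, StrictMono φ ∧
      ∀ n, (C (φ n)).N = N := by
    have : ∃ᶠ n in atTop, (C n).N = 1 ∨ (C n).N = 2 := Frequently.of_forall hN12
    rcases frequently_or_distrib.1 this with h1 | h1
    · exact ⟨1, Or.inl rfl, extraction_of_frequently_atTop h1⟩
    · exact ⟨2, Or.inr rfl, extraction_of_frequently_atTop h1⟩
  let U : Ultrafilter ℕ := hyperfilter ℕ
  have hU : (U : Filter ℕ) ≤ atTop := Nat.hyperfilter_le_atTop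
  obtain ⟨C₀, hC₀, hlim⟩ := exists_limit U hU (fun n => C (φ₁ n)) N hNφ
  obtain ⟨φ₂, hφ₂, hagree⟩ := extraction_forall_of_frequently
    (P := fun k n => Agree k C₀ (C (φ₁ n))) fun k => (hlim k).frequently.filter_mono hU
  have hφ : Tendsto (fun n => φ₁ (φ₂ n)) atTop atTop := (hφ₁.comp hφ₂).tendsto_atTop
  have hA : ∀ k, ∀ᶠ n in atTop, Agree k C₀ (C (φ₁ (φ₂ n))) := fun k =>
    (eventually_ge_atTop k).mono fun n hn => (hagree n).mono hn
  let L : ℤ → ℝ := scalingLength N a b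
  have hL : ∀ j, Tendsto (fun n => ℓ (φ₁ (φ₂ n)) j) atTop (𝓝 (L j)) := fun j => by
    have h1 : ∀ n, ℓ (φ₁ (φ₂ n)) j =
        scalingLength N (ℓ (φ₁ (φ₂ n)) 0) (ℓ (φ₁ (φ₂ n)) 1) j := fun n => by
      rw [← hNφ (φ₂ n)]; exact (h _).eq_scalingLength j
    simp only [h1]
    exact tendsto_scalingLength (ha.comp hφ) (hb.comp hφ) j
  have hL0 : ∀ k, 0 ≤ L k := fun k => ge_of_tendsto' (hL k) fun n => (h _).nonneg k
  have hLs : ∀ k, L (k + C₀.N) = 3 * L k := fun k => by rw [hC₀]; exact scalingLength_add hN a b k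
  have hLpos : 0 < L 0 + L 1 := by
    rw [tendsto_nhds_unique (hL 0) (ha.comp hφ), tendsto_nhds_unique (hL 1) (hb.comp hφ)]
    exact hab
  have hdepth : C₀.N = 1 ∨ C₀.N = 2 ∧ ((∀ k, C₀.HasSp k) ∨ ∃ k, C₀.HasDepth (2 * k + 1)) := by
    rw [hC₀]
    refine hN.imp id fun hN2 => ⟨hN2, C₀.hasSp_or_hasDepth.imp id ?_⟩
    rintro ⟨d, hd⟩
    obtain ⟨n, hn⟩ := (hA (d + 1)).exists
    have hd' : (C (φ₁ (φ₂ n))).HasDepth d :=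
      ⟨(hn.hasSp (by omega)).1 hd.1, fun h' => hd.2 ((hn.hasSp le_rfl).2 h')⟩
    rcases (h (φ₁ (φ₂ n))).N_eq with h1 | ⟨k, -, hk⟩
    · have := hNφ (φ₂ n)
      omega
    · exact ⟨k, hk.unique hd' ▸ hd⟩
  obtain ⟨T, C', ℓ', i', hT, hcol, hcoord⟩ :=
    exists_isCollapse (rep := rep) (dep := dep) hL0 hLs hLpos hdepth
  refine ⟨fun n => φ₁ (φ₂ n), hφ₁.comp hφ₂, C₀, L, T, hL0, hLs,
    stronglyConvergent_of_isPIso (fun n => h _) hL ?_ hA, isTruncLimit_of_isPIso (fun n => h _) hL hA,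
    hcol, fun v => ?_⟩
  · rw [hgt_three]
    linarith [hL0 2]
  · rw [coord_mk hT, hcoord]
    refine (tendsto_levelCoord C₀ hL hLpos.ne' v).congr' ?_
    filter_upwards [hA (2 * dep v)] with n hn
    rw [coord_mk (h _), levelCoord_congr hn]

/-- The coordinates converge along strongly convergent sequences, since each subsequence has a further one
that converges to a tree with the limiting coordinates, and strong limits are unique. -/
theorem tendsto_coord {S : ℕ → MetrizedTree 3} {T : MetrizedTree 3} (h : MetrizedTree.StrongLimit S T)
    (v : stratum 3 {2}) : Tendsto (fun n => coord (mk (S n)) v) atTop (𝓝 (coord (mk T) v)) := by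
  obtain ⟨r, hr, A, d, hA, hT⟩ := h
  choose C ℓ i hm using fun n => (S n).exists_models
  obtain rfl : r = fun n k => i n ((C n).ray k) := funext fun n => (hm n).eq_of_isBaseRay (hr.isBaseRay n)
  obtain ⟨a, ha⟩ := hr.dist_tendsto 1 le_rfl (by norm_num)
  obtain ⟨b, hb⟩ := hr.dist_tendsto 2 (by norm_num) (by norm_num)
  obtain ⟨c, hc0, hc⟩ := hr.dist_tendsto_pos
  have h1 : ∀ n, (S n).dist (i n ((C n).ray 0)) (i n ((C n).ray 1)) = ℓ n 0 := fun n =>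
    ((hm n).dist_ray 1).trans (hgt_one _)
  have h2 : ∀ n, (S n).dist (i n ((C n).ray 0)) (i n ((C n).ray 2)) = ℓ n 0 + ℓ n 1 := fun n =>
    ((hm n).dist_ray 2).trans (hgt_two _)
  have h3 : ∀ n, (S n).dist (i n ((C n).ray 0)) (i n ((C n).ray 3)) = ℓ n 0 + ℓ n 1 + ℓ n 2 :=
    fun n => ((hm n).dist_ray 3).trans (hgt_three _)
  simp only [h1] at ha
  simp only [h2] at hb
  simp only [h3] at hc
  have hb' : Tendsto (fun n => ℓ n 1) atTop (𝓝 (b - a)) := by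
    simpa only [add_sub_cancel_left] using hb.sub ha
  -- the third edge has at most 9 times the length of the first, so that the first two do not vanish both
  have hbound : ∀ n, ℓ n 0 + ℓ n 1 + ℓ n 2 ≤ 10 * (ℓ n 0 + ℓ n 1) := fun n => by
    have p0 := (hm n).pos 0
    have p1 := (hm n).pos 1
    rcases (hm n).N_eq with hN | ⟨-, hN, -⟩
    · have e1 : ℓ n 1 = 3 * ℓ n 0 := (hm n).scale_one hN 0
      have e2 : ℓ n 2 = 3 * ℓ n 1 := (hm n).scale_one hN 1
      linarith
    · have e := (hm n).scale 0
      rw [hN] at e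
      have e : ℓ n 2 = 3 * ℓ n 0 := e
      linarith
  have hpos : 0 < a + (b - a) := by
    have := le_of_tendsto_of_tendsto' hc (hb.const_mul 10) hbound
    linarith
  refine tendsto_of_subseq_tendsto fun ns hns => ?_
  obtain ⟨φ, hφ, C₀, L, T₀, hL0, hLs, -, htr, hcol, hlim⟩ :=
    exists_subseq_strongLimit (fun n => hm (ns n)) (ha.comp hns) (hb'.comp hns) hpos
  have hA' := hA.comp (hns.comp hφ.tendsto_atTop)
  have he : mk T = mk T₀ := mk_eq_of_equivalent (hA'.equivalent hT hL0 hLs htr hcol)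
  exact ⟨φ, by rw [he]; exact hlim v⟩

theorem continuous_coord : Continuous coord := by
  refine continuous_pi fun v => continuous_def.2 fun O hO S T h hT => ?_
  exact (tendsto_coord h v).eventually (hO.mem_nhds hT)

theorem tendsto_mk {S : ℕ → MetrizedTree 3} {T : MetrizedTree 3} (h : MetrizedTree.StrongLimit S T) :
    Tendsto (fun n => mk (S n)) atTop (𝓝 (mk T)) := by
  refine tendsto_nhds.2 fun U hU hT => ?_
  exact hU S T h hT

/-- The space is sequentially compact: normalize the lengths of the edges above levels 0 and 1 to have
the sum 1. -/
theorem exists_subseq_tendsto (t : ℕ → ProjTreeSpace 3) : ∃ φ : ℕ → ℕ, StrictMono φ ∧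
    ∃ t₀, Tendsto (fun n => t (φ n)) atTop (𝓝 t₀) := by
  have key : ∀ n, ∃ C ℓ T i, mk T = t n ∧ Models C ℓ T i ∧ ℓ 0 + ℓ 1 = 1 := by
    intro n
    obtain ⟨C, ℓ, T, i, ht, h⟩ := exists_models (t n)
    have hp : 0 < ℓ 0 + ℓ 1 := add_pos (h.pos 0) (h.pos 1)
    let c : {c : ℝ // 0 < c} := ⟨(ℓ 0 + ℓ 1)⁻¹, inv_pos.2 hp⟩
    have h' := h.scaled c
    refine ⟨C, fun k => c.1 * ℓ k, T.scale c, i, ?_, h', ?_⟩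
    · rw [← ht]
      exact (h.mk_eq h' (IsIso.refl C) (inv_pos.2 hp) fun _ => rfl).symm
    · rw [← mul_add]
      exact inv_mul_cancel₀ hp.ne'
  choose C ℓ T i ht h hℓ using key
  have hmem : ∀ n, ℓ n 0 ∈ Set.Icc (0 : ℝ) 1 := fun n =>
    ⟨(h n).nonneg 0, by linarith [(h n).nonneg 1, hℓ n]⟩
  obtain ⟨a, -, φ, hφ, ha⟩ := isCompact_Icc.tendsto_subseq hmem
  have hb : Tendsto (fun n => ℓ (φ n) 1) atTop (𝓝 (1 - a)) := by
    have : (fun n => ℓ (φ n) 1) = fun n => 1 - ℓ (φ n) 0 := funext fun n => by linarith [hℓ (φ n)]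
    rw [this]
    exact ha.const_sub 1
  obtain ⟨ψ, hψ, C₀, L, T₀, -, -, hs, htr, hcol, -⟩ :=
    exists_subseq_strongLimit (fun n => h (φ n)) ha hb (by linarith)
  refine ⟨_, hφ.comp hψ, mk T₀, ?_⟩
  have := tendsto_mk ⟨_, hs, _, _, htr, hcol⟩
  simpa only [ht, Function.comp_apply] using this

end ProjTreeSpace

theorem IsRooted.countable {V : Type*} {G : SimpleGraph V} {o : V} {q : V → V} {dep : V → ℕ}
    (h : IsRooted G o q dep) (hf : ∀ v, (G.neighborSet v).Finite) : Countable V := by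
  rw [← Set.countable_univ_iff]
  refine (Set.countable_iUnion fun n => (h.finite_ball hf n).countable).mono fun v _ => ?_
  exact Set.mem_iUnion.2 ⟨dep v, le_refl (dep v)⟩

namespace ProjTreeSpace

/-- The bijection is a homeomorphism. Its inverse is continuous because the coordinates are continuous on
`ℙ𝒯₃` and inducing on the completion; for the bijection itself, a subsequence of the image of a
convergent sequence converges, and its limit is the right one by its coordinates. -/
theorem exists_homeomorph {P : SimpleGraph (stratum 3 {2})} {o : stratum 3 {2}}
    {q : stratum 3 {2} → stratum 3 {2}} {R : P.end → ℕ → stratum 3 {2}}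
    (hP : IsRooted P o q dep) (hf : ∀ v, (P.neighborSet v).Finite)
    (hR : ∀ e, IsRootRay o q (R e) ∧ RayToEnd dep e (R e))
    (hanc : ∀ u v, IsAncestor q dep u v ↔ Extends rep dep u (rep v)) :
    ∃ Φ : EndCompletion P ≃ₜ ProjTreeSpace 3, ∀ y, Corresponds q R y (Φ y) := by
  obtain ⟨Φ, hcoord, hΦ⟩ := exists_equiv hP hf hR hanc
  have hind := hP.isInducing_endCoord hf hR
  have hinj : Function.Injective coord := by
    intro t t' htt
    obtain ⟨y, rfl⟩ := Φ.surjective t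
    obtain ⟨y', rfl⟩ := Φ.surjective t'
    rw [hcoord, hcoord] at htt
    rw [hP.endCoord_injective hf hR htt]
  have hsymm : Continuous Φ.symm := by
    rw [hind.continuous_iff]
    convert continuous_coord using 1
    funext t
    rw [Function.comp_apply, ← hcoord, Φ.apply_symm_apply]
  have := hP.countable hf
  have := hind.firstCountableTopology
  refine ⟨⟨Φ, ?_, hsymm⟩, hΦ⟩
  rw [continuous_iff_seqContinuous]
  intro y y₀ hy
  refine tendsto_of_subseq_tendsto fun ns hns => ?_
  obtain ⟨φ, hφ, t₀, ht₀⟩ := exists_subseq_tendsto fun n => Φ (y (ns n))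
  refine ⟨φ, ?_⟩
  have h1 : Tendsto (fun n => coord (Φ (y (ns (φ n))))) atTop (𝓝 (coord t₀)) :=
    (continuous_coord.tendsto t₀).comp ht₀
  have h2 : Tendsto (fun n => coord (Φ (y (ns (φ n))))) atTop (𝓝 (coord (Φ y₀))) := by
    simp only [hcoord]
    exact (hind.continuous.tendsto y₀).comp (hy.comp (hns.comp hφ.tendsto_atTop))
  have he : Φ y₀ = t₀ := hinj (tendsto_nhds_unique h2 h1)
  rw [← he] at ht₀
  exact ht₀

end ProjTreeSpace

theorem theorem1p10 :
    Infinite (ProjTreeSpace.stratum 3 {2}) ∧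
    ∃ P : SimpleGraph (ProjTreeSpace.stratum 3 {2}),
      P.IsTree ∧ (∀ v, (P.neighborSet v).Finite) ∧
      ∃ Φ : EndCompletion P ≃ₜ ProjTreeSpace 3,
        (∀ v, Φ (EndCompletion.point (Realization.vertex P v)) = v.1) ∧
        Φ '' (EndCompletion.point '' {x | ∀ v, x ≠ Realization.vertex P v}) =
          ProjTreeSpace.stratum 3 {1, 1} ∧
        Φ '' Set.range EndCompletion.endpt = ProjTreeSpace.stratum 3 {1} := by
  obtain ⟨P, o, q, hP, hf, hanc⟩ := ProjTreeSpace.isClassification.exists_isRooted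
  choose R hR using fun e => hP.exists_ray hf e
  obtain ⟨Φ, hΦ⟩ := ProjTreeSpace.exists_homeomorph hP hf hR hanc
  have h12 : ({2} : Multiset ℕ) ≠ {1, 1} := by decide
  have h13 : ({2} : Multiset ℕ) ≠ {1} := by decide
  have h23 : ({1, 1} : Multiset ℕ) ≠ {1} := by decide
  have hvertex : ∀ v, Φ (EndCompletion.point (Realization.vertex P v)) = v.1 := fun v =>
    (hΦ _).unique hP hR (.vertex v) rfl
  refine ⟨ProjTreeSpace.isClassification.infinite, P, hP.isTree, hf, Φ, hvertex, Set.ext fun t => ⟨?_, fun ht => ?_⟩,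
    Set.ext fun t => ⟨?_, fun ht => ?_⟩⟩
  · rintro ⟨_, ⟨x, hx, rfl⟩, rfl⟩
    rcases (hΦ (.point x)).mem_stratum hP hR with ⟨v, hv, -⟩ | ⟨x', -, h⟩ | ⟨e, he, -⟩
    · exact absurd (EndCompletion.point.inj hv) (hx v)
    · exact h
    · cases he
  · obtain ⟨y, rfl⟩ := Φ.surjective t
    refine ⟨y, ?_, rfl⟩
    rcases (hΦ y).mem_stratum hP hR with ⟨v, -, hv⟩ | ⟨x, rfl, -⟩ | ⟨e, -, h⟩
    · exact absurd (ProjTreeSpace.stratum_unique (hv ▸ v.2) ht) h12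
    · refine ⟨x, ?_, rfl⟩
      rintro v rfl
      rw [hvertex] at ht
      exact h12 (ProjTreeSpace.stratum_unique v.2 ht)
    · exact absurd (ProjTreeSpace.stratum_unique ht h) h23
  · rintro ⟨_, ⟨e, rfl⟩, rfl⟩
    rcases (hΦ (.endpt e)).mem_stratum hP hR with ⟨v, hv, -⟩ | ⟨x', hx, -⟩ | ⟨e, -, h⟩
    · cases hv
    · cases hx
    · exact h
  · obtain ⟨y, rfl⟩ := Φ.surjective t
    refine ⟨y, ?_, rfl⟩
    rcases (hΦ y).mem_stratum hP hR with ⟨v, -, hv⟩ | ⟨x, -, h⟩ | ⟨e, rfl, -⟩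
    · exact absurd (ProjTreeSpace.stratum_unique (hv ▸ v.2) ht) h13
    · exact absurd (ProjTreeSpace.stratum_unique h ht) h23
    · exact ⟨e, rfl⟩
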